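/- **Model.** Algorithms are fixed finite programs for a randomized real RAM: real arithmetic (with the constant $\pi$, square root and floor), comparisons, indirect addressing, uniformly random integers from $\{0,\dots,n\}$ and biased coin tosses, each instruction taking one step; time is worst case. An algorithm for a union of sets $A_1,\dots,A_m$ works as a server. Its input consists of $m$, $\epsilon$, $\gamma$ and numbers $m_1,\dots,m_m$ that approximate the set sizes. It accesses the sets only through requests, each at unit cost: a random element of $A_i$ from a generator $\mathrm{RandomElement}(A_i)$ (independent for each call), or a membership query "$x\in A_i$?" for an element $x$ obtained before. The requests are sent in rounds; in one round any number of requests is sent and all the answers are received. For $\alpha_L,\alpha_R,\beta_L,\beta_R\in(0,1)$, the list is an $((\alpha_L,\alpha_R),(\beta_L,\beta_R))$-list if for every $i$ we have $(1-\beta_L)|A_i|\le m_i\le(1+\beta_R)|A_i|$ and, if $A_i\ne\emptyset$, the generator returns only elements of $A_i$, each with probability in $\left[\frac{1-\alpha_L}{|A_i|},\frac{1+\alpha_R}{|A_i|}\right]$. For real $\lambda,l$ let $D(\lambda,d,l)$ be the set of the points $(x_1,\dots,x_d)$ with $x_k=i_k+j_k\lambda$ for integers $i_k$ and $j_k\in[-l,l]$.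 **Theorem.** There are programs for counting, for sampling, for membership and for the union, and constants $C$ and $c$, such that the following holds for all $d\ge1$, $m\ge2$, $\epsilon,\gamma,\alpha_L,\alpha_R,\beta_L,\beta_R\in(0,1)$, $0<\beta\le\min(\beta_L,\beta_R)$, real $\lambda,l$, and all closed balls $B_1,\dots,B_m$ in $\mathbb R^d$ with centers $p_i$ and radii $r_i>0$ such that for each $i$ either $r_i>\frac{2d^{3/2}}{\beta}$ or $p_i\in D(\lambda,d,l)$. Let $A_i=B_i\cap\mathbb Z^d$. 1. On each ball $B_i$ (given by $d$, $r_i$, the coordinates of $p_i$ and the accuracy parameters $\beta,\alpha_L,\alpha_R$ that the program uses), the counting program computes a number $m_i$ in time at most $C\,(d+\frac1\beta+|l|+|\lambda|)^c$, the sampling program generates a random lattice point in time at most $C\,(d+\frac1{\alpha_L}+\frac1{\alpha_R}+\frac1\beta+|l|+|\lambda|+\log(2+r_i))^c$, and the membership program decides whether a given lattice point lies in $B_i$ in time at most $C\,d$. With these numbers $m_i$ and these generators, $A_1,\dots,A_m$ is an $((\alpha_L,\alpha_R),(\beta_L,\beta_R))$-list. 2. Given $m$, $\epsilon$, $\gamma$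 and $m_1,\dots,m_m$, and with access to $A_1,\dots,A_m$ through these generators and membership queries, the union program runs in time at most $C\left(\frac1\epsilon+\log\frac1\gamma\right)^c\, m\,(\log m)^c$ and at most $C\log m$ rounds, and with probability at least $1-\gamma$ it outputs a number in $$\left[(1-\epsilon)(1-\alpha_L)(1-\beta_L)\,|A_1\cup\dots\cup A_m|,\ (1+\epsilon)(1+\alpha_R)(1+\beta_R)\,|A_1\cup\dots\cup A_m|\right],$$ that is, an approximation of the number of lattice points in $B_1\cup\dots\cup B_m$. -/

import Mathlib

/-! ## Lattice points of balls -/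

/-- The set of lattice points of the closed Euclidean ball with centre `p` and radius `r`. -/
def latticeBall {d : ℕ} (p : EuclideanSpace ℝ (Fin d)) (r : ℝ) : Set (Fin d → ℤ) :=
  {z | (WithLp.toLp 2 (fun k => (z k : ℝ)) : EuclideanSpace ℝ (Fin d)) ∈ Metric.closedBall p r}

/-- The set `D(lam, d, l)`: points all of whose coordinates are of the form `i + j * lam` with
integers `i` and `j`, where `j` lies in `[-l, l]`. -/
def centerSet (lam : ℝ) (d : ℕ) (l : ℝ) : Set (EuclideanSpace ℝ (Fin d)) :=
  {x | ∀ k, ∃ i j : ℤ, -l ≤ (j : ℝ) ∧ (j : ℝ) ≤ l ∧ x k = i + j * lam}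

/-! ## Lists of sets with approximate sizes and biased random generators -/

/-- `G` is an `(aL, aR)`-biased random generator for the set `A`: it produces elements of `A`, each
with probability in `[(1 - aL) / |A|, (1 + aR) / |A|]`. (No element can be produced from an
empty set, so nothing is required of `G` in that case.) -/
def IsBiasedGenerator {X : Type*} (aL aR : ℝ) (A : Set X) (G : PMF X) : Prop :=
  A.Nonempty → G.support ⊆ A ∧
    ∀ x ∈ A, (1 - aL) / (A.ncard : ℝ) ≤ (G x).toReal ∧ (G x).toReal ≤ (1 + aR) / (A.ncard : ℝ)

/-- A list of sets with approximate sizes and biased generators is an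
`((aL, aR), (bL, bR))`-list. -/
def IsBiasedList {X : Type*} {m : ℕ} (aL aR bL bR : ℝ) (A : Fin m → Set X)
    (size : Fin m → ℝ) (gen : Fin m → PMF X) : Prop :=
  ∀ i, (1 - bL) * ((A i).ncard : ℝ) ≤ size i ∧ size i ≤ (1 + bR) * ((A i).ncard : ℝ) ∧
    IsBiasedGenerator aL aR (A i) (gen i)

/-! ## A randomized real RAM, with rounds of requests to a list of sets

A program is a finite command tree, independent of the input. It works on real-valued arrays
`0, 1, 2, …`, and on registers that hold elements of the given sets. Elements are opaque to the
program: they can only be drawn from a set by its random generator and be tested for membership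
in a set. -/

namespace RandRAM

/-- The contents of the arrays: `M a i` is the entry of array `a` at index `i`. -/
abbrev Memory := ℕ → ℕ → ℝ

/-- Writing the value `v` to index `i` of array `a`. -/
noncomputable def Memory.write (M : Memory) (a i : ℕ) (v : ℝ) : Memory :=
  fun b j => if b = a ∧ j = i then v else M b j

/-- The memory whose array `a` starts with the `a`-th of the given lists, and is zero elsewhere. -/
noncomputable def load (rows : List (List ℝ)) : Memory :=
  fun a i => (rows.getD a []).getD i 0

/-- Arithmetic terms. -/
inductive Term : Type
  | rat (q : ℚ)
  | pi
  | read (a : ℕ) (i : Term)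
  | add (s t : Term)
  | sub (s t : Term)
  | mul (s t : Term)
  | div (s t : Term)
  | sqrt (t : Term)
  | floor (t : Term)

/-- The value of a term. An index is rounded down to a natural number. -/
noncomputable def Term.eval (M : Memory) : Term → ℝ
  | .rat q => (q : ℝ)
  | .pi => Real.pi
  | .read a i => M a ⌊i.eval M⌋₊
  | .add s t => s.eval M + t.eval M
  | .sub s t => s.eval M - t.eval M
  | .mul s t => s.eval M * t.eval M
  | .div s t => s.eval M / t.eval M
  | .sqrt t => Real.sqrt (t.eval M)
  | .floor t => (⌊t.eval M⌋ : ℝ)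

/-- The value of a term as a natural number. -/
noncomputable def Term.nat (M : Memory) (t : Term) : ℕ := ⌊t.eval M⌋₊

/-- Commands. -/
inductive Cmd : Type
  /-- no operation -/
  | skip
  /-- `set a i e`: write the value of `e` to index `i` of array `a` -/
  | set (a : ℕ) (i e : Term)
  /-- sequential composition -/
  | seq (c₁ c₂ : Cmd)
  /-- `ite e₁ e₂ c₁ c₂`: if `e₁ ≤ e₂` then `c₁` else `c₂` -/
  | ite (e₁ e₂ : Term) (c₁ c₂ : Cmd)
  /-- `loop e₁ e₂ c`: while `e₁ ≤ e₂` do `c` -/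
  | loop (e₁ e₂ : Term) (c : Cmd)
  /-- `toss a i p`: write `1` with probability `p` (clipped to `[0, 1]`) and otherwise `0` to
  index `i` of array `a` -/
  | toss (a : ℕ) (i p : Term)
  /-- `unif a i n`: write a uniformly distributed element of `{0, …, n}` to index `i` of
  array `a` -/
  | unif (a : ℕ) (i n : Term)
  /-- `draw n q h`: one round of `n` requests to random generators; for each `j < n`, request `j`
  puts a random element of the set with number `q[j]` into the register `h[j]` -/
  | draw (n : Term) (q h : ℕ)
  /-- `ask n q h o`: one round of `n` membership queries; for each `j < n`, query `j` sets `o[j]`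
  to `1` if the element in register `h[j]` belongs to the set with number `q[j]`, and to `0`
  if not -/
  | ask (n : Term) (q h o : ℕ)

/-- A state: the contents of the arrays, and of the registers for elements (initially empty). -/
structure State (X : Type) where
  mem : Memory
  reg : ℕ → Option X

/-- The initial state for the given input arrays. -/
noncomputable def start {X : Type} (rows : List (List ℝ)) : State X :=
  ⟨load rows, fun _ => none⟩

/-- The sets to which requests are sent (numbered `0, …, m - 1`), with their generators. -/
structure SetList (X : Type) (m : ℕ) where
  gen : Fin m → PMF X
  sets : Fin m → Set X

/-- The empty list of sets, for programs that make no requests. -/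
def noSets : SetList Empty 0 := ⟨fun i => i.elim0, fun i => i.elim0⟩

variable {X : Type} {m : ℕ}

/-- Put a random element of set `i` into register `t` (no effect if there is no set `i`). -/
noncomputable def drawOne (L : SetList X m) (i t : ℕ) (s : State X) : PMF (State X) :=
  if hi : i < m then
    (L.gen ⟨i, hi⟩).map fun x => ⟨s.mem, Function.update s.reg t (some x)⟩
  else PMF.pure s

/-- The (independent) random draws of a round. -/
noncomputable def drawAll (L : SetList X m) (q h : ℕ) : ℕ → State X → PMF (State X)
  | 0, s => PMF.pure s
  | n + 1, s => (drawAll L q h n s).bind fun s' =>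
      drawOne L ⌊s.mem q n⌋₊ ⌊s.mem h n⌋₊ s'

open Classical in
/-- The answer to the query whether the element in register `t` belongs to set `i`. -/
noncomputable def answer (L : SetList X m) (i t : ℕ) (s : State X) : ℝ :=
  if ∃ (hi : i < m) (x : X), s.reg t = some x ∧ x ∈ L.sets ⟨i, hi⟩ then 1 else 0

/-- The answers of a round of membership queries. -/
noncomputable def askAll (L : SetList X m) (q h o n : ℕ) (s : State X) : State X :=
  ⟨fun b j => if b = o ∧ j < n then answer L ⌊s.mem q j⌋₊ ⌊s.mem h j⌋₊ s else s.mem b j, s.reg⟩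

set_option linter.deprecated false in
/-- A coin that shows `true` with probability `p`, clipped to `[0, 1]`. -/
noncomputable def coin (p : ℝ) : PMF Bool :=
  PMF.bernoulli (min 1 p.toNNReal) (min_le_left _ _)

/-- `Runs L c s T R μ`: started in state `s`, the command `c` always halts, after at most `T` steps
and at most `R` rounds of requests, whatever the outcomes of its random choices, and the
distribution of its final state is `μ`. Every assignment, random choice and test takes one step
(terms have a constant size in a fixed program), and a round of `n` requests takes
`n + 1` steps. -/
inductive Runs (L : SetList X m) : Cmd → State X → ℕ → ℕ → PMF (State X) → Prop
  | skip (s : State X) : Runs L .skip s 1 0 (PMF.pure s)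
  | set (a : ℕ) (i e : Term) (s : State X) :
      Runs L (.set a i e) s 1 0
        (PMF.pure ⟨s.mem.write a (i.nat s.mem) (e.eval s.mem), s.reg⟩)
  | seq (c₁ c₂ : Cmd) (s : State X) (T₁ T₂ R₁ R₂ : ℕ) (μ : PMF (State X))
      (ν : State X → PMF (State X)) (h₁ : Runs L c₁ s T₁ R₁ μ)
      (h₂ : ∀ s' ∈ μ.support, Runs L c₂ s' T₂ R₂ (ν s')) :
      Runs L (.seq c₁ c₂) s (T₁ + T₂) (R₁ + R₂) (μ.bind ν)
  | iteTrue (e₁ e₂ : Term) (c₁ c₂ : Cmd) (s : State X) (T R : ℕ) (μ : PMF (State X))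
      (h : e₁.eval s.mem ≤ e₂.eval s.mem) (h₁ : Runs L c₁ s T R μ) :
      Runs L (.ite e₁ e₂ c₁ c₂) s (T + 1) R μ
  | iteFalse (e₁ e₂ : Term) (c₁ c₂ : Cmd) (s : State X) (T R : ℕ) (μ : PMF (State X))
      (h : ¬ e₁.eval s.mem ≤ e₂.eval s.mem) (h₂ : Runs L c₂ s T R μ) :
      Runs L (.ite e₁ e₂ c₁ c₂) s (T + 1) R μ
  | loopTrue (e₁ e₂ : Term) (c : Cmd) (s : State X) (T₁ T₂ R₁ R₂ : ℕ) (μ : PMF (State X))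
      (ν : State X → PMF (State X)) (h : e₁.eval s.mem ≤ e₂.eval s.mem)
      (h₁ : Runs L c s T₁ R₁ μ)
      (h₂ : ∀ s' ∈ μ.support, Runs L (.loop e₁ e₂ c) s' T₂ R₂ (ν s')) :
      Runs L (.loop e₁ e₂ c) s (T₁ + T₂ + 1) (R₁ + R₂) (μ.bind ν)
  | loopFalse (e₁ e₂ : Term) (c : Cmd) (s : State X)
      (h : ¬ e₁.eval s.mem ≤ e₂.eval s.mem) :
      Runs L (.loop e₁ e₂ c) s 1 0 (PMF.pure s)
  | toss (a : ℕ) (i p : Term) (s : State X) :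
      Runs L (.toss a i p) s 1 0
        ((coin (p.eval s.mem)).map fun b =>
          ⟨s.mem.write a (i.nat s.mem) (if b = true then 1 else 0), s.reg⟩)
  | unif (a : ℕ) (i n : Term) (s : State X) :
      Runs L (.unif a i n) s 1 0
        ((PMF.uniformOfFintype (Fin (n.nat s.mem + 1))).map fun k =>
          ⟨s.mem.write a (i.nat s.mem) ((k : ℕ) : ℝ), s.reg⟩)
  | draw (n : Term) (q h : ℕ) (s : State X) :
      Runs L (.draw n q h) s (n.nat s.mem + 1) 1 (drawAll L q h (n.nat s.mem) s)
  | ask (n : Term) (q h o : ℕ) (s : State X) :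
      Runs L (.ask n q h o) s (n.nat s.mem + 1) 1
        (PMF.pure (askAll L q h o (n.nat s.mem) s))
  | weaken (c : Cmd) (s : State X) (T T' R R' : ℕ) (μ : PMF (State X))
      (hT : T ≤ T') (hR : R ≤ R') (h : Runs L c s T R μ) : Runs L c s T' R' μ

/-- `RunsAlone c rows T μ`: without any requests, on the given input arrays, the program `c` halts
after at most `T` steps, and `μ` is the distribution of the final contents of its arrays. -/
def RunsAlone (c : Cmd) (rows : List (List ℝ)) (T : ℕ) (μ : PMF Memory) : Prop :=
  ∃ ν : PMF (State Empty), Runs noSets c (start rows) T 0 ν ∧ ν.map State.mem = μ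

/-- On the given input arrays, `c` computes the number `v` (found in array `0` at index `0`),
without requests and in at most `T` steps. -/
def Computes (c : Cmd) (rows : List (List ℝ)) (T : ℕ) (v : ℝ) : Prop :=
  ∃ μ : PMF Memory, RunsAlone c rows T μ ∧ μ.map (fun M => M 0 0) = PMF.pure v

/-- On the given input arrays, `c` generates a random integer vector with distribution `G` (found
in the first `d` entries of array `0`), without requests and in at most `T` steps. -/
def Generates (c : Cmd) (rows : List (List ℝ)) (T : ℕ) {d : ℕ} (G : PMF (Fin d → ℤ)) : Prop :=
  ∃ μ : PMF Memory, RunsAlone c rows T μ ∧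
    μ.map (fun M (k : Fin d) => M 0 (k : ℕ)) = G.map (fun z (k : Fin d) => (z k : ℝ))

end RandRAM

/-! A ball with radius above `2 d^(3/2) / β` has about as many lattice points as its volume. The
unit cubes around its lattice points are disjoint, lie in the ball enlarged by `√d / 2` and cover
the ball shrunk by `√d / 2`; the relative errors are controlled by `d * √d / (2r) ≤ β / 4`
(`ncard_mul_le_ballVol`, `ballVol_mul_le_ncard`). Any other ball has polynomially bounded radius and
its centre in `D(λ, d, l)`. The squared distance of an integer from a coordinate of the centre is
then `A² - 2λAt + λ²t²` with small integers `A` and `t`, so that sums of such squares take only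
polynomially many values (`boxVals_subset`). Dynamic programming over these values counts the points
exactly, and unranking a uniformly random number yields an exactly uniform point.

Sampling from a large ball is rejection sampling. The coordinates are sought independently. A
candidate at distance `x` from the centre is accepted with probability `(1 - x² / (2dr²))^(d²)`,
which is close to the Gaussian `exp(-d x² / (2r²))` but needs only arithmetic. A final test divides
out the product of these probabilities, so that all lattice points of the ball become equally likely
(`prod_accProb_mul_finProb`). Comparing Gaussian sums with integrals, and a Stirling type bound for
the volume, show that one attempt succeeds with probability at least `1 / (16d)`
(`le_card_mul_trialWeight`). If all attempts fail, the rounded centre is returned; this is so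
unlikely that it distorts no probability by more than `α / |A|` (`retry_bounds`).

For the union, a random index `i` is chosen with probability proportional to `size i` (after
splitting the sets into at most `2m` pieces and rejecting some), and an element `x` of set `i` is
drawn. All `N` samples are drawn in one round. The pair `(i, x)` survives width `g` if `x` lies in
none of the sets `i + 1, …, i + g - 1`. Every `x` of the union survives for at least one index,
namely the last set containing it, and for at most one index in each block of `g` consecutive ones.
So the sum of `size i` times the survival probabilities, divided by `⌈m / g⌉`, exceeds the size of
the union for no `g`, and is not below it once `g ≥ m`, up to the bias factors
(`sum_size_mul_survival_mem`). The maximum of these quantities over `g = 1, 2, 4, …` is therefore a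
correct estimate (`exists_best_width`).

Going from width `g` to `2g` takes `g` queries for each surviving sample, all in one round. About `K
⌈m / g⌉` survivors suffice for an accurate estimate, so each stage keeps at most `4K ⌈m / g⌉` of
them by shortening the prefix of samples in use; this costs `O(K m)` queries for any width
(`sv_stageCmd`). Since the length of the prefix depends on the outcomes, Chernoff bounds are applied
to all prefixes of sufficient length and all widths at once (`runs_sampling`). Only an upper tail at
each width and a lower tail at the best width are needed.

Programs are verified with triples that record a time bound, a postcondition for all outcomes, and
the expectations of a family of functions (`Pr`), or a single final state for deterministic pieces
(`Ev`, `Sv`). Joint distributions of independent choices enter as expectations of products. After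
the draws the program for unions is deterministic, so that its failure can be bounded by a sum of
such expectations (`runs_pick_draw`). -/

open scoped ENNReal


/-! ## Expectations under discrete distributions -/

namespace PMF

variable {α β : Type*}

/-- The expectation of a function with values in `[0, ∞]`. -/
noncomputable def ev (μ : PMF α) (f : α → ℝ≥0∞) : ℝ≥0∞ := ∑' a, μ a * f a

@[simp] theorem ev_pure (a : α) (f : α → ℝ≥0∞) : (PMF.pure a).ev f = f a := by
  unfold ev
  rw [tsum_eq_single a]
  · simp
  · intro b hb; simp [PMF.pure_apply, hb]

theorem ev_bind (μ : PMF α) (ν : α → PMF β) (f : β → ℝ≥0∞) :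
    (μ.bind ν).ev f = μ.ev fun a => (ν a).ev f := by
  unfold ev
  simp only [PMF.bind_apply, ← ENNReal.tsum_mul_right, ← ENNReal.tsum_mul_left, mul_assoc]
  rw [ENNReal.tsum_comm]

theorem ev_map (μ : PMF α) (g : α → β) (f : β → ℝ≥0∞) : (μ.map g).ev f = μ.ev (f ∘ g) := by
  rw [PMF.map, ev_bind]
  simp [Function.comp_def]

theorem ev_congr {μ : PMF α} {f g : α → ℝ≥0∞} (h : ∀ a ∈ μ.support, f a = g a) :
    μ.ev f = μ.ev g := by
  unfold ev
  refine tsum_congr fun a => ?_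
  by_cases ha : μ a = 0
  · simp [ha]
  · rw [h a ((PMF.mem_support_iff _ _).2 ha)]

theorem ev_mono {μ : PMF α} {f g : α → ℝ≥0∞} (h : ∀ a ∈ μ.support, f a ≤ g a) :
    μ.ev f ≤ μ.ev g := by
  unfold ev
  refine ENNReal.tsum_le_tsum fun a => ?_
  by_cases ha : μ a = 0
  · simp [ha]
  · gcongr; exact h a ((PMF.mem_support_iff _ _).2 ha)

@[simp] theorem ev_const (μ : PMF α) (c : ℝ≥0∞) : (μ.ev fun _ => c) = c := by
  unfold ev; rw [ENNReal.tsum_mul_right, PMF.tsum_coe, one_mul]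

theorem ev_add (μ : PMF α) (f g : α → ℝ≥0∞) : (μ.ev fun a => f a + g a) = μ.ev f + μ.ev g := by
  unfold ev; simp only [mul_add]; rw [ENNReal.tsum_add]

theorem ev_const_mul (μ : PMF α) (c : ℝ≥0∞) (f : α → ℝ≥0∞) :
    (μ.ev fun a => c * f a) = c * μ.ev f := by
  unfold ev; rw [← ENNReal.tsum_mul_left]; exact tsum_congr fun a => by ring

theorem ev_mul_const (μ : PMF α) (c : ℝ≥0∞) (f : α → ℝ≥0∞) :
    (μ.ev fun a => f a * c) = μ.ev f * c := by
  simp only [mul_comm _ c]; exact ev_const_mul μ c f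

theorem ev_sum {ι : Type*} (μ : PMF α) (s : Finset ι) (f : ι → α → ℝ≥0∞) :
    (μ.ev fun a => ∑ i ∈ s, f i a) = ∑ i ∈ s, μ.ev (f i) := by
  classical
  induction s using Finset.induction_on with
  | empty => simp
  | insert i s hi ih => simp only [Finset.sum_insert hi, ev_add, ih]

theorem ev_uniform (n : ℕ) (f : Fin (n + 1) → ℝ≥0∞) :
    (PMF.uniformOfFintype (Fin (n + 1))).ev f = (∑ k : Fin (n + 1), f k) / (n + 1 : ℕ) := by
  unfold ev
  rw [tsum_fintype, ENNReal.div_eq_inv_mul, Finset.mul_sum]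
  simp [PMF.uniformOfFintype_apply]

open Classical in
theorem toOuterMeasure_eq_ev (μ : PMF α) (s : Set α) :
    μ.toOuterMeasure s = μ.ev fun a => if a ∈ s then 1 else 0 := by
  rw [PMF.toOuterMeasure_apply]
  unfold ev
  refine tsum_congr fun a => ?_
  by_cases h : a ∈ s <;> simp [h]

open Classical in
theorem apply_eq_ev (μ : PMF α) (a : α) : μ a = μ.ev fun b => if b = a then 1 else 0 := by
  unfold ev
  rw [tsum_eq_single a]
  · simp
  · intro b hb; simp [hb]

end PMF

namespace RandRAM

/-! ## Terms -/

namespace Term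

instance : Add Term := ⟨Term.add⟩
instance : Sub Term := ⟨Term.sub⟩
instance : Mul Term := ⟨Term.mul⟩
instance : Div Term := ⟨Term.div⟩
instance instOfNat (n : ℕ) : OfNat Term n := ⟨Term.rat n⟩

/-- The entry at index `0` of an array. -/
def var (a : ℕ) : Term := Term.read a 0

variable (M : Memory) (s t : Term) (a n : ℕ)

@[simp] theorem eval_ofNat : (no_index (@OfNat.ofNat Term n (instOfNat n))).eval M = (n : ℝ) := by
  change ((n : ℚ) : ℝ) = n
  simp
@[simp] theorem eval_var : (var a).eval M = M a 0 := by
  change M a ⌊(((0 : ℕ) : ℚ) : ℝ)⌋₊ = M a 0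
  simp
@[simp] theorem eval_read : (Term.read a t).eval M = M a ⌊t.eval M⌋₊ := rfl
@[simp] theorem eval_add : (s + t).eval M = s.eval M + t.eval M := rfl
@[simp] theorem eval_sub : (s - t).eval M = s.eval M - t.eval M := rfl
@[simp] theorem eval_mul : (s * t).eval M = s.eval M * t.eval M := rfl
@[simp] theorem eval_div : (s / t).eval M = s.eval M / t.eval M := rfl
@[simp] theorem eval_sqrt : (Term.sqrt t).eval M = Real.sqrt (t.eval M) := rfl
@[simp] theorem eval_floor : (Term.floor t).eval M = (⌊t.eval M⌋ : ℝ) := rfl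
@[simp] theorem eval_pi : Term.pi.eval M = Real.pi := rfl

end Term

open Term

theorem Memory.write_ne (M : Memory) {a b : ℕ} (i : ℕ) (x : ℝ) (h : b ≠ a) :
    M.write a i x b = M b := by
  funext j; simp [Memory.write, h]

@[simp] theorem Memory.write_same (M : Memory) (a i : ℕ) (x : ℝ) : M.write a i x a i = x := by
  simp [Memory.write]

theorem Memory.write_self (M : Memory) (a i : ℕ) (x : ℝ) (j : ℕ) :
    M.write a i x a j = if j = i then x else M a j := by
  simp [Memory.write]

/-! ## Commands -/

infixr:60 " ;; " => Cmd.seq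

/-- Assignment to a variable. -/
def Cmd.put (a : ℕ) (e : Term) : Cmd := .set a 0 e

/-- `for i = 0, …, b - 1 do c` -/
def Cmd.forUp (i : ℕ) (b : Term) (c : Cmd) : Cmd :=
  .put i 0 ;; .loop (var i + 1) b (c ;; .put i (var i + 1))

/-- The arrays that a command does not write to. -/
def Cmd.keeps : Cmd → ℕ → Bool
  | .skip, _ => true
  | .set a _ _, b => b != a
  | .seq c d, b => c.keeps b && d.keeps b
  | .ite _ _ c d, b => c.keeps b && d.keeps b
  | .loop _ _ c, b => c.keeps b
  | .toss a _ _, b => b != a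
  | .unif a _ _, b => b != a
  | .draw _ _ _, _ => true
  | .ask _ _ _ o, b => b != o

variable {X : Type} {m : ℕ} {L : SetList X m}

theorem drawAll_mem (q h n : ℕ) (s : State X) :
    ∀ s' ∈ (drawAll L q h n s).support, s'.mem = s.mem := by
  induction n with
  | zero => intro s' hs'; simp [drawAll] at hs'; rw [hs']
  | succ n ih =>
    intro s' hs'
    simp only [drawAll, PMF.mem_support_bind_iff] at hs'
    obtain ⟨s₁, h₁, h₂⟩ := hs'
    rw [← ih s₁ h₁]
    unfold drawOne at h₂
    split_ifs at h₂
    · simp only [PMF.mem_support_map_iff] at h₂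
      obtain ⟨x, -, rfl⟩ := h₂
      rfl
    · simp only [PMF.support_pure, Set.mem_singleton_iff] at h₂
      rw [h₂]

/-- This is the frame rule. The set of arrays a command may write to is syntactic, so `decide`
settles which facts survive a subprogram, and loop invariants need to mention only what changes. -/
theorem Runs.keeps {c : Cmd} {s : State X} {T R : ℕ} {μ : PMF (State X)}
    (h : Runs L c s T R μ) (b : ℕ) (hb : c.keeps b = true) :
    ∀ s' ∈ μ.support, s'.mem b = s.mem b := by
  induction h with
  | skip s => intro s' hs'; simp at hs'; rw [hs']
  | set a i e s =>
    intro s' hs'; simp only [PMF.support_pure, Set.mem_singleton_iff] at hs'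
    rw [hs']; exact Memory.write_ne _ _ _ (by simpa [Cmd.keeps] using hb)
  | seq c₁ c₂ s T₁ T₂ R₁ R₂ μ ν h₁ h₂ ih₁ ih₂ =>
    simp only [Cmd.keeps, Bool.and_eq_true] at hb
    intro s' hs'
    simp only [PMF.mem_support_bind_iff] at hs'
    obtain ⟨s₁, hs₁, hs'⟩ := hs'
    rw [ih₂ s₁ hs₁ hb.2 s' hs', ih₁ hb.1 s₁ hs₁]
  | iteTrue e₁ e₂ c₁ c₂ s T R μ h h₁ ih =>
    simp only [Cmd.keeps, Bool.and_eq_true] at hb; exact ih hb.1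
  | iteFalse e₁ e₂ c₁ c₂ s T R μ h h₁ ih =>
    simp only [Cmd.keeps, Bool.and_eq_true] at hb; exact ih hb.2
  | loopTrue e₁ e₂ c s T₁ T₂ R₁ R₂ μ ν h h₁ h₂ ih₁ ih₂ =>
    intro s' hs'
    simp only [PMF.mem_support_bind_iff] at hs'
    obtain ⟨s₁, hs₁, hs'⟩ := hs'
    rw [ih₂ s₁ hs₁ hb s' hs', ih₁ hb s₁ hs₁]
  | loopFalse e₁ e₂ c s h => intro s' hs'; simp at hs'; rw [hs']
  | toss a i p s =>
    intro s' hs'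
    simp only [PMF.mem_support_map_iff] at hs'
    obtain ⟨x, -, rfl⟩ := hs'
    exact Memory.write_ne _ _ _ (by simpa [Cmd.keeps] using hb)
  | unif a i n s =>
    intro s' hs'
    simp only [PMF.mem_support_map_iff] at hs'
    obtain ⟨x, -, rfl⟩ := hs'
    exact Memory.write_ne _ _ _ (by simpa [Cmd.keeps] using hb)
  | draw n q h s => intro s' hs'; rw [drawAll_mem _ _ _ _ s' hs']
  | ask n q h o s =>
    intro s' hs'; simp only [PMF.support_pure, Set.mem_singleton_iff] at hs'
    have : b ≠ o := by simpa [Cmd.keeps] using hb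
    rw [hs']; funext j; simp [askAll, this]
  | weaken c s T T' R R' μ hT hR h ih => exact ih hb

/-! ## Runs without requests -/

/-- A run without requests, described by its effect on the arrays. -/
def Rv (L : SetList X m) (c : Cmd) (M : Memory) (T : ℕ) (μ : PMF Memory) : Prop :=
  ∀ reg, Runs L c ⟨M, reg⟩ T 0 (μ.map fun M' => ⟨M', reg⟩)

theorem Rv.le {c : Cmd} {M : Memory} {T T' : ℕ} {μ : PMF Memory} (h : Rv L c M T μ)
    (hT : T ≤ T') : Rv L c M T' μ := fun reg => .weaken _ _ _ _ _ _ _ hT le_rfl (h reg)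

theorem Rv.keeps {c : Cmd} {M : Memory} {T : ℕ} {μ : PMF Memory} (h : Rv L c M T μ) :
    ∀ M' ∈ μ.support, ∀ b, c.keeps b = true → M' b = M b := by
  intro M' hM' b hb
  refine (h fun _ => none).keeps b hb ⟨M', fun _ => none⟩ ?_
  rw [PMF.mem_support_map_iff]; exact ⟨M', hM', rfl⟩

theorem map_mk_bind (μ : PMF Memory) (ν : Memory → PMF Memory) (reg : ℕ → Option X) :
    ((μ.map fun M' => (State.mk M' reg : State X)).bind fun s =>
      (ν s.mem).map fun M' => State.mk M' reg) = (μ.bind ν).map fun M' => State.mk M' reg := by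
  simp only [PMF.map, PMF.bind_bind, Function.comp_def, PMF.pure_bind]

theorem Rv.seq {c₁ c₂ : Cmd} {M : Memory} {T₁ T₂ : ℕ} {μ : PMF Memory} {ν : Memory → PMF Memory}
    (h₁ : Rv L c₁ M T₁ μ) (h₂ : ∀ M' ∈ μ.support, Rv L c₂ M' T₂ (ν M')) :
    Rv L (c₁ ;; c₂) M (T₁ + T₂) (μ.bind ν) := by
  intro reg
  rw [← map_mk_bind]
  refine Runs.seq _ _ _ _ _ 0 0 _ _ (h₁ reg) fun s' hs' => ?_
  simp only [PMF.mem_support_map_iff] at hs'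
  obtain ⟨M', hM', rfl⟩ := hs'
  exact h₂ M' hM' reg

theorem Rv.loopTrue {e₁ e₂ : Term} {c : Cmd} {M : Memory} {T₁ T₂ : ℕ} {μ : PMF Memory}
    {ν : Memory → PMF Memory} (h : e₁.eval M ≤ e₂.eval M)
    (h₁ : Rv L c M T₁ μ) (h₂ : ∀ M' ∈ μ.support, Rv L (.loop e₁ e₂ c) M' T₂ (ν M')) :
    Rv L (.loop e₁ e₂ c) M (T₁ + T₂ + 1) (μ.bind ν) := by
  intro reg
  rw [← map_mk_bind]
  refine Runs.loopTrue _ _ _ _ _ _ 0 0 _ _ h (h₁ reg) fun s' hs' => ?_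
  simp only [PMF.mem_support_map_iff] at hs'
  obtain ⟨M', hM', rfl⟩ := hs'
  exact h₂ M' hM' reg

theorem Rv.loopFalse {e₁ e₂ : Term} {c : Cmd} {M : Memory} (h : ¬ e₁.eval M ≤ e₂.eval M) :
    Rv L (.loop e₁ e₂ c) M 1 (PMF.pure M) := by
  intro reg; rw [PMF.pure_map]; exact Runs.loopFalse _ _ _ _ h

theorem Rv.iteTrue {e₁ e₂ : Term} {c₁ c₂ : Cmd} {M : Memory} {T : ℕ} {μ : PMF Memory}
    (h : e₁.eval M ≤ e₂.eval M) (h₁ : Rv L c₁ M T μ) : Rv L (.ite e₁ e₂ c₁ c₂) M (T + 1) μ :=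
  fun reg => Runs.iteTrue _ _ _ _ _ _ _ _ h (h₁ reg)

theorem Rv.iteFalse {e₁ e₂ : Term} {c₁ c₂ : Cmd} {M : Memory} {T : ℕ} {μ : PMF Memory}
    (h : ¬ e₁.eval M ≤ e₂.eval M) (h₁ : Rv L c₂ M T μ) : Rv L (.ite e₁ e₂ c₁ c₂) M (T + 1) μ :=
  fun reg => Runs.iteFalse _ _ _ _ _ _ _ _ h (h₁ reg)

/-- Probabilistic triples: `c` halts within `T` steps, all possible final arrays satisfy `Q`, and
for each `i` the expectation of `f i` over the final arrays is `v i`. -/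
def Pr (L : SetList X m) {ι : Type*} (c : Cmd) (M : Memory) (T : ℕ) (Q : Memory → Prop)
    (f : ι → Memory → ℝ≥0∞) (v : ι → ℝ≥0∞) : Prop :=
  ∃ μ : PMF Memory, Rv L c M T μ ∧ (∀ M' ∈ μ.support, Q M') ∧ ∀ i, μ.ev (f i) = v i

/-- Deterministic triples. -/
def Ev (L : SetList X m) (c : Cmd) (M : Memory) (T : ℕ) (Q : Memory → Prop) : Prop :=
  ∃ M', Rv L c M T (PMF.pure M') ∧ Q M'

section Det

variable {c c₁ c₂ : Cmd} {M : Memory} {T T' T₁ T₂ : ℕ} {Q Q' : Memory → Prop}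

theorem Ev.le (h : Ev L c M T Q) (hT : T ≤ T') : Ev L c M T' Q := by
  obtain ⟨M', h, hQ⟩ := h; exact ⟨M', h.le hT, hQ⟩

theorem Ev.mono (h : Ev L c M T Q) (hQ : ∀ M', Q M' → Q' M') : Ev L c M T Q' := by
  obtain ⟨M', h, h'⟩ := h; exact ⟨M', h, hQ _ h'⟩

theorem Ev.frame (h : Ev L c M T Q) :
    Ev L c M T fun M' => Q M' ∧ ∀ b, c.keeps b = true → M' b = M b := by
  obtain ⟨M', h, hQ⟩ := h; exact ⟨M', h, hQ, h.keeps M' (by simp)⟩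

theorem Ev.skip (h : Q M) : Ev L .skip M 1 Q :=
  ⟨M, fun reg => by rw [PMF.pure_map]; exact Runs.skip _, h⟩

theorem Ev.set {a : ℕ} {i e : Term} (h : Q (M.write a (i.nat M) (e.eval M))) :
    Ev L (.set a i e) M 1 Q :=
  ⟨_, fun reg => by rw [PMF.pure_map]; exact Runs.set _ _ _ _, h⟩

theorem Ev.put {a : ℕ} {e : Term} (h : Q (M.write a 0 (e.eval M))) : Ev L (.put a e) M 1 Q := by
  refine Ev.set ?_
  have : (0 : Term).nat M = 0 := by simp [Term.nat]
  rwa [this]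

theorem Ev.seq (h₁ : Ev L c₁ M T₁ fun M' => Ev L c₂ M' T₂ Q) : Ev L (c₁ ;; c₂) M (T₁ + T₂) Q := by
  obtain ⟨M₁, h₁, M₂, h₂, hQ⟩ := h₁
  refine ⟨M₂, ?_, hQ⟩
  have := Rv.seq (ν := fun _ => PMF.pure M₂) h₁ fun M' hM' => by
    simp only [PMF.support_pure, Set.mem_singleton_iff] at hM'; rw [hM']; exact h₂
  rwa [PMF.pure_bind] at this

theorem Ev.ite {e₁ e₂ : Term} (h₁ : e₁.eval M ≤ e₂.eval M → Ev L c₁ M T Q)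
    (h₂ : e₂.eval M < e₁.eval M → Ev L c₂ M T Q) : Ev L (.ite e₁ e₂ c₁ c₂) M (T + 1) Q := by
  by_cases h : e₁.eval M ≤ e₂.eval M
  · obtain ⟨M', h', hQ⟩ := h₁ h; exact ⟨M', h'.iteTrue h, hQ⟩
  · obtain ⟨M', h', hQ⟩ := h₂ (not_le.1 h); exact ⟨M', h'.iteFalse h, hQ⟩

/-- Loops: `I k` is an invariant that guarantees that there are at most `k` further iterations. -/
theorem Ev.loop {e₁ e₂ : Term} (I : ℕ → Memory → Prop)
    (h₀ : ∀ M', I 0 M' → e₂.eval M' < e₁.eval M')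
    (hs : ∀ k M', I (k + 1) M' → e₁.eval M' ≤ e₂.eval M' → Ev L c M' T (I k))
    (hQ : ∀ k M', I k M' → e₂.eval M' < e₁.eval M' → Q M') (k : ℕ) (hk : I k M) :
    Ev L (.loop e₁ e₂ c) M (k * (T + 1) + 1) Q := by
  induction k generalizing M with
  | zero => exact ⟨M, (Rv.loopFalse (not_le.2 (h₀ M hk))).le (by omega), hQ 0 M hk (h₀ M hk)⟩
  | succ k ih =>
    by_cases h : e₁.eval M ≤ e₂.eval M
    · obtain ⟨M₁, h₁, hI⟩ := hs k M hk h
      obtain ⟨M₂, h₂, hQ⟩ := ih hI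
      refine ⟨M₂, ?_, hQ⟩
      have := Rv.loopTrue (ν := fun _ => PMF.pure M₂) h h₁ fun M' hM' => by
        simp only [PMF.support_pure, Set.mem_singleton_iff] at hM'; rw [hM']; exact h₂
      rw [PMF.pure_bind] at this
      exact this.le (by ring_nf; omega)
    · exact ⟨M, (Rv.loopFalse h).le (by omega), hQ _ M hk (not_le.1 h)⟩

/-- Counting loops. The invariant `I k` has to hold when the counter has the value `k`. -/
theorem Ev.forUp {i : ℕ} {b : Term} (n : ℕ) (I : ℕ → Memory → Prop) (hi : c.keeps i = true)
    (h₀ : I 0 (M.write i 0 0))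
    (hb : ∀ M', (∀ a, a ≠ i → c.keeps a = true → M' a = M a) → b.eval M' = n)
    (hs : ∀ k < n, ∀ M', M' i 0 = (k : ℝ) → (∀ a, a ≠ i → c.keeps a = true → M' a = M a) → I k M' →
      Ev L c M' T fun M'' => I (k + 1) (M''.write i 0 ((k + 1 : ℕ) : ℝ)))
    (hQ : ∀ M', M' i 0 = (n : ℝ) → (∀ a, a ≠ i → c.keeps a = true → M' a = M a) → I n M' → Q M') :
    Ev L (.forUp i b c) M (n * (T + 2) + 2) Q := by
  have key : Ev L (.loop (var i + 1) b (c ;; .put i (var i + 1))) (M.write i 0 0)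
      (n * (T + 1 + 1) + 1) Q := by
    refine Ev.loop (fun k M' => ∃ j, k + j = n ∧ M' i 0 = (j : ℝ) ∧
      (∀ a, a ≠ i → c.keeps a = true → M' a = M a) ∧ I j M') ?_ ?_ ?_ n ?_
    · rintro M' ⟨j, hj, hj', hf, -⟩
      simp only [eval_add, eval_var, eval_ofNat, hj', hb M' hf]
      push_cast
      rw [← hj]; push_cast; linarith
    · rintro k M' ⟨j, hj, hj', hf, hI⟩ -
      refine Ev.seq ((hs j (by omega) M' hj' hf hI).frame.mono ?_)
      rintro M'' ⟨hI', hf'⟩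
      refine Ev.put ⟨j + 1, by omega, ?_, ?_, ?_⟩
      · simp [hf' i hi, hj']
      · intro a ha hk
        rw [Memory.write_ne _ _ _ ha, hf' a hk, hf a ha hk]
      · have : (var i + 1).eval M'' = ((j + 1 : ℕ) : ℝ) := by simp [hf' i hi, hj']
        rw [this]; exact hI'
    · rintro k M' ⟨j, hj, hj', hf, hI⟩ hlt
      simp only [eval_add, eval_var, eval_ofNat, hj', hb M' hf] at hlt
      have : n < j + 1 := by exact_mod_cast hlt
      obtain rfl : j = n := by omega
      exact hQ M' hj' hf hI
    · refine ⟨0, by simp, by simp, fun a ha hk => Memory.write_ne _ _ _ ha, h₀⟩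
  refine Ev.le (Ev.seq (Ev.put ?_)) (?_ : 1 + (n * (T + 1 + 1) + 1) ≤ _)
  · simpa using key
  · ring_nf; omega

end Det

section Prob

variable {ι ι' : Type*} {c c₁ c₂ : Cmd} {M : Memory} {T T' T₁ T₂ : ℕ} {Q Q' : Memory → Prop}
  {f : ι → Memory → ℝ≥0∞} {v : ι → ℝ≥0∞}

theorem Pr.le (h : Pr L c M T Q f v) (hT : T ≤ T') : Pr L c M T' Q f v := by
  obtain ⟨μ, h, hQ⟩ := h; exact ⟨μ, h.le hT, hQ⟩

theorem Pr.frame (h : Pr L c M T Q f v) :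
    Pr L c M T (fun M' => Q M' ∧ ∀ b, c.keeps b = true → M' b = M b) f v := by
  obtain ⟨μ, h, hQ, hf⟩ := h
  exact ⟨μ, h, fun M' hM' => ⟨hQ M' hM', h.keeps M' hM'⟩, hf⟩

/-- Reindexing along `g` specialises a triple that is known for all functions of some observation to
the functions that are needed. -/
theorem Pr.mono {f' : ι' → Memory → ℝ≥0∞} {v' : ι' → ℝ≥0∞} (h : Pr L c M T Q f v) (g : ι' → ι)
    (hQ : ∀ M', Q M' → Q' M' ∧ ∀ i, f' i M' = f (g i) M') (hv : ∀ i, v' i = v (g i)) :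
    Pr L c M T Q' f' v' := by
  obtain ⟨μ, h, hQ', hf⟩ := h
  refine ⟨μ, h, fun M' hM' => (hQ M' (hQ' M' hM')).1, fun i => ?_⟩
  rw [hv, ← hf]
  exact PMF.ev_congr fun M' hM' => (hQ M' (hQ' M' hM')).2 i

theorem Pr.of_ev (h : Ev L c M T fun M' => Q M' ∧ ∀ i, f i M' = v i) : Pr L c M T Q f v := by
  obtain ⟨M', h, hQ, hf⟩ := h
  exact ⟨_, h, by simpa using hQ, by simpa using hf⟩

/-- This is the tower rule: `f₁ i` is the conditional expectation of `f i` given the arrays after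
the first command. -/
theorem Pr.seq {Q₁ : Memory → Prop} {f₁ : ι → Memory → ℝ≥0∞} (h₁ : Pr L c₁ M T₁ Q₁ f₁ v)
    (h₂ : ∀ M', Q₁ M' → Pr L c₂ M' T₂ Q f fun i => f₁ i M') :
    Pr L (c₁ ;; c₂) M (T₁ + T₂) Q f v := by
  obtain ⟨μ, hr, hQ₁, hf₁⟩ := h₁
  -- Outside the support of `μ` nothing is known about the second command; an arbitrary distribution
  -- fills the gap.
  have : ∀ M', ∃ ν : PMF Memory, M' ∈ μ.support →
      Rv L c₂ M' T₂ ν ∧ (∀ M'' ∈ ν.support, Q M'') ∧ ∀ i, ν.ev (f i) = f₁ i M' := by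
    intro M'
    by_cases hM' : M' ∈ μ.support
    · obtain ⟨ν, hν⟩ := h₂ M' (hQ₁ M' hM'); exact ⟨ν, fun _ => hν⟩
    · exact ⟨PMF.pure M', fun h => absurd h hM'⟩
  choose ν hν using this
  refine ⟨μ.bind ν, hr.seq fun M' hM' => (hν M' hM').1, ?_, fun i => ?_⟩
  · intro M'' hM''
    simp only [PMF.mem_support_bind_iff] at hM''
    obtain ⟨M', hM', hM''⟩ := hM''
    exact (hν M' hM').2.1 M'' hM''
  · rw [PMF.ev_bind, ← hf₁]
    exact PMF.ev_congr fun M' hM' => (hν M' hM').2.2 i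

theorem Pr.seq_ev (h₁ : Ev L c₁ M T₁ fun M' => Pr L c₂ M' T₂ Q f v) :
    Pr L (c₁ ;; c₂) M (T₁ + T₂) Q f v := by
  obtain ⟨M', h₁, hQ⟩ := h₁
  refine Pr.seq (Q₁ := fun M'' => M'' = M') (f₁ := fun i _ => v i) ⟨_, h₁, ?_, ?_⟩ ?_
  · simp
  · simp
  · rintro M'' rfl; exact hQ

theorem Pr.ite {e₁ e₂ : Term} (h₁ : e₁.eval M ≤ e₂.eval M → Pr L c₁ M T Q f v)
    (h₂ : e₂.eval M < e₁.eval M → Pr L c₂ M T Q f v) : Pr L (.ite e₁ e₂ c₁ c₂) M (T + 1) Q f v := by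
  by_cases h : e₁.eval M ≤ e₂.eval M
  · obtain ⟨M', h', hQ⟩ := h₁ h; exact ⟨M', h'.iteTrue h, hQ⟩
  · obtain ⟨M', h', hQ⟩ := h₂ (not_le.1 h); exact ⟨M', h'.iteFalse h, hQ⟩

set_option linter.deprecated false in
theorem ev_coin (p : ℝ) (f : Bool → ℝ≥0∞) :
    (coin p).ev f = min 1 (ENNReal.ofReal p) * f true + (1 - min 1 (ENNReal.ofReal p)) * f false := by
  unfold coin PMF.ev
  rw [tsum_bool, add_comm]
  have : ((min 1 p.toNNReal : NNReal) : ℝ≥0∞) = min 1 (ENNReal.ofReal p) := by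
    rw [ENNReal.coe_min]; rfl
  simp [PMF.bernoulli, this]

theorem Pr.toss {a : ℕ} {i p : Term} (h₁ : Q (M.write a (i.nat M) 1))
    (h₀ : Q (M.write a (i.nat M) 0))
    (hv : ∀ j, v j = min 1 (ENNReal.ofReal (p.eval M)) * f j (M.write a (i.nat M) 1) +
      (1 - min 1 (ENNReal.ofReal (p.eval M))) * f j (M.write a (i.nat M) 0)) :
    Pr L (.toss a i p) M 1 Q f v := by
  refine ⟨(coin (p.eval M)).map fun b => M.write a (i.nat M) (if b = true then 1 else 0),
    fun reg => ?_, ?_, fun j => ?_⟩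
  · rw [PMF.map_comp]; exact Runs.toss _ _ _ _
  · intro M' hM'
    simp only [PMF.mem_support_map_iff] at hM'
    obtain ⟨b, -, rfl⟩ := hM'
    cases b <;> simpa
  · rw [PMF.ev_map, ev_coin, hv]; simp

theorem Pr.unif {a : ℕ} {i n : Term} (h : ∀ k ≤ n.nat M, Q (M.write a (i.nat M) (k : ℕ)))
    (hv : ∀ j, v j = (∑ k ∈ Finset.range (n.nat M + 1), f j (M.write a (i.nat M) (k : ℕ))) /
      (n.nat M + 1 : ℕ)) :
    Pr L (.unif a i n) M 1 Q f v := by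
  refine ⟨(PMF.uniformOfFintype (Fin (n.nat M + 1))).map fun k : Fin (n.nat M + 1) =>
      M.write a (i.nat M) ((k : ℕ) : ℝ),
    fun reg => ?_, ?_, fun j => ?_⟩
  · rw [PMF.map_comp]
    have h := Runs.unif (L := L) a i n ⟨M, reg⟩
    change Runs L _ _ 1 0 (PMF.map _ (PMF.map (fun k : Fin (n.nat M + 1) => (k : ℕ)) _)) at h
    rw [PMF.map_comp] at h
    exact h
  · intro M' hM'
    simp only [PMF.mem_support_map_iff] at hM'
    obtain ⟨b, -, rfl⟩ := hM'
    exact h b (by omega)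
  · rw [PMF.ev_map, PMF.ev_uniform, hv, ← Fin.sum_univ_eq_sum_range
      (fun k => f j (M.write a (i.nat M) (k : ℕ)))]
    rfl

/-- `F k` is the expected final value when at most `k` iterations remain. The expectation is
preserved by each iteration, as for a martingale. -/
theorem Pr.loop {e₁ e₂ : Term} (I : ℕ → Memory → Prop) (F : ℕ → ι → Memory → ℝ≥0∞)
    (h₀ : ∀ M', I 0 M' → e₂.eval M' < e₁.eval M')
    (hs : ∀ k M', I (k + 1) M' → e₁.eval M' ≤ e₂.eval M' →
      Pr L c M' T (I k) (F k) fun i => F (k + 1) i M')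
    (hQ : ∀ k M', I k M' → e₂.eval M' < e₁.eval M' → Q M' ∧ ∀ i, f i M' = F k i M') (k : ℕ)
    (hk : I k M) (hv : ∀ i, v i = F k i M) :
    Pr L (.loop e₁ e₂ c) M (k * (T + 1) + 1) Q f v := by
  induction k generalizing M v with
  | zero =>
    refine ⟨_, (Rv.loopFalse (not_le.2 (h₀ M hk))).le (by omega), ?_, ?_⟩
    · simpa using (hQ 0 M hk (h₀ M hk)).1
    · intro i; rw [PMF.ev_pure, hv, (hQ 0 M hk (h₀ M hk)).2]
  | succ k ih =>
    by_cases h : e₁.eval M ≤ e₂.eval M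
    · obtain ⟨μ, h₁, hI, hF⟩ := hs k M hk h
      have : ∀ M', ∃ ν : PMF Memory, M' ∈ μ.support → Rv L (.loop e₁ e₂ c) M' (k * (T + 1) + 1) ν ∧
          (∀ M'' ∈ ν.support, Q M'') ∧ ∀ i, ν.ev (f i) = F k i M' := by
        intro M'
        by_cases hM' : M' ∈ μ.support
        · obtain ⟨ν, hν⟩ := ih (hI M' hM') (v := fun i => F k i M') fun i => rfl
          exact ⟨ν, fun _ => hν⟩
        · exact ⟨PMF.pure M', fun h => absurd h hM'⟩
      choose ν hν using this
      refine ⟨μ.bind ν, (h₁.loopTrue h fun M' hM' => (hν M' hM').1).le (by ring_nf; omega), ?_,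
        fun i => ?_⟩
      · intro M'' hM''
        simp only [PMF.mem_support_bind_iff] at hM''
        obtain ⟨M', hM', hM''⟩ := hM''
        exact (hν M' hM').2.1 M'' hM''
      · rw [PMF.ev_bind, hv]
        refine Eq.trans ?_ (hF i)
        exact PMF.ev_congr fun M' hM' => (hν M' hM').2.2 i
    · refine ⟨_, (Rv.loopFalse h).le (by omega), ?_, ?_⟩
      · simpa using (hQ _ M hk (not_le.1 h)).1
      · intro i; rw [PMF.ev_pure, hv, (hQ _ M hk (not_le.1 h)).2]

theorem Pr.forUp {i : ℕ} {b : Term} (n : ℕ) (I : ℕ → Memory → Prop) (F : ℕ → ι → Memory → ℝ≥0∞)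
    (hi : c.keeps i = true) (h₀ : I 0 (M.write i 0 0))
    (hb : ∀ M', (∀ a, a ≠ i → c.keeps a = true → M' a = M a) → b.eval M' = n)
    (hs : ∀ k < n, ∀ M', M' i 0 = (k : ℝ) → (∀ a, a ≠ i → c.keeps a = true → M' a = M a) → I k M' →
      Pr L c M' T (fun M'' => I (k + 1) (M''.write i 0 ((k + 1 : ℕ) : ℝ)))
        (fun j M'' => F (k + 1) j (M''.write i 0 ((k + 1 : ℕ) : ℝ))) fun j => F k j M')
    (hQ : ∀ M', M' i 0 = (n : ℝ) → (∀ a, a ≠ i → c.keeps a = true → M' a = M a) → I n M' →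
      Q M' ∧ ∀ j, f j M' = F n j M')
    (hv : ∀ j, v j = F 0 j (M.write i 0 0)) :
    Pr L (.forUp i b c) M (n * (T + 2) + 2) Q f v := by
  have key : Pr L (.loop (var i + 1) b (c ;; .put i (var i + 1))) (M.write i 0 0)
      (n * (T + 1 + 1) + 1) Q f v := by
    refine Pr.loop (fun k M' => ∃ j, k + j = n ∧ M' i 0 = (j : ℝ) ∧
      (∀ a, a ≠ i → c.keeps a = true → M' a = M a) ∧ I j M') (fun k => F (n - k)) ?_ ?_ ?_ n ?_ ?_
    · rintro M' ⟨j, hj, hj', hf, -⟩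
      simp only [eval_add, eval_var, eval_ofNat, hj', hb M' hf]
      push_cast
      rw [← hj]; push_cast; linarith
    · rintro k M' ⟨j, hj, hj', hf, hI⟩ -
      obtain rfl : j = n - (k + 1) := by omega
      have e : n - (k + 1) + 1 = n - k := by omega
      refine Pr.seq (hs _ (by omega) M' hj' hf hI).frame ?_
      rintro M'' ⟨hI', hf'⟩
      refine Pr.of_ev (Ev.put ?_)
      have h1 : (var i + 1).eval M'' = ((n - (k + 1) + 1 : ℕ) : ℝ) := by
        simp [hf' i hi, hj']
      rw [h1]
      refine ⟨⟨_, by omega, by simp, ?_, hI'⟩, fun l => by rw [← e]⟩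
      intro a ha hk
      rw [Memory.write_ne _ _ _ ha, hf' a hk, hf a ha hk]
    · rintro k M' ⟨j, hj, hj', hf, hI⟩ hlt
      simp only [eval_add, eval_var, eval_ofNat, hj', hb M' hf] at hlt
      have : n < j + 1 := by exact_mod_cast hlt
      obtain rfl : j = n := by omega
      obtain rfl : k = 0 := by omega
      exact hQ M' hj' hf hI
    · refine ⟨0, by simp, by simp, fun a ha hk => Memory.write_ne _ _ _ ha, h₀⟩
    · intro j; rw [hv, Nat.sub_self]
  refine Pr.le (Pr.seq_ev (Ev.put ?_)) (?_ : 1 + (n * (T + 1 + 1) + 1) ≤ _)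
  · simpa using key
  · ring_nf; omega

end Prob

/-! ## Programs without requests -/

theorem Computes.of_ev {c : Cmd} {rows : List (List ℝ)} {T : ℕ} {v : ℝ}
    (h : Ev noSets c (load rows) T fun M => M 0 0 = v) : Computes c rows T v := by
  obtain ⟨M', h, hv⟩ := h
  refine ⟨_, ⟨_, h fun _ => none, rfl⟩, ?_⟩
  simp [PMF.pure_map, hv]

end RandRAM

namespace RandRAM
open Term

/-! ## Input -/

/-- The sequence that starts with the coordinates of a vector and is zero afterwards. -/
noncomputable def coords {d : ℕ} (x : Fin d → ℝ) : ℕ → ℝ := fun k => if h : k < d then x ⟨k, h⟩ else 0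

theorem coords_val {d : ℕ} (x : Fin d → ℝ) (k : Fin d) : coords x k = x k := by simp [coords]

theorem getD_ofFn {d : ℕ} (x : Fin d → ℝ) (k : ℕ) : (List.ofFn x).getD k 0 = coords x k := by
  unfold coords
  split_ifs with h
  · simp [List.getD, h]
  · simp [List.getD, h]

@[simp] theorem load_one {d : ℕ} (x : Fin d → ℝ) (l : List ℝ) (rows : List (List ℝ)) :
    load (l :: List.ofFn x :: rows) 1 = coords x := by
  funext k
  rw [← getD_ofFn]; rfl

@[simp] theorem load_two {d : ℕ} (x : Fin d → ℝ) (l l' : List ℝ) (rows : List (List ℝ)) :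
    load (l :: l' :: List.ofFn x :: rows) 2 = coords x := by
  funext k
  rw [← getD_ofFn]; rfl

@[simp] theorem load_zero (l : List ℝ) (rows : List (List ℝ)) (k : ℕ) :
    load (l :: rows) 0 k = l.getD k 0 := rfl

end RandRAM

/-! ## Membership -/

theorem mem_latticeBall {d : ℕ} (p : EuclideanSpace ℝ (Fin d)) {r : ℝ} (hr : 0 < r)
    (z : Fin d → ℤ) : z ∈ latticeBall p r ↔ ∑ k, ((z k : ℝ) - p k) ^ 2 ≤ r ^ 2 := by
  unfold latticeBall
  rw [Set.mem_ofPred_eq, Metric.mem_closedBall, EuclideanSpace.dist_eq,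
    Real.sqrt_le_left hr.le]
  simp [Real.dist_eq, sq_abs]

namespace RandRAM
open Term

/-- The membership program. -/
def memberCmd : Cmd :=
  .put 4 0 ;;
  .forUp 3 (.read 0 0)
    (.put 4 (var 4 + (.read 2 (var 3) - .read 1 (var 3)) * (.read 2 (var 3) - .read 1 (var 3)))) ;;
  .ite (var 4) (.read 0 1 * .read 0 1) (.put 0 1) (.put 0 0)

theorem computes_member {d : ℕ} (p : EuclideanSpace ℝ (Fin d)) {r : ℝ} (hr : 0 < r)
    (z : Fin d → ℤ) :
    Computes memberCmd [[(d : ℝ), r], List.ofFn (fun k => p k), List.ofFn (fun k => (z k : ℝ))]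
      (3 * d + 5) (Set.indicator (latticeBall p r) 1 z) := by
  apply Computes.of_ev
  refine Ev.le (Ev.seq (Ev.put (Ev.seq (Ev.forUp d (T := 1) (fun k M => M 4 0 =
    ∑ j ∈ Finset.range k, (coords (fun i => (z i : ℝ)) j - coords (fun i => p i) j) ^ 2)
    (by decide) ?_ ?_ ?_ ?_)))) (?_ : 1 + (d * (1 + 2) + 2 + 2) ≤ _)
  · simp [Memory.write_ne]
  · intro M' hf
    rw [show (Term.read 0 0).eval M' = M' 0 0 by simp, hf 0 (by decide) (by decide)]
    simp [Memory.write_ne]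
  · intro k hk M' hc hf hI
    refine Ev.put ?_
    have h1 := hf 1 (by decide) (by decide)
    have h2 := hf 2 (by decide) (by decide)
    simp [Memory.write_ne] at h1 h2
    simp [Memory.write_ne, hI, hc, h1, h2, Finset.sum_range_succ]
    ring
  · intro M' hc hf hI
    have h0 := hf 0 (by decide) (by decide)
    simp [Memory.write_ne] at h0
    have hsum : ∑ j ∈ Finset.range d,
        (coords (fun i => (z i : ℝ)) j - coords (fun i => p i) j) ^ 2 =
        ∑ k, ((z k : ℝ) - p k) ^ 2 := by
      rw [Finset.sum_range]; simp [coords_val]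
    rw [hsum] at hI
    refine Ev.ite (fun h => Ev.put ?_) (fun h => Ev.put ?_)
    · simp [hI, h0, ← sq] at h
      rw [Set.indicator_of_mem ((mem_latticeBall p hr z).2 h)]
      simp
    · simp [hI, h0, ← sq] at h
      rw [Set.indicator_of_notMem fun h' => not_lt.2 ((mem_latticeBall p hr z).1 h') h]
      simp
  · omega

end RandRAM


/-! ## The number of lattice points of a ball and its volume -/

open MeasureTheory

/-- The volume of a ball of radius `r` in dimension `d`. -/
noncomputable def ballVol (d : ℕ) (r : ℝ) : ℝ :=
  r ^ d * (Real.sqrt Real.pi ^ d / Real.Gamma ((d : ℝ) / 2 + 1))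

theorem ballVol_zero (r : ℝ) : ballVol 0 r = 1 := by simp [ballVol]

theorem ballVol_one (r : ℝ) : ballVol 1 r = 2 * r := by
  have h : Real.Gamma ((1 : ℝ) / 2 + 1) = 1 / 2 * Real.sqrt Real.pi := by
    rw [Real.Gamma_add_one (by norm_num), Real.Gamma_one_half_eq]
  have hp : Real.sqrt Real.pi ≠ 0 := (Real.sqrt_pos.2 Real.pi_pos).ne'
  simp only [ballVol, pow_one, Nat.cast_one, h]
  field_simp

/-- This recurrence, started in dimension `0` or `1`, removes the Gamma function: a machine that
knows `π` computes the volume by arithmetic. -/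
theorem ballVol_add_two (d : ℕ) (r : ℝ) :
    ballVol (d + 2) r = ballVol d r * (2 * Real.pi * r ^ 2 / (d + 2)) := by
  have h1 : ((d : ℝ) / 2 + 1) ≠ 0 := by positivity
  have h2 : (((d + 2 : ℕ) : ℝ) / 2 + 1) = ((d : ℝ) / 2 + 1) + 1 := by push_cast; ring
  have h3 : Real.Gamma ((d : ℝ) / 2 + 1) ≠ 0 := (Real.Gamma_pos_of_pos (by positivity)).ne'
  have h4 : Real.sqrt Real.pi ^ 2 = Real.pi := Real.sq_sqrt Real.pi_pos.le
  unfold ballVol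
  rw [h2, Real.Gamma_add_one h1, pow_add, pow_add, h4]
  field_simp

theorem ballVol_pos (d : ℕ) {r : ℝ} (hr : 0 < r) : 0 < ballVol d r := by
  unfold ballVol
  have := Real.Gamma_pos_of_pos (s := (d : ℝ) / 2 + 1) (by positivity)
  have := Real.pi_pos
  positivity

theorem ballVol_mul (d : ℕ) (s r : ℝ) : ballVol d (s * r) = s ^ d * ballVol d r := by
  unfold ballVol; rw [mul_pow]; ring

theorem volume_closedBall_eq_ballVol {d : ℕ} (hd : 1 ≤ d) (p : EuclideanSpace ℝ (Fin d)) {r : ℝ}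
    (hr : 0 ≤ r) : volume (Metric.closedBall p r) = ENNReal.ofReal (ballVol d r) := by
  have : Nonempty (Fin d) := ⟨⟨0, hd⟩⟩
  rw [EuclideanSpace.volume_closedBall, ballVol, Fintype.card_fin,
    ENNReal.ofReal_mul (pow_nonneg hr d), ENNReal.ofReal_pow hr]

/-- The unit cube around a lattice point. -/
def latticeCube {d : ℕ} (z : Fin d → ℤ) : Set (EuclideanSpace ℝ (Fin d)) :=
  {x | ∀ k, x k ∈ Set.Ico ((z k : ℝ) - 1 / 2) (z k + 1 / 2)}

theorem latticeCube_eq {d : ℕ} (z : Fin d → ℤ) : latticeCube z =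
    (WithLp.ofLp : EuclideanSpace ℝ (Fin d) → (Fin d → ℝ)) ⁻¹'
      Set.univ.pi fun k => Set.Ico ((z k : ℝ) - 1 / 2) (z k + 1 / 2) := by
  ext x; simp [latticeCube]

theorem measurableSet_latticeCube {d : ℕ} (z : Fin d → ℤ) : MeasurableSet (latticeCube z) := by
  rw [latticeCube_eq]
  exact (PiLp.volume_preserving_ofLp (Fin d)).measurable
    (MeasurableSet.univ_pi fun k => measurableSet_Ico)

theorem volume_latticeCube {d : ℕ} (z : Fin d → ℤ) : volume (latticeCube z) = 1 := by
  rw [latticeCube_eq, (PiLp.volume_preserving_ofLp (Fin d)).measure_preimage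
    (MeasurableSet.univ_pi fun k => measurableSet_Ico).nullMeasurableSet, Real.volume_pi_Ico]
  simp
  norm_num

theorem mem_latticeCube_round {d : ℕ} (x : EuclideanSpace ℝ (Fin d)) :
    x ∈ latticeCube fun k => round (x k) := by
  intro k
  have h1 := round_le_add_half (x k)
  have h2 := sub_half_lt_round (x k)
  constructor <;> linarith

theorem latticeCube_disjoint {d : ℕ} {z z' : Fin d → ℤ} (h : z ≠ z') :
    Disjoint (latticeCube z) (latticeCube z') := by
  rw [Set.disjoint_left]
  intro x hx hx'
  refine h (funext fun k => ?_)
  have h1 := hx k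
  have h2 := hx' k
  simp only [Set.mem_Ico] at h1 h2
  have h3 : (z k : ℝ) < z' k + 1 := by linarith
  have h4 : (z' k : ℝ) < z k + 1 := by linarith
  have h3' : z k < z' k + 1 := by exact_mod_cast h3
  have h4' : z' k < z k + 1 := by exact_mod_cast h4
  omega

theorem dist_le_of_mem_latticeCube {d : ℕ} {z : Fin d → ℤ} {x : EuclideanSpace ℝ (Fin d)}
    (h : x ∈ latticeCube z) :
    dist x (WithLp.toLp 2 (fun k => (z k : ℝ)) : EuclideanSpace ℝ (Fin d)) ≤ Real.sqrt d / 2 := by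
  rw [EuclideanSpace.dist_eq, show Real.sqrt d / 2 = Real.sqrt (d / 4) by
    rw [Real.sqrt_div' _ (by norm_num), show (4 : ℝ) = 2 ^ 2 by norm_num,
      Real.sqrt_sq (by norm_num)]]
  apply Real.sqrt_le_sqrt
  have : ∀ k ∈ Finset.univ, dist (x k) ((WithLp.toLp 2 (fun k => (z k : ℝ)) :
      EuclideanSpace ℝ (Fin d)) k) ^ 2 ≤ 1 / 4 := by
    intro k _
    have h1 := h k
    simp only [Set.mem_Ico] at h1
    rw [Real.dist_eq, sq_abs]
    simp only
    nlinarith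
  refine (Finset.sum_le_sum this).trans (le_of_eq ?_)
  simp; ring

theorem latticeBall_subset_pi {d : ℕ} (p : EuclideanSpace ℝ (Fin d)) {r : ℝ} (hr : 0 < r) :
    latticeBall p r ⊆ (Fintype.piFinset fun k => Finset.Icc ⌈p k - r⌉ ⌊p k + r⌋ :
      Finset (Fin d → ℤ)) := by
  intro z hz
  rw [mem_latticeBall p hr] at hz
  simp only [Finset.mem_coe, Fintype.mem_piFinset, Finset.mem_Icc, Int.ceil_le, Int.le_floor]
  intro k
  have h := (Finset.single_le_sum (f := fun k => ((z k : ℝ) - p k) ^ 2)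
    (fun i _ => sq_nonneg _) (Finset.mem_univ k)).trans hz
  have := abs_le_of_sq_le_sq' h hr.le
  constructor <;> linarith [this.1, this.2]

theorem latticeBall_finite {d : ℕ} (p : EuclideanSpace ℝ (Fin d)) {r : ℝ} (hr : 0 < r) :
    (latticeBall p r).Finite := (Finset.finite_toSet _).subset (latticeBall_subset_pi p hr)

/-- This crude bound is easy to compute. It only serves to decide how often the rejection sampling
is repeated, where its logarithm matters. -/
theorem ncard_latticeBall_le_pow {d : ℕ} (p : EuclideanSpace ℝ (Fin d)) {r : ℝ} (hr : 0 < r) :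
    ((latticeBall p r).ncard : ℝ) ≤ (2 * r + 1) ^ d := by
  have h := Set.ncard_le_ncard (latticeBall_subset_pi p hr) (Finset.finite_toSet _)
  rw [Set.ncard_coe_finset, Fintype.card_piFinset] at h
  refine (Nat.cast_le.2 h).trans ?_
  push_cast
  refine (Finset.prod_le_prod (g := fun _ => 2 * r + 1) (fun k _ => Nat.cast_nonneg _)
    fun k _ => ?_).trans (by simp)
  rw [Int.card_Icc]
  rcases le_or_gt 0 (⌊p k + r⌋ + 1 - ⌈p k - r⌉) with h | h
  · have : (((⌊p k + r⌋ + 1 - ⌈p k - r⌉).toNat : ℕ) : ℝ) = ((⌊p k + r⌋ + 1 - ⌈p k - r⌉ : ℤ) : ℝ) := by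
      exact_mod_cast Int.toNat_of_nonneg h
    rw [this]; push_cast
    have h1 := Int.floor_le (p k + r)
    have h2 := Int.le_ceil (p k - r)
    linarith
  · rw [Int.toNat_of_nonpos h.le]; simp; linarith

/-- The disjoint unit cubes around the points of the ball fit into the ball whose radius is larger
by half the diagonal of a cube. -/
theorem ncard_latticeBall_le_ballVol {d : ℕ} (hd : 1 ≤ d) (p : EuclideanSpace ℝ (Fin d)) {r : ℝ}
    (hr : 0 < r) : ((latticeBall p r).ncard : ℝ) ≤ ballVol d (r + Real.sqrt d / 2) := by
  have hfin := latticeBall_finite p hr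
  have hr' : 0 < r + Real.sqrt d / 2 := by positivity
  have h : volume (⋃ z ∈ hfin.toFinset, latticeCube z) ≤
      volume (Metric.closedBall p (r + Real.sqrt d / 2)) := by
    refine measure_mono ?_
    intro x hx
    simp only [Set.mem_iUnion, Set.Finite.mem_toFinset, exists_prop] at hx
    obtain ⟨z, hz, hx⟩ := hx
    have h1 := dist_le_of_mem_latticeCube hx
    have h2 : dist _ p ≤ r := hz
    rw [Metric.mem_closedBall]
    linarith [dist_triangle x (WithLp.toLp 2 (fun k => (z k : ℝ))) p]
  rw [measure_biUnion_finset (fun z _ z' _ h => latticeCube_disjoint h)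
    (fun z _ => measurableSet_latticeCube z), volume_closedBall_eq_ballVol hd p hr'.le] at h
  simp only [volume_latticeCube, Finset.sum_const, nsmul_eq_mul, mul_one] at h
  rw [Set.ncard_eq_toFinset_card _ hfin]
  rw [← ENNReal.ofReal_natCast] at h
  exact (ENNReal.ofReal_le_ofReal_iff (ballVol_pos d hr').le).1 h

/-- Rounding the coordinates moves a point by at most half the diagonal of a cube, so each point of
the shrunken ball lies in the cube of a lattice point of the ball. -/
theorem ballVol_le_ncard_latticeBall {d : ℕ} (hd : 1 ≤ d) (p : EuclideanSpace ℝ (Fin d)) {r : ℝ}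
    (hr : 0 < r) (hr' : Real.sqrt d / 2 ≤ r) :
    ballVol d (r - Real.sqrt d / 2) ≤ (latticeBall p r).ncard := by
  have hfin := latticeBall_finite p hr
  have h : volume (Metric.closedBall p (r - Real.sqrt d / 2)) ≤
      volume (⋃ z ∈ hfin.toFinset, latticeCube z) := by
    refine measure_mono ?_
    intro x hx
    simp only [Set.mem_iUnion, Set.Finite.mem_toFinset, exists_prop]
    refine ⟨_, ?_, mem_latticeCube_round x⟩
    have h1 := dist_le_of_mem_latticeCube (mem_latticeCube_round x)
    rw [Metric.mem_closedBall] at hx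
    change dist _ p ≤ r
    rw [dist_comm] at h1
    linarith [dist_triangle (WithLp.toLp 2 (fun k => (round (x k) : ℝ))) x p]
  have h' := h.trans (measure_biUnion_finset_le _ _)
  rw [volume_closedBall_eq_ballVol hd p (by linarith)] at h'
  simp only [volume_latticeCube, Finset.sum_const, nsmul_eq_mul, mul_one] at h'
  rw [Set.ncard_eq_toFinset_card _ hfin]
  rw [← ENNReal.ofReal_natCast] at h'
  exact (ENNReal.ofReal_le_ofReal_iff (Nat.cast_nonneg _)).1 h'

theorem sqrt_div_two_le {d : ℕ} {r β : ℝ} (hβ : 0 < β)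
    (hr : 2 * (d : ℝ) * Real.sqrt d / β < r) : d * (Real.sqrt d / 2) ≤ β / 4 * r := by
  rw [div_lt_iff₀ hβ] at hr
  linarith

theorem one_le_sqrt_of_one_le {d : ℕ} (hd : 1 ≤ d) : 1 ≤ Real.sqrt d := by
  rw [Real.one_le_sqrt]; exact_mod_cast hd

theorem two_lt_of_large {d : ℕ} {r β : ℝ} (hβ : 0 < β) (hβ1 : β < 1)
    (hr : 2 * (d : ℝ) * Real.sqrt d / β < r) : 2 * (d : ℝ) * Real.sqrt d < r := by
  refine lt_of_le_of_lt ?_ hr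
  rw [le_div_iff₀ hβ]
  have := Real.sqrt_nonneg d
  nlinarith [mul_nonneg (Nat.cast_nonneg (α := ℝ) d) this]

/-- The number of lattice points of a large ball is at least almost its volume. -/
theorem ballVol_mul_le_ncard {d : ℕ} (hd : 1 ≤ d) (p : EuclideanSpace ℝ (Fin d)) {r β : ℝ}
    (hβ : 0 < β) (hβ1 : β < 1) (hr : 2 * (d : ℝ) * Real.sqrt d / β < r) :
    ballVol d r * (1 - β / 4) ≤ (latticeBall p r).ncard := by
  have hd' : (1 : ℝ) ≤ d := by exact_mod_cast hd
  have h1 := sqrt_div_two_le hβ hr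
  have h2 := two_lt_of_large hβ hβ1 hr
  have hs := one_le_sqrt_of_one_le hd
  have hr0 : 0 < r := by nlinarith
  refine le_trans ?_ (ballVol_le_ncard_latticeBall hd p hr0 (by nlinarith))
  set t := Real.sqrt d / 2 / r with ht
  have e : r - Real.sqrt d / 2 = (1 - t) * r := by rw [ht]; field_simp
  have hdt : d * t ≤ β / 4 := by rw [ht, ← mul_div_assoc, div_le_iff₀ hr0]; exact h1
  have ht0 : 0 ≤ t := by positivity
  have ht1 : t ≤ 1 := by nlinarith
  rw [e, ballVol_mul, mul_comm]
  have hb := one_add_mul_le_pow (a := -t) (by linarith) d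
  rw [← sub_eq_add_neg] at hb
  exact mul_le_mul_of_nonneg_right (by linarith) (ballVol_pos d hr0).le

theorem ncard_mul_le_ballVol {d : ℕ} (hd : 1 ≤ d) (p : EuclideanSpace ℝ (Fin d)) {r β : ℝ}
    (hβ : 0 < β) (hβ1 : β < 1) (hr : 2 * (d : ℝ) * Real.sqrt d / β < r) :
    (1 - β / 4) * (latticeBall p r).ncard ≤ ballVol d r := by
  have hd' : (1 : ℝ) ≤ d := by exact_mod_cast hd
  have h1 := sqrt_div_two_le hβ hr
  have h2 := two_lt_of_large hβ hβ1 hr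
  have hs := one_le_sqrt_of_one_le hd
  have hr0 : 0 < r := by nlinarith
  have hle := ncard_latticeBall_le_ballVol hd p hr0
  set t := Real.sqrt d / 2 / r with ht
  have e : r + Real.sqrt d / 2 = (1 + t) * r := by rw [ht]; field_simp
  have hdt : d * t ≤ β / 4 := by rw [ht, ← mul_div_assoc, div_le_iff₀ hr0]; exact h1
  have ht0 : 0 ≤ t := by positivity
  have ht1 : t ≤ 1 := by nlinarith
  rw [e, ballVol_mul] at hle
  have hb := one_add_mul_le_pow (a := -t) (by linarith) d
  -- An upper bound for `(1 + t)^d` is obtained as the reciprocal of `(1 - t)^d`, so that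
  -- Bernoulli's inequality for `1 - t` suffices in both directions.
  have hb' : (1 + -t) ^ d * (1 + t) ^ d ≤ 1 := by
    rw [← mul_pow]; exact pow_le_one₀ (by nlinarith) (by nlinarith)
  have hv := (ballVol_pos d hr0).le
  calc (1 - β / 4) * ((latticeBall p r).ncard : ℝ)
      ≤ (1 + -t) ^ d * ((1 + t) ^ d * ballVol d r) :=
        mul_le_mul (by linarith) hle (Nat.cast_nonneg _) (by apply pow_nonneg; linarith)
    _ = ((1 + -t) ^ d * (1 + t) ^ d) * ballVol d r := by ring
    _ ≤ ballVol d r := mul_le_of_le_one_left hv hb'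

namespace RandRAM
open Term

/-- The volume of a ball, for the dimension in variable `2` and the radius in variable `3`, is
written to variable `6`. -/
def volumeCmd : Cmd :=
  .put 5 (var 2) ;; .put 6 1 ;;
  .loop 2 (var 5) (.put 6 (var 6 * (2 * Term.pi * (var 3 * var 3) / var 5)) ;; .put 5 (var 5 - 2)) ;;
  .ite 1 (var 5) (.put 6 (var 6 * (2 * var 3))) .skip

variable {X : Type} {m : ℕ} {L : SetList X m}

theorem ev_volumeCmd {M : Memory} {d : ℕ} {r : ℝ} (hd : M 2 0 = d) (hr : M 3 0 = r) :
    Ev L volumeCmd M (3 * d + 5) fun M' => M' 6 0 = ballVol d r := by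
  -- The accumulated factor times the volume in the remaining dimension `k` is invariant. The
  -- dimension drops by two, so `d` is a generous bound for the number of iterations.
  refine Ev.le (Ev.seq (Ev.put (Ev.seq (Ev.put (Ev.seq (Ev.loop (T := 2) (fun j M' => ∃ k : ℕ, k ≤ j ∧
    M' 5 0 = k ∧ M' 3 0 = r ∧ M' 6 0 * ballVol k r = ballVol d r) ?_ ?_ ?_ d ?_))))))
    (?_ : 1 + (1 + ((d * (2 + 1) + 1) + 2)) ≤ _)
  · rintro M' ⟨k, hk, h5, h3, h6⟩
    obtain rfl : k = 0 := by omega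
    simp [h5]
  · rintro j M' ⟨k, hk, h5, h3, h6⟩ hle
    simp [h5] at hle
    obtain ⟨k, rfl⟩ : ∃ i, k = i + 2 := ⟨k - 2, by
      have : 2 ≤ k := by exact_mod_cast hle
      omega⟩
    refine Ev.seq (Ev.put (Ev.put ⟨k, by omega, ?_⟩))
    rw [ballVol_add_two] at h6
    simp [Memory.write_ne, h5, h3]
    rw [← h6]; ring
  · rintro j M' ⟨k, hk, h5, h3, h6⟩ hlt
    simp [h5] at hlt
    have hk2 : k ≤ 1 := by exact_mod_cast hlt
    refine Ev.ite (fun h => Ev.put ?_) (fun h => Ev.skip ?_)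
    · simp [h5] at h
      obtain rfl : k = 1 := by omega
      simp [h3, ← h6, ballVol_one]
    · simp [h5] at h
      subst h
      simp [← h6, ballVol_zero]
  · exact ⟨d, le_rfl, by simp [Memory.write_ne, hd], by simp [Memory.write_ne, hr], by simp⟩
  · omega

end RandRAM


/-! ## Sums over the lattice points of a box -/

/-- The candidates for a coordinate of a lattice point whose distance from `c` is at most `w`. -/
noncomputable def cand (w : ℕ) (c : ℝ) (y : ℕ) : ℤ := ⌊c⌋ - w + y

/-- The squared distance of a candidate from the centre. -/
noncomputable def candSq (w : ℕ) (c : ℝ) (y : ℕ) : ℝ := ((cand w c y : ℝ) - c) ^ 2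

/-- The sum of `f (x₀ + … + x_{j-1})` over all choices of squared distances `x_i` of candidates
for the coordinates `P i`. -/
noncomputable def boxSum {R : Type*} [AddCommMonoid R] (P : ℕ → ℝ) (w : ℕ) : ℕ → (ℝ → R) → R
  | 0, f => f 0
  | j + 1, f => ∑ y ∈ Finset.range (2 * w + 2), boxSum P w j fun v => f (v + candSq w (P j) y)

/-- The sums of squared distances of candidates. -/
def boxVals (P : ℕ → ℝ) (w : ℕ) : ℕ → Set ℝ
  | 0 => {0}
  | j + 1 => {u | ∃ v ∈ boxVals P w j, ∃ y < 2 * w + 2, u = v + candSq w (P j) y}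

namespace RandRAM
open Term

/-- The first `n` entries of `aV` are distinct elements of `S`, with weights in `aW` such that
the weighted sum of `f` over them is `F f`. -/
structure IsTable (M : Memory) (aV aW an n : ℕ) (S : Set ℝ) (F : (ℝ → ℝ) → ℝ) : Prop where
  card : M an 0 = n
  mem : ∀ i < n, M aV i ∈ S
  inj : ∀ i < n, ∀ j < n, M aV i = M aV j → i = j
  sum : ∀ f : ℝ → ℝ, ∑ i ∈ Finset.range n, M aW i * f (M aV i) = F f

theorem IsTable.congr {M M' : Memory} {aV aW an n : ℕ} {S : Set ℝ} {F : (ℝ → ℝ) → ℝ}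
    (h : IsTable M aV aW an n S F) (hV : M' aV = M aV) (hW : M' aW = M aW) (hn : M' an = M an) :
    IsTable M' aV aW an n S F := by
  refine ⟨by rw [hn, h.card], ?_, ?_, ?_⟩
  · rw [hV]; exact h.mem
  · rw [hV]; exact h.inj
  · rw [hV, hW]; exact h.sum

/-- The entries of a table are distinct, so its length is bounded by the number of attainable sums
rather than by the exponential number of choices. This makes the dynamic programming polynomial. -/
theorem IsTable.le_card {M : Memory} {aV aW an n : ℕ} {S : Set ℝ} {F : (ℝ → ℝ) → ℝ}
    (h : IsTable M aV aW an n S F) (D : Finset ℝ) (hD : S ⊆ D) : n ≤ D.card := by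
  have := Finset.card_le_card_of_injOn (s := Finset.range n) (t := D) (M aV)
    (fun i hi => hD (h.mem i (by simpa using hi)))
    (fun i hi j hj => h.inj i (by simpa using hi) j (by simpa using hj))
  simpa using this

/-- Adds the value in variable `21`, with the weight in variable `23`, to the table with values
in array `13`, weights in array `14` and size in variable `15`. -/
def insertCmd : Cmd :=
  .put 22 (var 15) ;;
  .forUp 19 (var 15) (.ite (.read 13 (var 19)) (var 21)
    (.ite (var 21) (.read 13 (var 19)) (.put 22 (var 19)) .skip) .skip) ;;
  .ite (var 15) (var 22)
    (.set 13 (var 15) (var 21) ;; .set 14 (var 15) 0 ;; .put 15 (var 15 + 1)) .skip ;;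
  .set 14 (var 22) (.read 14 (var 22) + var 23)

variable {X : Type} {m : ℕ} {L : SetList X m}

theorem ev_insertCmd {M : Memory} {n : ℕ} {S : Set ℝ} {F : (ℝ → ℝ) → ℝ} {v c : ℝ} {D : ℕ}
    (h : IsTable M 13 14 15 n S F) (hv : M 21 0 = v) (hc : M 23 0 = c) (hS : v ∈ S) (hD : n ≤ D) :
    Ev L insertCmd M (5 * D + 8) fun M' => ∃ n', IsTable M' 13 14 15 n' S fun f => F f + c * f v := by
  -- Variable `22` keeps the value `n` until an entry equal to `v` is met, and then holds its
  -- position. Position `n` is thus the signal to append a new entry.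
  refine Ev.le (Ev.seq (Ev.put (Ev.seq (Ev.forUp n (T := 3) (fun b M' =>
    (M' 22 0 = n ∧ ∀ i < b, M 13 i ≠ v) ∨ ∃ i < n, M' 22 0 = (i : ℝ) ∧ M 13 i = v)
    (by decide) ?_ ?_ ?_ ?_)))) (?_ : 1 + (n * (3 + 2) + 2 + (4 + 1)) ≤ _)
  · left; simp [Memory.write_ne, h.card]
  · intro M' hf
    simp [hf 15 (by decide) (by decide), Memory.write_ne, h.card]
  · intro k hk M' hc hf hI
    have h13 := hf 13 (by decide) (by decide)
    have h21 := hf 21 (by decide) (by decide)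
    simp only [Memory.write_ne M 0 _ (show 13 ≠ 22 by decide),
      Memory.write_ne M 0 _ (show 21 ≠ 22 by decide)] at h13 h21
    refine Ev.ite (fun h1 => Ev.ite (fun h2 => Ev.put ?_) (fun h2 => Ev.skip ?_)) (fun h1 =>
      Ev.le (Ev.skip ?_) (by omega))
    · right
      simp [hc, h13, h21, hv] at h1 h2
      exact ⟨k, hk, by simp [Memory.write_ne, hc], le_antisymm h1 h2⟩
    · simp [hc, h13, h21, hv] at h1 h2
      simp only [Memory.write_ne _ _ _ (show 22 ≠ 19 by decide)]
      refine hI.imp (fun hI => ⟨hI.1, fun i hi => ?_⟩) id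
      rcases Nat.lt_succ_iff_lt_or_eq.1 hi with hi | rfl
      · exact hI.2 i hi
      · exact h2.ne
    · simp [hc, h13, h21, hv] at h1
      simp only [Memory.write_ne _ _ _ (show 22 ≠ 19 by decide)]
      refine hI.imp (fun hI => ⟨hI.1, fun i hi => ?_⟩) id
      rcases Nat.lt_succ_iff_lt_or_eq.1 hi with hi | rfl
      · exact hI.2 i hi
      · exact h1.ne'
  · intro M' hc' hf hI
    have h13 := hf 13 (by decide) (by decide)
    have h14 := hf 14 (by decide) (by decide)
    have h15 := hf 15 (by decide) (by decide)
    have h21 := hf 21 (by decide) (by decide)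
    have h23 := hf 23 (by decide) (by decide)
    simp only [Memory.write_ne M 0 _ (show 13 ≠ 22 by decide),
      Memory.write_ne M 0 _ (show 14 ≠ 22 by decide),
      Memory.write_ne M 0 _ (show 15 ≠ 22 by decide),
      Memory.write_ne M 0 _ (show 23 ≠ 22 by decide),
      Memory.write_ne M 0 _ (show 21 ≠ 22 by decide)] at h13 h14 h15 h21 h23
    have hM' : IsTable M' 13 14 15 n S F := h.congr h13 h14 h15
    refine Ev.seq (T₁ := 4) (T₂ := 1) ?_
    rcases hI with ⟨h22, hne⟩ | ⟨i, hi, h22, hiv⟩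
    · refine Ev.ite (T := 3) (fun _ => ?_) (fun h1 => ?_)
      · refine Ev.seq (T₁ := 1) (T₂ := 2) (Ev.set (Ev.seq (T₁ := 1) (T₂ := 1) (Ev.set (Ev.put
          (Ev.set ⟨n + 1, ?_, ?_, ?_, ?_⟩)))))
        · simp [Memory.write_ne, Term.nat, hM'.card]
        · intro i hi
          simp [Memory.write_ne, Memory.write_self, Term.nat, hM'.card, h21, hv]
          split_ifs with h1
          · exact hS
          · exact hM'.mem i (by omega)
        · intro i hi j hj
          simp [Memory.write_ne, Memory.write_self, Term.nat, hM'.card, h21, hv]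
          split_ifs with h1 h2 h2
          · omega
          · intro h3; rw [h13] at h3; exact absurd h3.symm (hne j (by omega))
          · intro h3; rw [h13] at h3; exact absurd h3 (hne i (by omega))
          · exact hM'.inj i (by omega) j (by omega)
        · intro f
          rw [Finset.sum_range_succ]
          simp [Memory.write_ne, Memory.write_self, Term.nat, hM'.card, h21, hv, h22, h23, hc]
          rw [← hM'.sum]
          refine Finset.sum_congr rfl fun i hi => ?_
          have : i ≠ n := by simp at hi; omega
          simp [this]
      · simp [hM'.card, h22] at h1
    · refine Ev.ite (T := 3) (fun h1 => ?_) (fun _ => ?_)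
      · simp [hM'.card, h22] at h1; omega
      · refine Ev.le (Ev.skip (Ev.set ⟨n, ?_, ?_, ?_, ?_⟩)) (by omega)
        · simp [Memory.write_ne, hM'.card]
        · simp only [Memory.write_ne _ _ _ (show 13 ≠ 14 by decide)]; exact hM'.mem
        · simp only [Memory.write_ne _ _ _ (show 13 ≠ 14 by decide)]; exact hM'.inj
        · intro f
          rw [← hM'.sum]
          simp [Memory.write_ne, Memory.write_self, Term.nat, h22, h23, hc]
          rw [← Finset.sum_erase_add _ _ (Finset.mem_range.2 hi),
            ← Finset.sum_erase_add (Finset.range n) _ (Finset.mem_range.2 hi), add_assoc]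
          congr 1
          · refine Finset.sum_congr rfl fun j hj => ?_
            simp [Finset.ne_of_mem_erase hj]
          · simp [h13, hiv]; ring
  · omega

/-- Extends the table in arrays `10`, `11` and variable `12` by one coordinate, whose centre is in
variable `20`; the half width of the box is in variable `7`. -/
def extendCmd : Cmd :=
  .put 15 0 ;;
  .forUp 17 (var 12) (.forUp 18 (2 * var 7 + 2)
    (.put 24 (Term.floor (var 20) - var 7 + var 18 - var 20) ;;
      .put 21 (.read 10 (var 17) + var 24 * var 24) ;; .put 23 (.read 11 (var 17)) ;;
      insertCmd)) ;;
  .forUp 17 (var 15) (.set 10 (var 17) (.read 13 (var 17)) ;; .set 11 (var 17) (.read 14 (var 17))) ;;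
  .put 12 (var 15)

/-- Equal sums are merged on insertion, so the table under construction never has more than `D.card`
entries either, and each insertion is a linear search in at most that many. -/
theorem ev_extendCmd {M : Memory} {n w : ℕ} {S S' : Set ℝ} {F : (ℝ → ℝ) → ℝ} {c : ℝ} {D : Finset ℝ}
    (h : IsTable M 10 11 12 n S F) (hw : M 7 0 = w) (hc : M 20 0 = c) (hD : S ⊆ D)
    (hS' : ∀ v ∈ S, ∀ y < 2 * w + 2, v + candSq w c y ∈ S') (hD' : S' ⊆ D) :
    Ev L extendCmd M (D.card * ((2 * w + 2) * (5 * D.card + 13) + 8) + 10)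
      fun M' => ∃ n', IsTable M' 10 11 12 n' S' fun f =>
        ∑ y ∈ Finset.range (2 * w + 2), F fun v => f (v + candSq w c y) := by
  have hn := h.le_card D hD
  set Dc := D.card
  refine Ev.le (Ev.seq (Ev.put (Ev.seq (Ev.forUp n (T := (2 * w + 2) * (5 * Dc + 13) + 2) (fun a M' =>
    ∃ n', IsTable M' 13 14 15 n' S' fun f => ∑ a' ∈ Finset.range a, ∑ y ∈ Finset.range (2 * w + 2),
      M 11 a' * f (M 10 a' + candSq w c y)) (by decide) ?_ ?_ ?_ ?_))))
    (?_ : 1 + (n * (((2 * w + 2) * (5 * Dc + 13) + 2) + 2) + 2 + ((Dc * (2 + 2) + 2) + 1)) ≤ _)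
  · refine ⟨0, ?_, ?_, ?_, ?_⟩ <;> simp [Memory.write_ne]
  · intro M' hf
    simp [hf 12 (by decide) (by decide), Memory.write_ne, h.card]
  · rintro a ha M' ha' hf hI
    have h7 := hf 7 (by decide) (by decide)
    have h20 := hf 20 (by decide) (by decide)
    have h10 := hf 10 (by decide) (by decide)
    have h11 := hf 11 (by decide) (by decide)
    simp [Memory.write_ne] at h7 h20 h10 h11
    refine Ev.le (Ev.forUp (2 * w + 2) (T := 5 * Dc + 11) (fun y M'' =>
      ∃ n', IsTable M'' 13 14 15 n' S' fun f => ∑ a' ∈ Finset.range a,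
        ∑ y ∈ Finset.range (2 * w + 2), M 11 a' * f (M 10 a' + candSq w c y) +
        ∑ y' ∈ Finset.range y, M 11 a * f (M 10 a + candSq w c y'))
      (by decide) ?_ ?_ ?_ ?_) (?_ : (2 * w + 2) * ((5 * Dc + 11) + 2) + 2 ≤ _)
    · obtain ⟨n', hI⟩ := hI
      refine ⟨n', ?_⟩
      simpa using hI.congr (Memory.write_ne _ _ _ (by decide)) (Memory.write_ne _ _ _ (by decide))
        (Memory.write_ne _ _ _ (by decide))
    · intro M'' hf'
      simp [hf' 7 (by decide) (by decide), h7, hw]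
    · rintro y hy M'' hy' hf' ⟨n', hI'⟩
      have h7' := hf' 7 (by decide) (by decide)
      have h20' := hf' 20 (by decide) (by decide)
      have h10' := hf' 10 (by decide) (by decide)
      have h11' := hf' 11 (by decide) (by decide)
      have h17' := hf' 17 (by decide) (by decide)
      refine Ev.le (Ev.seq (Ev.put (Ev.seq (Ev.put (Ev.seq (Ev.put (Ev.mono (ev_insertCmd (n := n')
        (c := M 11 a) (v := M 10 a + candSq w c y) (D := Dc) (hI'.congr ?_ ?_ ?_)
        ?_ ?_ ?_ ?_) ?_)))))))
        (?_ : 1 + (1 + (1 + (5 * Dc + 8))) ≤ _)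
      · simp [Memory.write_ne]
      · simp [Memory.write_ne]
      · simp [Memory.write_ne]
      · simp [Memory.write_ne, h7', h20', h10', h17', ha', hy', h7, h20, h10, candSq, cand, hw, hc]
        ring
      · simp [Memory.write_ne, h11', h17', ha', h11]
      · exact hS' _ (h.mem a ha) y hy
      · exact hI'.le_card D hD'
      · rintro M₃ ⟨n'', hn''⟩
        refine ⟨n'', ?_⟩
        have := hn''.congr (M' := M₃.write 18 0 ((y + 1 : ℕ) : ℝ))
          (Memory.write_ne _ _ _ (by decide)) (Memory.write_ne _ _ _ (by decide))
          (Memory.write_ne _ _ _ (by decide))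
        simp only [Finset.sum_range_succ _ y, ← add_assoc]
        exact this
      · omega
    · rintro M'' hy' hf' ⟨n', hI'⟩
      refine ⟨n', ?_⟩
      simp only [Finset.sum_range_succ _ a]
      exact hI'.congr (Memory.write_ne _ _ _ (by decide)) (Memory.write_ne _ _ _ (by decide))
        (Memory.write_ne _ _ _ (by decide))
    · ring_nf; omega
  · rintro M' ha' hf ⟨n', hI⟩
    have hn' : n' ≤ Dc := hI.le_card D hD'
    refine Ev.le (Ev.seq (Ev.forUp n' (T := 2) (fun k M'' =>
      ∀ i < k, M'' 10 i = M' 13 i ∧ M'' 11 i = M' 14 i) (by decide) ?_ ?_ ?_ ?_))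
      (?_ : (n' * (2 + 2) + 2) + 1 ≤ _)
    · intro i hi; omega
    · intro M'' hf'
      simp [hf' 15 (by decide) (by decide), hI.card]
    · rintro k hk M'' hk' hf' hI'
      have h13' := hf' 13 (by decide) (by decide)
      have h14' := hf' 14 (by decide) (by decide)
      refine Ev.seq (Ev.set (Ev.set ?_))
      intro i hi
      simp [Memory.write_ne, Memory.write_self, Term.nat, hk', h13', h14']
      constructor <;> split_ifs with h1
      · rw [h1]
      · exact (hI' i (by omega)).1
      · rw [h1]
      · exact (hI' i (by omega)).2
    · intro M'' _ hf' hI'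
      have h15' := hf' 15 (by decide) (by decide)
      refine Ev.put ⟨n', ?_, ?_, ?_, ?_⟩
      · simp [h15', hI.card]
      · intro i hi
        simp only [Memory.write_ne _ _ _ (show 10 ≠ 12 by decide), (hI' i hi).1]
        exact hI.mem i hi
      · intro i hi j hj
        simp only [Memory.write_ne _ _ _ (show 10 ≠ 12 by decide), (hI' i hi).1, (hI' j hj).1]
        exact hI.inj i hi j hj
      · intro f
        simp only [Memory.write_ne _ _ _ (show 10 ≠ 12 by decide),
          Memory.write_ne _ _ _ (show 11 ≠ 12 by decide), ← h.sum]
        rw [Finset.sum_comm, ← hI.sum]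
        refine Finset.sum_congr rfl fun i hi => ?_
        rw [(hI' i (by simpa using hi)).1, (hI' i (by simpa using hi)).2]
    · gcongr
  · have := Nat.mul_le_mul_right (((2 * w + 2) * (5 * Dc + 13) + 2) + 2) hn
    have e : Dc * ((2 * w + 2) * (5 * Dc + 13) + 8) =
      Dc * (((2 * w + 2) * (5 * Dc + 13) + 2) + 2) + 4 * Dc := by ring
    rw [e]
    omega

/-- Tabulates the sums of squared distances over the last coordinates, as many as variable `8`
says, of the `d` coordinates in array `1`; `d` is in variable `2`. -/
def tableCmd : Cmd :=
  .put 12 1 ;; .set 10 0 0 ;; .set 11 0 1 ;;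
  .forUp 16 (var 8) (.put 20 (.read 1 (var 2 - 1 - var 16)) ;; extendCmd)

/-- The coordinates enter from the last one backwards. A table for `J` of them then covers precisely
the coordinates that are still open when the unranking has fixed all the earlier ones. -/
theorem ev_tableCmd {M : Memory} {d J w : ℕ} {P : ℕ → ℝ} {D : Finset ℝ}
    (hd : M 2 0 = d) (hw : M 7 0 = w) (hJ : M 8 0 = J) (hJd : J ≤ d)
    (hP : ∀ j < J, M 1 (d - 1 - j) = P j) (hD : ∀ j ≤ J, boxVals P w j ⊆ D) :
    Ev L tableCmd M (d * (D.card * ((2 * w + 2) * (5 * D.card + 13) + 8) + 13) + 5)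
      fun M' => ∃ n, IsTable M' 10 11 12 n (boxVals P w J) (boxSum P w J) := by
  set T := D.card * ((2 * w + 2) * (5 * D.card + 13) + 8) + 10
  refine Ev.le (Ev.seq (Ev.put (Ev.seq (Ev.set (Ev.seq (Ev.set (Ev.forUp J (T := 1 + T) (fun j M' =>
    ∃ n, IsTable M' 10 11 12 n (boxVals P w j) (boxSum P w j)) (by decide) ?_ ?_ ?_ ?_)))))))
    (?_ : 1 + (1 + (1 + (J * ((1 + T) + 2) + 2))) ≤ _)
  · refine ⟨1, ?_, ?_, ?_, ?_⟩ <;> simp [Memory.write_ne, Term.nat, boxVals, boxSum]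
  · intro M' hf
    simp [hf 8 (by decide) (by decide), Memory.write_ne, hJ]
  · rintro j hj M' hj' hf ⟨n, hI⟩
    have h1 := hf 1 (by decide) (by decide)
    have h2 := hf 2 (by decide) (by decide)
    have h7 := hf 7 (by decide) (by decide)
    simp [Memory.write_ne] at h1 h2 h7
    refine Ev.seq (Ev.put (Ev.mono (ev_extendCmd (n := n) (w := w) (S := boxVals P w j)
      (S' := boxVals P w (j + 1)) (F := boxSum P w j) (c := P j) (D := D)
      (hI.congr ?_ ?_ ?_) ?_ ?_ ?_ ?_ ?_) ?_))
    · simp [Memory.write_ne]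
    · simp [Memory.write_ne]
    · simp [Memory.write_ne]
    · simp [Memory.write_ne, h7, hw]
    · have : ((d : ℝ) - 1 - j) = ((d - 1 - j : ℕ) : ℝ) := by
        rw [Nat.cast_sub (by omega), Nat.cast_sub (by omega)]; simp
      simp [h1, h2, hd, hj', this, hP j hj]
    · exact hD j hj.le
    · intro v hv y hy; exact ⟨v, hv, y, hy, rfl⟩
    · exact hD (j + 1) hj
    · rintro M'' ⟨n', hn'⟩
      exact ⟨n', hn'.congr (Memory.write_ne _ _ _ (by decide)) (Memory.write_ne _ _ _ (by decide))
        (Memory.write_ne _ _ _ (by decide))⟩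
  · intro M' _ _ hI; exact hI
  · have := Nat.mul_le_mul_right (T + 3) hJd
    have e : 1 + T + 2 = T + 3 := by ring
    rw [e]
    change _ ≤ d * (T + 3) + 5
    omega

/-- Sums the weights of the table entries that are at most variable `25`, into variable `26`. -/
def countTableCmd : Cmd :=
  .put 26 0 ;;
  .forUp 19 (var 12) (.ite (.read 10 (var 19)) (var 25) (.put 26 (var 26 + .read 11 (var 19))) .skip)

theorem ev_countTableCmd {M : Memory} {n D : ℕ} {S : Set ℝ} {F : (ℝ → ℝ) → ℝ} {ρ : ℝ}
    (h : IsTable M 10 11 12 n S F) (hρ : M 25 0 = ρ) (hn : n ≤ D) :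
    Ev L countTableCmd M (4 * D + 3) fun M' => M' 26 0 = F fun v => if v ≤ ρ then 1 else 0 := by
  refine Ev.le (Ev.seq (Ev.put (Ev.forUp n (T := 2) (fun k M' => M' 26 0 =
    ∑ i ∈ Finset.range k, M 11 i * if M 10 i ≤ ρ then 1 else 0) (by decide) ?_ ?_ ?_ ?_)))
    (?_ : 1 + (n * (2 + 2) + 2) ≤ _)
  · simp [Memory.write_ne]
  · intro M' hf
    simp [hf 12 (by decide) (by decide), Memory.write_ne, h.card]
  · intro k hk M' hk' hf hI
    have h10 := hf 10 (by decide) (by decide)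
    have h11 := hf 11 (by decide) (by decide)
    have h25 := hf 25 (by decide) (by decide)
    simp [Memory.write_ne] at h10 h11 h25
    refine Ev.ite (fun h1 => Ev.put ?_) (fun h1 => Ev.skip ?_)
    · simp [hk', h10, h25, hρ] at h1
      simp [Memory.write_ne, Finset.sum_range_succ, hI, hk', h11, h1]
    · simp [hk', h10, h25, hρ] at h1
      simp [Memory.write_ne, Finset.sum_range_succ, hI, h1]
  · intro M' _ _ hI
    rw [hI, ← h.sum]
  · omega

end RandRAM


/-! ## Counting lattice points in a box -/

section Box

variable (P : ℕ → ℝ) (w : ℕ)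

theorem boxSum_eq_sum {R : Type*} [AddCommMonoid R] (j : ℕ) (f : ℝ → R) :
    boxSum P w j f = ∑ Y : Fin j → Fin (2 * w + 2), f (∑ i : Fin j, candSq w (P i) (Y i)) := by
  induction j generalizing f with
  | zero => simp [boxSum]
  | succ j ih =>
    simp only [boxSum, ih]
    rw [← (Fin.snocEquiv fun _ => Fin (2 * w + 2)).sum_comp, Fintype.sum_prod_type,
      Finset.sum_range]
    refine Finset.sum_congr rfl fun y _ => Finset.sum_congr rfl fun Y _ => ?_
    simp [Fin.snocEquiv, Fin.sum_univ_castSucc]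

/-- The number of choices of candidates with sum of squared distances at most `ρ`. -/
noncomputable def boxCount (j : ℕ) (ρ : ℝ) : ℕ := boxSum P w j fun v => if v ≤ ρ then 1 else 0

theorem boxCount_cast (j : ℕ) (ρ : ℝ) :
    (boxCount P w j ρ : ℝ) = boxSum P w j fun v => if v ≤ ρ then (1 : ℝ) else 0 := by
  simp [boxCount, boxSum_eq_sum]

theorem boxCount_zero (ρ : ℝ) : boxCount P w 0 ρ = if 0 ≤ ρ then 1 else 0 := rfl

theorem boxCount_succ (j : ℕ) (ρ : ℝ) : boxCount P w (j + 1) ρ =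
    ∑ y ∈ Finset.range (2 * w + 2), boxCount P w j (ρ - candSq w (P j) y) := by
  simp only [boxCount, boxSum, le_sub_iff_add_le]

/-- The rank of a choice of candidates in the lexicographic order. -/
noncomputable def boxRank : ℕ → ℝ → (ℕ → ℕ) → ℕ
  | 0, _, _ => 0
  | j + 1, ρ, Y => ∑ y ∈ Finset.range (Y j), boxCount P w j (ρ - candSq w (P j) y) +
      boxRank j (ρ - candSq w (P j) (Y j)) Y

/-- Split `boxCount` into blocks by the candidate of coordinate `j`: the rank is the total size of
the blocks before `Y j` plus a rank inside that block, which by induction is smaller than the block.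
-/
theorem boxRank_lt (Y : ℕ → ℕ) (j : ℕ) (ρ : ℝ) (hY : ∀ i < j, Y i < 2 * w + 2)
    (h : ∑ i ∈ Finset.range j, candSq w (P i) (Y i) ≤ ρ) :
    boxRank P w j ρ Y < boxCount P w j ρ := by
  induction j generalizing ρ with
  | zero =>
    have h : 0 ≤ ρ := by simpa using h
    simp [boxRank, boxCount_zero, h]
  | succ j ih =>
    rw [Finset.sum_range_succ] at h
    have h1 := ih (ρ - candSq w (P j) (Y j)) (fun i hi => hY i (by omega)) (by linarith)
    rw [boxCount_succ, boxRank]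
    have h2 : Finset.range (Y j + 1) ⊆ Finset.range (2 * w + 2) :=
      Finset.range_subset_range.2 (hY j (by omega))
    refine lt_of_lt_of_le ?_ (Finset.sum_le_sum_of_subset h2)
    rw [Finset.sum_range_succ]
    omega

/-- For a centre coordinate `i + tλ`, the difference from an integer is `A - tλ` with an integer
`A`, and its square is `A² - 2λ(At) + λ²t²`. All sums therefore have the form `a - 2λb + λ²c` with
bounded integers, and the bound counts the triples `(a, b, c)`. -/
theorem boxVals_subset {lam : ℝ} {l Λ d : ℕ} (hlam : |lam| ≤ Λ)
    (hP : ∀ i < d, ∃ a b : ℤ, |b| ≤ l ∧ P i = a + b * lam) :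
    ∃ D : Finset ℝ, (∀ j ≤ d, boxVals P w j ⊆ D) ∧
      D.card ≤ (d * (w + 1 + l * Λ) ^ 2 + 1) * (2 * (d * ((w + 1 + l * Λ) * l)) + 1) *
        (d * l ^ 2 + 1) := by
  classical
  set Y := w + 1 + l * Λ with hYdef
  have key : ∀ j ≤ d, ∀ u ∈ boxVals P w j, ∃ a b c : ℤ, 0 ≤ a ∧ a ≤ j * Y ^ 2 ∧
      |b| ≤ j * (Y * l) ∧ 0 ≤ c ∧ c ≤ j * l ^ 2 ∧ u = a - 2 * lam * b + lam ^ 2 * c := by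
    intro j
    induction j with
    | zero => intro _ u hu; exact ⟨0, 0, 0, by simpa [boxVals] using hu⟩
    | succ j ih =>
      rintro hj u ⟨v, hv, y, hy, rfl⟩
      obtain ⟨a, b, c, ha, ha', hb, hc, hc', rfl⟩ := ih (by omega) v hv
      obtain ⟨i, t, ht, hPj⟩ := hP j (by omega)
      -- A candidate is within `w + 1` of the centre, and the integer part `i` of the centre differs
      -- from it by `|tλ| ≤ l Λ`.
      have hA : |(cand w (P j) y - i : ℤ)| ≤ (Y : ℤ) := by
        have h1 : |((cand w (P j) y : ℤ) : ℝ) - P j| ≤ w + 1 := by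
          have h2 := Int.floor_le (P j)
          have h3 := Int.lt_floor_add_one (P j)
          have h4 : (y : ℝ) + 1 ≤ 2 * w + 2 := by exact_mod_cast hy
          have h5 : (0 : ℝ) ≤ y := Nat.cast_nonneg y
          unfold cand
          push_cast
          rw [abs_le]
          constructor <;> linarith
        have h6 : |(t : ℝ) * lam| ≤ l * Λ := by
          rw [abs_mul]
          refine mul_le_mul ?_ hlam (abs_nonneg _) (Nat.cast_nonneg _)
          exact_mod_cast ht
        have h7 : |((cand w (P j) y - i : ℤ) : ℝ)| ≤ Y := by
          have e : ((cand w (P j) y - i : ℤ) : ℝ) = ((cand w (P j) y : ℤ) - P j) + t * lam := by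
            rw [hPj]; push_cast; ring
          rw [e, hYdef]; push_cast
          exact (abs_add_le _ _).trans (add_le_add h1 h6)
        exact_mod_cast h7
      set A : ℤ := cand w (P j) y - i with hAdef
      have hA2 : A ^ 2 ≤ (Y : ℤ) ^ 2 := by
        rw [← sq_abs A]; exact pow_le_pow_left₀ (abs_nonneg _) hA 2
      have ht2 : t ^ 2 ≤ (l : ℤ) ^ 2 := by
        rw [← sq_abs t]; exact pow_le_pow_left₀ (abs_nonneg _) ht 2
      have hAt : |A * t| ≤ (Y : ℤ) * l := by
        rw [abs_mul]; exact mul_le_mul hA ht (abs_nonneg _) (by positivity)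
      refine ⟨a + A ^ 2, b + A * t, c + t ^ 2, by positivity, ?_, ?_, by positivity, ?_, ?_⟩
      · push_cast; linarith
      · refine (abs_add_le _ _).trans ?_
        push_cast
        linarith
      · push_cast; linarith
      · have e : candSq w (P j) y = ((A : ℝ) - t * lam) ^ 2 := by
          rw [candSq, hAdef, hPj]; push_cast; ring
        rw [e]; push_cast; ring
  refine ⟨((Finset.Icc (0 : ℤ) (d * Y ^ 2) ×ˢ Finset.Icc (-(d * (Y * l)) : ℤ) (d * (Y * l))) ×ˢ
    Finset.Icc (0 : ℤ) (d * l ^ 2)).image fun q => (q.1.1 : ℝ) - 2 * lam * q.1.2 + lam ^ 2 * q.2,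
    ?_, ?_⟩
  · intro j hj u hu
    obtain ⟨a, b, c, ha, ha', hb, hc, hc', rfl⟩ := key j hj u hu
    have hj' : (j : ℤ) ≤ d := by exact_mod_cast hj
    simp only [Finset.coe_image, Set.mem_image, Finset.mem_coe, Finset.mem_product, Finset.mem_Icc]
    refine ⟨((a, b), c), ⟨⟨⟨ha, ha'.trans ?_⟩, abs_le.1 (hb.trans ?_)⟩, hc, hc'.trans ?_⟩, rfl⟩
    · gcongr
    · gcongr
    · gcongr
  · refine Finset.card_image_le.trans (le_of_eq ?_)
    rw [Finset.card_product, Finset.card_product, Int.card_Icc, Int.card_Icc, Int.card_Icc]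
    have e1 : ((d : ℤ) * (Y : ℤ) ^ 2 + 1 - 0) = ((d * Y ^ 2 + 1 : ℕ) : ℤ) := by push_cast; ring
    have e2 : ((d : ℤ) * (Y * l) + 1 - -(d * (Y * l))) = ((2 * (d * (Y * l)) + 1 : ℕ) : ℤ) := by
      push_cast; ring
    have e3 : ((d : ℤ) * (l : ℤ) ^ 2 + 1 - 0) = ((d * l ^ 2 + 1 : ℕ) : ℤ) := by push_cast; ring
    rw [e1, e2, e3, Int.toNat_natCast, Int.toNat_natCast, Int.toNat_natCast]

end Box

/-! ## Lattice points of a ball as choices of candidates -/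

section BallBox

variable {d : ℕ} (p : EuclideanSpace ℝ (Fin d))

/-- The coordinates of a point in reverse order. -/
noncomputable def revCoords (j : ℕ) : ℝ := RandRAM.coords (fun k => p k) (d - 1 - j)

theorem revCoords_rev (k : Fin d) : revCoords p (k.rev : ℕ) = p k := by
  have : d - 1 - (k.rev : ℕ) = k := by simp [Fin.val_rev]; omega
  rw [revCoords, this, RandRAM.coords_val]

theorem exists_cand {c r : ℝ} (z : ℤ) (h : |(z : ℝ) - c| ≤ r) :
    ∃ y < 2 * ⌈r⌉₊ + 2, z = cand ⌈r⌉₊ c y := by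
  have h1 := Int.floor_le c
  have h2 := Int.lt_floor_add_one c
  have h3 := Nat.le_ceil r
  have h4 := abs_le.1 h
  have h5 : ⌊c⌋ < z + ⌈r⌉₊ + 1 := by
    have : (⌊c⌋ : ℝ) < ((z + ⌈r⌉₊ + 1 : ℤ) : ℝ) := by push_cast; linarith
    exact_mod_cast this
  have h6 : z < ⌊c⌋ + ⌈r⌉₊ + 1 := by
    have : (z : ℝ) < ((⌊c⌋ + ⌈r⌉₊ + 1 : ℤ) : ℝ) := by push_cast; linarith
    exact_mod_cast this
  exact ⟨(z - (⌊c⌋ - ⌈r⌉₊)).toNat, by omega, by unfold cand; omega⟩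

theorem abs_sub_le_of_mem_latticeBall {r : ℝ} (hr : 0 < r) {z : Fin d → ℤ}
    (hz : z ∈ latticeBall p r) (k : Fin d) : |(z k : ℝ) - p k| ≤ r := by
  rw [mem_latticeBall p hr] at hz
  exact abs_le_of_sq_le_sq ((Finset.single_le_sum (f := fun k => ((z k : ℝ) - p k) ^ 2)
    (fun i _ => sq_nonneg _) (Finset.mem_univ k)).trans hz) hr.le

theorem exists_choice {r : ℝ} (hr : 0 < r) {z : Fin d → ℤ} (hz : z ∈ latticeBall p r) :
    ∃ Y : ℕ → ℕ, (∀ i < d, Y i < 2 * ⌈r⌉₊ + 2) ∧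
      (∀ k : Fin d, z k = cand ⌈r⌉₊ (p k) (Y k.rev)) ∧
      ∑ i ∈ Finset.range d, candSq ⌈r⌉₊ (revCoords p i) (Y i) ≤ r ^ 2 := by
  choose y hy hzy using fun k => exists_cand (z k) (abs_sub_le_of_mem_latticeBall p hr hz k)
  refine ⟨fun i => if h : i < d then y (Fin.rev ⟨i, h⟩) else 0, ?_, ?_, ?_⟩
  · intro i hi; simp only [hi, dif_pos]; exact hy _
  · intro k
    simp only [Fin.is_lt, dif_pos, Fin.eta, Fin.rev_rev]
    exact hzy k
  · rw [mem_latticeBall p hr] at hz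
    refine le_trans (le_of_eq ?_) hz
    rw [Finset.sum_range, ← Equiv.sum_comp Fin.revPerm]
    refine Finset.sum_congr rfl fun k _ => ?_
    simp only [Fin.revPerm_apply, Fin.is_lt, dif_pos, Fin.eta, Fin.rev_rev]
    rw [revCoords_rev, candSq, ← hzy]

/-- The candidates for a coordinate are distinct and include every integer within distance `r` of
the centre, so the admissible choices are in bijection with the lattice points. -/
theorem ncard_latticeBall_eq_boxCount {r : ℝ} (hr : 0 < r) :
    (latticeBall p r).ncard = boxCount (revCoords p) ⌈r⌉₊ d (r ^ 2) := by
  classical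
  set w := ⌈r⌉₊
  rw [boxCount, boxSum_eq_sum]
  have e : (∑ Y : Fin d → Fin (2 * w + 2),
      if ∑ i : Fin d, candSq w (revCoords p i) (Y i) ≤ r ^ 2 then 1 else 0) =
      (Finset.univ.filter fun Y : Fin d → Fin (2 * w + 2) =>
        ∑ i : Fin d, candSq w (revCoords p i) (Y i) ≤ r ^ 2).card := by simp
  rw [e, ← Set.ncard_coe_finset]
  symm
  refine Set.ncard_congr (fun Y _ k => cand w (p k) (Y k.rev)) ?_ ?_ ?_
  · intro Y hY
    rw [mem_latticeBall p hr]
    simp only [Finset.coe_filter, Finset.mem_univ, true_and, Set.mem_ofPred_eq] at hY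
    refine le_trans (le_of_eq ?_) hY
    rw [← Equiv.sum_comp Fin.revPerm]
    refine Finset.sum_congr rfl fun k _ => ?_
    have h := revCoords_rev p k.rev
    rw [Fin.rev_rev] at h
    simp [candSq, h]
  · intro Y Y' _ _ h
    funext i
    have := congrFun h i.rev
    simp only [Fin.rev_rev, cand] at this
    ext; omega
  · intro z hz
    obtain ⟨Y, hY, hzY, hs⟩ := exists_choice p hr hz
    refine ⟨fun i => ⟨Y i, hY i i.2⟩, ?_, ?_⟩
    · simp only [Finset.coe_filter, Finset.mem_univ, true_and, Set.mem_ofPred_eq]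
      rwa [Finset.sum_range] at hs
    · funext k; exact (hzY k).symm

end BallBox

namespace RandRAM
open Term

/-- Replaces the rank in variable `30` by the lattice point with this rank in the ball with squared
radius in variable `31`. -/
def unrankCmd : Cmd :=
  .forUp 32 (var 2)
    (.put 8 (var 2 - 1 - var 32) ;; tableCmd ;; .put 34 0 ;; .put 37 (.read 1 (var 32)) ;;
      .forUp 33 (2 * var 7 + 2)
        (.ite 1 (var 34) .skip
          (.put 35 (Term.floor (var 37) - var 7 + var 33) ;; .set 0 (var 32) (var 35) ;;
            .put 25 (var 31 - (var 35 - var 37) * (var 35 - var 37)) ;; countTableCmd ;;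
            .ite (var 26) (var 30) (.put 30 (var 30 - var 26)) (.put 34 1 ;; .put 31 (var 25)))))

variable {X : Type} {m : ℕ} {L : SetList X m}

/-- One step of the selection of a coordinate. -/
theorem ev_unrankStep {M : Memory} {w j k n y D : ℕ} {P : ℕ → ℝ}
    (hw : M 7 0 = w) (hk : M 32 0 = k) (hy : M 33 0 = y) (hc : M 37 0 = P j) (hn : n ≤ D)
    (hI : IsTable M 10 11 12 n (boxVals P w j) (boxSum P w j)) :
    Ev L (.put 35 (Term.floor (var 37) - var 7 + var 33) ;; .set 0 (var 32) (var 35) ;;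
      .put 25 (var 31 - (var 35 - var 37) * (var 35 - var 37)) ;; countTableCmd ;;
      .ite (var 26) (var 30) (.put 30 (var 30 - var 26)) (.put 34 1 ;; .put 31 (var 25))) M
      (4 * D + 9) fun M' => (∀ i, M' 0 i = if i = k then (cand w (P j) y : ℝ) else M 0 i) ∧
        ((boxCount P w j (M 31 0 - candSq w (P j) y) ≤ M 30 0 ∧ M' 31 0 = M 31 0 ∧
          M' 34 0 = M 34 0 ∧ M' 30 0 = M 30 0 - boxCount P w j (M 31 0 - candSq w (P j) y)) ∨
        (M 30 0 < boxCount P w j (M 31 0 - candSq w (P j) y) ∧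
          M' 31 0 = M 31 0 - candSq w (P j) y ∧ M' 34 0 = 1 ∧ M' 30 0 = M 30 0)) := by
  refine Ev.le (Ev.seq (Ev.put (Ev.seq (Ev.set (Ev.seq (Ev.put (Ev.seq (Ev.mono
    (ev_countTableCmd (n := n) (D := D) (S := boxVals P w j) (F := boxSum P w j)
      (ρ := M 31 0 - candSq w (P j) y) (hI.congr ?_ ?_ ?_) ?_ hn).frame ?_))))))))
    (?_ : 1 + (1 + (1 + ((4 * D + 3) + 3))) ≤ _)
  · simp [Memory.write_ne]
  · simp [Memory.write_ne]
  · simp [Memory.write_ne]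
  · simp [Memory.write_ne, hw, hy, hc, candSq, cand]; ring
  · rintro M' ⟨h26, hf⟩
    have h0 := hf 0 (by decide)
    have h31 := hf 31 (by decide)
    have h34 := hf 34 (by decide)
    have h30 := hf 30 (by decide)
    have h25 := hf 25 (by decide)
    rw [← boxCount_cast] at h26
    have hz : ∀ i, M' 0 i = if i = k then (cand w (P j) y : ℝ) else M 0 i := by
      intro i
      simp [h0, Memory.write_ne, Memory.write_self, Term.nat, hk, hw, hc, hy, cand]
    simp [Memory.write_ne, hw, hy, hc] at h31 h34 h30 h25
    refine Ev.ite (T := 2) (fun h => Ev.le (Ev.put ?_) (by omega)) (fun h =>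
      Ev.seq (T₁ := 1) (T₂ := 1) (Ev.put (Ev.put ?_)))
    · simp [h26, h30] at h
      refine ⟨fun i => by simp [Memory.write_ne, hz], Or.inl ?_⟩
      simp [Memory.write_ne, h26, h30, h31, h34, h]
    · simp [h26, h30] at h
      refine ⟨fun i => by simp [Memory.write_ne, hz], Or.inr ?_⟩
      refine ⟨h, ?_, ?_, ?_⟩
      · simp [Memory.write_ne, h25, candSq, cand]
        ring
      · simp [Memory.write_ne]
      · simp [Memory.write_ne, h30]
  · omega

/-- For each coordinate, block sizes are subtracted from the rank until the remainder falls into a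
block. The first conclusion holds for every `U`, even if no point has this rank; it is needed when
the ball is empty. -/
theorem ev_unrankCmd {M : Memory} {d w U : ℕ} {c P : ℕ → ℝ} {ρ : ℝ} {D : Finset ℝ}
    (hd : M 2 0 = d) (hw : M 7 0 = w) (h1 : M 1 = c) (hU : M 30 0 = U) (hρ : M 31 0 = ρ)
    (hP : ∀ j < d, P j = c (d - 1 - j)) (hD : ∀ j ≤ d, boxVals P w j ⊆ D) :
    Ev L unrankCmd M (d * ((d * (D.card * ((2 * w + 2) * (5 * D.card + 13) + 8) + 13) + 5) +
        (2 * w + 2) * (4 * D.card + 12) + 7) + 2)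
      fun M' => (∀ k < d, ∃ z : ℤ, M' 0 k = z) ∧ ∀ Y : ℕ → ℕ, (∀ i < d, Y i < 2 * w + 2) →
        ∑ i ∈ Finset.range d, candSq w (P i) (Y i) ≤ ρ → U = boxRank P w d ρ Y →
        ∀ k < d, M' 0 k = (cand w (c k) (Y (d - 1 - k)) : ℝ) := by
  set Tt := d * (D.card * ((2 * w + 2) * (5 * D.card + 13) + 8) + 13) + 5 with hTt
  refine Ev.le (Ev.forUp d (T := 1 + (Tt + (1 + (1 + ((2 * w + 2) * ((4 * D.card + 10) + 2) + 2)))))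
    (fun k M' => (∀ i < k, ∃ z : ℤ, M' 0 i = z) ∧
      ∀ Y : ℕ → ℕ, (∀ i < d, Y i < 2 * w + 2) →
        ∑ i ∈ Finset.range d, candSq w (P i) (Y i) ≤ ρ → U = boxRank P w d ρ Y →
        (∀ i < k, M' 0 i = (cand w (c i) (Y (d - 1 - i)) : ℝ)) ∧
        (M' 30 0 = boxRank P w (d - k) (M' 31 0) Y ∧
          ∑ i ∈ Finset.range (d - k), candSq w (P i) (Y i) ≤ M' 31 0)) (by decide) ?_ ?_ ?_ ?_)
    (le_of_eq (by ring))
  · refine ⟨by simp, fun Y hY hs hr => ⟨by simp, ?_, ?_⟩⟩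
    · simp [Memory.write_ne, hU, hρ, hr]
    · simpa [Memory.write_ne, hρ] using hs
  · intro M' hf
    simp [hf 2 (by decide) (by decide), hd]
  · rintro k hk M' hk' hf ⟨hz, hI⟩
    have h1' := hf 1 (by decide) (by decide)
    have h2' := hf 2 (by decide) (by decide)
    have h7' := hf 7 (by decide) (by decide)
    have ed : d - k = (d - 1 - k) + 1 := by omega
    set j := d - 1 - k with hj
    have hPj : P j = c k := by rw [hP j (by omega)]; congr 1; omega
    refine Ev.seq (Ev.put (Ev.seq (Ev.mono (ev_tableCmd (d := d) (J := j) (w := w) (P := P) (D := D)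
      ?_ ?_ ?_ (by omega) ?_ fun i hi => hD i (by omega)).frame ?_)))
    · simp [Memory.write_ne, h2', hd]
    · simp [Memory.write_ne, h7', hw]
    · simp [h2', hd, hk', hj]
      rw [Nat.cast_sub (by omega), Nat.cast_sub (by omega)]; simp
    · intro i hi
      simp [Memory.write_ne, h1', h1, hP i (by omega)]
    rintro M₁ ⟨⟨n, hn⟩, hf₁⟩
    have g0 := hf₁ 0 (by decide)
    have g1 := hf₁ 1 (by decide)
    have g7 := hf₁ 7 (by decide)
    have g30 := hf₁ 30 (by decide)
    have g31 := hf₁ 31 (by decide)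
    have g32 := hf₁ 32 (by decide)
    simp [Memory.write_ne] at g0 g1 g7 g30 g31 g32
    have hnD : n ≤ D.card := hn.le_card D (hD j (by omega))
    refine Ev.seq (Ev.put (Ev.seq (Ev.put ?_)))
    -- While `y ≤ Y j`, the flag in variable `34` is clear and the blocks before `y` have been
    -- subtracted from the rank. After the correct candidate the flag is set, and the remaining
    -- iterations change nothing.
    refine Ev.forUp (2 * w + 2) (T := 4 * D.card + 10) (fun y M₂ =>
      (∀ i < k, M₂ 0 i = M' 0 i) ∧ (0 < y ∨ M₂ 34 0 ≠ 0 → ∃ z : ℤ, M₂ 0 k = z) ∧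
      ∀ Y : ℕ → ℕ, (∀ i < d, Y i < 2 * w + 2) →
        ∑ i ∈ Finset.range d, candSq w (P i) (Y i) ≤ ρ → U = boxRank P w d ρ Y →
        (y ≤ Y j → M₂ 34 0 = 0 ∧ M₂ 31 0 = M' 31 0 ∧
          M₂ 30 0 + ((∑ y' ∈ Finset.range y, boxCount P w j (M' 31 0 - candSq w (P j) y') : ℕ) : ℝ) =
            boxRank P w (j + 1) (M' 31 0) Y) ∧
        (Y j < y → M₂ 34 0 = 1 ∧ M₂ 31 0 = M' 31 0 - candSq w (P j) (Y j) ∧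
          M₂ 30 0 = boxRank P w j (M' 31 0 - candSq w (P j) (Y j)) Y ∧
          M₂ 0 k = (cand w (P j) (Y j) : ℝ))) (by decide) ?_ ?_ ?_ ?_
    · refine ⟨by simp [Memory.write_ne, g0], by simp [Memory.write_ne], fun Y hY hs hr => ⟨fun _ => ?_, by simp⟩⟩
      simp [Memory.write_ne, g30, g31, (hI Y hY hs hr).2.1, ed]
    · intro M₂ hf₂
      have := hf₂ 7 (by decide) (by decide)
      simp [this, Memory.write_ne, g7, h7', hw]
    · rintro y hy M₂ hy' hf₂ ⟨hz₂, hzk, hI₂⟩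
      have q7 := hf₂ 7 (by decide) (by decide)
      have q10 := hf₂ 10 (by decide) (by decide)
      have q11 := hf₂ 11 (by decide) (by decide)
      have q12 := hf₂ 12 (by decide) (by decide)
      have q32 := hf₂ 32 (by decide) (by decide)
      have q37 := hf₂ 37 (by decide) (by decide)
      simp [Memory.write_ne] at q7 q10 q11 q12 q32
      refine Ev.ite (T := 4 * D.card + 9) (fun h34 => Ev.le (Ev.skip ?_) (by omega)) (fun h34 => ?_)
      · simp at h34
        refine ⟨by simpa [Memory.write_ne] using hz₂, fun _ => ?_, fun Y hY hs hr => ?_⟩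
        · simpa [Memory.write_ne] using hzk (Or.inr (by linarith))
        · have := hI₂ Y hY hs hr
          have hYy : Y j < y := by
            by_contra hle
            have := (this.1 (not_lt.1 hle)).1
            rw [this] at h34; norm_num at h34
          refine ⟨fun h => absurd h (by omega), fun _ => ?_⟩
          simpa [Memory.write_ne] using this.2 hYy
      · simp at h34
        refine Ev.mono (ev_unrankStep (n := n) (w := w) (j := j) (k := k) (y := y) (P := P)
          ?_ ?_ ?_ ?_ hnD (hn.congr q10 q11 q12)) ?_
        · rw [q7, g7, h7', hw]
        · rw [q32, g32, hk']
        · exact hy'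
        · simp [q37, Memory.write_ne, g1, g32, hk', h1', h1, hPj]
        · rintro M₃ ⟨h0, h3⟩
          refine ⟨?_, ?_, ?_⟩
          · intro i hi
            simp [Memory.write_ne, h0, hi.ne, hz₂ i hi]
          · intro _
            exact ⟨cand w (P j) y, by simp [Memory.write_ne, h0]⟩
          · intro Y hY hs hr
            have hIY := hI₂ Y hY hs hr
            have hyY : y ≤ Y j := by
              by_contra hlt
              have := (hIY.2 (not_le.1 hlt)).1
              rw [this] at h34; norm_num at h34
            obtain ⟨e34, e31, e30⟩ := hIY.1 hyY
            have hsj := (hI Y hY hs hr).2.2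
            rw [ed, Finset.sum_range_succ] at hsj
            rw [e31] at h3
            rw [boxRank] at e30
            -- Before the correct candidate the whole block of `y` still fits under the rank and is
            -- subtracted. At the correct candidate `boxRank_lt` says that the rank is smaller than
            -- the block.
            rcases Nat.lt_or_eq_of_le hyY with hlt | heq
            · have h4 : ∑ y' ∈ Finset.range (y + 1), boxCount P w j (M' 31 0 - candSq w (P j) y') ≤
                  ∑ y' ∈ Finset.range (Y j), boxCount P w j (M' 31 0 - candSq w (P j) y') :=
                Finset.sum_le_sum_of_subset (Finset.range_subset_range.2 hlt)
              have h4' : ((∑ y' ∈ Finset.range (y + 1),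
                  boxCount P w j (M' 31 0 - candSq w (P j) y') : ℕ) : ℝ) ≤
                  (∑ y' ∈ Finset.range (Y j), boxCount P w j (M' 31 0 - candSq w (P j) y') : ℕ) :=
                Nat.cast_le.2 h4
              rw [Finset.sum_range_succ, Nat.cast_add] at h4'
              rw [Nat.cast_add] at e30
              have h5 : (0 : ℝ) ≤ boxRank P w j (M' 31 0 - candSq w (P j) (Y j)) Y :=
                Nat.cast_nonneg _
              rcases h3 with ⟨h31, h32, h33, h35⟩ | ⟨h31, -⟩
              · refine ⟨fun _ => ⟨?_, ?_, ?_⟩, fun h => absurd h (by omega)⟩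
                · simp [Memory.write_ne, h33, e34]
                · simp [Memory.write_ne, h32]
                · simp only [Finset.sum_range_succ, boxRank, Nat.cast_add]
                  simp only [Memory.write_ne _ _ _ (show 30 ≠ 33 by decide), h35]
                  linarith
              · linarith
            · have h4 := boxRank_lt P w Y j (M' 31 0 - candSq w (P j) (Y j))
                (fun i hi => hY i (by omega)) (by linarith)
              have h4' : (boxRank P w j (M' 31 0 - candSq w (P j) (Y j)) Y : ℝ) <
                boxCount P w j (M' 31 0 - candSq w (P j) (Y j)) := Nat.cast_lt.2 h4
              rw [heq, Nat.cast_add] at e30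
              rw [heq] at h3
              rcases h3 with ⟨h31, -⟩ | ⟨h31, h32, h33, h35⟩
              · linarith
              · refine ⟨fun h => absurd h (by omega), fun _ => ⟨?_, ?_, ?_, ?_⟩⟩
                · simp [Memory.write_ne, h33]
                · simp [Memory.write_ne, h32]
                · simp only [Memory.write_ne _ _ _ (show 30 ≠ 33 by decide), h35]
                  linarith
                · simp [Memory.write_ne, h0, heq]
    · rintro M₂ _ hf₂ ⟨hz₂, hzk, hI₂⟩
      refine ⟨?_, fun Y hY hs hr => ?_⟩
      · intro i hi
        simp only [Memory.write_ne _ _ _ (show 0 ≠ 32 by decide)]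
        rcases Nat.lt_succ_iff_lt_or_eq.1 hi with hi | rfl
        · rw [hz₂ i hi]; exact hz i hi
        · exact hzk (Or.inl (by omega))
      · obtain ⟨e34, e31, e30, e0⟩ := (hI₂ Y hY hs hr).2 (hY j (by omega))
        have hsj := (hI Y hY hs hr).2.2
        rw [ed, Finset.sum_range_succ] at hsj
        have ed' : d - (k + 1) = j := by omega
        simp only [Memory.write_ne _ _ _ (show 0 ≠ 32 by decide),
          Memory.write_ne _ _ _ (show 30 ≠ 32 by decide),
          Memory.write_ne _ _ _ (show 31 ≠ 32 by decide), e31, e30, ed']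
        refine ⟨?_, trivial, by linarith⟩
        intro i hi
        rcases Nat.lt_succ_iff_lt_or_eq.1 hi with hi | rfl
        · rw [hz₂ i hi]; exact (hI Y hY hs hr).1 i hi
        · rw [e0, hPj, hj]
  · rintro M' _ _ ⟨hz, hI⟩
    refine ⟨hz, fun Y hY hs hr => (hI Y hY hs hr).1⟩

end RandRAM


/-! ## Small balls -/

/-- A bound for all the parameters on which the running times of the programs depend. -/
noncomputable def sizeBound (d : ℕ) (β l lam : ℝ) : ℕ := d + ⌈1 / β⌉₊ + ⌊|l|⌋₊ + ⌈|lam|⌉₊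

theorem sizeBound_le {d : ℕ} (hd : 1 ≤ d) {β : ℝ} (hβ : 0 < β) (hβ1 : β < 1) (l lam : ℝ) :
    (sizeBound d β l lam : ℝ) ≤ 2 * (d + 1 / β + |l| + |lam|) := by
  have hd' : (1 : ℝ) ≤ d := by exact_mod_cast hd
  have h1 : 1 ≤ 1 / β := by rw [le_div_iff₀ hβ]; linarith
  have h2 := (Nat.ceil_lt_add_one (by positivity : 0 ≤ 1 / β)).le
  have h3 := Nat.floor_le (abs_nonneg l)
  have h4 := (Nat.ceil_lt_add_one (abs_nonneg lam)).le
  unfold sizeBound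
  push_cast
  linarith [abs_nonneg l, abs_nonneg lam]

theorem radius_small {d n : ℕ} (hd : 1 ≤ d) (hdn : d ≤ n) {r β : ℝ} (hβ : 0 < β)
    (hβn : 1 / β ≤ n) (hr : r ≤ 2 * (d : ℝ) * Real.sqrt d / β) : ⌈r⌉₊ ≤ 2 * n ^ 3 := by
  have hd' : (1 : ℝ) ≤ d := by exact_mod_cast hd
  have hdn' : (d : ℝ) ≤ n := by exact_mod_cast hdn
  have hs : Real.sqrt d ≤ d := by
    rw [Real.sqrt_le_left (by linarith)]; nlinarith
  rw [Nat.ceil_le]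
  push_cast
  refine hr.trans ?_
  have e : 2 * (d : ℝ) * Real.sqrt d / β = 2 * (d * Real.sqrt d * (1 / β)) := by ring
  rw [e, pow_succ, sq]
  gcongr
  exact hs.trans hdn'

/-- With `n` bounding all parameters, the radius is at most `2n³`. The three factors in
`boxVals_subset` are then at most `17n⁷`, `9n⁵` and `2n³`, with product `306n¹⁵`. -/
theorem exists_boxVals_bound {d : ℕ} (hd : 1 ≤ d) (p : EuclideanSpace ℝ (Fin d)) {r β lam l : ℝ}
    (hβ : 0 < β) (hr : r ≤ 2 * (d : ℝ) * Real.sqrt d / β) (hp : p ∈ centerSet lam d l) :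
    ⌈r⌉₊ ≤ 2 * sizeBound d β l lam ^ 3 ∧
    ∃ D : Finset ℝ, (∀ j ≤ d, boxVals (revCoords p) ⌈r⌉₊ j ⊆ D) ∧
      D.card ≤ 306 * sizeBound d β l lam ^ 15 := by
  set n := sizeBound d β l lam with hn
  have hdn : d ≤ n := by rw [hn, sizeBound]; omega
  have hln : ⌊|l|⌋₊ ≤ n := by rw [hn, sizeBound]; omega
  have hLn : ⌈|lam|⌉₊ ≤ n := by rw [hn, sizeBound]; omega
  have hβn : 1 / β ≤ n := (Nat.le_ceil _).trans (by
    rw [hn, sizeBound]; exact_mod_cast (by omega : ⌈1 / β⌉₊ ≤ _))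
  have hw := radius_small hd hdn hβ hβn hr
  refine ⟨hw, ?_⟩
  obtain ⟨D, hD, hc⟩ := boxVals_subset (revCoords p) ⌈r⌉₊ (lam := lam) (l := ⌊|l|⌋₊)
    (Λ := ⌈|lam|⌉₊) (d := d) (Nat.le_ceil _) (fun i hi => by
      obtain ⟨a, b, h1, h2, h3⟩ := hp ⟨d - 1 - i, by omega⟩
      refine ⟨a, b, ?_, ?_⟩
      · have h4 : |(b : ℝ)| ≤ |l| := (abs_le.2 ⟨h1, h2⟩).trans (le_abs_self l)
        rw [Int.abs_eq_natAbs]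
        have h5 : ((b.natAbs : ℕ) : ℝ) ≤ |l| := by rw [Nat.cast_natAbs]; push_cast; exact h4
        exact_mod_cast Nat.le_floor h5
      · rw [← h3, revCoords, RandRAM.coords, dif_pos (show d - 1 - i < d by omega)])
  refine ⟨D, hD, hc.trans ?_⟩
  have h1n : 1 ≤ n := hd.trans hdn
  have hpow : ∀ k, 1 ≤ n ^ k := fun k => Nat.one_le_pow _ _ h1n
  have hY : ⌈r⌉₊ + 1 + ⌊|l|⌋₊ * ⌈|lam|⌉₊ ≤ 4 * n ^ 3 := by
    have h1 : ⌊|l|⌋₊ * ⌈|lam|⌉₊ ≤ n * n := Nat.mul_le_mul hln hLn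
    have h2 : n * n ≤ n ^ 3 := by rw [pow_succ, sq]; exact Nat.le_mul_of_pos_right _ h1n
    have := hpow 3
    omega
  set Y := ⌈r⌉₊ + 1 + ⌊|l|⌋₊ * ⌈|lam|⌉₊
  have ha : d * Y ^ 2 + 1 ≤ 17 * n ^ 7 := by
    have h1 : d * Y ^ 2 ≤ n * (4 * n ^ 3) ^ 2 := Nat.mul_le_mul hdn (Nat.pow_le_pow_left hY 2)
    have h2 : n * (4 * n ^ 3) ^ 2 = 16 * n ^ 7 := by ring
    have := hpow 7
    omega
  have hb : 2 * (d * (Y * ⌊|l|⌋₊)) + 1 ≤ 9 * n ^ 5 := by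
    have h1 : d * (Y * ⌊|l|⌋₊) ≤ n * ((4 * n ^ 3) * n) :=
      Nat.mul_le_mul hdn (Nat.mul_le_mul hY hln)
    have h2 : n * ((4 * n ^ 3) * n) = 4 * n ^ 5 := by ring
    have := hpow 5
    omega
  have hc' : d * ⌊|l|⌋₊ ^ 2 + 1 ≤ 2 * n ^ 3 := by
    have h1 : d * ⌊|l|⌋₊ ^ 2 ≤ n * n ^ 2 := Nat.mul_le_mul hdn (Nat.pow_le_pow_left hln 2)
    have h2 : n * n ^ 2 = n ^ 3 := by ring
    have := hpow 3
    omega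
  calc _ ≤ 17 * n ^ 7 * (9 * n ^ 5) * (2 * n ^ 3) := Nat.mul_le_mul (Nat.mul_le_mul ha hb) hc'
    _ = 306 * n ^ 15 := by ring

/-- The degree `34` is `1 + 15 + 3 + 15`: coordinates, table entries, candidates per coordinate, and
the linear search of each insertion. -/
theorem tableTime_le {d n w D : ℕ} (hn : 1 ≤ n) (hd : d ≤ n) (hw : w ≤ 2 * n ^ 3)
    (hD : D ≤ 306 * n ^ 15) :
    d * (D * ((2 * w + 2) * (5 * D + 13) + 8) + 13) + 5 ≤ 3000000 * n ^ 34 := by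
  have hpow : ∀ k, 1 ≤ n ^ k := fun k => Nat.one_le_pow _ _ hn
  have h1 : 2 * w + 2 ≤ 6 * n ^ 3 := by have := hpow 3; omega
  have h2 : 5 * D + 13 ≤ 1543 * n ^ 15 := by have := hpow 15; omega
  have h3 : (2 * w + 2) * (5 * D + 13) + 8 ≤ 9266 * n ^ 18 := by
    have := Nat.mul_le_mul h1 h2
    have e : 6 * n ^ 3 * (1543 * n ^ 15) = 9258 * n ^ 18 := by ring
    have := hpow 18
    omega
  have h4 : D * ((2 * w + 2) * (5 * D + 13) + 8) + 13 ≤ 2835409 * n ^ 33 := by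
    have := Nat.mul_le_mul hD h3
    have e : 306 * n ^ 15 * (9266 * n ^ 18) = 2835396 * n ^ 33 := by ring
    have := hpow 33
    omega
  have := Nat.mul_le_mul hd h4
  have e : n * (2835409 * n ^ 33) = 2835409 * n ^ 34 := by ring
  have := hpow 34
  omega

theorem rpow_three_halves {d : ℕ} (hd : 1 ≤ d) : (d : ℝ) ^ (3 / 2 : ℝ) = d * Real.sqrt d := by
  have : (0 : ℝ) < d := by exact_mod_cast hd
  rw [show (3 / 2 : ℝ) = 1 + 1 / 2 by norm_num, Real.rpow_add this, Real.rpow_one,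
    Real.sqrt_eq_rpow]

namespace RandRAM
open Term

variable {X : Type} {m : ℕ} {L : SetList X m}

/-- Counts the lattice points of the ball with radius in variable `3` and centre in array `1`, for
dimension in variable `2`, into variable `26`. -/
def countBallCmd : Cmd :=
  .put 7 (0 - Term.floor (0 - var 3)) ;; .put 8 (var 2) ;; tableCmd ;; .put 25 (var 3 * var 3) ;;
  countTableCmd

/-- The machine offers only the floor, so ceilings are computed by negating twice. -/
theorem neg_floor_neg {r : ℝ} (hr : 0 < r) : 0 - (⌊0 - r⌋ : ℝ) = (⌈r⌉₊ : ℝ) := by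
  rw [zero_sub, zero_sub, Int.floor_neg]
  push_cast
  rw [neg_neg, natCast_ceil_eq_intCast_ceil hr.le]

theorem ev_countBallCmd {M : Memory} {d n : ℕ} {p : EuclideanSpace ℝ (Fin d)} {r : ℝ}
    {D : Finset ℝ} (hr : 0 < r) (h1 : M 1 = coords fun k => p k) (h2 : M 2 0 = d) (h3 : M 3 0 = r)
    (hD : ∀ j ≤ d, boxVals (revCoords p) ⌈r⌉₊ j ⊆ D) (hn : 1 ≤ n) (hdn : d ≤ n)
    (hw : ⌈r⌉₊ ≤ 2 * n ^ 3) (hDn : D.card ≤ 306 * n ^ 15) :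
    Ev L countBallCmd M (3001500 * n ^ 34) fun M' => M' 7 0 = ⌈r⌉₊ ∧
      M' 26 0 = (latticeBall p r).ncard := by
  refine Ev.le (Ev.seq (Ev.put (Ev.seq (Ev.put (Ev.seq (Ev.mono (ev_tableCmd (d := d) (J := d)
    (w := ⌈r⌉₊) (P := revCoords p) (D := D) ?_ ?_ ?_ le_rfl ?_ hD).frame ?_))))))
    (?_ : 1 + (1 + ((d * (D.card * ((2 * ⌈r⌉₊ + 2) * (5 * D.card + 13) + 8) + 13) + 5) +
      (1 + (4 * D.card + 3)))) ≤ _)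
  · simp [Memory.write_ne, h2]
  · simp [Memory.write_ne, h3, neg_floor_neg hr, -zero_sub]
  · simp [Memory.write_ne, h2]
  · intro j hj
    simp [Memory.write_ne, h1, revCoords]
  · rintro M' ⟨⟨k, hk⟩, hf⟩
    have g3 := hf 3 (by decide)
    have g7 := hf 7 (by decide)
    simp [Memory.write_ne] at g3 g7
    refine Ev.seq (Ev.put (Ev.mono (ev_countTableCmd (n := k) (D := D.card) (ρ := r ^ 2)
      (hk.congr ?_ ?_ ?_) ?_ (hk.le_card D (hD d le_rfl))).frame ?_))
    · simp [Memory.write_ne]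
    · simp [Memory.write_ne]
    · simp [Memory.write_ne]
    · simp [g3, h3, sq]
    · rintro M'' ⟨h26, hf'⟩
      have g7' := hf' 7 (by decide)
      refine ⟨?_, ?_⟩
      · rw [g7', Memory.write_ne _ _ _ (by decide), g7]
        simpa [h3] using neg_floor_neg hr
      · rw [h26, ← boxCount_cast, ncard_latticeBall_eq_boxCount p hr]
  · have := tableTime_le hn hdn hw hDn
    have h15 : n ^ 15 ≤ n ^ 34 := Nat.pow_le_pow_right hn (by norm_num)
    have h34 : 1 ≤ n ^ 34 := Nat.one_le_pow _ _ hn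
    omega

/-! ## The counting program -/

/-- The counting program. -/
def countCmd : Cmd :=
  .put 2 (.read 0 0) ;; .put 3 (.read 0 1) ;; .put 4 (.read 0 2) ;;
  .ite (var 3) (2 * var 2 * Term.sqrt (var 2) / var 4)
    (countBallCmd ;; .put 0 (var 26)) (volumeCmd ;; .put 0 (var 6))

theorem computes_count {d : ℕ} (hd : 1 ≤ d) (p : EuclideanSpace ℝ (Fin d)) {r β lam l : ℝ}
    (hr : 0 < r) (hβ : 0 < β) (hβ1 : β < 1)
    (hp : 2 * (d : ℝ) * Real.sqrt d / β < r ∨ p ∈ centerSet lam d l) :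
    ∃ v : ℝ, Computes countCmd [[(d : ℝ), r, β], List.ofFn fun k => p k]
        (3001600 * sizeBound d β l lam ^ 34) v ∧
      (1 - β) * (latticeBall p r).ncard ≤ v ∧ v ≤ (1 + β) * (latticeBall p r).ncard := by
  set n := sizeBound d β l lam with hn
  have hdn : d ≤ n := by rw [hn, sizeBound]; omega
  have h1n : 1 ≤ n := hd.trans hdn
  have h34 : 1 ≤ n ^ 34 := Nat.one_le_pow _ _ h1n
  have hdn' : d ≤ n ^ 34 := hdn.trans (Nat.le_self_pow (by norm_num) n)
  have hA : (0 : ℝ) ≤ (latticeBall p r).ncard := Nat.cast_nonneg _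
  by_cases hbig : 2 * (d : ℝ) * Real.sqrt d / β < r
  · refine ⟨ballVol d r, Computes.of_ev ?_, ?_, ?_⟩
    · refine Ev.le (Ev.seq (Ev.put (Ev.seq (Ev.put (Ev.seq (Ev.put (Ev.ite ?_ ?_)))))))
        (?_ : 1 + (1 + (1 + (((3 * d + 5) + 1) + 1))) ≤ _)
      · intro h
        simp [Memory.write_ne] at h
        linarith
      · intro h
        refine Ev.seq (T₁ := 3 * d + 5) (T₂ := 1) (Ev.mono (ev_volumeCmd (d := d) (r := r) ?_ ?_) fun M' h6 => Ev.put ?_)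
        · simp [Memory.write_ne]
        · simp [Memory.write_ne]
        · simp [h6]
      · omega
    · have h := ncard_mul_le_ballVol hd p hβ hβ1 hbig
      nlinarith
    · have h := ballVol_mul_le_ncard hd p hβ hβ1 hbig
      have hv := (ballVol_pos d hr).le
      -- The upper estimate rests on `(1 + β)(1 - β/4) ≥ 1`, which holds for `0 < β < 1`.
      nlinarith [mul_nonneg hβ.le hv, mul_nonneg (mul_nonneg hβ.le hβ.le) hv]
  · have hp' := hp.resolve_left hbig
    obtain ⟨hw, D, hD, hDc⟩ := exists_boxVals_bound hd p hβ (not_lt.1 hbig) hp'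
    refine ⟨(latticeBall p r).ncard, Computes.of_ev ?_, by nlinarith, by nlinarith⟩
    refine Ev.le (Ev.seq (Ev.put (Ev.seq (Ev.put (Ev.seq (Ev.put (Ev.ite ?_ ?_)))))))
      (?_ : 1 + (1 + (1 + (((3001500 * n ^ 34) + 1) + 1))) ≤ _)
    · intro h
      refine Ev.seq (Ev.mono (ev_countBallCmd (d := d) (p := p) (r := r) (D := D) hr ?_ ?_ ?_ hD h1n
        hdn hw hDc) fun M' h26 => Ev.put ?_)
      · simp [Memory.write_ne]
      · simp [Memory.write_ne]
      · simp [Memory.write_ne]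
      · simp [h26.2]
    · intro h
      simp [Memory.write_ne] at h
      linarith
    · omega

/-! ## Sampling from small balls -/

open Classical in
/-- The indicator of the event that the output is `z`. -/
noncomputable def outInd {d : ℕ} (z : Fin d → ℤ) (M : Memory) : ℝ≥0∞ :=
  if ∀ k : Fin d, M 0 k = z k then 1 else 0

/-- All possible outputs are integral, so rounding them yields a distribution on integer vectors
without loss, and the probability of `z` is the expectation of `outInd z`. -/
theorem Generates.of_pr {c : Cmd} {rows : List (List ℝ)} {T d : ℕ} {v : (Fin d → ℤ) → ℝ≥0∞}
    (h : Pr noSets c (load rows) T (fun M => ∀ k < d, ∃ z : ℤ, M 0 k = z) outInd v) :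
    ∃ G : PMF (Fin d → ℤ), Generates c rows T G ∧ ∀ z, G z = v z := by
  classical
  obtain ⟨μ, hr, hQ, hv⟩ := h
  refine ⟨μ.map fun M (k : Fin d) => round (M 0 (k : ℕ)), ⟨μ, ⟨_, hr fun _ => none, ?_⟩, ?_⟩, fun z => ?_⟩
  · rw [PMF.map_comp]; exact PMF.map_id μ
  · rw [PMF.map_comp]
    ext x
    rw [PMF.apply_eq_ev, PMF.apply_eq_ev, PMF.ev_map, PMF.ev_map]
    refine PMF.ev_congr fun M hM => ?_
    have : (fun k : Fin d => M 0 (k : ℕ)) = fun k : Fin d => ((round (M 0 (k : ℕ)) : ℤ) : ℝ) := by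
      funext k
      obtain ⟨z, hz⟩ := hQ M hM k k.2
      rw [hz, round_intCast]
    simp only [Function.comp_apply, this]
    congr
  · rw [PMF.apply_eq_ev, PMF.ev_map, ← hv]
    refine PMF.ev_congr fun M hM => ?_
    simp only [Function.comp_apply, outInd, funext_iff]
    congr 1
    refine propext (forall_congr' fun k => ?_)
    obtain ⟨z, hz⟩ := hQ M hM k k.2
    rw [hz, round_intCast]
    norm_cast

/-- The sampling program for small balls. -/
def smallSampleCmd : Cmd :=
  countBallCmd ;; .put 31 (var 3 * var 3) ;; .unif 30 0 (var 26 - 1) ;; unrankCmd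

/-- The rank is drawn uniformly from `N` numbers and then unranked deterministically. Each of the
`N` lattice points is the output for its own rank, so ranks and points correspond one to one. -/
theorem pr_smallSampleCmd {M : Memory} {d n : ℕ} {p : EuclideanSpace ℝ (Fin d)} {r : ℝ}
    {D : Finset ℝ} (hr : 0 < r) (h1 : M 1 = coords fun k => p k) (h2 : M 2 0 = d) (h3 : M 3 0 = r)
    (hD : ∀ j ≤ d, boxVals (revCoords p) ⌈r⌉₊ j ⊆ D) (hn : 1 ≤ n) (hdn : d ≤ n)
    (hw : ⌈r⌉₊ ≤ 2 * n ^ 3) (hDn : D.card ≤ 306 * n ^ 15) :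
    ∃ v : (Fin d → ℤ) → ℝ≥0∞, Pr L smallSampleCmd M (6100000 * n ^ 35)
      (fun M' => ∀ k < d, ∃ z : ℤ, M' 0 k = z) outInd v ∧
      ((latticeBall p r).Nonempty → ∀ z, v z =
        (latticeBall p r).indicator (fun _ => ((latticeBall p r).ncard : ℝ≥0∞)⁻¹) z) := by
  classical
  obtain ⟨M₁, hM₁, ⟨⟨h7, h26⟩, hf⟩⟩ := (ev_countBallCmd (L := L) hr h1 h2 h3 hD hn hdn hw hDn).frame
  have g1 := hf 1 (by decide)
  have g2 := hf 2 (by decide)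
  have g3 := hf 3 (by decide)
  set N := (latticeBall p r).ncard with hN
  set M₂ := M₁.write 31 0 (r * r) with hM₂
  set Tu := d * ((d * (D.card * ((2 * ⌈r⌉₊ + 2) * (5 * D.card + 13) + 8) + 13) + 5) +
        (2 * ⌈r⌉₊ + 2) * (4 * D.card + 12) + 7) + 2 with hTu
  have hun : ∀ U : ℕ, Ev L unrankCmd (M₂.write 30 0 U) Tu _ := fun U =>
    ev_unrankCmd (d := d) (w := ⌈r⌉₊) (U := U) (c := coords fun k => p k) (P := revCoords p)
      (ρ := r ^ 2) (D := D) (by simp [Memory.write_ne, hM₂, g2, h2])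
      (by simp [Memory.write_ne, hM₂, h7]) (by simp [Memory.write_ne, hM₂, g1, h1]) (by simp)
      (by simp [Memory.write_ne, hM₂, sq]) (fun _ _ => rfl) hD
  choose out hout hint hrank using hun
  refine ⟨fun z => (∑ k ∈ Finset.range (N - 1 + 1), outInd z (out k)) / ((N - 1 + 1 : ℕ) : ℝ≥0∞),
    Pr.le (Pr.seq_ev ⟨M₁, hM₁, Pr.seq_ev (Ev.put ?_)⟩)
      (?_ : (3001500 * n ^ 34) + (1 + (1 + Tu)) ≤ _), ?_⟩
  · have e : (var 3 * var 3).eval M₁ = r * r := by simp [g3, h3]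
    rw [e, ← hM₂]
    -- If the ball is empty, `-1` is rounded to the natural number `0`, in agreement with the
    -- truncated `N - 1`; the draw is then from `{0}`.
    have hnat : (var 26 - 1).nat M₂ = N - 1 := by
      rw [Term.nat]
      simp only [eval_sub, eval_var, eval_ofNat, hM₂, Memory.write_ne _ _ _ (show 26 ≠ 31 by decide),
        h26]
      rw [Nat.cast_one, Nat.floor_sub_one, Nat.floor_natCast]
    have hidx : (0 : Term).nat M₂ = 0 := by simp [Term.nat]
    refine Pr.seq (Pr.unif (Q := fun M' => ∃ k : ℕ, M' = M₂.write 30 0 k)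
      (f := fun z M' => outInd z (out ⌊M' 30 0⌋₊)) ?_ ?_) ?_
    · intro k _; exact ⟨k, by rw [hidx]⟩
    · intro z
      rw [hnat, hidx]
      simp
    · rintro _ ⟨k, rfl⟩
      refine Pr.of_ev ⟨out k, hout k, hint k, fun z => by simp⟩
  · have ht := tableTime_le hn hdn hw hDn
    have h15 : n ^ 18 ≤ n ^ 34 := Nat.pow_le_pow_right hn (by norm_num)
    have h34 : 1 ≤ n ^ 34 := Nat.one_le_pow _ _ hn
    have h34' : n ^ 34 ≤ n ^ 35 := Nat.pow_le_pow_right hn (by norm_num)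
    have hk : (2 * ⌈r⌉₊ + 2) * (4 * D.card + 12) ≤ 7416 * n ^ 18 := by
      have p3 : 1 ≤ n ^ 3 := Nat.one_le_pow _ _ hn
      have p15 : 1 ≤ n ^ 15 := Nat.one_le_pow _ _ hn
      calc (2 * ⌈r⌉₊ + 2) * (4 * D.card + 12) ≤ (6 * n ^ 3) * (1236 * n ^ 15) :=
            Nat.mul_le_mul (by omega) (by omega)
        _ = 7416 * n ^ 18 := by ring
    have h5 : Tu ≤ n * (3008000 * n ^ 34) + 2 := by
      rw [hTu]
      gcongr
      omega
    have e : n * (3008000 * n ^ 34) = 3008000 * n ^ 35 := by ring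
    omega
  · intro hne z
    have hfin := latticeBall_finite p hr
    have hNpos : 0 < N := (Set.ncard_pos hfin).2 hne
    have hN1 : N - 1 + 1 = N := by omega
    rw [hN1]
    set o : ℕ → (Fin d → ℤ) := fun k i => round (out k 0 i) with ho
    have hoz : ∀ k z, outInd z (out k) = if o k = z then 1 else 0 := by
      intro k z
      unfold outInd
      congr 1
      rw [funext_iff]
      refine propext (forall_congr' fun i => ?_)
      obtain ⟨y, hy⟩ := hint k i i.2
      rw [ho]; simp only [hy, round_intCast]
      norm_cast
    -- Every point is reached from its rank. Since there are as many ranks as points, this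
    -- surjectivity already gives injectivity.
    have hsub : hfin.toFinset ⊆ (Finset.range N).image o := by
      intro z hz
      rw [Set.Finite.mem_toFinset] at hz
      obtain ⟨Y, hY, hzY, hs⟩ := exists_choice p hr hz
      refine Finset.mem_image.2 ⟨boxRank (revCoords p) ⌈r⌉₊ d (r ^ 2) Y, ?_, ?_⟩
      · rw [Finset.mem_range, hN, ncard_latticeBall_eq_boxCount p hr]
        exact boxRank_lt _ _ Y d _ hY hs
      · funext i
        have h := hrank _ Y hY hs rfl i i.2
        have e : d - 1 - (i : ℕ) = (i.rev : ℕ) := by simp [Fin.val_rev]; omega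
        rw [coords_val, e, ← hzY] at h
        simp only [ho, h, round_intCast]
    have hcard : hfin.toFinset.card = N := (Set.ncard_eq_toFinset_card _ hfin).symm
    have himg : (Finset.range N).image o = hfin.toFinset := by
      refine (Finset.eq_of_subset_of_card_le hsub ?_).symm
      rw [hcard]
      exact Finset.card_image_le.trans (by simp)
    have hinj : Set.InjOn o (Finset.range N) := Finset.injOn_of_card_image_eq (by
      rw [himg, hcard, Finset.card_range])
    simp only [hoz]
    by_cases hz : z ∈ latticeBall p r
    · rw [Set.indicator_of_mem hz]
      have hz' : z ∈ (Finset.range N).image o := by rw [himg]; simpa using hz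
      obtain ⟨k, hk, hkz⟩ := Finset.mem_image.1 hz'
      rw [Finset.sum_eq_single_of_mem k hk fun j hj hjk => ?_, if_pos hkz, one_div]
      exact if_neg fun h => hjk (hinj hj hk (h.trans hkz.symm))
    · rw [Set.indicator_of_notMem hz, Finset.sum_eq_zero fun k hk => ?_, ENNReal.zero_div]
      refine if_neg fun h => hz ?_
      have : z ∈ (Finset.range N).image o := Finset.mem_image.2 ⟨k, hk, h⟩
      rw [himg] at this
      simpa using this

end RandRAM


namespace RandRAM
open Term

variable {X : Type} {m : ℕ} {L : SetList X m}

/-! ## Rejection sampling -/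

/-- The value of repeating an attempt up to `n` times, if a successful attempt contributes `S`, an
attempt fails with probability `κ`, and final failure is worth `h`. -/
noncomputable def retry (S κ : ℝ≥0∞) (n : ℕ) (h : ℝ≥0∞) : ℝ≥0∞ :=
  S * ∑ j ∈ Finset.range n, κ ^ j + κ ^ n * h

theorem retry_zero (S κ h : ℝ≥0∞) : retry S κ 0 h = h := by simp [retry]

theorem retry_succ (S κ : ℝ≥0∞) (n : ℕ) (h : ℝ≥0∞) :
    retry S κ (n + 1) h = S + κ * retry S κ n h := by
  unfold retry
  rw [Finset.sum_range_succ']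
  simp only [pow_succ, pow_zero, ← Finset.sum_mul]
  ring

/-- Raises variable `42` to the power `d * d`, into variable `44`. -/
def powCmd : Cmd := .put 44 1 ;; .forUp 43 (var 2 * var 2) (.put 44 (var 44 * var 42))

theorem ev_powCmd {M : Memory} {d : ℕ} (h2 : M 2 0 = d) :
    Ev L powCmd M (3 * (d * d) + 3) fun M' => M' 44 0 = M 42 0 ^ (d * d) := by
  refine Ev.le (Ev.seq (Ev.put (Ev.forUp (d * d) (T := 1) (fun k M' => M' 44 0 = M 42 0 ^ k)
    (by decide) ?_ ?_ ?_ ?_))) (?_ : 1 + (d * d * (1 + 2) + 2) ≤ _)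
  · simp [Memory.write_ne]
  · intro M' hf
    simp [hf 2 (by decide) (by decide), Memory.write_ne, h2]
  · intro k hk M' hk' hf hI
    have h42 := hf 42 (by decide) (by decide)
    simp [Memory.write_ne] at h42
    refine Ev.put ?_
    simp [Memory.write_ne, hI, h42, pow_succ]
  · intro M' _ _ hI; exact hI
  · omega

/-- The probability with which a candidate for a coordinate is accepted. -/
noncomputable def accProb (d w : ℕ) (r c : ℝ) (y : ℕ) : ℝ :=
  if candSq w c y ≤ r ^ 2 then (1 - candSq w c y / (2 * d * r ^ 2)) ^ (d * d) else 0

/-- One attempt to find a coordinate. -/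
def tryCmd : Cmd :=
  .ite 1 (var 40) .skip
    (.unif 45 0 (2 * var 7 + 1) ;;
      .put 41 (Term.floor (var 37) - var 7 + var 45) ;;
      .put 47 ((var 41 - var 37) * (var 41 - var 37)) ;;
      .ite (var 47) (var 3 * var 3)
        (.put 42 (1 - var 47 / (2 * var 2 * (var 3 * var 3))) ;; powCmd ;; .toss 40 0 (var 44))
        .skip)

/-- The candidate that has been accepted for a coordinate. -/
noncomputable def coordObs (w : ℕ) (c : ℝ) (M : Memory) : Option ℕ :=
  open Classical in if M 40 0 = 0 then none else some ⌊M 41 0 - (⌊c⌋ - w)⌋₊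

/-- The state of the search for a coordinate. -/
def CoordState (d w : ℕ) (r c : ℝ) (M : Memory) : Prop :=
  M 40 0 = 0 ∨ ∃ y < 2 * w + 2, candSq w c y ≤ r ^ 2 ∧ M 40 0 = 1 ∧ M 41 0 = (cand w c y : ℝ) ∧
    M 42 0 = 1 - candSq w c y / (2 * d * r ^ 2) ∧ M 47 0 = candSq w c y

theorem coordObs_eq {w y : ℕ} {c : ℝ} {M : Memory} (h : M 40 0 = 1)
    (h' : M 41 0 = (cand w c y : ℝ)) : coordObs w c M = some y := by
  unfold coordObs
  rw [if_neg (by rw [h]; norm_num), h']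
  simp [cand]

theorem accProb_mem {d w : ℕ} (hd : 1 ≤ d) {r c : ℝ} (hr : 0 < r) (y : ℕ) :
    0 ≤ accProb d w r c y ∧ accProb d w r c y ≤ 1 := by
  unfold accProb
  have hd' : (1 : ℝ) ≤ d := by exact_mod_cast hd
  have h0 : 0 ≤ candSq w c y := sq_nonneg _
  split_ifs with h
  · have h1 : candSq w c y / (2 * d * r ^ 2) ≤ 1 := by
      rw [div_le_one (by positivity)]
      nlinarith [sq_nonneg r]
    have h2 : 0 ≤ candSq w c y / (2 * d * r ^ 2) := by positivity
    exact ⟨pow_nonneg (by linarith) _, pow_le_one₀ (by linarith) (by linarith)⟩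
  · simp

/-- Letting `φ` range over all functions of the observation records the entire law of an attempt.
Later steps choose the `φ` they need. -/
theorem pr_tryCmd {M : Memory} {d w : ℕ} {r c : ℝ} (hd : 1 ≤ d) (hr : 0 < r) (h2 : M 2 0 = d)
    (h3 : M 3 0 = r) (h7 : M 7 0 = w) (h37 : M 37 0 = c) (h40 : M 40 0 = 0) :
    Pr L tryCmd M (3 * (d * d) + 10) (CoordState d w r c)
      (fun (φ : Option ℕ → ℝ≥0∞) M' => φ (coordObs w c M'))
      fun φ => (∑ y ∈ Finset.range (2 * w + 2), (ENNReal.ofReal (accProb d w r c y) * φ (some y) +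
        (1 - ENNReal.ofReal (accProb d w r c y)) * φ none)) / (2 * w + 2 : ℕ) := by
  refine Pr.ite (T := 3 * (d * d) + 9) (fun h => ?_) fun _ => ?_
  · simp [h40] at h; linarith
  have hnat : (2 * var 7 + 1 : Term).nat M = 2 * w + 1 := by
    rw [Term.nat]
    have : (2 * var 7 + 1 : Term).eval M = ((2 * w + 1 : ℕ) : ℝ) := by simp [h7]
    rw [this, Nat.floor_natCast]
  have hidx : (0 : Term).nat M = 0 := by simp [Term.nat]
  refine Pr.le (Pr.seq (Pr.unif (Q := fun M' => ∃ y < 2 * w + 2, M' = M.write 45 0 (y : ℝ))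
    (f := fun φ M' => ENNReal.ofReal (accProb d w r c ⌊M' 45 0⌋₊) * φ (some ⌊M' 45 0⌋₊) +
        (1 - ENNReal.ofReal (accProb d w r c ⌊M' 45 0⌋₊)) * φ none) ?_ ?_) ?_)
    (?_ : 1 + (1 + (1 + ((1 + ((3 * (d * d) + 3) + 1)) + 1))) ≤ _)
  · intro k hk
    rw [hnat] at hk
    exact ⟨k, by omega, by rw [hidx]⟩
  · intro φ
    simp only [hnat, hidx, Memory.write_same, Nat.floor_natCast,
      show 2 * w + 1 + 1 = 2 * w + 2 from rfl]
  · rintro _ ⟨y, hy, rfl⟩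
    refine Pr.seq_ev (Ev.put (Pr.seq_ev (Ev.put ?_)))
    have e45 : ∀ M' : Memory, M' 45 0 = y → ⌊M' 45 0⌋₊ = y := fun M' h => by rw [h, Nat.floor_natCast]
    simp only [Memory.write_same, Nat.floor_natCast]
    have e41 : (Term.floor (var 37) - var 7 + var 45).eval (M.write 45 0 (y : ℝ)) = (cand w c y : ℝ) := by
      simp [Memory.write_ne, h37, h7, cand]
    rw [e41]
    set M₁ := (M.write 45 0 (y : ℝ)).write 41 0 (cand w c y : ℝ) with hM₁
    have e47 : ((var 41 - var 37) * (var 41 - var 37)).eval M₁ = candSq w c y := by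
      simp [hM₁, Memory.write_ne, h37, candSq, sq]
    rw [e47]
    set M₂ := M₁.write 47 0 (candSq w c y) with hM₂
    have k2 : M₂ 2 0 = d := by simp [hM₂, hM₁, Memory.write_ne, h2]
    have k3 : M₂ 3 0 = r := by simp [hM₂, hM₁, Memory.write_ne, h3]
    have k40 : M₂ 40 0 = 0 := by simp [hM₂, hM₁, Memory.write_ne, h40]
    have k41 : M₂ 41 0 = cand w c y := by simp [hM₂, hM₁, Memory.write_ne]
    have k47 : M₂ 47 0 = candSq w c y := by simp [hM₂]
    refine Pr.ite (fun h => ?_) (fun h => ?_)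
    · have hle : candSq w c y ≤ r ^ 2 := by simpa [k47, k3, sq] using h
      refine Pr.seq_ev (Ev.put (Pr.seq_ev (Ev.mono (ev_powCmd (d := d) ?_).frame ?_)))
      · simp [Memory.write_ne, k2]
      · rintro M₃ ⟨h44, hf⟩
        have g41 := hf 41 (by decide)
        have g42 := hf 42 (by decide)
        have g47 := hf 47 (by decide)
        have g44 : M₃ 44 0 = accProb d w r c y := by
          rw [h44, accProb, if_pos hle]
          simp [k47, k2, k3, sq]
        have hidx₃ : (0 : Term).nat M₃ = 0 := by simp [Term.nat]
        refine Pr.toss (Or.inr ⟨y, hy, hle, ?_, ?_, ?_, ?_⟩) (Or.inl ?_) ?_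
        · simp [hidx₃]
        · simp [Memory.write_ne, g41, k41]
        · simp [Memory.write_ne, g42, k47, k2, k3, sq]
        · simp [Memory.write_ne, g47, k47]
        · simp [hidx₃]
        · intro φ
          have hp : min 1 (ENNReal.ofReal (accProb d w r c y)) =
              ENNReal.ofReal (accProb d w r c y) :=
            min_eq_right (ENNReal.ofReal_le_one.2 (accProb_mem hd hr y).2)
          rw [eval_var, g44, hp, hidx₃, coordObs_eq (y := y) (by simp)
            (by simp [Memory.write_ne, g41, k41])]
          congr 3
          simp [coordObs]
    · have hlt : ¬ candSq w c y ≤ r ^ 2 := by simpa [k47, k3, sq] using h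
      refine Pr.le (Pr.of_ev (Ev.skip ⟨Or.inl k40, fun φ => ?_⟩)) (by omega : 1 ≤ _)
      simp [accProb, hlt, coordObs, k40]
  · omega

/-- The weight of a candidate in one attempt. -/
noncomputable def accWeight (d w : ℕ) (r c : ℝ) (y : ℕ) : ℝ≥0∞ :=
  ENNReal.ofReal (accProb d w r c y) / (2 * w + 2 : ℕ)

/-- The probability that an attempt fails. -/
noncomputable def rejWeight (d w : ℕ) (r c : ℝ) : ℝ≥0∞ :=
  (∑ y ∈ Finset.range (2 * w + 2), (1 - ENNReal.ofReal (accProb d w r c y))) / (2 * w + 2 : ℕ)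

/-- The search for a coordinate. -/
def coordCmd : Cmd := .put 40 0 ;; .forUp 48 (48 * (var 2 * var 2)) tryCmd

theorem pr_coordCmd {M : Memory} {d w : ℕ} {r c : ℝ} (hd : 1 ≤ d) (hr : 0 < r) (h2 : M 2 0 = d)
    (h3 : M 3 0 = r) (h7 : M 7 0 = w) (h37 : M 37 0 = c) :
    Pr L coordCmd M (48 * (d * d) * (3 * (d * d) + 12) + 3) (CoordState d w r c)
      (fun (φ : Option ℕ → ℝ≥0∞) M' => φ (coordObs w c M'))
      fun φ => retry (∑ y ∈ Finset.range (2 * w + 2), accWeight d w r c y * φ (some y))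
        (rejWeight d w r c) (48 * (d * d)) (φ none) := by
  set n := 48 * (d * d) with hn
  set S : (Option ℕ → ℝ≥0∞) → ℝ≥0∞ := fun φ =>
    ∑ y ∈ Finset.range (2 * w + 2), accWeight d w r c y * φ (some y) with hS
  -- Once a candidate has been accepted, the value is settled; before that, the `n - k` attempts
  -- that are left are worth `retry … (n - k)`.
  refine Pr.le (Pr.seq_ev (Ev.put (Pr.forUp n (T := 3 * (d * d) + 10) (fun _ M' => CoordState d w r c M')
    (fun k φ M' => (coordObs w c M').elim (retry (S φ) (rejWeight d w r c) (n - k) (φ none))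
      fun y => φ (some y)) (by decide) ?_ ?_ ?_ ?_ ?_)))
    (?_ : 1 + (n * ((3 * (d * d) + 10) + 2) + 2) ≤ _)
  · left; simp [Memory.write_ne]
  · intro M' hf
    simp [hf 2 (by decide) (by decide), Memory.write_ne, h2, hn]
  · intro k hk M' hk' hf hI
    have g2 := hf 2 (by decide) (by decide)
    have g3 := hf 3 (by decide) (by decide)
    have g7 := hf 7 (by decide) (by decide)
    have g37 := hf 37 (by decide) (by decide)
    simp [Memory.write_ne] at g2 g3 g7 g37
    have hobs : ∀ M'' : Memory, ∀ x, coordObs w c (M''.write 48 0 x) = coordObs w c M'' := by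
      intro M'' x; simp [coordObs, Memory.write_ne]
    have hcs : ∀ M'' : Memory, ∀ x, CoordState d w r c (M''.write 48 0 x) ↔ CoordState d w r c M'' := by
      intro M'' x; simp [CoordState, Memory.write_ne]
    simp only [hobs, hcs]
    rcases hI with h40 | ⟨y, hy, hle, h40, h41, h42⟩
    · refine (pr_tryCmd hd hr (by rw [g2, h2]) (by rw [g3, h3]) (by rw [g7, h7]) (by rw [g37, h37])
        h40).mono (fun φ o => o.elim (retry (S φ) (rejWeight d w r c) (n - (k + 1)) (φ none))
          fun y => φ (some y)) (fun M'' h => ⟨h, fun φ => rfl⟩) fun φ => ?_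
      have e : n - k = (n - (k + 1)) + 1 := by omega
      have ho : coordObs w c M' = none := by simp [coordObs, h40]
      rw [ho]
      simp only [Option.elim]
      rw [e, retry_succ, Finset.sum_add_distrib, ENNReal.add_div, ← Finset.sum_mul, hS]
      congr 1
      · rw [ENNReal.div_eq_inv_mul, Finset.mul_sum]
        refine Finset.sum_congr rfl fun y _ => ?_
        rw [accWeight, ENNReal.div_eq_inv_mul]; ring
      · rw [rejWeight, ENNReal.div_eq_inv_mul, ENNReal.div_eq_inv_mul]; ring
    · refine Pr.le (Pr.of_ev (Ev.ite (fun _ => Ev.skip ⟨Or.inr ⟨y, hy, hle, h40, h41, h42⟩, fun φ => ?_⟩)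
        fun h => ?_)) (by omega : 1 + 1 ≤ _)
      · rw [coordObs_eq h40 h41]; rfl
      · simp [h40] at h
  · intro M' _ _ hI
    refine ⟨hI, fun φ => ?_⟩
    rw [Nat.sub_self, retry_zero]
    cases coordObs w c M' <;> rfl
  · intro φ
    simp [coordObs, Memory.write_ne, hS]
  · have : n * ((3 * (d * d) + 10) + 2) = n * (3 * (d * d) + 12) := by ring
    omega

/-- Looks for all coordinates of a point, independently of each other. -/
def pointCmd : Cmd :=
  .forUp 32 (var 2) (.put 37 (.read 1 (var 32)) ;; coordCmd ;;
    .ite 1 (var 40)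
      (.set 53 (var 32) (var 41) ;; .put 51 (var 51 * var 42) ;; .put 52 (var 52 + var 47))
      (.put 50 0))

/-- One attempt to find a lattice point. -/
def trialCmd : Cmd :=
  .put 50 1 ;; .put 51 1 ;; .put 52 0 ;; pointCmd ;;
  .ite 1 (var 50)
    (.ite (var 52) (var 3 * var 3)
      (.put 42 ((1 - 1 / (2 * var 2)) / var 51) ;; powCmd ;; .toss 54 0 (var 44)) .skip) .skip

/-- The lattice point that has been found. -/
noncomputable def trialObs (d : ℕ) (M : Memory) : Option (Fin d → ℤ) :=
  open Classical in if M 54 0 = 0 then none else some fun k => round (M 53 k)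

/-- The probability that one attempt finds a given lattice point of the ball. -/
noncomputable def trialWeight (d w : ℕ) (r : ℝ) (c : ℕ → ℝ) : ℝ≥0∞ :=
  (∏ k ∈ Finset.range d, ((2 * w + 2 : ℕ) : ℝ≥0∞)⁻¹ *
    ∑ j ∈ Finset.range (48 * (d * d)), rejWeight d w r (c k) ^ j) *
    ENNReal.ofReal ((1 - 1 / (2 * d)) ^ (d * d))

/-- The state of the search for a lattice point of a ball. -/
def TrialState {d : ℕ} (p : EuclideanSpace ℝ (Fin d)) (r : ℝ) (M : Memory) : Prop :=
  M 54 0 = 0 ∨ M 54 0 = 1 ∧ ∃ z ∈ latticeBall p r, ∀ k : Fin d, M 53 k = z k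

/-- The factor of a coordinate in the probability that a lattice point is accepted. -/
noncomputable def accFactor (d : ℕ) (r x : ℝ) : ℝ := 1 - x ^ 2 / (2 * d * r ^ 2)

/-- This is the Weierstrass product inequality, by induction: the cross terms that are dropped are
nonnegative. -/
theorem one_sub_sum_le_prod {ι : Type*} {s : Finset ι} {a : ι → ℝ} (h0 : ∀ i ∈ s, 0 ≤ a i)
    (h1 : ∀ i ∈ s, a i ≤ 1) : 1 - ∑ i ∈ s, a i ≤ ∏ i ∈ s, (1 - a i) := by
  classical
  induction s using Finset.induction_on with
  | empty => simp
  | insert i s hi ih =>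
    rw [Finset.sum_insert hi, Finset.prod_insert hi]
    have h2 := ih (fun j hj => h0 j (Finset.mem_insert_of_mem hj))
      fun j hj => h1 j (Finset.mem_insert_of_mem hj)
    have h3 : 0 ≤ ∑ j ∈ s, a j := Finset.sum_nonneg fun j hj => h0 j (Finset.mem_insert_of_mem hj)
    have h4 := h0 i (Finset.mem_insert_self _ _)
    have h5 := h1 i (Finset.mem_insert_self _ _)
    nlinarith [mul_nonneg h4 h3, mul_le_mul_of_nonneg_left h2 (sub_nonneg.2 h5)]

/-- For a point of the ball the deductions `x i² / (2dr²)` add up to at most `1 / (2d)`. This bound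
makes `finProb` a genuine probability. -/
theorem le_prod_accFactor {d : ℕ} (hd : 1 ≤ d) {r : ℝ} (hr : 0 < r) (x : ℕ → ℝ)
    (hx : ∑ i ∈ Finset.range d, x i ^ 2 ≤ r ^ 2) :
    1 - 1 / (2 * (d : ℝ)) ≤ ∏ i ∈ Finset.range d, accFactor d r (x i) := by
  have hd' : (1 : ℝ) ≤ d := by exact_mod_cast hd
  have h1 : ∀ i ∈ Finset.range d, x i ^ 2 / (2 * d * r ^ 2) ≤ 1 := by
    intro i hi
    rw [div_le_one (by positivity)]
    have := (Finset.single_le_sum (f := fun i => x i ^ 2) (fun i _ => sq_nonneg _) hi).trans hx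
    nlinarith [sq_nonneg r]
  have h2 := one_sub_sum_le_prod (s := Finset.range d)
    (a := fun i => x i ^ 2 / (2 * d * r ^ 2)) (fun i _ => by positivity) h1
  refine le_trans ?_ h2
  rw [← Finset.sum_div]
  have : (∑ i ∈ Finset.range d, x i ^ 2) / (2 * d * r ^ 2) ≤ 1 / (2 * d) := by
    rw [div_le_div_iff₀ (by positivity) (by positivity)]
    nlinarith
  linarith

/-- The sequence that starts with the coordinates of a lattice point. -/
def zcoords {d : ℕ} (z : Fin d → ℤ) (i : ℕ) : ℤ := if h : i < d then z ⟨i, h⟩ else 0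

theorem zcoords_val {d : ℕ} (z : Fin d → ℤ) (k : Fin d) : zcoords z k = z k := by simp [zcoords]

theorem sum_zcoords_le {d : ℕ} (p : EuclideanSpace ℝ (Fin d)) {r : ℝ} (hr : 0 < r)
    (z : Fin d → ℤ) : z ∈ latticeBall p r ↔
      ∑ i ∈ Finset.range d, ((zcoords z i : ℝ) - coords (fun k => p k) i) ^ 2 ≤ r ^ 2 := by
  rw [mem_latticeBall p hr, Finset.sum_range]
  simp only [zcoords_val, coords_val]

/-- The probability that the final test accepts a lattice point. -/
noncomputable def finProb (d : ℕ) (r : ℝ) (x : ℕ → ℝ) : ℝ :=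
  ((1 - 1 / (2 * d)) / ∏ i ∈ Finset.range d, accFactor d r (x i)) ^ (d * d)

theorem one_sub_half_pos {d : ℕ} (hd : 1 ≤ d) : 0 < 1 - 1 / (2 * (d : ℝ)) := by
  have hd' : (1 : ℝ) ≤ d := by exact_mod_cast hd
  have : 1 / (2 * (d : ℝ)) < 1 := by rw [div_lt_one (by positivity)]; linarith
  linarith

theorem finProb_le_one {d : ℕ} (hd : 1 ≤ d) {r : ℝ} (hr : 0 < r) (x : ℕ → ℝ)
    (hx : ∑ i ∈ Finset.range d, x i ^ 2 ≤ r ^ 2) : finProb d r x ≤ 1 := by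
  have h0 := one_sub_half_pos hd
  have h1 := le_prod_accFactor hd hr x hx
  unfold finProb
  exact pow_le_one₀ (div_nonneg h0.le (h0.le.trans h1)) ((div_le_one (h0.trans_le h1)).2 h1)

/-- The final test divides out exactly the product of the acceptance probabilities of the
coordinates. What remains does not depend on the point, so all lattice points of the ball are
equally likely. -/
theorem prod_accProb_mul_finProb {d w : ℕ} (hd : 1 ≤ d) {r : ℝ} (hr : 0 < r) (c : ℕ → ℝ)
    (y : ℕ → ℕ) (hx : ∑ i ∈ Finset.range d, ((cand w (c i) (y i) : ℝ) - c i) ^ 2 ≤ r ^ 2) :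
    (∏ i ∈ Finset.range d, ENNReal.ofReal (accProb d w r (c i) (y i))) *
      ENNReal.ofReal (finProb d r fun i => (cand w (c i) (y i) : ℝ) - c i) =
      ENNReal.ofReal ((1 - 1 / (2 * d)) ^ (d * d)) := by
  have h0 := one_sub_half_pos hd
  have h1 := h0.trans_le (le_prod_accFactor hd hr _ hx)
  have h2 : ∀ i ∈ Finset.range d, accProb d w r (c i) (y i) =
      accFactor d r ((cand w (c i) (y i) : ℝ) - c i) ^ (d * d) := by
    intro i hi
    rw [accProb, if_pos]
    · rfl
    · exact (Finset.single_le_sum (f := fun i => ((cand w (c i) (y i) : ℝ) - c i) ^ 2)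
        (fun i _ => sq_nonneg _) hi).trans hx
  rw [← ENNReal.ofReal_prod_of_nonneg fun i _ => (accProb_mem hd hr _).1,
    Finset.prod_congr rfl h2, Finset.prod_pow,
    ← ENNReal.ofReal_mul (pow_nonneg h1.le _), finProb, ← mul_pow, mul_div_cancel₀ _ h1.ne']

/-- The state after `k` coordinates have been looked for. -/
def PointState (d k : ℕ) (r : ℝ) (c : ℕ → ℝ) (M : Memory) : Prop :=
  M 54 0 = 0 ∧ (M 50 0 = 0 ∨ M 50 0 = 1 ∧ ∃ z : ℕ → ℤ, (∀ i < k, M 53 i = z i) ∧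
    M 51 0 = ∏ i ∈ Finset.range k, accFactor d r ((z i : ℝ) - c i) ∧
    M 52 0 = ∑ i ∈ Finset.range k, ((z i : ℝ) - c i) ^ 2)

open Classical in
/-- `φ`, provided that the first `k` coordinates of `z` have been found. -/
noncomputable def pointInd (k : ℕ) (z : ℕ → ℤ) (φ : ℝ≥0∞) (M : Memory) : ℝ≥0∞ :=
  if M 50 0 = 1 ∧ ∀ i < k, M 53 i = z i then φ else 0

/-- The probability that a given candidate is found for a coordinate. -/
noncomputable def coordWeight (d w : ℕ) (r c : ℝ) (y : ℕ) : ℝ≥0∞ :=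
  accWeight d w r c y * ∑ j ∈ Finset.range (48 * (d * d)), rejWeight d w r c ^ j

theorem pr_pointCmd {ι : Type*} {M : Memory} {d w : ℕ} {c : ℕ → ℝ} {r : ℝ} (hd : 1 ≤ d)
    (hr : 0 < r) (h1 : M 1 = c) (h2 : M 2 0 = d) (h3 : M 3 0 = r) (h7 : M 7 0 = w)
    (h54 : M 54 0 = 0) (h50 : M 50 0 = 1) (h51 : M 51 0 = 1) (h52 : M 52 0 = 0)
    (ζ : ι → ℕ → ℤ) (φ : ι → ℝ≥0∞) (Y : ι → ℕ → ℕ)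
    (hYlt : ∀ z, ∀ i < d, Y z i < 2 * w + 2) (hY : ∀ z, ∀ i < d, ζ z i = cand w (c i) (Y z i)) :
    Pr L pointCmd M (d * (48 * (d * d) * (3 * (d * d) + 12) + 10) + 2) (PointState d d r c)
      (fun z => pointInd d (ζ z) (φ z))
      fun z => (∏ i ∈ Finset.range d, coordWeight d w r (c i) (Y z i)) * φ z := by
  classical
  set W : ℕ → ℕ → ℝ≥0∞ := fun i => coordWeight d w r (c i) with hW
  set Tc := 48 * (d * d) * (3 * (d * d) + 12) + 3 with hTc
  -- The product over `Finset.Ico k d` is the probability that the coordinates not yet treated will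
  -- be found as prescribed by `z`.
  refine Pr.le (Pr.forUp d (T := 1 + (Tc + 4)) (fun k => PointState d k r c)
    (fun k z => pointInd k (ζ z) ((∏ i ∈ Finset.Ico k d, W i (Y z i)) * φ z)) (by decide)
    ?_ ?_ ?_ ?_ ?_) (?_ : d * ((1 + (Tc + 4)) + 2) + 2 ≤ _)
  · refine ⟨by simp [Memory.write_ne, h54], Or.inr ⟨by simp [Memory.write_ne, h50], fun _ => 0, ?_⟩⟩
    simp [Memory.write_ne, h51, h52]
  · intro M' hf
    simp [hf 2 (by decide) (by decide), h2]
  · rintro k hk M' hk' hf ⟨hI54, hI⟩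
    have g1 := hf 1 (by decide) (by decide)
    have g2 := hf 2 (by decide) (by decide)
    have g3 := hf 3 (by decide) (by decide)
    have g7 := hf 7 (by decide) (by decide)
    have e37 : (Term.read 1 (var 32)).eval M' = c k := by simp [g1, h1, hk']
    refine Pr.seq_ev (Ev.put ?_)
    rw [e37]
    refine Pr.seq ((pr_coordCmd (w := w) (c := c k) hd hr (by simp [Memory.write_ne, g2, h2])
      (by simp [Memory.write_ne, g3, h3]) (by simp [Memory.write_ne, g7, h7])
      (by simp)).frame.mono
      (f' := fun (z : ι) M'' => (coordObs w (c k) M'').elim 0 fun y =>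
        if (M' 50 0 = 1 ∧ ∀ i < k, M' 53 i = ζ z i) ∧ y = Y z k then
          (∏ i ∈ Finset.Ico (k + 1) d, W i (Y z i)) * φ z else 0)
      (fun z o => o.elim 0 fun y =>
        if (M' 50 0 = 1 ∧ ∀ i < k, M' 53 i = ζ z i) ∧ y = Y z k then
          (∏ i ∈ Finset.Ico (k + 1) d, W i (Y z i)) * φ z else 0)
      (fun M'' h => ⟨h, fun z => rfl⟩) ?_) ?_
    · intro z
      simp only [Option.elim, retry, mul_zero, add_zero]
      by_cases hm : M' 50 0 = 1 ∧ ∀ i < k, M' 53 i = ζ z i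
      · rw [pointInd, if_pos hm]
        simp only [eq_true hm, true_and, mul_ite, mul_zero]
        rw [Finset.sum_ite_eq', if_pos (Finset.mem_range.2 (hYlt z k hk)),
          Finset.prod_eq_prod_Ico_succ_bot hk]
        rw [hW]; beta_reduce; rw [show coordWeight d w r (c k) (Y z k) = accWeight d w r (c k) (Y z k) *
          ∑ j ∈ Finset.range (48 * (d * d)), rejWeight d w r (c k) ^ j from rfl]
        ring
      · simp [hm, pointInd]
    · rintro M'' ⟨hcs, hf'⟩
      have q50 := hf' 50 (by decide)
      have q51 := hf' 51 (by decide)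
      have q52 := hf' 52 (by decide)
      have q53 := hf' 53 (by decide)
      have q54 := hf' 54 (by decide)
      have q32 := hf' 32 (by decide)
      simp only [Memory.write_ne _ _ _ (show 50 ≠ 37 by decide),
        Memory.write_ne _ _ _ (show 51 ≠ 37 by decide),
        Memory.write_ne _ _ _ (show 52 ≠ 37 by decide),
        Memory.write_ne _ _ _ (show 53 ≠ 37 by decide),
        Memory.write_ne _ _ _ (show 54 ≠ 37 by decide),
        Memory.write_ne _ _ _ (show 32 ≠ 37 by decide)] at q50 q51 q52 q53 q54 q32
      refine Pr.of_ev (Ev.ite (T := 3) (fun h40 => ?_) (fun h40 => ?_))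
      · rcases hcs with h | ⟨y, hy, hle, h40, h41, h42, h47⟩
        · simp [h] at h40; linarith
        refine Ev.seq (T₁ := 1) (T₂ := 2) (Ev.set (Ev.seq (T₁ := 1) (T₂ := 1) (Ev.put (Ev.put
          ⟨⟨?_, ?_⟩, fun z => ?_⟩))))
        · simp [Memory.write_ne, q54, hI54]
        · rcases hI with h50 | ⟨h50, z, hz, h51, h52⟩
          · left; simp [Memory.write_ne, q50, h50]
          · right
            refine ⟨by simp [Memory.write_ne, q50, h50],
              fun i => if i = k then cand w (c k) y else z i, ?_, ?_, ?_⟩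
            · intro i hi
              simp [Memory.write_ne, Memory.write_self, Term.nat, q32, hk', h41, q53]
              split_ifs with hik
              · rfl
              · exact hz i (by omega)
            · rw [Finset.prod_range_succ]
              beta_reduce
              rw [if_pos rfl, Finset.prod_congr rfl (fun i hi => by
                rw [if_neg (Finset.mem_range.1 hi).ne])]
              simp [Memory.write_ne, q51, h51, h42, accFactor, candSq]
            · rw [Finset.sum_range_succ]
              beta_reduce
              rw [if_pos rfl, Finset.sum_congr rfl (fun i hi => by
                rw [if_neg (Finset.mem_range.1 hi).ne])]
              simp [Memory.write_ne, q52, h52, h47, candSq]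
        · rw [coordObs_eq h40 h41]
          simp only [Option.elim, pointInd]
          congr 1
          refine propext ?_
          simp [Memory.write_ne, Memory.write_self, Term.nat, q32, hk', h41, q50, q53, and_assoc]
          intro h50
          constructor
          · intro h
            refine ⟨fun i hi => ?_, ?_⟩
            · have := h i (by omega)
              rwa [if_neg hi.ne] at this
            · have := h k (by omega)
              rw [if_pos rfl, hY z k hk] at this
              have h2 : cand w (c k) y = cand w (c k) (Y z k) := by exact_mod_cast this
              unfold cand at h2
              omega
          · rintro ⟨h, rfl⟩ i hi
            split_ifs with hik
            · rw [hik, hY z k hk]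
            · exact h i (by omega)
      · rcases hcs with h | ⟨y, hy, hle, h40', -⟩
        · refine Ev.le (Ev.put ⟨⟨?_, Or.inl ?_⟩, fun z => ?_⟩) (by omega : 1 ≤ _)
          · simp [Memory.write_ne, q54, hI54]
          · simp [Memory.write_ne]
          · have : coordObs w (c k) M'' = none := by simp [coordObs, h]
            rw [this]
            simp [Memory.write_ne, pointInd]
        · simp [h40'] at h40
  · intro M' _ hf hI
    exact ⟨hI, fun z => by simp⟩
  · intro z
    simp [pointInd, Memory.write_ne, h50, hW]
  · have e : d * ((1 + (Tc + 4)) + 2) = d * (48 * (d * d) * (3 * (d * d) + 12) + 10) := by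
      rw [hTc]; ring
    omega

/-- The probability is the same for each `z` of the ball: the acceptance probabilities cancel, and
the factors left from the search, geometric sums of rejection weights, depend only on the centre. -/
theorem pr_trialCmd_aux {M : Memory} {d w : ℕ} {p : EuclideanSpace ℝ (Fin d)} {r : ℝ} (hd : 1 ≤ d)
    (hr : 0 < r) (hw : w = ⌈r⌉₊) (h1 : M 1 = coords fun k => p k) (h2 : M 2 0 = d) (h3 : M 3 0 = r)
    (h7 : M 7 0 = w) (h54 : M 54 0 = 0) :
    Pr L trialCmd M (d * (48 * (d * d) * (3 * (d * d) + 12) + 10) + 3 * (d * d) + 12)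
      (TrialState p r)
      (fun (z : latticeBall p r) M' =>
        open Classical in if trialObs d M' = some z.1 then (1 : ℝ≥0∞) else 0)
      fun _ => trialWeight d w r (coords fun k => p k) := by
  classical
  set c := coords fun k => p k with hc
  have hex : ∀ z : latticeBall p r, ∀ i : ℕ, ∃ y, i < d →
      y < 2 * w + 2 ∧ zcoords z.1 i = cand w (c i) y := by
    intro z i
    by_cases hi : i < d
    · obtain ⟨y, hy, hzy⟩ := exists_cand (z.1 ⟨i, hi⟩)
        (abs_sub_le_of_mem_latticeBall p hr z.2 ⟨i, hi⟩)
      refine ⟨y, fun _ => ⟨hw ▸ hy, ?_⟩⟩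
      rw [show c i = p ⟨i, hi⟩ from coords_val (fun k => p k) ⟨i, hi⟩,
        show zcoords z.1 i = z.1 ⟨i, hi⟩ from zcoords_val z.1 ⟨i, hi⟩, hzy, hw]
    · exact ⟨0, fun h => absurd h hi⟩
  choose Y hY using hex
  set φ : latticeBall p r → ℝ≥0∞ := fun z =>
    ENNReal.ofReal (finProb d r fun i => (zcoords z.1 i : ℝ) - c i) with hφ
  refine Pr.le (Pr.seq_ev (Ev.put (Pr.seq_ev (Ev.put (Pr.seq_ev (Ev.put (Pr.seq
    ((pr_pointCmd (w := w) (c := c) hd hr (by simp [Memory.write_ne, h1])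
      (by simp [Memory.write_ne, h2]) (by simp [Memory.write_ne, h3])
      (by simp [Memory.write_ne, h7]) (by simp [Memory.write_ne, h54])
      (by simp [Memory.write_ne]) (by simp [Memory.write_ne]) (by simp)
      (fun z : latticeBall p r => zcoords z.1) φ Y (fun z i hi => (hY z i hi).1)
      (fun z i hi => (hY z i hi).2)).frame.mono id (fun M' h => ⟨h, fun z => rfl⟩) ?_) ?_)))))))
    (?_ : 1 + (1 + (1 + ((d * (48 * (d * d) * (3 * (d * d) + 12) + 10) + 2) +
      ((1 + ((3 * (d * d) + 3) + 1)) + 1 + 1)))) ≤ _)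
  · intro z
    simp only [id, coordWeight, hφ]
    rw [Finset.prod_mul_distrib, trialWeight]
    have hcand : ∀ i ∈ Finset.range d, (zcoords z.1 i : ℝ) - c i = (cand w (c i) (Y z i) : ℝ) - c i := by
      intro i hi
      rw [(hY z i (Finset.mem_range.1 hi)).2]
    have hs := (sum_zcoords_le p hr z.1).1 z.2
    rw [← hc, Finset.sum_congr rfl fun i hi => by rw [hcand i hi]] at hs
    have key := prod_accProb_mul_finProb (w := w) hd hr c (Y z) hs
    have e : finProb d r (fun i => (zcoords z.1 i : ℝ) - c i) =
        finProb d r fun i => (cand w (c i) (Y z i) : ℝ) - c i := by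
      unfold finProb
      rw [Finset.prod_congr rfl fun i hi => congrArg (accFactor d r) (hcand i hi)]
    simp only [e, ← key, Finset.prod_mul_distrib, accWeight, ENNReal.div_eq_inv_mul]
    ring
  · rintro M' ⟨⟨h54', hI⟩, hf⟩
    have g2 := hf 2 (by decide)
    have g3 := hf 3 (by decide)
    simp [Memory.write_ne] at g2 g3
    have hnone : trialObs d M' = none := by simp [trialObs, h54']
    refine Pr.ite (fun h50 => ?_) fun h50 => ?_
    · have h50' : M' 50 0 = 1 := by
        rcases hI with h | h
        · simp [h] at h50; linarith
        · exact h.1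
      obtain ⟨-, x, hx53, hx51, hx52⟩ := hI.resolve_left (by rw [h50']; norm_num)
      refine Pr.ite (fun h52 => ?_) fun h52 => ?_
      · simp only [eval_var, eval_mul, g3, h3, hx52] at h52
        have hx : ∑ i ∈ Finset.range d, ((x i : ℝ) - c i) ^ 2 ≤ r ^ 2 := by rw [sq r]; exact h52
        refine Pr.seq_ev (Ev.put (Pr.seq_ev ((ev_powCmd (d := d) ?_).frame.mono ?_)))
        · simp [Memory.write_ne, g2, h2]
        · rintro M'' ⟨h44, hf'⟩
          have q53 := hf' 53 (by decide)
          rw [Memory.write_ne _ _ _ (by decide)] at q53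
          have hp : M'' 44 0 = finProb d r fun i => (x i : ℝ) - c i := by
            rw [h44]
            simp [g2, h2, hx51, finProb]
          have hidx : (0 : Term).nat M'' = 0 := by simp [Term.nat]
          have hle : min 1 (ENNReal.ofReal ((var 44).eval M'')) = ENNReal.ofReal (M'' 44 0) := by
            rw [eval_var, min_eq_right]
            rw [hp, ← ENNReal.ofReal_one]
            exact ENNReal.ofReal_le_ofReal (finProb_le_one hd hr _ hx)
          have hmem : (fun k : Fin d => x k) ∈ latticeBall p r := by
            rw [sum_zcoords_le p hr, Finset.sum_congr rfl fun i hi => ?_]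
            · exact hx
            · rw [zcoords, dif_pos (Finset.mem_range.1 hi)]
          refine Pr.toss ?_ ?_ fun z => ?_
          · refine Or.inr ⟨by simp [hidx], _, hmem, fun k => ?_⟩
            rw [Memory.write_ne _ _ _ (by decide), q53, hx53 k k.2]
          · left; simp [hidx]
          · have o0 : trialObs d (M''.write 54 0 0) = none := by simp [trialObs]
            have o1 : trialObs d (M''.write 54 0 1) = some fun k : Fin d => x k := by
              simp only [trialObs, Memory.write_same, one_ne_zero, if_false]
              congr 1; funext k
              rw [Memory.write_ne _ _ _ (by decide), q53, hx53 k k.2, round_intCast]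
            rw [hle, hidx, o0, o1, hp]
            simp only [Option.some.injEq, reduceCtorEq, if_false, mul_zero, add_zero, mul_ite, mul_one,
              pointInd, h50', true_and, hφ, id]
            by_cases hz : (fun k : Fin d => x k) = z.1
            · have e : ∀ i < d, x i = zcoords z.1 i := fun i hi => by
                rw [← hz, zcoords, dif_pos hi]
              rw [if_pos hz, if_pos fun i hi => by rw [hx53 i hi, e i hi]]
              have e' : ∏ i ∈ Finset.range d, accFactor d r ((x i : ℝ) - c i) =
                  ∏ i ∈ Finset.range d, accFactor d r ((zcoords z.1 i : ℝ) - c i) :=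
                Finset.prod_congr rfl fun i hi => by rw [e i (Finset.mem_range.1 hi)]
              simp only [finProb, e']
            · rw [if_neg hz, if_neg fun h => hz ?_]
              funext k
              have := h k k.2
              rw [hx53 k k.2, zcoords_val] at this
              exact_mod_cast this
      -- The point that was assembled lies outside the ball, hence it differs from every `z` in
      -- question.
      · refine Pr.le (Pr.of_ev (Ev.skip ⟨Or.inl h54', fun z => ?_⟩)) (by omega : 1 ≤ _)
        rw [hnone, if_neg (by simp)]
        symm
        refine if_neg fun h => ?_
        simp only [eval_var, eval_mul, g3, h3, hx52] at h52
        have hs := (sum_zcoords_le p hr z.1).1 z.2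
        have e : ∀ i ∈ Finset.range d, ((zcoords z.1 i : ℝ) - c i) ^ 2 = ((x i : ℝ) - c i) ^ 2 := by
          intro i hi
          rw [← hx53 i (Finset.mem_range.1 hi), h.2 i (Finset.mem_range.1 hi), id]
        rw [← hc, Finset.sum_congr rfl e] at hs
        nlinarith
    · refine Pr.le (Pr.of_ev (Ev.skip ⟨Or.inl h54', fun z => ?_⟩)) (by omega : 1 ≤ _)
      rw [hnone, if_neg (by simp)]
      symm
      refine if_neg fun h => ?_
      simp [h.1] at h50
  · omega

end RandRAM


/-! ## Gaussian sums -/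

/-- Factor out `exp(-a x²)` and use `exp s ≥ 1 + s` with `s = a x² - a t²`. On the unit interval
centred at `x` the mean of `t²` is `x² + 1/12`, which leaves the factor `1 - a/12`. -/
theorem one_sub_mul_exp_le_integral {a : ℝ} (x : ℝ) :
    (1 - a / 12) * Real.exp (-a * x ^ 2) ≤ ∫ t in (x - 1 / 2)..(x + 1 / 2), Real.exp (-a * t ^ 2) := by
  have h1 : ∫ t in (x - 1 / 2)..(x + 1 / 2), ((1 + a * x ^ 2) - a * t ^ 2) = 1 - a / 12 := by
    rw [intervalIntegral.integral_sub (by simp) (by apply Continuous.intervalIntegrable; fun_prop),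
      intervalIntegral.integral_const_mul, integral_pow]
    simp only [intervalIntegral.integral_const, smul_eq_mul]
    push_cast
    ring
  rw [← h1, mul_comm, ← intervalIntegral.integral_const_mul]
  refine intervalIntegral.integral_mono_on (by linarith)
    (by apply Continuous.intervalIntegrable; fun_prop)
    (by apply Continuous.intervalIntegrable; fun_prop) fun t _ => ?_
  have h2 : Real.exp (-a * t ^ 2) = Real.exp (-a * x ^ 2) * Real.exp (a * x ^ 2 - a * t ^ 2) := by
    rw [← Real.exp_add]; ring_nf
  rw [h2]
  have := Real.add_one_le_exp (a * x ^ 2 - a * t ^ 2)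
  exact mul_le_mul_of_nonneg_left (by linarith) (Real.exp_pos _).le

/-- The unit intervals around the summation points are adjacent, so the sum is compared with one
integral, which is at most the full Gaussian integral. -/
theorem gaussian_sum_le {a : ℝ} (ha : 0 < a) (x : ℝ) (n : ℕ) :
    (1 - a / 12) * ∑ y ∈ Finset.range n, Real.exp (-a * (x + y) ^ 2) ≤ Real.sqrt (Real.pi / a) := by
  have hint : ∀ u v : ℝ, IntervalIntegrable (fun t => Real.exp (-a * t ^ 2)) MeasureTheory.volume u v :=
    fun u v => by apply Continuous.intervalIntegrable; fun_prop
  calc (1 - a / 12) * ∑ y ∈ Finset.range n, Real.exp (-a * (x + y) ^ 2)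
      ≤ ∑ y ∈ Finset.range n, ∫ t in (x - 1 / 2 + y)..(x - 1 / 2 + ((y + 1 : ℕ) : ℝ)),
          Real.exp (-a * t ^ 2) := by
        rw [Finset.mul_sum]
        refine Finset.sum_le_sum fun y _ => ?_
        have := one_sub_mul_exp_le_integral (a := a) (x + y)
        rw [show x - 1 / 2 + (y : ℝ) = x + y - 1 / 2 by ring,
          show x - 1 / 2 + ((y + 1 : ℕ) : ℝ) = x + y + 1 / 2 by push_cast; ring]
        exact this
    _ = ∫ t in (x - 1 / 2 + ((0 : ℕ) : ℝ))..(x - 1 / 2 + (n : ℝ)), Real.exp (-a * t ^ 2) :=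
        intervalIntegral.sum_integral_adjacent_intervals (a := fun k => x - 1 / 2 + (k : ℝ))
          fun k _ => hint _ _
    _ ≤ ∫ t : ℝ, Real.exp (-a * t ^ 2) := by
        rw [intervalIntegral.integral_of_le (by simp)]
        exact MeasureTheory.setIntegral_le_integral (integrable_exp_neg_mul_sq ha)
          (Filter.Eventually.of_forall fun t => (Real.exp_pos _).le)
    _ = Real.sqrt (Real.pi / a) := integral_gaussian a

/-! ## The volume of a ball, compared with a Gaussian integral -/

/-- The reciprocal of `1 + 2/d` is `1 - 2/(d+2) ≤ exp(-2/(d+2))`; raise this to the power `d + 2`.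
-/
theorem exp_two_le_pow (d : ℕ) (hd : 1 ≤ d) : Real.exp 2 ≤ (1 + 2 / (d : ℝ)) ^ (d + 2) := by
  have hd' : (0 : ℝ) < d := by exact_mod_cast hd
  have h1 : (1 + 2 / (d : ℝ))⁻¹ ≤ Real.exp (-(2 / (d + 2))) := by
    have := Real.add_one_le_exp (-(2 / ((d : ℝ) + 2)))
    refine le_trans (le_of_eq ?_) this
    field_simp
    ring
  have h2 : ((1 + 2 / (d : ℝ))⁻¹) ^ (d + 2) ≤ Real.exp (-2) := by
    refine (pow_le_pow_left₀ (by positivity) h1 _).trans (le_of_eq ?_)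
    rw [← Real.exp_nat_mul]
    congr 1
    push_cast
    field_simp
  rw [inv_pow, Real.exp_neg] at h2
  exact (inv_le_inv₀ (by positivity) (Real.exp_pos _)).1 h2

/-- A lower bound of Stirling type, squared to avoid roots. The induction goes in steps of two along
the recurrence for the volume: the right side grows by the factor `(1 + 2/n)^(n+2) ≥ e²`. The
constant `1/5` is small enough for the base cases `d = 1` and `d = 2`. -/
theorem exp_mul_le_ballVol_sq {r : ℝ} (hr : 0 < r) (d : ℕ) (hd : 1 ≤ d) :
    1 / 5 * Real.exp d ≤ ballVol d r ^ 2 * (d / (2 * Real.pi * r ^ 2)) ^ d * d ^ 2 := by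
  have hpi := Real.pi_pos
  have he := Real.exp_one_lt_d9
  have hpi4 := Real.pi_lt_d2
  induction d using Nat.strong_induction_on with
  | _ d ih =>
    match d, hd with
    | 1, _ =>
      rw [ballVol_one]
      have : (2 * r) ^ 2 * (((1 : ℕ) : ℝ) / (2 * Real.pi * r ^ 2)) ^ 1 * ((1 : ℕ) : ℝ) ^ 2 =
        2 / Real.pi := by
        push_cast; field_simp
      rw [this, le_div_iff₀ hpi, Nat.cast_one]
      nlinarith
    | 2, _ =>
      have e : ballVol 2 r = Real.pi * r ^ 2 := by
        have := ballVol_add_two 0 r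
        rw [zero_add] at this
        rw [this, ballVol_zero]
        push_cast; ring
      have : (Real.pi * r ^ 2) ^ 2 * (((2 : ℕ) : ℝ) / (2 * Real.pi * r ^ 2)) ^ 2 * ((2 : ℕ) : ℝ) ^ 2 =
        4 := by
        push_cast; field_simp; try norm_num
      rw [e, this]
      have : Real.exp ((2 : ℕ) : ℝ) = Real.exp 1 * Real.exp 1 := by
        rw [← Real.exp_add]; norm_num
      rw [this]
      nlinarith [Real.exp_pos 1]
    | d + 3, _ =>
      set n := d + 1 with hn
      have h1 := ih n (by omega) (by omega)
      have h2 := exp_two_le_pow n (by omega)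
      have hn' : (0 : ℝ) < n := by exact_mod_cast (by omega : 0 < n)
      rw [show d + 3 = n + 2 by omega, ballVol_add_two]
      have e1 : Real.exp ((n + 2 : ℕ) : ℝ) = Real.exp n * Real.exp 2 := by
        rw [← Real.exp_add]; push_cast; rfl
      have e2 : (ballVol n r * (2 * Real.pi * r ^ 2 / (n + 2))) ^ 2 *
          (((n + 2 : ℕ) : ℝ) / (2 * Real.pi * r ^ 2)) ^ (n + 2) * ((n + 2 : ℕ) : ℝ) ^ 2 =
          (ballVol n r ^ 2 * (n / (2 * Real.pi * r ^ 2)) ^ n * n ^ 2) * (1 + 2 / (n : ℝ)) ^ (n + 2) := by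
        have e3 : (1 + 2 / (n : ℝ)) = (n + 2) / n := by field_simp
        rw [e3]
        push_cast
        simp only [div_pow, pow_add]
        field_simp
      rw [e1, e2, ← mul_assoc]
      exact mul_le_mul h1 h2 (Real.exp_pos _).le (by positivity)

theorem neg_sub_sq_le_log {u : ℝ} (h1 : u ≤ 1 / 2) :
    -u - 2 * u ^ 2 ≤ Real.log (1 - u) := by
  have h2 : 0 < 1 - u := by linarith
  refine le_trans ?_ (Real.one_sub_inv_le_log_of_pos h2)
  have : (1 - u)⁻¹ ≤ 1 + u + 2 * u ^ 2 := by
    rw [inv_le_iff_one_le_mul₀ h2]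
    nlinarith [mul_nonneg (sq_nonneg u) (by linarith : 0 ≤ 1 - 2 * u)]
  linarith

namespace RandRAM

/-- This bounds the loss due to the normalisation in the final test: with `u = 1/(2d)`, the exponent
`d² (-u - 2u²)` equals `-(d/2 + 1/2)`. -/
theorem exp_neg_le_pow (d : ℕ) (hd : 1 ≤ d) :
    Real.exp (-(d / 2 + 1 / 2)) ≤ (1 - 1 / (2 * (d : ℝ))) ^ (d * d) := by
  have hd' : (1 : ℝ) ≤ d := by exact_mod_cast hd
  have h1 : 1 / (2 * (d : ℝ)) ≤ 1 / 2 := by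
    rw [div_le_div_iff₀ (by positivity) (by norm_num)]; linarith
  have h2 := neg_sub_sq_le_log (u := 1 / (2 * (d : ℝ))) h1
  rw [← Real.exp_log (one_sub_half_pos hd), ← Real.exp_nat_mul, Real.exp_le_exp]
  refine le_trans (le_of_eq ?_) (mul_le_mul_of_nonneg_left h2 (Nat.cast_nonneg _))
  push_cast
  field_simp
  ring

/-! ## The probability that an attempt succeeds -/

variable {d w : ℕ} {r c : ℝ}

/-- By `1 - s ≤ exp(-s)`, the acceptance probability is at most the Gaussian weight with parameter
`a = d / (2r²)`. -/
theorem one_sub_mul_sum_accProb_le (hd : 1 ≤ d) (hr : 0 < r) (ha : (d : ℝ) / (2 * r ^ 2) ≤ 12) :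
    (1 - d / (2 * r ^ 2) / 12) * ∑ y ∈ Finset.range (2 * w + 2), accProb d w r c y ≤
      Real.sqrt (Real.pi / (d / (2 * r ^ 2))) := by
  have hd' : (1 : ℝ) ≤ d := by exact_mod_cast hd
  have ha0 : 0 < (d : ℝ) / (2 * r ^ 2) := by positivity
  refine le_trans (mul_le_mul_of_nonneg_left (Finset.sum_le_sum fun y _ => ?_) (by linarith))
    (gaussian_sum_le ha0 (⌊c⌋ - w - c) (2 * w + 2))
  unfold accProb
  split_ifs with h
  · have h0 : 0 ≤ candSq w c y := sq_nonneg _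
    have h1 : candSq w c y / (2 * d * r ^ 2) ≤ 1 := by
      rw [div_le_one (by positivity)]
      nlinarith [sq_nonneg r]
    have h2 : 1 - candSq w c y / (2 * d * r ^ 2) ≤ Real.exp (-(candSq w c y / (2 * d * r ^ 2))) := by
      have := Real.add_one_le_exp (-(candSq w c y / (2 * d * r ^ 2))); linarith
    refine (pow_le_pow_left₀ (by linarith) h2 _).trans (le_of_eq ?_)
    rw [← Real.exp_nat_mul]
    congr 1
    have e : candSq w c y = (⌊c⌋ - w - c + y) ^ 2 := by
      simp only [candSq, cand]; push_cast; ring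
    rw [← e]
    push_cast
    field_simp
  · exact (Real.exp_pos _).le

/-- Candidates within `r/d` of the centre are accepted with probability at least `1/2`, by
Bernoulli's inequality with `d² · 1/(2d³) ≤ 1/2`. At least `r/d` of the candidates `⌊c⌋, ⌊c⌋ + 1, …`
qualify, while the window has at most `4r` candidates. -/
theorem le_sum_accProb (hd : 1 ≤ d) (hr : 2 * (d : ℝ) ≤ r) (hw : w = ⌈r⌉₊) :
    ((2 * w + 2 : ℕ) : ℝ) / (8 * d) ≤ ∑ y ∈ Finset.range (2 * w + 2), accProb d w r c y := by
  have hd' : (1 : ℝ) ≤ d := by exact_mod_cast hd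
  have hr0 : 0 < r := by linarith
  set J := ⌊r / d⌋₊ with hJ
  have hJr : (J : ℝ) ≤ r / d := Nat.floor_le (by positivity)
  have hrd : r / d ≤ r := div_le_self hr0.le hd'
  have h1rd : 1 ≤ r / d := by rw [le_div_iff₀ (by positivity)]; linarith
  have hJw : J ≤ w := by
    have : (J : ℝ) ≤ w := hJr.trans (hrd.trans (hw ▸ Nat.le_ceil r))
    exact_mod_cast this
  have hwr : (w : ℝ) ≤ r + 1 := hw ▸ (Nat.ceil_lt_add_one hr0.le).le
  have hhalf : ∀ j ≤ J, 1 / 2 ≤ accProb d w r c (w + j) := by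
    intro j hj
    have hx : |(⌊c⌋ : ℝ) + j - c| ≤ r / d := by
      have h1 := Int.floor_le c
      have h2 := Int.lt_floor_add_one c
      have h3 : (j : ℝ) ≤ J := by exact_mod_cast hj
      have h4 : (0 : ℝ) ≤ j := Nat.cast_nonneg _
      rw [abs_le]; constructor <;> linarith
    have hsq : candSq w c (w + j) ≤ (r / d) ^ 2 := by
      have : candSq w c (w + j) = ((⌊c⌋ : ℝ) + j - c) ^ 2 := by
        simp only [candSq, cand]; push_cast; ring
      rw [this]
      exact sq_le_sq' (by linarith [(abs_le.1 hx).1]) (abs_le.1 hx).2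
    have h0 : 0 ≤ candSq w c (w + j) := sq_nonneg _
    rw [accProb, if_pos (hsq.trans (pow_le_pow_left₀ (by positivity) hrd 2))]
    have hu : candSq w c (w + j) / (2 * d * r ^ 2) ≤ 1 / (2 * d ^ 3) := by
      rw [div_le_div_iff₀ (by positivity) (by positivity)]
      calc candSq w c (w + j) * (2 * d ^ 3) ≤ (r / d) ^ 2 * (2 * d ^ 3) := by gcongr
        _ = 1 * (2 * d * r ^ 2) := by field_simp
    have hu0 : 0 ≤ candSq w c (w + j) / (2 * d * r ^ 2) := by positivity
    have hu1 : 1 / (2 * (d : ℝ) ^ 3) ≤ 1 := by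
      rw [div_le_one (by positivity)]
      have := one_le_pow₀ (n := 3) hd'
      linarith
    have hb := one_add_mul_le_pow (a := -(candSq w c (w + j) / (2 * d * r ^ 2))) (by linarith) (d * d)
    rw [← sub_eq_add_neg] at hb
    refine le_trans ?_ hb
    have h5 : ((d * d : ℕ) : ℝ) * (candSq w c (w + j) / (2 * d * r ^ 2)) ≤ 1 / 2 := by
      calc ((d * d : ℕ) : ℝ) * (candSq w c (w + j) / (2 * d * r ^ 2))
          ≤ ((d * d : ℕ) : ℝ) * (1 / (2 * (d : ℝ) ^ 3)) := by gcongr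
        _ = 1 / (2 * (d : ℝ)) := by push_cast; field_simp
        _ ≤ 1 / 2 := by rw [div_le_div_iff₀ (by positivity) (by norm_num)]; linarith
    linarith
  have hsub : (Finset.range (J + 1)).image (fun j => w + j) ⊆ Finset.range (2 * w + 2) := by
    intro y hy
    simp only [Finset.mem_image, Finset.mem_range] at hy ⊢
    omega
  refine le_trans ?_ (Finset.sum_le_sum_of_subset_of_nonneg hsub fun y _ _ => (accProb_mem hd hr0 y).1)
  rw [Finset.sum_image (fun a _ b _ h => by simpa using h)]
  refine le_trans ?_ (Finset.card_nsmul_le_sum _ _ (1 / 2) fun j hj =>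
    hhalf j (by have := Finset.mem_range.1 hj; omega))
  rw [Finset.card_range, nsmul_eq_mul]
  have hJ1 : r / d < J + 1 := Nat.lt_floor_add_one _
  push_cast
  calc (2 * (w : ℝ) + 2) / (8 * d) ≤ (4 * r) / (8 * d) := by gcongr; linarith
    _ = r / d * (1 / 2) := by field_simp; norm_num
    _ ≤ (J + 1) * (1 / 2) := by gcongr

theorem rejWeight_eq (hd : 1 ≤ d) (hr : 0 < r) : rejWeight d w r c =
    ENNReal.ofReal (1 - (∑ y ∈ Finset.range (2 * w + 2), accProb d w r c y) / (2 * w + 2 : ℕ)) := by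
  have hw : (0 : ℝ) < (2 * w + 2 : ℕ) := by positivity
  rw [rejWeight, Finset.sum_congr rfl fun y _ => by
    rw [← ENNReal.ofReal_one, ← ENNReal.ofReal_sub _ (accProb_mem hd hr y).1],
    ← ENNReal.ofReal_sum_of_nonneg fun y _ => by linarith [(accProb_mem (w := w) (c := c) hd hr y).2],
    ← ENNReal.ofReal_natCast, ← ENNReal.ofReal_div_of_pos hw]
  congr 1
  rw [Finset.sum_sub_distrib, sub_div]
  simp only [Finset.sum_const, Finset.card_range, nsmul_eq_mul, mul_one]
  rw [div_self hw.ne']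

/-- If `Z` is the sum of acceptance probabilities and `κ` the probability of rejection, then `1 - κ
= Z / (2w+2)`, so the geometric sum gives `(1 - κ^n) / Z`. It remains to see that running out of
attempts is rare. -/
theorem le_inv_mul_sum_rejWeight (hd : 1 ≤ d) (hr : 2 * (d : ℝ) ≤ r) (hw : w = ⌈r⌉₊) :
    ENNReal.ofReal ((1 - 1 / (4 * d)) / ∑ y ∈ Finset.range (2 * w + 2), accProb d w r c y) ≤
      ((2 * w + 2 : ℕ) : ℝ≥0∞)⁻¹ * ∑ j ∈ Finset.range (48 * (d * d)), rejWeight d w r c ^ j := by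
  have hd' : (1 : ℝ) ≤ d := by exact_mod_cast hd
  have hr0 : 0 < r := by linarith
  have hZ := le_sum_accProb (c := c) hd hr hw
  set Z := ∑ y ∈ Finset.range (2 * w + 2), accProb d w r c y with hZd
  have hW : (0 : ℝ) < (2 * w + 2 : ℕ) := by positivity
  have hZ0 : 0 < Z := lt_of_lt_of_le (by positivity) hZ
  have hZW : Z ≤ (2 * w + 2 : ℕ) := by
    have := Finset.sum_le_sum fun y (_ : y ∈ Finset.range (2 * w + 2)) =>
      (accProb_mem (w := w) (c := c) hd hr0 y).2
    simpa using this
  set κ := 1 - Z / (2 * w + 2 : ℕ) with hκ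
  have hκ0 : 0 ≤ κ := by rw [hκ, sub_nonneg, div_le_one hW]; exact hZW
  set n := 48 * (d * d) with hn
  -- An attempt succeeds with probability at least `1/(8d)`, so `48d²` of them all fail with
  -- probability at most `exp(-6d)`, which is below `1/(4d)`.
  have hκn : κ ^ n ≤ 1 / (4 * d) := by
    have h1 : κ ≤ 1 - 1 / (8 * d) := by
      rw [hκ]
      have : 1 / (8 * (d : ℝ)) ≤ Z / (2 * w + 2 : ℕ) := by
        rw [le_div_iff₀ hW]
        calc _ = ((2 * w + 2 : ℕ) : ℝ) / (8 * d) := by ring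
          _ ≤ Z := hZ
      linarith
    have h2 : κ ≤ Real.exp (-(1 / (8 * d))) := by
      have := Real.add_one_le_exp (-(1 / (8 * (d : ℝ)))); linarith
    have h3 : κ ^ n ≤ Real.exp (-(6 * d)) := by
      refine (pow_le_pow_left₀ hκ0 h2 n).trans (le_of_eq ?_)
      rw [← Real.exp_nat_mul, hn]
      congr 1
      push_cast
      field_simp
      norm_num
    refine h3.trans ?_
    rw [Real.exp_neg, ← one_div]
    have := Real.add_one_le_exp (6 * (d : ℝ))
    exact one_div_le_one_div_of_le (by positivity) (by linarith)
  rw [rejWeight_eq hd hr0, ← hZd, ← hκ, ← ENNReal.ofReal_natCast, ← ENNReal.ofReal_inv_of_pos hW,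
    Finset.sum_congr rfl fun j _ => by rw [← ENNReal.ofReal_pow hκ0],
    ← ENNReal.ofReal_sum_of_nonneg fun j _ => pow_nonneg hκ0 j,
    ← ENNReal.ofReal_mul (by positivity)]
  refine ENNReal.ofReal_le_ofReal ?_
  have hg : (1 - κ) * ∑ j ∈ Finset.range n, κ ^ j = 1 - κ ^ n := mul_neg_geom_sum κ n
  have e : ∑ j ∈ Finset.range n, κ ^ j = (1 - κ ^ n) * ((2 * w + 2 : ℕ) : ℝ) / Z := by
    rw [← hg, hκ]
    field_simp
    ring
  rw [e]
  calc (1 - 1 / (4 * (d : ℝ))) / Z ≤ (1 - κ ^ n) / Z := by gcongr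
    _ = _ := by field_simp

/-- The left side of the product is at least three quarters of the volume `V`. Each coordinate
contributes about `s = √(a/π)`, the reciprocal of the Gaussian integral, and `V * s^d * d * θ ≥ 1/4`
by the Stirling bound. The further losses are at most the factors `3/4` and `95/96`, which leaves
more than `1/(16d)`. -/
theorem le_card_mul_trialWeight (hd : 1 ≤ d) (p : EuclideanSpace ℝ (Fin d)) {β : ℝ} (hβ : 0 < β)
    (hβ1 : β < 1) (hr : 2 * (d : ℝ) * Real.sqrt d / β < r) (hw : w = ⌈r⌉₊) (c : ℕ → ℝ) :
    ENNReal.ofReal (1 / (16 * d)) ≤ (latticeBall p r).ncard * trialWeight d w r c := by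
  have hd' : (1 : ℝ) ≤ d := by exact_mod_cast hd
  have hpi := Real.pi_pos
  have hr2 : 2 * (d : ℝ) ≤ r := by
    have h1 := two_lt_of_large hβ hβ1 hr
    have h2 := one_le_sqrt_of_one_le hd
    nlinarith
  have hr0 : 0 < r := by linarith
  set a := (d : ℝ) / (2 * r ^ 2) with ha
  have ha0 : 0 < a := by positivity
  -- This is `d² / (2r²) ≤ 1/8`, from `r ≥ 2d`; it makes the error factor `(1 - a/12)^d` harmless.
  have had : d * a ≤ 1 / 8 := by
    rw [ha, mul_div_assoc', div_le_div_iff₀ (by positivity) (by norm_num)]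
    nlinarith
  have ha1 : a ≤ 1 / 8 := by nlinarith
  set s := Real.sqrt (a / Real.pi) with hs
  have hs0 : 0 < s := Real.sqrt_pos.2 (by positivity)
  set Lf := (1 - 1 / (4 * (d : ℝ))) * (1 - a / 12) * s with hLf
  have h4d : 1 / (4 * (d : ℝ)) ≤ 1 / 4 := by
    rw [div_le_div_iff₀ (by positivity) (by norm_num)]; linarith
  have hLf0 : 0 ≤ Lf := mul_nonneg (mul_nonneg (by linarith) (by linarith)) hs0.le
  have hfac : ∀ k ∈ Finset.range d, ENNReal.ofReal Lf ≤ ((2 * w + 2 : ℕ) : ℝ≥0∞)⁻¹ *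
      ∑ j ∈ Finset.range (48 * (d * d)), rejWeight d w r (c k) ^ j := by
    intro k _
    refine le_trans (ENNReal.ofReal_le_ofReal ?_) (le_inv_mul_sum_rejWeight hd hr2 hw)
    have hZ0 : 0 < ∑ y ∈ Finset.range (2 * w + 2), accProb d w r (c k) y :=
      lt_of_lt_of_le (by positivity) (le_sum_accProb (c := c k) hd hr2 hw)
    have hZ := one_sub_mul_sum_accProb_le (w := w) (c := c k) hd hr0 (by rw [← ha]; linarith)
    rw [← ha] at hZ
    have hss : s * Real.sqrt (Real.pi / a) = 1 := by
      rw [hs, ← Real.sqrt_mul (by positivity), show a / Real.pi * (Real.pi / a) = 1 by field_simp,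
        Real.sqrt_one]
    rw [le_div_iff₀ hZ0, hLf]
    calc _ = (1 - 1 / (4 * (d : ℝ))) * (s * ((1 - a / 12) *
          ∑ y ∈ Finset.range (2 * w + 2), accProb d w r (c k) y)) := by ring
      _ ≤ (1 - 1 / (4 * (d : ℝ))) * (s * Real.sqrt (Real.pi / a)) := by
          refine mul_le_mul_of_nonneg_left (mul_le_mul_of_nonneg_left hZ hs0.le) (by linarith)
      _ = _ := by rw [hss, mul_one]
  set θ := (1 - 1 / (2 * (d : ℝ))) ^ (d * d) with hθ
  have hθ0 : 0 < θ := pow_pos (one_sub_half_pos hd) _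
  have htw : ENNReal.ofReal (Lf ^ d * θ) ≤ trialWeight d w r c := by
    rw [trialWeight, ENNReal.ofReal_mul (by positivity), ENNReal.ofReal_pow hLf0]
    refine mul_le_mul_left ?_ _
    calc _ = ∏ _k ∈ Finset.range d, ENNReal.ofReal Lf := by simp
      _ ≤ _ := Finset.prod_le_prod' hfac
  refine le_trans ?_ (mul_le_mul_right htw _)
  rw [← ENNReal.ofReal_natCast, ← ENNReal.ofReal_mul (Nat.cast_nonneg _)]
  refine ENNReal.ofReal_le_ofReal ?_
  set V := ballVol d r with hV
  have hV0 : 0 < V := ballVol_pos d hr0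
  have hA : V * (3 / 4) ≤ ((latticeBall p r).ncard : ℝ) := by
    refine le_trans ?_ (ballVol_mul_le_ncard hd p hβ hβ1 hr)
    gcongr
    linarith
  have h1 : (3 / 4 : ℝ) ≤ (1 - 1 / (4 * (d : ℝ))) ^ d := by
    have := one_add_mul_le_pow (a := -(1 / (4 * (d : ℝ)))) (by linarith) d
    rw [← sub_eq_add_neg] at this
    refine le_trans (le_of_eq ?_) this
    field_simp
    norm_num
  have h2 : (95 / 96 : ℝ) ≤ (1 - a / 12) ^ d := by
    have := one_add_mul_le_pow (a := -(a / 12)) (by linarith) d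
    rw [← sub_eq_add_neg] at this
    linarith
  -- Squaring brings in `exp_mul_le_ballVol_sq`: the factors `e^d` and `e^(-d)` cancel, and `1/(5e)
  -- ≥ 1/16` remains.
  have h3 : (1 / 4 : ℝ) ≤ V * s ^ d * d * θ := by
    have g1 := exp_mul_le_ballVol_sq hr0 d hd
    have g2 := exp_neg_le_pow d hd
    have g3 : s ^ 2 = d / (2 * Real.pi * r ^ 2) := by
      rw [hs, Real.sq_sqrt (by positivity), ha]; field_simp
    refine (pow_le_pow_iff_left₀ (by norm_num) (by positivity) two_ne_zero).1 ?_
    have e1 : (V * s ^ d * d * θ) ^ 2 = (V ^ 2 * (d / (2 * Real.pi * r ^ 2)) ^ d * d ^ 2) * θ ^ 2 := by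
      rw [← g3]; ring
    have e2 : Real.exp (-(d / 2 + 1 / 2)) ^ 2 = Real.exp (-d) * Real.exp (-1) := by
      rw [← Real.exp_nat_mul, ← Real.exp_add]; congr 1; push_cast; ring
    have e3 : 5 / 16 ≤ Real.exp (-1) := by
      rw [Real.exp_neg, show (5 / 16 : ℝ) = (16 / 5 : ℝ)⁻¹ by norm_num]
      exact inv_anti₀ (Real.exp_pos _) (by linarith [Real.exp_one_lt_d9])
    calc (1 / 4 : ℝ) ^ 2 = 1 / 5 * (5 / 16) := by norm_num
      _ ≤ 1 / 5 * Real.exp (-1) := by gcongr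
      _ = (1 / 5 * Real.exp d) * (Real.exp (-d) * Real.exp (-1)) := by
          rw [Real.exp_neg (d : ℝ)]; field_simp
      _ = (1 / 5 * Real.exp d) * Real.exp (-(d / 2 + 1 / 2)) ^ 2 := by rw [e2]
      _ ≤ (V ^ 2 * (d / (2 * Real.pi * r ^ 2)) ^ d * d ^ 2) * θ ^ 2 := by
          gcongr
      _ = _ := e1.symm
  calc 1 / (16 * (d : ℝ)) ≤ (1 / 4) * (3 / 4) * (3 / 4) * (95 / 96) / d := by
        rw [div_le_div_iff₀ (by positivity) (by positivity)]; linarith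
    _ ≤ (V * s ^ d * d * θ) * (3 / 4) * (1 - 1 / (4 * (d : ℝ))) ^ d * (1 - a / 12) ^ d / d := by
        gcongr
    _ = (V * (3 / 4)) * (Lf ^ d * θ) := by
        rw [hLf, mul_pow, mul_pow]; field_simp
    _ ≤ _ := by gcongr

end RandRAM


namespace RandRAM
open Term

variable {X : Type} {m : ℕ} {L : SetList X m}

/-! ## Sampling from large balls -/

open Classical in
-- If only elements of `A` or `none` can be observed and all elements of `A` have the same
-- probability `δ`, the law of the observation is determined; the remaining mass `κ` sits at `none`.
theorem Pr.option {β : Type*} {c : Cmd} {M : Memory} {T : ℕ} {Q : Memory → Prop}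
    {o : Memory → Option β} (A : Finset β) {δ : ℝ≥0∞}
    (h : Pr L c M T Q (fun (z : A) M' => if o M' = some z.1 then (1 : ℝ≥0∞) else 0) fun _ => δ)
    (hQ : ∀ M', Q M' → o M' = none ∨ ∃ z ∈ A, o M' = some z) :
    ∃ κ : ℝ≥0∞, A.card * δ + κ = 1 ∧ Pr L c M T Q (fun (φ : Option β → ℝ≥0∞) M' => φ (o M'))
      fun φ => δ * ∑ z ∈ A, φ (some z) + κ * φ none := by
  obtain ⟨μ, hr, hμ, hf⟩ := h
  have hsum : ∀ φ : Option β → ℝ≥0∞, μ.ev (fun M' => φ (o M')) = δ * ∑ z ∈ A, φ (some z) +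
      μ.ev (fun M' => if o M' = none then 1 else 0) * φ none := by
    intro φ
    rw [Finset.mul_sum, ← PMF.ev_mul_const]
    have : ∀ z ∈ A, δ * φ (some z) =
        μ.ev fun M' => (if o M' = some z then 1 else 0) * φ (some z) := by
      intro z hz
      rw [PMF.ev_mul_const]
      exact congrArg (· * φ (some z)) (hf ⟨z, hz⟩).symm
    rw [Finset.sum_congr rfl this, ← PMF.ev_sum, ← PMF.ev_add]
    refine PMF.ev_congr fun M' hM' => ?_
    rcases hQ M' (hμ M' hM') with h | ⟨z, hz, h⟩
    · simp [h]
    · simp [h, hz]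
  refine ⟨_, ?_, μ, hr, hμ, hsum⟩
  have := hsum fun _ => 1
  simpa [mul_comm] using this.symm

/-- Repeats the attempts to find a lattice point until a failure is unlikely enough. -/
def attemptsCmd : Cmd :=
  .loop (var 57) (var 56)
    (.ite 1 (var 54) .skip trialCmd ;; .put 56 (var 56 * (1 - 1 / (16 * var 2))))

/-- The sampling program for large balls. -/
def largeSampleCmd : Cmd :=
  .put 7 (0 - Term.floor (0 - var 3)) ;; .put 56 1 ;;
  .forUp 58 (var 2) (.put 56 (var 56 * (2 * var 3 + 1))) ;; .put 54 0 ;; attemptsCmd ;;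
  .ite 1 (var 54)
    (.forUp 32 (var 2) (.set 0 (var 32) (.read 53 (var 32))))
    (.forUp 32 (var 2) (.set 0 (var 32) (Term.floor (.read 1 (var 32) + 1 / 2))))

theorem TrialState.trialObs {d : ℕ} {p : EuclideanSpace ℝ (Fin d)} {r : ℝ} {M : Memory}
    (h : TrialState p r M) : (M 54 0 = 0 ∧ trialObs d M = none) ∨
      (M 54 0 = 1 ∧ ∃ z ∈ latticeBall p r, trialObs d M = some z ∧ ∀ k : Fin d, M 53 k = z k) := by
  rcases h with h | ⟨h, z, hz, hk⟩
  · exact Or.inl ⟨h, by simp [RandRAM.trialObs, h]⟩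
  · refine Or.inr ⟨h, z, hz, ?_, hk⟩
    simp [RandRAM.trialObs, h, hk]

/-- The time of one attempt. -/
def trialTime (d : ℕ) : ℕ := d * (48 * (d * d) * (3 * (d * d) + 12) + 10) + 3 * (d * d) + 12

theorem pr_trialCmd {d w : ℕ} {p : EuclideanSpace ℝ (Fin d)} {r : ℝ} (hd : 1 ≤ d)
    (hr : 0 < r) (hw : w = ⌈r⌉₊) {A : Finset (Fin d → ℤ)} (hA : (A : Set (Fin d → ℤ)) = latticeBall p r) :
    ∃ κ : ℝ≥0∞, A.card * trialWeight d w r (coords fun k => p k) + κ = 1 ∧ ∀ M : Memory,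
      M 1 = coords (fun k => p k) → M 2 0 = d → M 3 0 = r → M 7 0 = w → M 54 0 = 0 →
      Pr L trialCmd M (trialTime d) (TrialState p r)
        (fun (φ : Option (Fin d → ℤ) → ℝ≥0∞) M' => φ (trialObs d M'))
        fun φ => trialWeight d w r (coords fun k => p k) * ∑ z ∈ A, φ (some z) + κ * φ none := by
  classical
  set δ := trialWeight d w r (coords fun k => p k) with hδ
  have key : ∀ M : Memory,
      M 1 = coords (fun k => p k) → M 2 0 = d → M 3 0 = r → M 7 0 = w → M 54 0 = 0 →
      ∃ κ : ℝ≥0∞, A.card * δ + κ = 1 ∧ Pr L trialCmd M (trialTime d) (TrialState p r)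
        (fun (φ : Option (Fin d → ℤ) → ℝ≥0∞) M' => φ (trialObs d M'))
        fun φ => δ * ∑ z ∈ A, φ (some z) + κ * φ none := by
    intro M h1 h2 h3 h7 h54
    refine Pr.option A ((pr_trialCmd_aux hd hr hw h1 h2 h3 h7 h54).mono
      (fun z => ⟨z.1, hA ▸ z.2⟩) (fun M' h => ⟨h, fun z => by congr⟩) fun z => rfl) fun M' h => ?_
    rcases h.trialObs with h | ⟨-, z, hz, h, -⟩
    · exact Or.inl h.2
    · exact Or.inr ⟨z, by rw [← Finset.mem_coe, hA]; exact hz, h⟩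
  refine ⟨1 - A.card * δ, ?_, fun M h1 h2 h3 h7 h54 => ?_⟩
  -- Applying `key` to one concrete memory shows `|A| δ ≤ 1`, so the truncated subtraction is exact
  -- and `κ` can be chosen independently of the memory.
  · obtain ⟨κ, hκ, -⟩ := key (fun a i => if a = 1 then coords (fun k => p k) i else
      if a = 2 then d else if a = 3 then r else if a = 7 then w else 0) (by funext; simp) (by simp)
      (by simp) (by simp) (by simp)
    exact add_tsub_cancel_of_le (by rw [← hκ]; exact le_self_add)
  · obtain ⟨κ, hκ, h⟩ := key M h1 h2 h3 h7 h54
    have hfin : A.card * δ ≠ ∞ := by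
      intro h; rw [h] at hκ; simp at hκ
    rw [← hκ, ENNReal.add_sub_cancel_left hfin]
    exact h

/-- Variable `56` runs through `B (1 - 1/(16d))^j` until it drops below `α`. So the number `K` of
attempts is found without logarithms. -/
theorem pr_attemptsCmd {M : Memory} {d w K : ℕ} {p : EuclideanSpace ℝ (Fin d)} {r B α : ℝ}
    (hd : 1 ≤ d) {A : Finset (Fin d → ℤ)} {δ κ : ℝ≥0∞}
    (htr : ∀ M : Memory,
      M 1 = coords (fun k => p k) → M 2 0 = d → M 3 0 = r → M 7 0 = w → M 54 0 = 0 →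
      Pr L trialCmd M (trialTime d) (TrialState p r)
        (fun (φ : Option (Fin d → ℤ) → ℝ≥0∞) M' => φ (trialObs d M'))
        fun φ => δ * ∑ z ∈ A, φ (some z) + κ * φ none)
    (hK : B * (1 - 1 / (16 * d)) ^ K < α) (hK' : ∀ j < K, α ≤ B * (1 - 1 / (16 * d)) ^ j)
    (h1 : M 1 = coords fun k => p k) (h2 : M 2 0 = d) (h3 : M 3 0 = r)
    (h7 : M 7 0 = w) (h54 : M 54 0 = 0) (h57 : M 57 0 = α) (h56 : M 56 0 = B) :
    Pr L attemptsCmd M (K * (trialTime d + 3) + 1) (TrialState p r)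
        (fun (φ : Option (Fin d → ℤ) → ℝ≥0∞) M' => φ (trialObs d M'))
        fun φ => retry (δ * ∑ z ∈ A, φ (some z)) κ K (φ none) := by
  have _ := hd
  have hobs : ∀ M'' : Memory, ∀ x, trialObs d (M''.write 56 0 x) = trialObs d M'' := by
    intro M'' x; simp [trialObs, Memory.write_ne]
  have hts : ∀ M'' : Memory, ∀ x, TrialState p r M'' → TrialState p r (M''.write 56 0 x) := by
    intro M'' x; simp [TrialState, Memory.write_ne]
  refine Pr.le (Pr.loop (T := trialTime d + 1 + 1) (fun k M' => k ≤ K ∧ TrialState p r M' ∧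
      M' 1 = coords (fun k => p k) ∧ M' 2 0 = d ∧ M' 3 0 = r ∧ M' 7 0 = w ∧ M' 57 0 = α ∧
      M' 56 0 = B * (1 - 1 / (16 * d)) ^ (K - k))
    (fun k φ M' => (trialObs d M').elim (retry (δ * ∑ z ∈ A, φ (some z)) κ k (φ none))
      fun z => φ (some z)) ?_ ?_ ?_ K ?_ ?_) (?_ : K * ((trialTime d + 1 + 1) + 1) + 1 ≤ _)
  · rintro M' ⟨-, -, -, -, -, -, h57, h56⟩
    simpa [h57, h56] using hK
  · rintro k M' ⟨hk, hts', h1, h2, h3, h7, h57, h56⟩ -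
    have hstep : ∀ M'' : Memory, M'' 2 = M' 2 → M'' 56 = M' 56 →
        (var 56 * (1 - 1 / (16 * var 2))).eval M'' = B * (1 - 1 / (16 * d)) ^ (K - k) := by
      intro M'' e2 e56
      have e : K - k = (K - (k + 1)) + 1 := by omega
      simp [e2, e56, h2, h56]
      rw [e, pow_succ, mul_assoc]
    rcases hts'.trialObs with ⟨h54, ho⟩ | ⟨h54, z, hz, ho, -⟩
    · refine Pr.seq (T₁ := trialTime d + 1) (T₂ := 1) (Pr.ite (fun h => ?_) fun _ =>
        (htr M' h1 h2 h3 h7 h54).frame.mono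
        (fun φ o => o.elim (retry (δ * ∑ z ∈ A, φ (some z)) κ k (φ none)) fun z => φ (some z))
        (fun M'' h => ⟨h, fun φ => rfl⟩) fun φ => ?_) ?_
      · simp [h54] at h; linarith
      · rw [ho]; simp only [Option.elim]; rw [retry_succ]
      · rintro M'' ⟨hts'', hf⟩
        refine Pr.of_ev (Ev.put ?_)
        rw [hstep M'' (hf 2 (by decide)) (hf 56 (by decide))]
        refine ⟨⟨by omega, hts _ _ hts'', ?_, ?_, ?_, ?_, ?_, by simp⟩, fun φ => by rw [hobs]⟩
        · rw [Memory.write_ne _ _ _ (by decide), hf 1 (by decide), h1]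
        · rw [Memory.write_ne _ _ _ (by decide), hf 2 (by decide), h2]
        · rw [Memory.write_ne _ _ _ (by decide), hf 3 (by decide), h3]
        · rw [Memory.write_ne _ _ _ (by decide), hf 7 (by decide), h7]
        · rw [Memory.write_ne _ _ _ (by decide), hf 57 (by decide), h57]
    · refine Pr.le (Pr.of_ev (Ev.seq (T₁ := 2) (T₂ := 1) (Ev.ite (fun _ => Ev.skip (Ev.put ?_)) fun h => ?_)))
        (by rw [trialTime]; omega)
      · rw [hstep M' rfl rfl]
        refine ⟨⟨by omega, hts _ _ hts', ?_, ?_, ?_, ?_, ?_, by simp⟩, fun φ => by rw [hobs, ho]; rfl⟩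
        all_goals rw [Memory.write_ne _ _ _ (by decide)]; assumption
      · simp [h54] at h
  · rintro k M' ⟨hk, hts', -, -, -, -, h57, h56⟩ hlt
    refine ⟨hts', fun φ => ?_⟩
    simp only [eval_var, h57, h56] at hlt
    obtain rfl : k = 0 := by
      by_contra hne
      exact absurd hlt (not_lt.2 (hK' (K - k) (by omega)))
    rw [retry_zero]
    cases trialObs d M' <;> rfl
  · exact ⟨le_rfl, Or.inl h54, h1, h2, h3, h7, h57, by simpa using h56⟩
  · intro φ
    simp [trialObs, h54]
  · exact le_of_eq (by ring)

/-- The rounded centre is the output when all attempts fail; that it belongs to the ball keeps the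
support of the generator inside the ball. -/
theorem round_mem_latticeBall {d : ℕ} (p : EuclideanSpace ℝ (Fin d)) {r : ℝ} (hr0 : 0 < r)
    (hr : Real.sqrt d / 2 ≤ r) : (fun k => round (p k)) ∈ latticeBall p r := by
  rw [mem_latticeBall p hr0]
  calc ∑ k, ((round (p k) : ℝ) - p k) ^ 2 ≤ ∑ _k : Fin d, (1 / 4 : ℝ) := by
        refine Finset.sum_le_sum fun k _ => ?_
        have h := abs_sub_round (p k)
        rw [abs_sub_comm] at h
        have h' := abs_le.1 h
        nlinarith
    _ = (Real.sqrt d / 2) ^ 2 := by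
        rw [div_pow, Real.sq_sqrt (Nat.cast_nonneg _)]; simp; ring
    _ ≤ r ^ 2 := pow_le_pow_left₀ (by positivity) hr 2

theorem pr_largeSampleCmd {M : Memory} {d K : ℕ} {p : EuclideanSpace ℝ (Fin d)} {r α : ℝ}
    (hd : 1 ≤ d) (hr : 0 < r) {A : Finset (Fin d → ℤ)} (hA : (A : Set (Fin d → ℤ)) = latticeBall p r)
    (hK : (2 * r + 1) ^ d * (1 - 1 / (16 * (d : ℝ))) ^ K < α)
    (hK' : ∀ j < K, α ≤ (2 * r + 1) ^ d * (1 - 1 / (16 * (d : ℝ))) ^ j)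
    (h1 : M 1 = coords fun k => p k) (h2 : M 2 0 = d) (h3 : M 3 0 = r) (h57 : M 57 0 = α) :
    ∃ κ : ℝ≥0∞, A.card * trialWeight d ⌈r⌉₊ r (coords fun k => p k) + κ = 1 ∧
      Pr L largeSampleCmd M (K * (trialTime d + 3) + 6 * d + 9)
        (fun M' => ∀ k < d, ∃ z : ℤ, M' 0 k = z) outInd
        fun z => open Classical in retry (trialWeight d ⌈r⌉₊ r (coords fun k => p k) *
          ∑ z' ∈ A, if z' = z then 1 else 0) κ K (if (fun k => round (p k)) = z then 1 else 0) := by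
  classical
  obtain ⟨κ, hκ, htr⟩ := pr_trialCmd (L := L) hd hr rfl hA
  refine ⟨κ, hκ, Pr.le (Pr.seq_ev (Ev.put (Pr.seq_ev (Ev.put (Pr.seq_ev ((Ev.forUp d (T := 1)
    (fun k M' => M' 56 0 = (2 * r + 1) ^ k) (by decide) ?_ ?_ ?_ (fun _ _ _ h => h)).frame.mono ?_))))))
    (?_ : 1 + (1 + ((d * (1 + 2) + 2) + (1 + ((K * (trialTime d + 3) + 1) +
      ((d * (1 + 2) + 2) + 1))))) ≤ _)⟩
  · simp [Memory.write_ne]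
  · intro M' hf
    simp [hf 2 (by decide) (by decide), Memory.write_ne, h2]
  · intro k hk M' hk' hf hI
    have g3 := hf 3 (by decide) (by decide)
    simp [Memory.write_ne] at g3
    refine Ev.put ?_
    simp [Memory.write_ne, hI, g3, h3, pow_succ]
  · rintro M₁ ⟨h56, hf⟩
    have g1 := hf 1 (by decide)
    have g2 := hf 2 (by decide)
    have g3 := hf 3 (by decide)
    have g7 := hf 7 (by decide)
    have g57 := hf 57 (by decide)
    simp [Memory.write_ne, -zero_sub] at g1 g2 g3 g7 g57
    rw [h3, neg_floor_neg hr] at g7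
    refine Pr.seq_ev (Ev.put (Pr.seq ((pr_attemptsCmd (w := ⌈r⌉₊) (α := α) hd htr hK hK' ?_ ?_ ?_ ?_ ?_ ?_
      ?_).frame.mono (fun z o => if (o.getD fun k => round (p k)) = z then 1 else 0)
      (fun M' h => ⟨h, fun z => rfl⟩) fun z => by simp only [Option.getD]) ?_))
    · simp [Memory.write_ne, g1, h1]
    · simp [Memory.write_ne, g2, h2]
    · simp [Memory.write_ne, g3, h3]
    · simp [Memory.write_ne, g7]
    · simp
    · simp [Memory.write_ne, g57, h57]
    · simp [Memory.write_ne, h56]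
    · rintro M₂ ⟨hts, hf'⟩
      have q1 := hf' 1 (by decide)
      have q2 := hf' 2 (by decide)
      simp [Memory.write_ne, g1, g2, h1] at q1 q2
      refine Pr.of_ev (Ev.ite (fun h => ?_) fun h => ?_)
      · rcases hts.trialObs with ⟨h54, -⟩ | ⟨h54, z, hz, ho, hk⟩
        · simp [h54] at h; linarith
        · refine Ev.forUp d (T := 1) (fun k M' => ∀ i < k, M' 0 i = zcoords z i) (by decide) ?_ ?_ ?_ ?_
          · simp
          · intro M' hf
            simp [hf 2 (by decide) (by decide), q2, h2]
          · intro k hk' M' hk'' hf hI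
            refine Ev.set ?_
            intro i hi
            have e : M' 53 k = zcoords z k := by
              rw [hf 53 (by decide) (by decide), hk ⟨k, hk'⟩, zcoords, dif_pos hk']
            simp [Memory.write_ne, Memory.write_self, Term.nat, hk'', e]
            split_ifs with hik
            · rw [hik]
            · exact hI i (by omega)
          · intro M' _ _ hI
            refine ⟨fun k hk => ⟨_, hI k hk⟩, fun z' => ?_⟩
            rw [ho, outInd]
            congr 1
            simp only [Option.getD, funext_iff, eq_iff_iff]
            refine forall_congr' fun k => ?_
            rw [hI k k.2, zcoords_val]
            norm_cast
      · rcases hts.trialObs with ⟨h54, ho⟩ | ⟨h54, -⟩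
        · refine Ev.forUp d (T := 1) (fun k M' => ∀ i < k, M' 0 i = (round (coords (fun k => p k) i) : ℤ))
            (by decide) ?_ ?_ ?_ ?_
          · simp
          · intro M' hf
            simp [hf 2 (by decide) (by decide), q2, h2]
          · intro k hk' M' hk'' hf hI
            have e1 := hf 1 (by decide) (by decide)
            refine Ev.set ?_
            intro i hi
            simp [Memory.write_ne, Memory.write_self, Term.nat, hk'', e1, q1, round_eq]
            simp only [round_eq, one_div] at hI
            split_ifs with hik
            · rw [hik]
            · exact hI i (by omega)
          · intro M' _ _ hI
            refine ⟨fun k hk => ⟨_, hI k hk⟩, fun z' => ?_⟩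
            rw [ho, outInd]
            congr 1
            simp only [Option.getD, funext_iff, eq_iff_iff]
            refine forall_congr' fun k => ?_
            rw [hI k k.2, coords_val]
            norm_cast
        · simp [h54] at h
  · omega

/-- Since `n δ = 1 - κ`, the geometric sum gives each of the `n` points the probability `(1 - κ^K) /
n`. The fallback adds at most `κ^K`, which is at most `α / n` by `hK`. -/
theorem retry_bounds {n K : ℕ} (hn : 0 < n) {δ κ : ℝ≥0∞} (h : n * δ + κ = 1) {α : ℝ} (hα : 0 < α)
    (hK : κ ^ K * n ≤ ENNReal.ofReal α) (b : ℝ≥0∞) (hb : b ≤ 1) :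
    (1 - α) / n ≤ (retry δ κ K b).toReal ∧ (retry δ κ K b).toReal ≤ (1 + α) / n := by
  have hn' : (0 : ℝ) < n := by exact_mod_cast hn
  have hn1 : (1 : ℝ) ≤ n := by exact_mod_cast hn
  have hκ1 : κ ≤ 1 := by rw [← h]; exact le_add_self
  have hδ1 : δ ≤ 1 := by
    rw [← h]
    refine le_trans ?_ le_self_add
    exact le_mul_of_one_le_left' (by exact_mod_cast hn)
  have hκ : κ ≠ ∞ := (hκ1.trans_lt ENNReal.one_lt_top).ne
  have hδ : δ ≠ ∞ := (hδ1.trans_lt ENNReal.one_lt_top).ne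
  have hbf : b ≠ ∞ := (hb.trans_lt ENNReal.one_lt_top).ne
  have h' : (n : ℝ) * δ.toReal + κ.toReal = 1 := by
    have := congrArg ENNReal.toReal h
    rwa [ENNReal.toReal_add (ENNReal.mul_ne_top (by simp) hδ) hκ, ENNReal.toReal_mul,
      ENNReal.toReal_natCast, ENNReal.toReal_one] at this
  have hK' : κ.toReal ^ K * n ≤ α := by
    have := ENNReal.toReal_mono ENNReal.ofReal_ne_top hK
    rwa [ENNReal.toReal_mul, ENNReal.toReal_pow, ENNReal.toReal_natCast,
      ENNReal.toReal_ofReal hα.le] at this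
  have hv : (retry δ κ K b).toReal = δ.toReal * ∑ j ∈ Finset.range K, κ.toReal ^ j +
      κ.toReal ^ K * b.toReal := by
    rw [retry, ENNReal.toReal_add, ENNReal.toReal_mul, ENNReal.toReal_sum, ENNReal.toReal_mul,
      ENNReal.toReal_pow]
    · simp
    · intro j _; exact ENNReal.pow_ne_top hκ
    · exact ENNReal.mul_ne_top hδ (ENNReal.sum_ne_top.2 fun j _ => ENNReal.pow_ne_top hκ)
    · exact ENNReal.mul_ne_top (ENNReal.pow_ne_top hκ) hbf
  have hg : (1 - κ.toReal) * ∑ j ∈ Finset.range K, κ.toReal ^ j = 1 - κ.toReal ^ K :=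
    mul_neg_geom_sum _ K
  have hδn : δ.toReal * ∑ j ∈ Finset.range K, κ.toReal ^ j = (1 - κ.toReal ^ K) / n := by
    rw [← hg, ← h']; field_simp; ring
  have hb0 : 0 ≤ b.toReal := ENNReal.toReal_nonneg
  have hb1 : b.toReal ≤ 1 := by
    have := ENNReal.toReal_mono ENNReal.one_ne_top hb; simpa using this
  have hp0 : 0 ≤ κ.toReal ^ K := pow_nonneg ENNReal.toReal_nonneg K
  have hpa : κ.toReal ^ K ≤ α := le_trans (le_mul_of_one_le_right hp0 hn1) hK'
  rw [hv, hδn]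
  constructor
  · refine le_trans ?_ (le_add_of_nonneg_right (mul_nonneg hp0 hb0))
    gcongr
  · have : κ.toReal ^ K * b.toReal ≤ κ.toReal ^ K * n / n := by
      rw [mul_div_assoc, div_self hn'.ne']
      gcongr
    refine (add_le_add_right this _).trans ?_
    rw [← add_div]
    gcongr
    linarith

/-- `K` is the first exponent that works. Taking logarithms at the exponent before it, with `-log α
≤ 1/α`, bounds `K`. -/
theorem exists_attempts {d : ℕ} (hd : 1 ≤ d) {r α : ℝ} (hr : 0 < r) (hα : 0 < α) :
    ∃ K : ℕ, (2 * r + 1) ^ d * (1 - 1 / (16 * (d : ℝ))) ^ K < α ∧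
      (∀ j < K, α ≤ (2 * r + 1) ^ d * (1 - 1 / (16 * (d : ℝ))) ^ j) ∧
      (K : ℝ) ≤ 1 + 16 * d * (d * (1 + Real.log (2 + r)) + 1 / α) := by
  have hd' : (1 : ℝ) ≤ d := by exact_mod_cast hd
  have hB : 0 < (2 * r + 1) ^ d := by positivity
  have h16 : 1 / (16 * (d : ℝ)) ≤ 1 / 16 := by
    rw [div_le_div_iff₀ (by positivity) (by norm_num)]; linarith
  have h16' : 0 < 1 / (16 * (d : ℝ)) := by positivity
  have hex : ∃ K : ℕ, (2 * r + 1) ^ d * (1 - 1 / (16 * (d : ℝ))) ^ K < α := by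
    obtain ⟨K, hK⟩ := exists_pow_lt_of_lt_one (div_pos hα hB)
      (by linarith : 1 - 1 / (16 * (d : ℝ)) < 1)
    exact ⟨K, by rw [mul_comm]; rwa [lt_div_iff₀ hB] at hK⟩
  classical
  refine ⟨Nat.find hex, Nat.find_spec hex, fun j hj => not_lt.1 (Nat.find_min hex hj), ?_⟩
  rcases Nat.eq_zero_or_pos (Nat.find hex) with h0 | hpos
  · rw [h0, Nat.cast_zero]
    have := Real.log_nonneg (by linarith : (1 : ℝ) ≤ 2 + r)
    positivity
  · have hk := not_lt.1 (Nat.find_min hex (Nat.sub_lt hpos one_pos))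
    set k := Nat.find hex - 1 with hkd
    have hK : (Nat.find hex : ℝ) = k + 1 := by
      rw [hkd]; push_cast [Nat.cast_sub (show 1 ≤ Nat.find hex from hpos)]; ring
    have h1 : (1 - 1 / (16 * (d : ℝ))) ^ k ≤ Real.exp (-(k / (16 * d))) := by
      have h2 : 1 - 1 / (16 * (d : ℝ)) ≤ Real.exp (-(1 / (16 * d))) := by
        have := Real.add_one_le_exp (-(1 / (16 * (d : ℝ)))); linarith
      refine (pow_le_pow_left₀ (by linarith) h2 k).trans (le_of_eq ?_)
      rw [← Real.exp_nat_mul]; congr 1; ring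
    have h3 : α ≤ (2 * r + 1) ^ d * Real.exp (-(k / (16 * d))) := by
      refine hk.trans ?_; gcongr
    have h4 : Real.log α ≤ d * Real.log (2 * r + 1) - k / (16 * d) := by
      have := Real.log_le_log hα h3
      rwa [Real.log_mul hB.ne' (Real.exp_pos _).ne', Real.log_exp, Real.log_pow, ← sub_eq_add_neg] at this
    have h5 : Real.log (2 * r + 1) ≤ 1 + Real.log (2 + r) := by
      have h6 : Real.log (2 * r + 1) ≤ Real.log (2 * (2 + r)) :=
        Real.log_le_log (by positivity) (by linarith)
      rw [Real.log_mul (by norm_num) (by positivity)] at h6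
      linarith [Real.log_two_lt_d9]
    have h6 : -Real.log α ≤ 1 / α := by
      rw [← Real.log_inv, ← one_div]
      have := Real.log_le_sub_one_of_pos (one_div_pos.2 hα)
      linarith
    have h7 : (k : ℝ) / (16 * d) ≤ d * (1 + Real.log (2 + r)) + 1 / α := by
      have := mul_le_mul_of_nonneg_left h5 (by linarith : (0 : ℝ) ≤ d)
      linarith
    rw [div_le_iff₀ (by positivity)] at h7
    rw [hK]; linarith

/-! ## The sampling program -/

/-- Reads the input of the sampling program. -/
def sampleInputCmd : Cmd :=
  .put 2 (.read 0 0) ;; .put 3 (.read 0 1) ;; .put 4 (.read 0 2) ;; .put 57 (.read 0 3) ;;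
  .ite (.read 0 4) (var 57) (.put 57 (.read 0 4)) .skip

/-- The sampling program. -/
def sampleCmd : Cmd :=
  sampleInputCmd ;;
  .ite (var 3) (2 * var 2 * Term.sqrt (var 2) / var 4) smallSampleCmd largeSampleCmd

theorem ev_sampleInputCmd {d : ℕ} (x : Fin d → ℝ) (r β αL αR : ℝ) :
    Ev L sampleInputCmd (load [[(d : ℝ), r, β, αL, αR], List.ofFn x]) 6 fun M =>
      M 1 = coords x ∧ M 2 0 = d ∧ M 3 0 = r ∧ M 4 0 = β ∧ M 57 0 = min αL αR := by
  refine Ev.le (Ev.seq (Ev.put (Ev.seq (Ev.put (Ev.seq (Ev.put (Ev.seq (Ev.put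
    (Ev.ite (T := 1) (fun h => Ev.put ?_) fun h => Ev.skip ?_)))))))))
    (?_ : 1 + (1 + (1 + (1 + (1 + 1)))) ≤ _)
  · simp [Memory.write_ne] at h ⊢
    exact h
  · simp [Memory.write_ne] at h ⊢
    exact h.le
  · norm_num

theorem isBiasedGenerator_of_uniform {β : Type*} {A : Set β} {G : PMF β} {αL αR : ℝ}
    (hL : 0 < αL) (hR : 0 < αR)
    (h : A.Nonempty → ∀ z, G z = A.indicator (fun _ => (A.ncard : ℝ≥0∞)⁻¹) z) :
    IsBiasedGenerator αL αR A G := by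
  intro hne
  refine ⟨fun z hz => ?_, fun z hz => ?_⟩
  · by_contra hn
    rw [PMF.mem_support_iff, h hne, Set.indicator_of_notMem hn] at hz
    exact hz rfl
  · rw [h hne, Set.indicator_of_mem hz, ENNReal.toReal_inv, ENNReal.toReal_natCast, ← one_div]
    constructor <;> gcongr <;> linarith

theorem trialTime_le {d : ℕ} (hd : 1 ≤ d) : trialTime d + 3 ≤ 800 * d ^ 5 := by
  have h : ∀ k, k ≤ 5 → d ^ k ≤ d ^ 5 := fun k hk => Nat.pow_le_pow_right hd hk
  have e : trialTime d + 3 = 144 * d ^ 5 + 576 * d ^ 3 + 10 * d ^ 1 + 3 * d ^ 2 + 15 * d ^ 0 := by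
    rw [trialTime]; ring
  have := h 3 (by norm_num)
  have := h 2 (by norm_num)
  have := h 1 (by norm_num)
  have := h 0 (by norm_num)
  omega

theorem generates_sample {d : ℕ} (hd : 1 ≤ d) (p : EuclideanSpace ℝ (Fin d)) {r β lam l αL αR : ℝ}
    (hr : 0 < r) (hβ : 0 < β) (hβ1 : β < 1) (hL : αL ∈ Set.Ioo (0 : ℝ) 1) (hR : αR ∈ Set.Ioo (0 : ℝ) 1)
    (hp : 2 * (d : ℝ) * Real.sqrt d / β < r ∨ p ∈ centerSet lam d l) :
    ∃ (T : ℕ) (G : PMF (Fin d → ℤ)),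
      Generates sampleCmd [[(d : ℝ), r, β, αL, αR], List.ofFn fun k => p k] T G ∧
      ((T : ℝ) ≤ 6100020 * sizeBound d β l lam ^ 35 ∨
        (T : ℝ) ≤ (2 + 16 * d * (d * (1 + Real.log (2 + r)) + (1 / αL + 1 / αR))) * (800 * d ^ 5)) ∧
      IsBiasedGenerator αL αR (latticeBall p r) G := by
  classical
  have hd' : (1 : ℝ) ≤ d := by exact_mod_cast hd
  have hfin := latticeBall_finite p hr
  obtain ⟨M, hM, h1, h2, h3, h4, h57⟩ := ev_sampleInputCmd (L := noSets) (fun k => p k) r β αL αR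
  by_cases hbig : r ≤ 2 * (d : ℝ) * Real.sqrt d / β
  · set n := sizeBound d β l lam with hn
    have hdn : d ≤ n := by rw [hn, sizeBound]; omega
    have h1n : 1 ≤ n := hd.trans hdn
    obtain ⟨hw, D, hD, hDc⟩ := exists_boxVals_bound hd p hβ hbig (hp.resolve_left (not_lt.2 hbig))
    obtain ⟨v, hv, hv'⟩ := pr_smallSampleCmd (L := noSets) hr h1 h2 h3 hD h1n hdn hw hDc
    obtain ⟨G, hG, hGv⟩ := Generates.of_pr (c := sampleCmd)
      (Pr.seq_ev ⟨M, hM, Pr.ite (fun _ => hv) fun h => absurd h (not_lt.2 (by simpa [h2, h3, h4]))⟩)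
    refine ⟨_, G, hG, Or.inl ?_, isBiasedGenerator_of_uniform hL.1 hR.1 fun hne z => by rw [hGv, hv' hne]⟩
    have : 1 ≤ n ^ 35 := Nat.one_le_pow _ _ h1n
    have : 6 + (6100000 * n ^ 35 + 1) ≤ 6100020 * n ^ 35 := by omega
    exact_mod_cast this
  · have hlarge := not_le.1 hbig
    set α := min αL αR with hα
    have hα0 : 0 < α := lt_min hL.1 hR.1
    have hr2 := two_lt_of_large hβ hβ1 hlarge
    have hs1 := one_le_sqrt_of_one_le hd
    have hround : (fun k => round (p k)) ∈ latticeBall p r :=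
      round_mem_latticeBall p hr (by nlinarith)
    set A := hfin.toFinset with hAd
    have hA : (A : Set (Fin d → ℤ)) = latticeBall p r := hfin.coe_toFinset
    have hcard : (latticeBall p r).ncard = A.card := Set.ncard_eq_toFinset_card _ hfin
    obtain ⟨K, hK, hK', hKT⟩ := exists_attempts hd hr hα0
    obtain ⟨κ, hκ, hv⟩ := pr_largeSampleCmd (L := noSets) hd hr hA hK hK' h1 h2 h3 h57
    set δ := trialWeight d ⌈r⌉₊ r (coords fun k => p k) with hδ
    obtain ⟨G, hG, hGv⟩ := Generates.of_pr (c := sampleCmd)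
      (Pr.seq_ev ⟨M, hM, Pr.ite (fun h => absurd h (not_le.2 (by simpa [h2, h3, h4]))) fun _ => hv⟩)
    refine ⟨_, G, hG, Or.inr ?_, ?_⟩
    · have hα' : 1 / α ≤ 1 / αL + 1 / αR := by
        have e1 := one_div_pos.2 hL.1
        have e2 := one_div_pos.2 hR.1
        rcases min_choice αL αR with h | h <;> rw [hα, h] <;> linarith
      have ht := trialTime_le hd
      have hd5 : d ≤ d ^ 5 := Nat.le_self_pow (by norm_num) d
      have h5 : 6 + (K * (trialTime d + 3) + 6 * d + 9 + 1) ≤ (K + 1) * (800 * d ^ 5) := by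
        have := Nat.mul_le_mul_left K ht
        rw [add_mul]; omega
      calc ((6 + (K * (trialTime d + 3) + 6 * d + 9 + 1) : ℕ) : ℝ) ≤ ((K + 1) * (800 * d ^ 5) : ℕ) := by
            exact_mod_cast h5
        _ = ((K : ℝ) + 1) * (800 * d ^ 5) := by push_cast; ring
        _ ≤ _ := by
            refine mul_le_mul_of_nonneg_right ?_ (by positivity)
            have := mul_le_mul_of_nonneg_left hα' (by positivity : (0 : ℝ) ≤ 16 * d)
            linarith
    · have hA0 : 0 < A.card := Finset.card_pos.2 ⟨_, hfin.mem_toFinset.2 hround⟩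
      have hκK : κ ^ K * A.card ≤ ENNReal.ofReal α := by
        have h16 : 1 / (16 * (d : ℝ)) ≤ 1 := by
          rw [div_le_one (by positivity)]; linarith
        have hq := le_card_mul_trialWeight hd p hβ hβ1 hlarge rfl (coords fun k => p k)
        rw [hcard, ← hδ] at hq
        -- The success probability `|A| δ` of an attempt is at least `1/(16d)`, which justifies the
        -- factor used in the loop.
        have hκ1 : κ ≤ ENNReal.ofReal (1 - 1 / (16 * d)) := by
          rw [ENNReal.ofReal_sub _ (by positivity), ENNReal.ofReal_one]
          refine ENNReal.le_sub_of_add_le_left ENNReal.ofReal_ne_top ?_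
          rw [← hκ]
          gcongr
        have hAr := ncard_latticeBall_le_pow p hr
        rw [hcard] at hAr
        calc κ ^ K * A.card ≤ ENNReal.ofReal (1 - 1 / (16 * d)) ^ K * ENNReal.ofReal ((2 * r + 1) ^ d) := by
              gcongr
              rw [← ENNReal.ofReal_natCast]
              exact ENNReal.ofReal_le_ofReal hAr
          _ = ENNReal.ofReal ((2 * r + 1) ^ d * (1 - 1 / (16 * (d : ℝ))) ^ K) := by
              rw [← ENNReal.ofReal_pow (by linarith), ← ENNReal.ofReal_mul (pow_nonneg (by linarith) K),
                mul_comm]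
          _ ≤ ENNReal.ofReal α := ENNReal.ofReal_le_ofReal hK.le
      intro _
      refine ⟨fun z hz => ?_, fun z hz => ?_⟩
      · by_contra hn
        rw [PMF.mem_support_iff, hGv] at hz
        refine hz ?_
        have hne : (fun k => round (p k)) ≠ z := fun h => hn (h ▸ hround)
        rw [if_neg hne, Finset.sum_eq_zero fun z' hz' => if_neg fun h => hn ?_]
        · simp [retry]
        · rw [← h, ← hA]; exact hz'
      · have hzA : z ∈ A := by rw [← Finset.mem_coe, hA]; exact hz
        rw [hGv, Finset.sum_ite_eq', if_pos hzA, mul_one, hcard]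
        have hb := retry_bounds hA0 hκ hα0 hκK
          (if (fun k => round (p k)) = z then 1 else 0) (by split_ifs <;> simp)
        refine ⟨le_trans ?_ hb.1, hb.2.trans ?_⟩
        · gcongr; exact min_le_left _ _
        · gcongr; exact min_le_right _ _

end RandRAM


namespace RandRAM
open Term

variable {X : Type} {m : ℕ} {L : SetList X m}

/-! ## Deterministic runs with requests -/

/-- Deterministic triples for states. -/
def Sv (L : SetList X m) (c : Cmd) (s : State X) (T R : ℕ) (Q : State X → Prop) : Prop :=
  ∃ s', Runs L c s T R (PMF.pure s') ∧ Q s'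

section Sv

variable {c c₁ c₂ : Cmd} {s : State X} {T T' T₁ T₂ R R' R₁ R₂ : ℕ} {Q Q' : State X → Prop}

theorem Sv.le (h : Sv L c s T R Q) (hT : T ≤ T') (hR : R ≤ R') : Sv L c s T' R' Q := by
  obtain ⟨s', h, hQ⟩ := h; exact ⟨s', .weaken _ _ _ _ _ _ _ hT hR h, hQ⟩

theorem Sv.mono (h : Sv L c s T R Q) (hQ : ∀ s', Q s' → Q' s') : Sv L c s T R Q' := by
  obtain ⟨s', h, h'⟩ := h; exact ⟨s', h, hQ _ h'⟩

theorem Sv.of_ev (h : Ev L c s.mem T fun M' => Q ⟨M', s.reg⟩) : Sv L c s T 0 Q := by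
  obtain ⟨M', h, hQ⟩ := h
  refine ⟨⟨M', s.reg⟩, ?_, hQ⟩
  have := h s.reg
  rwa [PMF.pure_map] at this

theorem Sv.seq (h₁ : Sv L c₁ s T₁ R₁ fun s' => Sv L c₂ s' T₂ R₂ Q) :
    Sv L (c₁ ;; c₂) s (T₁ + T₂) (R₁ + R₂) Q := by
  obtain ⟨s₁, h₁, s₂, h₂, hQ⟩ := h₁
  refine ⟨s₂, ?_, hQ⟩
  have := Runs.seq _ _ _ _ _ _ _ _ (fun _ => PMF.pure s₂) h₁ fun s' hs' => by
    simp only [PMF.support_pure, Set.mem_singleton_iff] at hs'; rw [hs']; exact h₂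
  rwa [PMF.pure_bind] at this

theorem Sv.ask {n : Term} {q h o : ℕ} (hQ : Q (askAll L q h o (n.nat s.mem) s)) :
    Sv L (.ask n q h o) s (n.nat s.mem + 1) 1 Q := ⟨_, .ask _ _ _ _ _, hQ⟩

theorem Sv.loop {e₁ e₂ : Term} (I : ℕ → State X → Prop)
    (h₀ : ∀ s', I 0 s' → e₂.eval s'.mem < e₁.eval s'.mem)
    (hs : ∀ k s', I (k + 1) s' → e₁.eval s'.mem ≤ e₂.eval s'.mem → Sv L c s' T R (I k))
    (hQ : ∀ k s', I k s' → e₂.eval s'.mem < e₁.eval s'.mem → Q s') (k : ℕ) (hk : I k s) :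
    Sv L (.loop e₁ e₂ c) s (k * (T + 1) + 1) (k * R) Q := by
  induction k generalizing s with
  | zero =>
    exact ⟨s, .weaken _ _ _ _ _ _ _ (by omega) (by omega) (.loopFalse _ _ _ _ (not_le.2 (h₀ s hk))),
      hQ 0 s hk (h₀ s hk)⟩
  | succ k ih =>
    by_cases h : e₁.eval s.mem ≤ e₂.eval s.mem
    · obtain ⟨s₁, h₁, hI⟩ := hs k s hk h
      obtain ⟨s₂, h₂, hQ⟩ := ih hI
      refine ⟨s₂, ?_, hQ⟩
      have := Runs.loopTrue _ _ _ _ _ _ _ _ _ (fun _ => PMF.pure s₂) h h₁ fun s' hs' => by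
        simp only [PMF.support_pure, Set.mem_singleton_iff] at hs'; rw [hs']; exact h₂
      rw [PMF.pure_bind] at this
      exact .weaken _ _ _ _ _ _ _ (by ring_nf; omega) (by ring_nf; omega) this
    · exact ⟨s, .weaken _ _ _ _ _ _ _ (by omega) (by omega) (.loopFalse _ _ _ _ h),
        hQ _ s hk (not_le.1 h)⟩

end Sv

/-! ## The program for unions -/

/-- Reads the input of the program for unions, and adds up the sizes. -/
def serverInputCmd : Cmd :=
  .put 2 (.read 0 0) ;; .put 3 (.read 0 1) ;; .put 4 (.read 0 2) ;; .put 5 0 ;;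
  .forUp 7 (var 2) (.put 5 (var 5 + .read 1 (var 7)))

/-- The number of pieces into which the set with the number in variable `7` is split. -/
def pieceTerm : Term := Term.floor (.read 1 (var 7) * var 2 / var 5) + 1

/-- Lists the pieces of the sets: array `9` contains the numbers of their sets. -/
def pieceCmd : Cmd :=
  .put 6 0 ;; .put 7 0 ;; .put 8 pieceTerm ;;
  .loop (var 7 + 1) (var 2) (.ite 1 (var 8)
    (.set 9 (var 6) (var 7) ;; .put 6 (var 6 + 1) ;; .put 8 (var 8 - 1))
    (.put 7 (var 7 + 1) ;; .put 8 pieceTerm))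

/-- Computes the number of samples. -/
def sampleCountCmd : Cmd :=
  .put 11 0 ;; .put 12 1 ;;
  .loop (var 12) (100 * var 2 / (var 3 * var 4)) (.put 12 (2 * var 12) ;; .put 11 (var 11 + 1)) ;;
  .put 13 (16 * var 11 / (var 3 * var 3)) ;; .put 14 (0 - Term.floor (0 - var 13 * var 6))

/-- Selects the sets of the samples, with probabilities that are proportional to the sizes. -/
def pickCmd : Cmd :=
  .forUp 19 (var 14) (.unif 18 0 (var 6 - 1) ;; .set 15 (var 19) (.read 9 (var 18)) ;;
    .set 16 (var 19) (var 19) ;; .put 8 (.read 1 (.read 9 (var 18)) * var 2 / var 5) ;;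
    .toss 17 (var 19) (var 8 / (Term.floor (var 8) + 1)))

/-- Lists the samples that are alive, up to a given number. -/
def scanCmd : Cmd :=
  .put 24 0 ;; .put 19 0 ;;
  .loop (var 19 + 1) (var 23) (
    .ite 1 (.read 17 (var 19))
      (.ite (var 24 + 1) (4 * var 13 * var 21)
        (.set 25 (var 24) (var 19) ;; .put 24 (var 24 + 1)) (.put 23 (var 19)))
      .skip ;;
    .put 19 (var 19 + 1))

/-- Updates the estimate. -/
def estimateCmd : Cmd :=
  .put 26 (var 6 * var 5 / var 2 * (var 24 / (var 23 * var 21))) ;;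
  .ite (var 22) (var 26) (.put 22 (var 26)) .skip

/-- Prepares membership queries for the samples that are alive. -/
def queryCmd : Cmd :=
  .forUp 26 (var 24 * var 20) (.put 30 (Term.floor (var 26 / var 20)) ;;
    .set 27 (var 26) (.read 15 (.read 25 (var 30)) + var 20 + (var 26 - var 30 * var 20)) ;;
    .set 28 (var 26) (.read 25 (var 30)))

/-- Evaluates the answers. -/
def killCmd : Cmd :=
  .forUp 26 (var 24 * var 20) (.ite 1 (.read 29 (var 26))
    (.set 17 (.read 25 (Term.floor (var 26 / var 20))) 0) .skip)

/-- One stage of the program for unions. -/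
def stageCmd : Cmd :=
  .put 21 (0 - Term.floor (0 - var 2 / var 20)) ;; scanCmd ;; estimateCmd ;; queryCmd ;;
  .ask (var 24 * var 20) 27 28 29 ;; killCmd ;; .put 20 (2 * var 20)

/-- All stages of the program for unions. -/
def stagesCmd : Cmd :=
  .put 20 1 ;; .put 22 0 ;; .put 23 (var 14) ;; .loop (var 20 + 1) (2 * var 2) stageCmd ;;
  .put 0 (var 22)

/-- The program for unions. -/
def serverCmd : Cmd :=
  serverInputCmd ;; .ite (var 5) 0 (.put 0 0)
    (pieceCmd ;; sampleCountCmd ;; pickCmd ;; .draw (var 14) 15 16 ;; stagesCmd)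

theorem ev_serverInputCmd (x : Fin m → ℝ) (ε γ : ℝ) :
    Ev L serverInputCmd (load [[(m : ℝ), ε, γ], List.ofFn x]) (3 * m + 6) fun M =>
      M 1 = coords x ∧ M 2 0 = m ∧ M 3 0 = ε ∧ M 4 0 = γ ∧ M 5 0 = ∑ i, x i := by
  refine Ev.le (Ev.seq (Ev.put (Ev.seq (Ev.put (Ev.seq (Ev.put (Ev.seq (Ev.put (Ev.forUp m (T := 1)
    (fun k M' => M' 5 0 = ∑ i ∈ Finset.range k, coords x i) (by decide) ?_ ?_ ?_ ?_)))))))))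
    (?_ : 1 + (1 + (1 + (1 + (m * (1 + 2) + 2)))) ≤ _)
  · simp [Memory.write_ne]
  · intro M' hf
    simp [hf 2 (by decide) (by decide), Memory.write_ne]
  · intro k hk M' hk' hf hI
    have g1 := hf 1 (by decide) (by decide)
    simp [Memory.write_ne] at g1
    refine Ev.put ?_
    simp [Memory.write_ne, hI, g1, hk', Finset.sum_range_succ]
  · intro M' _ hf hI
    refine ⟨?_, ?_, ?_, ?_, ?_⟩
    · simp [hf 1 (by decide) (by decide), Memory.write_ne]
    · simp [hf 2 (by decide) (by decide), Memory.write_ne]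
    · simp [hf 3 (by decide) (by decide), Memory.write_ne]
    · simp [hf 4 (by decide) (by decide), Memory.write_ne]
    · rw [hI, Finset.sum_range]
      simp [coords_val]
  · omega

/-- The identity for all `φ` expresses that set `i` is listed exactly `⌊wt i⌋ + 1` times. Uniform
choice from this list takes constant time, and the excess over `wt i` is removed later by a biased
coin. -/
theorem ev_pieceCmd {M : Memory} {wt : ℕ → ℝ} (h2 : M 2 0 = m) (hwt : ∀ i, M 1 i * m / M 5 0 = wt i)
    (hwt0 : ∀ i, 0 ≤ wt i) :
    Ev L pieceCmd M (5 * (m + ∑ i ∈ Finset.range m, (⌊wt i⌋₊ + 1)) + 4) fun M' =>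
      M' 6 0 = (∑ i ∈ Finset.range m, (⌊wt i⌋₊ + 1) : ℕ) ∧
      ∃ I : ℕ → ℕ, (∀ u < ∑ i ∈ Finset.range m, (⌊wt i⌋₊ + 1), M' 9 u = I u ∧ I u < m) ∧
        ∀ φ : ℕ → ℝ≥0∞, ∑ u ∈ Finset.range (∑ i ∈ Finset.range m, (⌊wt i⌋₊ + 1)), φ (I u) =
          ∑ i ∈ Finset.range m, ((⌊wt i⌋₊ + 1 : ℕ) : ℝ≥0∞) * φ i := by
  set c : ℕ → ℕ := fun i => ⌊wt i⌋₊ + 1 with hc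
  have hterm : ∀ (M' : Memory) (i : ℕ), M' 1 = M 1 → M' 2 = M 2 → M' 5 = M 5 → M' 7 0 = i →
      pieceTerm.eval M' = (c i : ℝ) := by
    intro M' i e1 e2 e5 e7
    simp [pieceTerm, e1, e2, e5, e7, h2, hwt, hc, natCast_floor_eq_intCast_floor (hwt0 i)]
  have hsumle : ∀ i, i < m → ∑ j ∈ Finset.range (i + 1), c j ≤ ∑ j ∈ Finset.range m, c j := fun i hi =>
    Finset.sum_le_sum_of_subset (Finset.range_mono (by omega))
  -- `rem` counts the pieces of set `i` that are still to be listed. Each iteration lists a piece or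
  -- moves to the next set, so `k + P + i` is constant.
  refine Ev.le (Ev.seq (Ev.put (Ev.seq (Ev.put (Ev.seq (Ev.put (Ev.loop (T := 4) (fun k M' =>
      M' 1 = M 1 ∧ M' 2 = M 2 ∧ M' 5 = M 5 ∧ ∃ i rem P : ℕ, i ≤ m ∧ M' 7 0 = i ∧ M' 8 0 = rem ∧
        M' 6 0 = P ∧ k + P + i = m + ∑ j ∈ Finset.range m, c j ∧
        P + rem = ∑ j ∈ Finset.range (i + 1), c j ∧ rem ≤ c i ∧ (i = m → rem = c m) ∧
        ∃ I : ℕ → ℕ, (∀ u < P, M' 9 u = I u ∧ I u < m) ∧ ∀ φ : ℕ → ℝ≥0∞,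
          ∑ u ∈ Finset.range P, φ (I u) + rem * φ i = ∑ j ∈ Finset.range (i + 1), (c j : ℝ≥0∞) * φ j)
    ?_ ?_ ?_ (m + ∑ j ∈ Finset.range m, c j) ?_)))))))
    (?_ : 1 + (1 + (1 + ((m + ∑ j ∈ Finset.range m, c j) * (4 + 1) + 1))) ≤ _)
  · rintro M' ⟨-, e2, -, i, rem, P, hi, h7, -, -, hk, hP, -, -, -⟩
    have : i = m := by
      by_contra hne
      have := hsumle i (by omega)
      omega
    simp [e2, h2, h7, this]
  · rintro k M' ⟨e1, e2, e5, i, rem, P, hi, h7, h8, h6, hk, hP, hrem, hm', I, hI, hφ⟩ hlt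
    have him : i < m := by
      simp [e2, h2, h7] at hlt
      exact_mod_cast hlt
    refine Ev.ite (T := 3) (fun h => ?_) fun h => ?_
    · have h1 : 1 ≤ rem := by simp [h8] at h; omega
      have hfl : (var 6).nat M' = P := by simp [Term.nat, h6]
      refine Ev.seq (T₁ := 1) (T₂ := 2) (Ev.set (Ev.seq (T₁ := 1) (T₂ := 1) (Ev.put (Ev.put
        ⟨?_, ?_, ?_, i, rem - 1, P + 1, hi, ?_, ?_, ?_, ?_, ?_, ?_, ?_, fun u => if u = P then i else I u,
          ?_, ?_⟩))))
      · simp [Memory.write_ne, e1]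
      · simp [Memory.write_ne, e2]
      · simp [Memory.write_ne, e5]
      · simp [Memory.write_ne, h7]
      · simp [Memory.write_ne, h8, Nat.cast_sub h1]
      · simp [Memory.write_ne, h6]
      · omega
      · omega
      · omega
      · omega
      · intro u hu
        simp only [hfl]
        simp [Memory.write_ne, Memory.write_self, h7]
        split_ifs with hup
        · exact ⟨rfl, him⟩
        · exact hI u (by omega)
      · intro φ
        rw [← hφ, Finset.sum_range_succ]
        beta_reduce
        rw [if_pos rfl, Finset.sum_congr rfl fun u hu => by rw [if_neg (Finset.mem_range.1 hu).ne]]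
        obtain ⟨q, rfl⟩ := Nat.exists_eq_add_of_le' h1
        simp only [Nat.add_sub_cancel]
        push_cast
        ring
    · have h0 : rem = 0 := by
        simp [h8] at h; omega
      subst h0
      have hsucc : (var 7 + 1).eval M' = ((i + 1 : ℕ) : ℝ) := by simp [h7]
      refine Ev.le (Ev.seq (T₁ := 1) (T₂ := 1) (Ev.put (Ev.put ⟨?_, ?_, ?_, i + 1, c (i + 1), P, him, ?_, ?_, ?_,
        ?_, ?_, ?_, ?_, I, ?_, ?_⟩))) (by norm_num)
      · simp [Memory.write_ne, e1]
      · simp [Memory.write_ne, e2]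
      · simp [Memory.write_ne, e5]
      · simp [Memory.write_ne, h7]
      · rw [Memory.write_same, hsucc]
        refine hterm _ _ ?_ ?_ ?_ ?_
        · simp [Memory.write_ne, e1]
        · simp [Memory.write_ne, e2]
        · simp [Memory.write_ne, e5]
        · simp
      · simp [Memory.write_ne, h6]
      · omega
      · rw [Finset.sum_range_succ, ← hP]; rfl
      · exact le_rfl
      · intro h; rw [h]
      · intro u hu
        simpa [Memory.write_ne] using hI u hu
      · intro φ
        rw [Finset.sum_range_succ, ← hφ]
        simp
  · rintro k M' ⟨e1, e2, e5, i, rem, P, hi, h7, h8, h6, hk, hP, hrem, hm', I, hI, hφ⟩ hlt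
    have him : i = m := by
      simp [e2, h2, h7] at hlt
      have : m < i + 1 := by exact_mod_cast hlt
      omega
    subst him
    have hr := hm' rfl
    have hPe : P = ∑ j ∈ Finset.range i, c j := by
      rw [Finset.sum_range_succ] at hP; omega
    subst hPe
    refine ⟨h6, I, hI, fun φ => ?_⟩
    -- At the end the invariant also counts unlisted pieces of the nonexistent set with number `m`;
    -- cutting off `φ` removes them without subtracting possibly infinite values.
    have h := hφ fun j => if j < i then φ j else 0
    rw [Finset.sum_range_succ] at h
    simp only [lt_irrefl, if_false, mul_zero, add_zero] at h
    have h' : ∑ u ∈ Finset.range (∑ j ∈ Finset.range i, c j), φ (I u) =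
        ∑ u ∈ Finset.range (∑ j ∈ Finset.range i, c j), if I u < i then φ (I u) else 0 :=
      Finset.sum_congr rfl fun u hu => (if_pos (hI u (Finset.mem_range.1 hu)).2).symm
    exact h'.trans (h.trans (Finset.sum_congr rfl fun j hj => by rw [if_pos (Finset.mem_range.1 hj)]))
  · refine ⟨?_, ?_, ?_, 0, c 0, 0, by omega, ?_, ?_, ?_, ?_, ?_, ?_, ?_, fun _ => 0, ?_, ?_⟩
    · simp [Memory.write_ne]
    · simp [Memory.write_ne]
    · simp [Memory.write_ne]
    · simp [Memory.write_ne]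
    · rw [Memory.write_same]
      refine hterm _ _ ?_ ?_ ?_ ?_ <;> simp [Memory.write_ne]
    · simp [Memory.write_ne]
    · omega
    · simp
    · exact le_rfl
    · intro h; rw [h]
    · intro u hu; omega
    · intro φ; simp
  · simp only [hc]; omega

end RandRAM


/-! ### The parts of the program for unions: sample numbers, scanning, queries and their evaluation
-/

namespace RandRAM
open Term

variable {X : Type} {m : ℕ} {L : SetList X m}

/-- Doubling until `100m/(εγ)` is exceeded finds an exponent `κ` of logarithmic size without a
logarithm. The accuracy parameter is `K = 16κ/ε²`, and `K` samples are taken per piece. -/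
theorem ev_sampleCountCmd {M : Memory} {P k₀ : ℕ} {ε γ : ℝ} (h2 : M 2 0 = m) (h3 : M 3 0 = ε)
    (h4 : M 4 0 = γ) (h6 : M 6 0 = P) (hP : 0 < P) (hm : 1 ≤ m) (hε : 0 < ε) (hγ : 0 < γ)
    (hk₀ : 100 * m / (ε * γ) < 2 ^ k₀) (hγ1 : γ < 1) (hε1 : ε < 1) :
    Ev L sampleCountCmd M (3 * k₀ + 6) fun M' => ∃ κ : ℕ, 1 ≤ κ ∧ κ ≤ k₀ ∧
      100 * m / (ε * γ) < 2 ^ κ ∧ M' 13 0 = 16 * κ / ε ^ 2 ∧ M' 14 0 = ⌈16 * κ / ε ^ 2 * P⌉₊ := by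
  have hm' : (1 : ℝ) ≤ m := by exact_mod_cast hm
  have hbig : 1 < 100 * m / (ε * γ) := by
    rw [lt_div_iff₀ (by positivity)]; nlinarith
  refine Ev.le (Ev.seq (Ev.put (Ev.seq (Ev.put (Ev.seq (Ev.loop (T := 2) (fun k M' =>
      M' 2 = M 2 ∧ M' 3 = M 3 ∧ M' 4 = M 4 ∧ M' 6 = M 6 ∧ ∃ κ : ℕ, k + κ = k₀ ∧ M' 11 0 = κ ∧
        M' 12 0 = 2 ^ κ)
    ?_ ?_ ?_ k₀ ?_))))))
    (?_ : 1 + (1 + ((k₀ * (2 + 1) + 1) + 2)) ≤ _)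
  · rintro M' ⟨e2, e3, e4, -, κ, hk, h11, h12⟩
    obtain rfl : κ = k₀ := by omega
    simpa [e2, e3, e4, h2, h3, h4, h12] using hk₀
  · rintro k M' ⟨e2, e3, e4, e6, κ, hk, h11, h12⟩ -
    refine Ev.seq (T₁ := 1) (T₂ := 1) (Ev.put (Ev.put ⟨?_, ?_, ?_, ?_, κ + 1, by omega, ?_, ?_⟩))
    · simp [Memory.write_ne, e2]
    · simp [Memory.write_ne, e3]
    · simp [Memory.write_ne, e4]
    · simp [Memory.write_ne, e6]
    · simp [Memory.write_ne, h11]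
    · simp [Memory.write_ne, h12, pow_succ, mul_comm]
  · rintro k M' ⟨e2, e3, e4, e6, κ, hk, h11, h12⟩ hlt
    simp [e2, e3, e4, h2, h3, h4, h12] at hlt
    have hκ : 1 ≤ κ := by
      by_contra h
      obtain rfl : κ = 0 := by omega
      rw [pow_zero] at hlt; linarith
    have e13 : (16 * var 11 / (var 3 * var 3)).eval M' = 16 * κ / ε ^ 2 := by
      simp [h11, e3, h3, sq]
    refine Ev.seq (T₁ := 1) (T₂ := 1) (Ev.put (Ev.put ⟨κ, hκ, by omega, hlt, ?_, ?_⟩))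
    · rw [e13]; simp [Memory.write_ne]
    · rw [e13, Memory.write_same]
      have hpos : 0 < 16 * (κ : ℝ) / ε ^ 2 * P := by
        have : (1 : ℝ) ≤ κ := by exact_mod_cast hκ
        have : (0 : ℝ) < P := by exact_mod_cast hP
        positivity
      rw [← neg_floor_neg hpos]
      simp [Memory.write_ne, e6, h6]
  · refine ⟨?_, ?_, ?_, ?_, 0, by omega, ?_, ?_⟩ <;> simp [Memory.write_ne]
  · omega

/-- `a` and array `25` describe the numbers `t < n` for which `al t` holds. -/
def IsAliveList (al : ℕ → Prop) (n a : ℕ) (f : ℕ → ℕ) (M : Memory) : Prop :=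
  open Classical in (∀ k < a, M 25 k = f k) ∧ a = ((Finset.range n).filter al).card ∧
    (Finset.range a).image f = (Finset.range n).filter al

open Classical in
-- The scan stops in front of the first living sample that would exceed the limit `B`, and shortens
-- the prefix in use to `n'`. The last alternative records that a shortened prefix is nearly full,
-- which later shows that it is not too short.
theorem ev_scanCmd {M : Memory} {al : ℕ → Prop} {n : ℕ} {B : ℝ} (hB : 0 ≤ B) (h23 : M 23 0 = n)
    (h17 : ∀ t < n, M 17 t = if al t then 1 else 0) (hM : 4 * M 13 0 * M 21 0 = B) :
    Ev L scanCmd M (6 * n + 3) fun M' => ∃ n' a : ℕ, ∃ f : ℕ → ℕ, n' ≤ n ∧ M' 23 0 = n' ∧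
      M' 24 0 = a ∧ IsAliveList al n' a f M' ∧ (a : ℝ) ≤ B ∧
      (n' = n ∨ B < ((Finset.range (n' + 1)).filter al).card) := by
  refine Ev.le (Ev.seq (Ev.put (Ev.seq (Ev.put (Ev.loop (T := 5) (fun k M' =>
      M' 13 = M 13 ∧ M' 17 = M 17 ∧ M' 21 = M 21 ∧ ∃ n' a : ℕ, ∃ f : ℕ → ℕ, n' ≤ n ∧
        M' 24 0 = a ∧ IsAliveList al n' a f M' ∧ (a : ℝ) ≤ B ∧
        ((M' 23 0 = n ∧ M' 19 0 = n' ∧ k + n' = n) ∨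
          (M' 23 0 = n' ∧ M' 19 0 = (n' + 1 : ℕ) ∧ B < ((Finset.range (n' + 1)).filter al).card)))
    ?_ ?_ ?_ n ?_))))) (?_ : 1 + (1 + (n * (5 + 1) + 1)) ≤ _)
  · rintro M' ⟨-, -, -, n', a, f, hn, -, -, -, ⟨e23, e19, hk⟩ | ⟨e23, e19, -⟩⟩
    · obtain rfl : n' = n := by omega
      simp [e23, e19]
    · simp [e23, e19]; linarith
  · rintro k M' ⟨e13, e17, e21, n', a, f, hn, h24, ⟨hf, ha, himg⟩, haB, ⟨e23, e19, hk⟩ | ⟨e23, e19, -⟩⟩ hlt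
    swap
    · simp [e23, e19] at hlt; linarith
    have hlt' : n' < n := by
      simp [e23, e19] at hlt
      exact_mod_cast hlt
    have hal : M' 17 n' = if al n' then 1 else 0 := by rw [e17]; exact h17 n' hlt'
    have hr : (Finset.range (n' + 1)).filter al =
        if al n' then insert n' ((Finset.range n').filter al) else (Finset.range n').filter al := by
      rw [Finset.range_add_one, Finset.filter_insert]
    have hnot : n' ∉ (Finset.range n').filter al := by simp
    by_cases halive : al n'
    · rw [if_pos halive] at hal hr
      have hcard : ((Finset.range (n' + 1)).filter al).card = a + 1 := by
        rw [hr, Finset.card_insert_of_notMem hnot, ← ha]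
      refine Ev.seq (T₁ := 4) (T₂ := 1) (Ev.ite (T := 3) (fun _ => Ev.ite (T := 2) (fun h => ?_) fun h => ?_)
        fun h => ?_)
      · have haB' : ((a + 1 : ℕ) : ℝ) ≤ B := by
          simp [h24, e13, e21, hM] at h; push_cast; exact h
        have hfl : (var 24).nat M' = a := by simp [Term.nat, h24]
        refine Ev.seq (T₁ := 1) (T₂ := 1) (Ev.set (Ev.put (Ev.put ⟨?_, ?_, ?_, n' + 1, a + 1,
          fun j => if j = a then n' else f j, hlt', ?_, ⟨?_, hcard.symm, ?_⟩, haB', Or.inl ⟨?_, ?_, by omega⟩⟩)))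
        · simp [Memory.write_ne, e13]
        · simp [Memory.write_ne, e17]
        · simp [Memory.write_ne, e21]
        · simp [Memory.write_ne, h24]
        · intro j hj
          simp only [hfl]
          simp [Memory.write_ne, Memory.write_self, e19]
          split_ifs with hja
          · rfl
          · exact hf j (by omega)
        · rw [hr, Finset.range_add_one, Finset.image_insert, if_pos rfl, ← himg]
          congr 1
          refine Finset.image_congr fun j hj => ?_
          have := Finset.mem_range.1 hj
          rw [if_neg (by omega)]
        · simp [Memory.write_ne, e23]
        · simp [Memory.write_ne, e19]
      · refine Ev.le (Ev.put (Ev.put ⟨?_, ?_, ?_, n', a, f, hn, ?_, ⟨?_, ha, himg⟩, haB, Or.inr ⟨?_, ?_, ?_⟩⟩))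
          (by norm_num)
        · simp [Memory.write_ne, e13]
        · simp [Memory.write_ne, e17]
        · simp [Memory.write_ne, e21]
        · simp [Memory.write_ne, h24]
        · simpa [Memory.write_ne] using hf
        · simp [Memory.write_ne, e19]
        · simp [Memory.write_ne, e19]
        · rw [hcard]
          simp [h24, e13, e21, hM] at h; push_cast; exact h
      · simp [e19, hal] at h
    · rw [if_neg halive] at hal hr
      refine Ev.seq (T₁ := 4) (T₂ := 1) (Ev.ite (T := 3) (fun h => ?_) fun h => Ev.le (Ev.skip (Ev.put
        ⟨?_, ?_, ?_, n' + 1, a, f, hlt', ?_, ⟨?_, ?_, ?_⟩, haB, Or.inl ⟨?_, ?_, by omega⟩⟩)) (by norm_num))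
      · simp [e19, hal] at h; linarith
      · simp [Memory.write_ne, e13]
      · simp [Memory.write_ne, e17]
      · simp [Memory.write_ne, e21]
      · simp [Memory.write_ne, h24]
      · simpa [Memory.write_ne] using hf
      · rw [hr, ha]
      · rw [hr, himg]
      · simp [Memory.write_ne, e23]
      · simp [e19]
  · rintro k M' ⟨-, -, -, n', a, f, hn, h24, hl, haB, ⟨e23, e19, hk⟩ | ⟨e23, e19, hc⟩⟩ hlt
    · obtain rfl : n' = n := by
        simp [e23, e19] at hlt
        have : n < n' + 1 := by exact_mod_cast hlt
        omega
      exact ⟨n', a, f, le_rfl, e23, h24, hl, haB, Or.inl rfl⟩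
    · exact ⟨n', a, f, hn, e23, h24, hl, haB, Or.inr hc⟩
  · refine ⟨?_, ?_, ?_, 0, 0, id, by omega, ?_, ⟨?_, ?_, ?_⟩, by simpa using hB, Or.inl ⟨?_, ?_, by omega⟩⟩
    · simp [Memory.write_ne]
    · simp [Memory.write_ne]
    · simp [Memory.write_ne]
    · simp [Memory.write_ne]
    · simp
    · simp
    · simp
    · simp [Memory.write_ne, h23]
    · simp
  · omega

theorem ev_estimateCmd {M : Memory} :
    Ev L estimateCmd M 3 fun M' => M' 22 0 = max (M 22 0)
      (M 6 0 * M 5 0 / M 2 0 * (M 24 0 / (M 23 0 * M 21 0))) := by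
  refine Ev.le (Ev.seq (T₂ := 2) (Ev.put (Ev.ite (T := 1) (fun h => Ev.put ?_) fun h => Ev.skip ?_)))
    (by norm_num : 1 + 2 ≤ _)
  · simp [Memory.write_ne] at h ⊢; exact h
  · simp [Memory.write_ne] at h ⊢; exact h.le

theorem floor_div_cast (j g : ℕ) : ⌊(j : ℝ) / g⌋ = ((j / g : ℕ) : ℤ) := by
  rw [← Nat.floor_div_eq_div (K := ℝ), Int.natCast_floor_eq_floor (by positivity)]

/-- Query `j` asks about the living sample number `j / g` and the `j % g`-th of the `g` sets by
which doubling extends its range, so that all pairs fit into one round. -/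
theorem ev_queryCmd {M : Memory} {a g : ℕ} {f I : ℕ → ℕ} (hg : 0 < g) (h24 : M 24 0 = a) (h20 : M 20 0 = g)
    (hf : ∀ k < a, M 25 k = f k) (hI : ∀ k < a, M 15 (f k) = I (f k)) :
    Ev L queryCmd M (5 * (a * g) + 2) fun M' => ∀ j < a * g,
      M' 27 j = (I (f (j / g)) + g + j % g : ℕ) ∧ M' 28 j = f (j / g) := by
  refine Ev.le (Ev.forUp (a * g) (T := 3) (fun k M' => ∀ j < k,
      M' 27 j = (I (f (j / g)) + g + j % g : ℕ) ∧ M' 28 j = f (j / g)) (by decide) ?_ ?_ ?_ ?_)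
    (?_ : a * g * (3 + 2) + 2 ≤ _)
  · simp
  · intro M' hf'
    simp [hf' 24 (by decide) (by decide), hf' 20 (by decide) (by decide), h24, h20]
  · intro k hk M' hk' hf' hinv
    have g24 := hf' 24 (by decide) (by decide)
    have g20 := hf' 20 (by decide) (by decide)
    have g25 := hf' 25 (by decide) (by decide)
    have g15 := hf' 15 (by decide) (by decide)
    have hlt : k / g < a := (Nat.div_lt_iff_lt_mul hg).2 hk
    have e30 : (Term.floor (var 26 / var 20)).eval M' = (k / g : ℕ) := by
      simp only [eval_floor, eval_div, eval_var, hk', g20, h20, floor_div_cast, Int.cast_natCast]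
    have hmod : (k : ℝ) - (k / g : ℕ) * g = (k % g : ℕ) := by
      have := Nat.div_add_mod' k g
      rw [sub_eq_iff_eq_add]
      exact_mod_cast (by omega : k = k % g + k / g * g)
    refine Ev.seq (T₁ := 1) (T₂ := 2) (Ev.put (Ev.seq (T₁ := 1) (T₂ := 1) (Ev.set (Ev.set ?_))))
    rw [e30]
    intro j hj
    have e27 : (Term.read 15 (.read 25 (var 30)) + var 20 + (var 26 - var 30 * var 20)).eval
        (M'.write 30 0 (k / g : ℕ)) = (I (f (k / g)) + g + k % g : ℕ) := by
      simp only [eval_add, eval_sub, eval_mul, eval_read, eval_var, Memory.write_same, Nat.floor_natCast,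
        Memory.write_ne _ _ _ (show 25 ≠ 30 by decide), Memory.write_ne _ _ _ (show 15 ≠ 30 by decide),
        Memory.write_ne _ _ _ (show 20 ≠ 30 by decide), Memory.write_ne _ _ _ (show 26 ≠ 30 by decide),
        g25, g15, g20, hf _ hlt, hI _ hlt, h20, hk', hmod]
      push_cast; ring
    rw [e27]
    have hidx : (var 26).nat (M'.write 30 0 (k / g : ℕ)) = k := by
      simp [Term.nat, Memory.write_ne, hk']
    rw [hidx]
    by_cases hjk : j = k
    · subst hjk
      simp [Memory.write_ne, Term.nat, hk', g25, hf _ hlt]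
    · have := hinv j (by omega)
      simp [Memory.write_ne, Memory.write_self, Term.nat, hk', hjk]
      simpa using this
  · intro M' _ _ hI'; exact hI'
  · omega

open Classical in
theorem ev_killCmd {M : Memory} {a g : ℕ} {f : ℕ → ℕ} {ans : ℕ → Prop} (hg : 0 < g) (h24 : M 24 0 = a)
    (h20 : M 20 0 = g) (hf : ∀ k < a, M 25 k = f k) (h29 : ∀ j < a * g, M 29 j = if ans j then 1 else 0) :
    Ev L killCmd M (4 * (a * g) + 2) fun M' => ∀ t, M' 17 t =
      if ∃ j < a * g, ans j ∧ f (j / g) = t then 0 else M 17 t := by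
  refine Ev.le (Ev.forUp (a * g) (T := 2) (fun k M' => ∀ t, M' 17 t =
      if ∃ j < k, ans j ∧ f (j / g) = t then 0 else M 17 t) (by decide) ?_ ?_ ?_ ?_)
    (?_ : a * g * (2 + 2) + 2 ≤ _)
  · simp [Memory.write_ne]
  · intro M' hf'
    simp [hf' 24 (by decide) (by decide), hf' 20 (by decide) (by decide), h24, h20]
  · intro k hk M' hk' hf' hinv
    have g20 := hf' 20 (by decide) (by decide)
    have g25 := hf' 25 (by decide) (by decide)
    have g29 := hf' 29 (by decide) (by decide)
    have hlt : k / g < a := (Nat.div_lt_iff_lt_mul hg).2 hk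
    have hidx : (Term.read 25 (Term.floor (var 26 / var 20))).nat M' = f (k / g) := by
      simp only [Term.nat, eval_read, eval_floor, eval_div, eval_var, hk', g20, h20, floor_div_cast,
        Int.cast_natCast, Nat.floor_natCast, g25, hf _ hlt]
    have hans : M' 29 k = if ans k then 1 else 0 := by rw [g29, h29 k hk]
    have hsplit : ∀ t, (∃ j < k + 1, ans j ∧ f (j / g) = t) ↔
        (∃ j < k, ans j ∧ f (j / g) = t) ∨ (ans k ∧ f (k / g) = t) := by
      intro t
      constructor
      · rintro ⟨j, hj, h⟩
        rcases Nat.lt_succ_iff_lt_or_eq.1 hj with hj | rfl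
        · exact Or.inl ⟨j, hj, h⟩
        · exact Or.inr h
      · rintro (⟨j, hj, h⟩ | h)
        · exact ⟨j, by omega, h⟩
        · exact ⟨k, by omega, h⟩
    refine Ev.ite (T := 1) (fun h => Ev.set fun t => ?_) fun h => Ev.skip fun t => ?_
    · have ha : ans k := by
        by_contra hn
        simp [hk', hans, hn] at h; linarith
      rw [hidx, Memory.write_ne _ _ _ (by decide), Memory.write_self]
      simp only [hsplit, ha, true_and, eval_ofNat, Nat.cast_zero]
      by_cases ht : t = f (k / g)
      · simp [ht]
      · rw [if_neg ht, hinv t]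
        simp [Ne.symm ht]
    · have ha : ¬ ans k := by
        intro hn
        simp [hk', hans, hn] at h
      rw [Memory.write_ne _ _ _ (by decide), hinv t]
      simp only [hsplit, ha, false_and, or_false]
  · intro M' _ _ hI'; exact hI'
  · omega

end RandRAM


/-! ### Living samples and the deterministic analysis of the stages -/

namespace RandRAM
open Term

variable {X : Type} {m : ℕ}

/-- Sample `t`, the element `x t` of set `I t`, is alive in a stage of width `g` if it has been accepted
and does not belong to the next `g - 1` sets. -/
def Alive (L : SetList X m) (I : ℕ → ℕ) (x : ℕ → X) (acc : ℕ → Prop) (g t : ℕ) : Prop :=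
  acc t ∧ ∀ (j : ℕ) (hj : j < m), I t < j → j < I t + g → x t ∉ L.sets ⟨j, hj⟩

open Classical in
/-- The number of the first `n` samples that are alive. -/
noncomputable def aliveCount (L : SetList X m) (I : ℕ → ℕ) (x : ℕ → X) (acc : ℕ → Prop) (g n : ℕ) : ℕ :=
  ((Finset.range n).filter (Alive L I x acc g)).card

open Classical in
theorem aliveCount_mono {L : SetList X m} {I : ℕ → ℕ} {x : ℕ → X} {acc : ℕ → Prop} {g : ℕ} :
    Monotone (aliveCount L I x acc g) := fun _ _ h =>
  Finset.card_le_card (Finset.filter_subset_filter _ (Finset.range_mono h))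

open Classical in
/-- The states before a stage of width `g` that uses at most `n` of the `N` samples. -/
structure IsStageState (L : SetList X m) (I : ℕ → ℕ) (x : ℕ → X) (acc : ℕ → Prop) (N P : ℕ) (S K : ℝ)
    (g n : ℕ) (s : State X) : Prop where
  two : s.mem 2 0 = m
  five : s.mem 5 0 = S
  six : s.mem 6 0 = P
  thirteen : s.mem 13 0 = K
  index : ∀ t < N, s.mem 15 t = I t
  reg : ∀ t < N, s.reg t = some (x t)
  le : n ≤ N
  width : s.mem 20 0 = g
  count : s.mem 23 0 = n
  alive : ∀ t < n, s.mem 17 t = if Alive L I x acc g t then 1 else 0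

variable {L : SetList X m} {I : ℕ → ℕ} {x : ℕ → X} {acc : ℕ → Prop} {N P : ℕ} {S K : ℝ}

/-- Doubling the width adds only the `g` sets from `I t + g` on, so the earlier answers remain
useful. Set numbers from `m` on do not matter; queries to them are answered negatively. -/
theorem alive_two_mul_iff {g t : ℕ} : Alive L I x acc (2 * g) t ↔ Alive L I x acc g t ∧
    ¬ ∃ j < g, ∃ h : I t + g + j < m, x t ∈ L.sets ⟨I t + g + j, h⟩ := by
  constructor
  · rintro ⟨ha, h⟩
    refine ⟨⟨ha, fun j hj h1 h2 => h j hj h1 (by omega)⟩, ?_⟩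
    rintro ⟨j, hjg, hj, hx⟩
    by_cases h0 : g = 0
    · omega
    exact h _ hj (by omega) (by omega) hx
  · rintro ⟨⟨ha, h⟩, hn⟩
    refine ⟨ha, fun j hj h1 h2 hx => ?_⟩
    by_cases hlt : j < I t + g
    · exact h j hj h1 hlt hx
    · obtain ⟨k, rfl⟩ := Nat.exists_eq_add_of_le (not_lt.1 hlt)
      exact hn ⟨k, by omega, hj, hx⟩

theorem Sv.seq_ev {c₁ c₂ : Cmd} {s : State X} {T₁ T₂ R : ℕ} {Q₁ : Memory → Prop} {Q : State X → Prop}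
    (h₁ : Ev L c₁ s.mem T₁ Q₁) (h₂ : ∀ M', Q₁ M' → (∀ a, c₁.keeps a = true → M' a = s.mem a) →
      Sv L c₂ ⟨M', s.reg⟩ T₂ R Q) : Sv L (c₁ ;; c₂) s (T₁ + T₂) R Q := by
  have := Sv.seq (Sv.mono (Sv.of_ev (Q := fun s' => Sv L c₂ s' T₂ R Q)
    (Ev.mono h₁.frame fun M' h => h₂ M' h.1 h.2)) fun _ h => h)
  rwa [zero_add] at this

open Classical in
-- At most `4K ⌈m/g⌉` samples are kept and each needs `g` queries, so a stage makes at most `12Km`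
-- queries for any width.
theorem sv_stageCmd {g n D : ℕ} {s : State X} (hs : IsStageState L I x acc N P S K g n s) (hg : 1 ≤ g)
    (hgm : g ≤ 2 * m) (hK : 0 ≤ K) (hD : 12 * K * m ≤ D) :
    Sv L stageCmd s (6 * N + 10 * (D + 2)) 1 fun s' => ∃ n' ≤ n,
      IsStageState L I x acc N P S K (2 * g) n' s' ∧
      (n' = n ∨ 4 * K * ⌈(m : ℝ) / g⌉₊ < aliveCount L I x acc g (n' + 1)) ∧
      s'.mem 22 0 = max (s.mem 22 0)
        (P * S / m * (aliveCount L I x acc g n' / (n' * ⌈(m : ℝ) / g⌉₊))) := by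
  have hg0 : (0 : ℝ) < g := by exact_mod_cast hg
  have hgm' : (g : ℝ) ≤ 2 * m := by exact_mod_cast hgm
  have hm0 : (0 : ℝ) < m := by linarith
  set b : ℕ := ⌈(m : ℝ) / g⌉₊ with hb
  -- Rounding up costs at most `g ≤ 2m`, the largest width allowed here.
  have hbg : (b : ℝ) * g ≤ 3 * m := by
    have := (Nat.ceil_lt_add_one (show 0 ≤ (m : ℝ) / g by positivity)).le
    have h1 := mul_le_mul_of_nonneg_right this hg0.le
    rw [add_mul, div_mul_cancel₀ _ hg0.ne'] at h1
    linarith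
  have e21 : (0 - Term.floor (0 - var 2 / var 20)).eval s.mem = (b : ℝ) := by
    rw [hb, ← neg_floor_neg (by positivity)]
    simp [hs.two, hs.width]
  have hreg := hs.reg
  have hal := hs.alive
  have hle := hs.le
  refine Sv.le (Sv.seq_ev (Q₁ := fun M' => M' 21 0 = b) (Ev.put (by rw [e21, Memory.write_same])) ?_ :
    Sv L stageCmd s (1 + ((6 * N + 3) + (3 + ((5 * D + 2) + ((D + 1) + ((4 * D + 2) + 1)))))) 1 _)
    (by omega) (by omega)
  intro M₀ h21 f₀
  refine Sv.seq_ev (Ev.le (ev_scanCmd (al := Alive L I x acc g) (n := n) (B := 4 * K * b) (by positivity)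
    ?_ ?_ ?_) (by omega)) ?_
  · exact (congrFun (f₀ 23 (by decide)) 0).trans hs.count
  · intro t ht
    exact (congrFun (f₀ 17 (by decide)) t).trans (hal t ht)
  · change 4 * M₀ 13 0 * M₀ 21 0 = _
    rw [f₀ 13 (by decide), hs.thirteen, h21]
  rintro M₁ ⟨n', a, f, hn', e23, e24, ⟨hf, ha, himg⟩, haB, hor⟩ f₁
  change ∀ a, _ → M₁ a = M₀ a at f₁
  have hag : a * g ≤ D := by
    have h1 := mul_le_mul_of_nonneg_right haB hg0.le
    have h2 := mul_le_mul_of_nonneg_left hbg (show 0 ≤ 4 * K by positivity)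
    have : ((a * g : ℕ) : ℝ) ≤ D := by push_cast; linarith
    exact_mod_cast this
  have hfm : ∀ k < a, f k < n' ∧ Alive L I x acc g (f k) := fun k hk => by
    have := himg ▸ Finset.mem_image_of_mem f (Finset.mem_range.2 hk)
    simpa using this
  have g₁ : ∀ b, b ≠ 21 → scanCmd.keeps b = true → M₁ b = s.mem b := fun b hb hb' =>
    (f₁ b hb').trans (f₀ b (by simpa [Cmd.put, Cmd.keeps] using hb))
  refine Sv.seq_ev ev_estimateCmd ?_
  intro M₂ e22 f₂
  change ∀ a, _ → M₂ a = M₁ a at f₂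
  change M₂ 22 0 = max (M₁ 22 0) (M₁ 6 0 * M₁ 5 0 / M₁ 2 0 * (M₁ 24 0 / (M₁ 23 0 * M₁ 21 0))) at e22
  rw [g₁ 22 (by decide) (by decide), g₁ 6 (by decide) (by decide), g₁ 5 (by decide) (by decide),
    g₁ 2 (by decide) (by decide), e24, e23, f₁ 21 (by decide), h21, hs.six, hs.five, hs.two, ha] at e22
  have g₂ : ∀ b, b ≠ 21 → scanCmd.keeps b = true → estimateCmd.keeps b = true → M₂ b = s.mem b :=
    fun b hb hb' hb'' => (f₂ b hb'').trans (g₁ b hb hb')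
  have e24' : M₂ 24 0 = a := by rw [f₂ 24 (by decide), e24]
  have e20' : M₂ 20 0 = g := by rw [g₂ 20 (by decide) (by decide) (by decide), hs.width]
  have hf' : ∀ k < a, M₂ 25 k = f k := fun k hk => by rw [f₂ 25 (by decide), hf k hk]
  refine Sv.seq_ev (Ev.le (ev_queryCmd (I := I) hg e24' e20' hf' fun k hk => ?_) (by nlinarith)) ?_
  · change M₂ 15 (f k) = _
    rw [g₂ 15 (by decide) (by decide) (by decide), hs.index _ (by have := (hfm k hk).1; omega)]
  intro M₃ hq f₃
  change ∀ a, _ → M₃ a = M₂ a at f₃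
  have hcnt : (var 24 * var 20).nat M₃ = a * g := by
    simp only [Term.nat, eval_mul, eval_var, f₃ 24 (by decide), f₃ 20 (by decide), e24', e20']
    exact_mod_cast Nat.floor_natCast (R := ℝ) (a * g)
  refine Sv.le (Sv.seq (Sv.le (Sv.ask ?_) (T' := D + 1) (R' := 1) (by rw [hcnt]; omega) le_rfl))
    le_rfl (add_zero 1).le
  change Sv L _ (askAll L 27 28 29 ((var 24 * var 20).nat M₃) _) _ 0 _
  rw [hcnt]
  obtain ⟨ans, hans⟩ : ∃ ans : ℕ → Prop, ans = fun j => ∃ h : I (f (j / g)) + g + j % g < m,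
    x (f (j / g)) ∈ L.sets ⟨I (f (j / g)) + g + j % g, h⟩ := ⟨_, rfl⟩
  set s₄ := askAll L 27 28 29 (a * g) ⟨M₃, s.reg⟩ with hs₄
  have f₄ : ∀ b ≠ 29, s₄.mem b = M₃ b := fun b hb => by
    funext j
    simp [hs₄, askAll, hb]
  have e29 : ∀ j < a * g, s₄.mem 29 j = if ans j then 1 else 0 := fun j hj => by
    have hja : j / g < a := (Nat.div_lt_iff_lt_mul hg).2 hj
    have hN : f (j / g) < N := by have := (hfm _ hja).1; omega
    simp only [hs₄, askAll, hj, and_self, if_true, answer, (hq j hj).1, (hq j hj).2, Nat.floor_natCast,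
      hreg _ hN, Option.some.injEq, hans]
    simp
  refine Sv.seq_ev (Ev.le (ev_killCmd (ans := ans) (a := a) hg ?_ ?_ (f := f) ?_ e29) (by nlinarith)) ?_
  · rw [f₄ 24 (by decide), f₃ 24 (by decide), e24']
  · rw [f₄ 20 (by decide), f₃ 20 (by decide), e20']
  · intro k hk
    rw [f₄ 25 (by decide), f₃ 25 (by decide), hf' k hk]
  intro M₅ e17 f₅
  have g₅ : ∀ b, b ≠ 21 → b ≠ 29 → scanCmd.keeps b = true → estimateCmd.keeps b = true →
      queryCmd.keeps b = true → killCmd.keeps b = true → M₅ b = s.mem b := fun b h1 h2 h3 h4 h5 h6 => by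
    rw [f₅ b h6, f₄ b h2, f₃ b h5, g₂ b h1 h3 h4]
  have e20 : (2 * var 20).eval M₅ = ((2 * g : ℕ) : ℝ) := by
    simp [g₅ 20 (by decide) (by decide) (by decide) (by decide) (by decide) (by decide), hs.width]
  refine Sv.of_ev (Ev.put ?_)
  rw [e20]
  refine ⟨n', hn', ⟨?_, ?_, ?_, ?_, ?_, hreg, by omega, Memory.write_same M₅ 20 0 _, ?_, ?_⟩, hor, ?_⟩
  · simp [Memory.write_ne, g₅ 2 (by decide) (by decide) (by decide) (by decide) (by decide) (by decide), hs.two]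
  · simp [Memory.write_ne, g₅ 5 (by decide) (by decide) (by decide) (by decide) (by decide) (by decide), hs.five]
  · simp [Memory.write_ne, g₅ 6 (by decide) (by decide) (by decide) (by decide) (by decide) (by decide), hs.six]
  · simp [Memory.write_ne, g₅ 13 (by decide) (by decide) (by decide) (by decide) (by decide) (by decide),
      hs.thirteen]
  · intro t ht
    simp [Memory.write_ne, g₅ 15 (by decide) (by decide) (by decide) (by decide) (by decide) (by decide),
      hs.index t ht]
  · simp [Memory.write_ne, f₅ 23 (by decide), f₄ 23 (by decide), f₃ 23 (by decide), f₂ 23 (by decide), e23]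
  · intro t ht
    have h17 : s₄.mem 17 t = if Alive L I x acc g t then 1 else 0 := by
      rw [f₄ 17 (by decide), f₃ 17 (by decide), g₂ 17 (by decide) (by decide) (by decide), hal t (by omega)]
    change M₅.write 20 0 ((2 * g : ℕ) : ℝ) 17 t = _
    rw [Memory.write_ne _ _ _ (by decide), e17 t, h17]
    by_cases hA : Alive L I x acc g t
    · obtain ⟨k, hk, rfl⟩ : ∃ k < a, f k = t := by
        have : t ∈ (Finset.range a).image f := by rw [himg]; simp [ht, hA]
        simpa using this
      have hiff : (∃ j < a * g, ans j ∧ f (j / g) = f k) ↔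
          ∃ j < g, ∃ h : I (f k) + g + j < m, x (f k) ∈ L.sets ⟨I (f k) + g + j, h⟩ := by
        constructor
        · rintro ⟨j, hj, h', hjk⟩
          simp only [hans, hjk] at h'
          obtain ⟨h, hx⟩ := h'
          exact ⟨j % g, Nat.mod_lt _ hg, h, hx⟩
        · rintro ⟨j, hj, h, hx⟩
          have h1 : (k * g + j) / g = k := by
            rw [mul_comm, Nat.mul_add_div hg, Nat.div_eq_of_lt hj, add_zero]
          have h2 : (k * g + j) % g = j := by
            rw [mul_comm, Nat.mul_add_mod, Nat.mod_eq_of_lt hj]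
          have h3 : k * g + j < a * g := by nlinarith
          refine ⟨k * g + j, h3, ?_, by rw [h1]⟩
          simp only [hans, h1, h2]
          exact ⟨h, hx⟩
      rw [alive_two_mul_iff, if_pos hA]
      simp only [hiff, hA, true_and]
      by_cases hE : ∃ j < g, ∃ h : I (f k) + g + j < m, x (f k) ∈ L.sets ⟨I (f k) + g + j, h⟩
      · rw [if_pos hE, if_neg (not_not.2 hE)]
      · rw [if_neg hE, if_pos hE]
    · rw [if_neg hA, if_neg (fun h => hA (alive_two_mul_iff.1 h).1)]
      simp
  · simp only [Memory.write_ne _ _ _ (show 22 ≠ 20 by decide), f₅ 22 (by decide), f₄ 22 (by decide),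
      f₃ 22 (by decide), e22, aliveCount]

open Classical in
-- The tail bounds appear as premises inside the postcondition, because the limits on time and
-- rounds have to hold for all outcomes. If they hold, every estimate is at most `1 + ε` times the
-- true value, and the one of stage `s₀` is at least `1 - ε` times it; so is the maximum.
theorem sv_stagesCmd {D nmin s₀ : ℕ} {q ε : ℝ} {s : State X} (h2 : s.mem 2 0 = m) (h5 : s.mem 5 0 = S)
    (h6 : s.mem 6 0 = P) (h13 : s.mem 13 0 = K) (h14 : s.mem 14 0 = N) (h15 : ∀ t < N, s.mem 15 t = I t)
    (h17 : ∀ t < N, s.mem 17 t = if acc t then 1 else 0) (hreg : ∀ t < N, s.reg t = some (x t))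
    (hK : 0 ≤ K) (hD : 12 * K * m ≤ D) (hm : 1 ≤ m) (hS : 0 ≤ S) (hn : 1 ≤ nmin) (hnN : nmin ≤ N) (hq : 0 ≤ q)
    (hε : 0 ≤ ε) (hnK : (1 + ε) * (q * nmin) ≤ 4 * K) (hs₀ : s₀ < Nat.clog 2 (2 * m)) :
    Sv L stagesCmd s (Nat.clog 2 (2 * m) * (6 * N + 10 * (D + 2) + 1) + 5) (Nat.clog 2 (2 * m)) fun s' =>
      (∀ k < Nat.clog 2 (2 * m), ∀ n, nmin ≤ n → n ≤ N →
        (aliveCount L I x acc (2 ^ k) n : ℝ) ≤ (1 + ε) * (n * (q * ⌈(m : ℝ) / (2 ^ k : ℕ)⌉₊))) →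
      (∀ n, nmin ≤ n → n ≤ N →
        (1 - ε) * (n * (q * ⌈(m : ℝ) / (2 ^ s₀ : ℕ)⌉₊)) ≤ (aliveCount L I x acc (2 ^ s₀) n : ℝ)) →
      s'.mem 0 0 ∈ Set.Icc ((1 - ε) * (P * S / m * q)) ((1 + ε) * (P * S / m * q)) := by
  set Lst := Nat.clog 2 (2 * m) with hLst
  set upper : Prop := ∀ k < Lst, ∀ n, nmin ≤ n → n ≤ N →
        (aliveCount L I x acc (2 ^ k) n : ℝ) ≤ (1 + ε) * (n * (q * ⌈(m : ℝ) / (2 ^ k : ℕ)⌉₊)) with hupper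
  set lower : Prop := ∀ n, nmin ≤ n → n ≤ N →
        (1 - ε) * (n * (q * ⌈(m : ℝ) / (2 ^ s₀ : ℕ)⌉₊)) ≤ (aliveCount L I x acc (2 ^ s₀) n : ℝ) with hlower
  have hm0 : (0 : ℝ) < m := by exact_mod_cast hm
  set V := P * S / m * q with hV
  have hW : 0 ≤ P * S / m := by positivity
  have hmL : 2 * m ≤ 2 ^ Lst := Nat.le_pow_clog (by norm_num) _
  refine Sv.le (Sv.seq_ev (Q₁ := fun M' => M' 20 0 = 1) (Ev.put (by simp)) ?_ :
    Sv L stagesCmd s (1 + (1 + (1 + ((Lst * (6 * N + 10 * (D + 2) + 1) + 1) + 1)))) (Lst * 1 + 0) _)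
    (by omega) (by omega)
  intro M₁ e20 f₁
  refine Sv.seq_ev (Q₁ := fun M' => M' 22 0 = 0) (Ev.put (by simp)) ?_
  intro M₂ e22 f₂
  change ∀ a, _ → M₂ a = M₁ a at f₂
  refine Sv.seq_ev (Q₁ := fun M' => M' 23 0 = N) (Ev.put ?_) ?_
  · rw [Memory.write_same]
    simp [f₂ 14 (by decide), f₁ 14 (by decide), h14]
  intro M₃ e23 f₃
  change ∀ a, _ → M₃ a = M₂ a at f₃
  have g₃ : ∀ a, a ≠ 20 → a ≠ 22 → a ≠ 23 → M₃ a = s.mem a := fun a h1 h2 h3 => by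
    rw [f₃ a (by simpa [Cmd.put, Cmd.keeps] using h3), f₂ a (by simpa [Cmd.put, Cmd.keeps] using h2),
      f₁ a (by simpa [Cmd.put, Cmd.keeps] using h1)]
  refine Sv.seq (Sv.loop (fun k s' => ∃ j n, k + j = Lst ∧ IsStageState L I x acc N P S K (2 ^ j) n s' ∧
    (upper → nmin ≤ n ∧ s'.mem 22 0 ≤ (1 + ε) * V ∧ (lower → s₀ < j → (1 - ε) * V ≤ s'.mem 22 0)))
    ?_ ?_ ?_ Lst ?_)
  · rintro s' ⟨j, n, hj, hs', -⟩
    obtain rfl : j = Lst := by omega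
    have : (2 * (m : ℝ)) ≤ (2 ^ Lst : ℕ) := by exact_mod_cast hmL
    simp only [eval_mul, eval_var, hs'.two, eval_add, hs'.width, eval_ofNat]
    simp at this ⊢
    linarith
  · rintro k s' ⟨j, n, hj, hs', hgood⟩ hlt
    have hg1 : 1 ≤ 2 ^ j := Nat.one_le_two_pow
    have hgm : 2 ^ j ≤ 2 * m := by
      simp [hs'.two, hs'.width] at hlt
      have : ((2 ^ j : ℕ) : ℝ) ≤ (2 * m : ℕ) := by push_cast; linarith
      exact_mod_cast this
    refine Sv.mono (sv_stageCmd hs' hg1 hgm hK hD) ?_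
    rintro s'' ⟨n', hn', hs'', hor, hest⟩
    refine ⟨j + 1, n', by omega, by rw [pow_succ, mul_comm]; exact hs'', fun hup => ?_⟩
    obtain ⟨hnn, hbest, hlow⟩ := hgood hup
    have hjL : j < Lst := by omega
    set b : ℕ := ⌈(m : ℝ) / (2 ^ j : ℕ)⌉₊ with hb
    have hb0 : (0 : ℝ) < b := by
      have : 0 < b := Nat.ceil_pos.2 (by positivity)
      exact_mod_cast this
    -- A cut below `nmin` would mean that more than `4Kb` of the first `nmin` samples are alive,
    -- against the upper tail bound and `hnK`.
    have hnn' : nmin ≤ n' := by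
      rcases hor with rfl | hor
      · exact hnn
      by_contra hlt
      have h1 : aliveCount L I x acc (2 ^ j) (n' + 1) ≤ aliveCount L I x acc (2 ^ j) nmin :=
        aliveCount_mono (by omega)
      have h2 := hup j hjL nmin le_rfl hnN
      have h3 : (aliveCount L I x acc (2 ^ j) (n' + 1) : ℝ) ≤ aliveCount L I x acc (2 ^ j) nmin := by
        exact_mod_cast h1
      have h4 := mul_le_mul_of_nonneg_right hnK hb0.le
      linarith [hor, h2, h3, h4]
    have hnle : n' ≤ N := hs''.le
    have hn0 : (0 : ℝ) < n' := by exact_mod_cast (by omega : 0 < n')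
    refine ⟨hnn', ?_, fun hlo hsj => ?_⟩
    · rw [hest]
      refine max_le hbest ?_
      have h1 : (aliveCount L I x acc (2 ^ j) n' : ℝ) / (n' * b) ≤ (1 + ε) * q := by
        rw [div_le_iff₀ (by positivity)]
        have := hup j hjL n' hnn' hnle
        linarith
      have := mul_le_mul_of_nonneg_left h1 hW
      rw [hV]; linarith
    · rw [hest]
      rcases Nat.lt_succ_iff_lt_or_eq.1 hsj with h | rfl
      · exact (hlow hlo h).trans (le_max_left _ _)
      · refine le_trans ?_ (le_max_right _ _)
        have h1 : (1 - ε) * q ≤ (aliveCount L I x acc (2 ^ s₀) n' : ℝ) / (n' * b) := by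
          rw [le_div_iff₀ (by positivity)]
          have := hlo n' hnn' hnle
          linarith
        have := mul_le_mul_of_nonneg_left h1 hW
        rw [hV]; linarith
  · rintro k s' ⟨j, n, hj, hs', hgood⟩ hlt
    refine Sv.of_ev (Ev.put ?_)
    intro hup hlo
    obtain ⟨-, hbest, hlow⟩ := hgood hup
    have hjL : Lst ≤ j := by
      refine Nat.clog_le_of_le_pow ?_
      simp [hs'.two, hs'.width] at hlt
      have : ((2 * m : ℕ) : ℝ) < (2 ^ j + 1 : ℕ) := by push_cast; linarith
      have : 2 * m < 2 ^ j + 1 := by exact_mod_cast this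
      omega
    simp only [Memory.write_same, eval_var]
    exact ⟨hlow hlo (by omega), hbest⟩
  · refine ⟨0, N, by omega, ⟨?_, ?_, ?_, ?_, ?_, hreg, le_rfl, ?_, e23, ?_⟩, fun _ => ⟨hnN, ?_, fun _ h => by omega⟩⟩
    · simp only [g₃ 2 (by decide) (by decide) (by decide), h2]
    · simp only [g₃ 5 (by decide) (by decide) (by decide), h5]
    · simp only [g₃ 6 (by decide) (by decide) (by decide), h6]
    · simp only [g₃ 13 (by decide) (by decide) (by decide), h13]
    · intro t ht
      simp only [g₃ 15 (by decide) (by decide) (by decide), h15 t ht]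
    · simp only [f₃ 20 (by decide), f₂ 20 (by decide), e20]
      simp
    · intro t ht
      simp only [g₃ 17 (by decide) (by decide) (by decide), h17 t ht]
      have : Alive L I x acc (2 ^ 0) t ↔ acc t :=
        ⟨fun h => h.1, fun h => ⟨h, fun j hj h1 h2 => by omega⟩⟩
      simp only [this]
    · change M₃ 22 0 ≤ _
      rw [f₃ 22 (by decide), e22]
      positivity

end RandRAM


/-! ### The joint law of the selected sets and of the drawn elements -/

namespace RandRAM
open Term

variable {X : Type} {m : ℕ} {L : SetList X m}

/-- The probability to accept a piece of a set with weight `w`. -/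
noncomputable def acceptProb (w : ℝ) : ℝ≥0∞ := ENNReal.ofReal (w / (⌊w⌋₊ + 1 : ℕ))

theorem acceptProb_le_one {w : ℝ} : acceptProb w ≤ 1 := by
  refine ENNReal.ofReal_le_one.2 ?_
  rw [div_le_one (by positivity)]
  push_cast
  exact (Nat.lt_floor_add_one w).le

/-- The mean of `H i a` for the set `i` of a random piece, where `a` tells whether it is accepted. -/
noncomputable def pieceMean (P : ℕ) (I : ℕ → ℕ) (wt : ℕ → ℝ) (H : ℕ → ℝ → ℝ≥0∞) : ℝ≥0∞ :=
  (∑ u ∈ Finset.range P, (acceptProb (wt (I u)) * H (I u) 1 + (1 - acceptProb (wt (I u))) * H (I u) 0)) / P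

/-- Independence is expressed by the factorisation of expectations of products `∏ H t`, one factor
for each sample. The products over the samples still to come are replaced by their means in the
loop. -/
theorem pr_pickCmd {M : Memory} {N P : ℕ} {I : ℕ → ℕ} {wt : ℕ → ℝ} (h6 : M 6 0 = P) (hP : 0 < P)
    (h14 : M 14 0 = N) (h9 : ∀ u < P, M 9 u = I u ∧ I u < m) (hwt : ∀ i, M 1 i * M 2 0 / M 5 0 = wt i)
    (hwt0 : ∀ i, 0 ≤ wt i) :
    Pr L pickCmd M (7 * N + 2)
      (fun M' => ∀ t < N, (∃ i < m, M' 15 t = i) ∧ M' 16 t = t ∧ (M' 17 t = 0 ∨ M' 17 t = 1))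
      (fun (H : ℕ → ℕ → ℝ → ℝ≥0∞) M' => ∏ t ∈ Finset.range N, H t ⌊M' 15 t⌋₊ (M' 17 t))
      (fun H => ∏ t ∈ Finset.range N, pieceMean P I wt (H t)) := by
  refine Pr.le (Pr.forUp N (T := 5) (fun k M' => ∀ t < k, (∃ i < m, M' 15 t = i) ∧ M' 16 t = t ∧
      (M' 17 t = 0 ∨ M' 17 t = 1))
    (fun k H M' => (∏ t ∈ Finset.range k, H t ⌊M' 15 t⌋₊ (M' 17 t)) *
      ∏ t ∈ Finset.Ico k N, pieceMean P I wt (H t)) (by decide) ?_ ?_ ?_ ?_ ?_)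
    (?_ : N * (5 + 2) + 2 ≤ _)
  · intro t ht; omega
  · intro M' hf
    simp [hf 14 (by decide) (by decide), h14]
  · intro k hk M' hk' hf hI
    have g1 := hf 1 (by decide) (by decide)
    have g2 := hf 2 (by decide) (by decide)
    have g5 := hf 5 (by decide) (by decide)
    have g6 := hf 6 (by decide) (by decide)
    have g9 := hf 9 (by decide) (by decide)
    have hP1 : (var 6 - 1).nat M' + 1 = P := by
      have : (P : ℝ) - 1 = (P - 1 : ℕ) := by rw [Nat.cast_sub hP]; simp
      simp only [Term.nat, eval_sub, eval_var, g6, h6, eval_ofNat, Nat.cast_one, this, Nat.floor_natCast]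
      omega
    have hz : (0 : Term).nat M' = 0 := by simp [Term.nat]
    refine Pr.seq (T₁ := 1) (T₂ := 4)
      (Q₁ := fun M'' => ∃ u < P, M'' = M'.write 18 0 (u : ℕ))
      (f₁ := fun H M'' => (∏ t ∈ Finset.range k, H t ⌊M' 15 t⌋₊ (M' 17 t)) *
        (acceptProb (wt (I ⌊M'' 18 0⌋₊)) * H k (I ⌊M'' 18 0⌋₊) 1 +
          (1 - acceptProb (wt (I ⌊M'' 18 0⌋₊))) * H k (I ⌊M'' 18 0⌋₊) 0) *
        ∏ t ∈ Finset.Ico (k + 1) N, pieceMean P I wt (H t)) (Pr.unif ?_ ?_) ?_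
    · intro u hu; exact ⟨u, by omega, by rw [hz]⟩
    · intro H
      rw [hP1, Finset.prod_eq_prod_Ico_succ_bot hk]
      simp only [hz, Memory.write_same, Nat.floor_natCast]
      rw [← Finset.sum_mul, ← Finset.mul_sum, pieceMean, ENNReal.div_eq_inv_mul, ENNReal.div_eq_inv_mul]
      ring
    rintro M'' ⟨u, hu, rfl⟩
    obtain ⟨hu9, hum⟩ := h9 u hu
    have e15 : (Term.read 9 (var 18)).eval (M'.write 18 0 (u : ℕ)) = (I u : ℝ) := by
      simp [Memory.write_ne, g9, hu9]
    have e19 : (var 19).nat (M'.write 18 0 (u : ℕ)) = k := by simp [Term.nat, Memory.write_ne, hk']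
    refine Pr.seq_ev (T₁ := 1) (T₂ := 3) (Ev.set ?_)
    rw [e15, e19]
    refine Pr.seq_ev (T₁ := 1) (T₂ := 2) (Ev.set ?_)
    have e19' : (var 19).nat ((M'.write 18 0 (u : ℕ)).write 15 k (I u : ℝ)) = k := by
      simp [Term.nat, Memory.write_ne, hk']
    have e16 : (var 19).eval ((M'.write 18 0 (u : ℕ)).write 15 k (I u : ℝ)) = k := by
      simp [Memory.write_ne, hk']
    rw [e19', e16]
    refine Pr.seq_ev (T₁ := 1) (T₂ := 1) (Ev.put ?_)
    have e8 : (Term.read 1 (.read 9 (var 18)) * var 2 / var 5).eval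
        (((M'.write 18 0 (u : ℕ)).write 15 k (I u : ℝ)).write 16 k k) = wt (I u) := by
      simp [Memory.write_ne, g9, hu9, g1, g2, g5, hwt]
    rw [e8]
    set M₁ := ((((M'.write 18 0 (u : ℕ)).write 15 k (I u : ℝ)).write 16 k k).write 8 0 (wt (I u))) with hM₁
    have e17 : (var 19).nat M₁ = k := by simp [hM₁, Term.nat, Memory.write_ne, hk']
    have ep : (var 8 / (Term.floor (var 8) + 1)).eval M₁ = wt (I u) / (⌊wt (I u)⌋₊ + 1 : ℕ) := by
      simp [hM₁, natCast_floor_eq_intCast_floor (hwt0 _)]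
    have hQ : ∀ y : ℝ, (y = 0 ∨ y = 1) → ∀ t < k + 1,
        (∃ i < m, ((M₁.write 17 k y).write 19 0 ((k + 1 : ℕ) : ℝ)) 15 t = i) ∧
        ((M₁.write 17 k y).write 19 0 ((k + 1 : ℕ) : ℝ)) 16 t = t ∧
        (((M₁.write 17 k y).write 19 0 ((k + 1 : ℕ) : ℝ)) 17 t = 0 ∨
          ((M₁.write 17 k y).write 19 0 ((k + 1 : ℕ) : ℝ)) 17 t = 1) := by
      intro y hy t ht
      by_cases htk : t = k
      · subst htk
        refine ⟨⟨I u, hum, ?_⟩, ?_, ?_⟩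
        · simp [hM₁, Memory.write_ne]
        · simp [hM₁, Memory.write_ne]
        · simpa [hM₁, Memory.write_ne] using hy
      · simpa [hM₁, Memory.write_ne, Memory.write_self, htk] using hI t (by omega)
    have hF : ∀ (y : ℝ) (H : ℕ → ℕ → ℝ → ℝ≥0∞), ∏ t ∈ Finset.range (k + 1),
        H t ⌊((M₁.write 17 k y).write 19 0 ((k + 1 : ℕ) : ℝ)) 15 t⌋₊
          (((M₁.write 17 k y).write 19 0 ((k + 1 : ℕ) : ℝ)) 17 t) =
        (∏ t ∈ Finset.range k, H t ⌊M' 15 t⌋₊ (M' 17 t)) * H k (I u) y := by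
      intro y H
      rw [Finset.prod_range_succ]
      congr 1
      · refine Finset.prod_congr rfl fun t ht => ?_
        have : t ≠ k := (Finset.mem_range.1 ht).ne
        simp [hM₁, Memory.write_ne, Memory.write_self, this]
      · simp [hM₁, Memory.write_ne]
    refine Pr.toss ?_ ?_ ?_
    · rw [e17]; exact hQ 1 (Or.inr rfl)
    · rw [e17]; exact hQ 0 (Or.inl rfl)
    · intro H
      rw [ep, e17]
      simp only [hF]
      change _ = min 1 (acceptProb _) * _ + (1 - min 1 (acceptProb _)) * _
      rw [min_eq_right acceptProb_le_one, Memory.write_same, Nat.floor_natCast]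
      ring
  · intro M' _ _ hI
    refine ⟨hI, fun H => ?_⟩
    rw [Finset.Ico_self, Finset.prod_empty, mul_one]
  · intro H
    rw [Finset.range_zero, Finset.prod_empty, one_mul, Finset.range_eq_Ico]
  · omega

/-- Request `t` writes to its own register `t`, so later draws do not disturb earlier ones and
products over the registers factorise. -/
theorem pr_draw_aux (q h : ℕ) {s : State X} (N : ℕ) (idx : ℕ → Fin m) (hq : ∀ t < N, s.mem q t = (idx t : ℕ))
    (hh : ∀ t < N, s.mem h t = t) :
    (∀ s' ∈ (drawAll L q h N s).support, s'.mem = s.mem ∧ ∀ t < N, ∃ x, s'.reg t = some x) ∧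
    ∀ H : ℕ → Option X → ℝ≥0∞,
      (drawAll L q h N s).ev (fun s' => ∏ t ∈ Finset.range N, H t (s'.reg t)) =
        ∏ t ∈ Finset.range N, (L.gen (idx t)).ev fun x => H t (some x) := by
  induction N with
  | zero => exact ⟨fun s' hs' => ⟨drawAll_mem _ _ _ _ _ hs', by simp⟩, by simp [drawAll]⟩
  | succ n ih =>
    obtain ⟨ih₁, ih₂⟩ := ih (fun t ht => hq t (by omega)) fun t ht => hh t (by omega)
    have hone : ∀ s', drawOne L ⌊s.mem q n⌋₊ ⌊s.mem h n⌋₊ s' =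
        (L.gen (idx n)).map fun x => ⟨s'.mem, Function.update s'.reg n (some x)⟩ := by
      intro s'
      rw [hq n (by omega), hh n (by omega), Nat.floor_natCast, Nat.floor_natCast, drawOne,
        dif_pos (idx n).2]
    simp only [drawAll, hone]
    refine ⟨?_, fun H => ?_⟩
    · intro s' hs'
      simp only [PMF.mem_support_bind_iff, PMF.mem_support_map_iff] at hs'
      obtain ⟨s₁, hs₁, x, -, rfl⟩ := hs'
      refine ⟨(ih₁ s₁ hs₁).1, fun t ht => ?_⟩
      by_cases htn : t = n
      · subst htn; exact ⟨x, by simp⟩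
      · obtain ⟨y, hy⟩ := (ih₁ s₁ hs₁).2 t (by omega)
        exact ⟨y, by simp [htn, hy]⟩
    · rw [PMF.ev_bind, Finset.prod_range_succ, ← ih₂, ← PMF.ev_mul_const]
      refine PMF.ev_congr fun s' _ => ?_
      rw [PMF.ev_map, ← PMF.ev_const_mul]
      refine PMF.ev_congr fun x _ => ?_
      simp only [Function.comp, Finset.prod_range_succ, Function.update_self]
      congr 1
      refine Finset.prod_congr rfl fun t ht => ?_
      rw [Function.update_of_ne (Finset.mem_range.1 ht).ne]

end RandRAM


/-! ### Survival probabilities and the size of the union -/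

namespace RandRAM

variable {X : Type} {m : ℕ}

/-- The elements of set `i` that do not belong to the next `g - 1` sets. -/
def survivors (L : SetList X m) (g : ℕ) (i : Fin m) : Set X :=
  {x | ∀ j : Fin m, i < j → (j : ℕ) < i + g → x ∉ L.sets j}

/-- The probability that a random element of set `i` does not belong to the next `g - 1` sets. -/
noncomputable def survival (L : SetList X m) (g : ℕ) (i : Fin m) : ℝ :=
  ((L.gen i).toOuterMeasure (survivors L g i)).toReal

variable {L : SetList X m} {aL aR bL bR : ℝ} {size : Fin m → ℝ} {g : ℕ}

theorem survival_le_one (i : Fin m) : survival L g i ≤ 1 := by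
  refine ENNReal.toReal_le_of_le_ofReal zero_le_one ?_
  rw [ENNReal.ofReal_one, PMF.toOuterMeasure_apply]
  calc ∑' x, (survivors L g i).indicator (L.gen i) x ≤ ∑' x, L.gen i x :=
        ENNReal.tsum_le_tsum fun x => Set.indicator_le_self _ _ x
    _ = 1 := (L.gen i).tsum_coe

theorem survival_nonneg (i : Fin m) : 0 ≤ survival L g i := ENNReal.toReal_nonneg

theorem survival_one (i : Fin m) : survival L 1 i = 1 := by
  have : survivors L 1 i = Set.univ := by
    refine Set.eq_univ_of_forall fun x j h1 h2 => ?_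
    have : (i : ℕ) < j := h1
    omega
  rw [survival, this, PMF.toOuterMeasure_apply]
  simp [(L.gen i).tsum_coe]

open Classical in
theorem survival_eq_sum {i : Fin m} {F : Finset X} (hF : ↑F = L.sets i) (hsupp : (L.gen i).support ⊆ L.sets i) :
    survival L g i = ∑ x ∈ F.filter (· ∈ survivors L g i), (L.gen i x).toReal := by
  rw [survival, PMF.toOuterMeasure_apply, tsum_eq_sum (s := F.filter (· ∈ survivors L g i)),
    ENNReal.toReal_sum]
  · refine Finset.sum_congr rfl fun x hx => ?_
    rw [Set.indicator_of_mem (Finset.mem_filter.1 hx).2]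
  · exact fun x _ => ne_top_of_le_ne_top ((L.gen i).apply_ne_top x) (Set.indicator_le_self _ _ x)
  · intro x hx
    by_contra h
    refine hx (Finset.mem_filter.2 ⟨?_, Set.mem_of_indicator_ne_zero h⟩)
    rw [← Finset.mem_coe, hF]
    refine hsupp ((L.gen i).mem_support_iff x |>.2 fun h0 => h ?_)
    simp [Set.indicator, h0]

open Classical in
-- `size i` approximates `|A i|` and each element has probability about `1 / |A i|`, so `|A i|`
-- cancels and the number of survivors remains. For an empty set both bounds on the size force it to
-- be zero.
theorem size_mul_survival_mem {i : Fin m} {F : Finset X} (hF : ↑F = L.sets i) (haL : aL < 1) (haR : 0 < aR)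
    (hbL : bL < 1) (h : IsBiasedList aL aR bL bR L.sets size L.gen) :
    size i * survival L g i ∈ Set.Icc
      ((1 - aL) * (1 - bL) * (F.filter (· ∈ survivors L g i)).card)
      ((1 + aR) * (1 + bR) * (F.filter (· ∈ survivors L g i)).card) := by
  obtain ⟨h1, h2, h3⟩ := h i
  have hcard : (L.sets i).ncard = F.card := by rw [← hF, Set.ncard_coe_finset]
  rw [hcard] at h1 h2
  have hs0 : 0 ≤ size i := le_trans (by have := sub_pos.2 hbL; positivity) h1
  rcases (L.sets i).eq_empty_or_nonempty with he | hne
  · have hF0 : F = ∅ := by rw [← Finset.coe_eq_empty, hF, he]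
    rw [hF0, Finset.card_empty, Nat.cast_zero, mul_zero] at h2
    have : size i = 0 := le_antisymm h2 hs0
    simp [this, hF0]
  obtain ⟨hsupp, hG⟩ := h3 hne
  rw [hcard] at hG
  have hF0 : (0 : ℝ) < F.card := by
    have : F.Nonempty := by rw [← Finset.coe_nonempty, hF]; exact hne
    exact_mod_cast this.card_pos
  have hmem : ∀ x ∈ F.filter (· ∈ survivors L g i), x ∈ L.sets i := fun x hx => by
    rw [← hF]; exact (Finset.mem_filter.1 hx).1
  set B := F.filter (· ∈ survivors L g i)
  have hlow : (1 - aL) / F.card * B.card ≤ survival L g i := by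
    rw [survival_eq_sum hF hsupp]
    refine le_trans ?_ (Finset.sum_le_sum fun x hx => (hG x (hmem x hx)).1)
    rw [Finset.sum_const, nsmul_eq_mul]; exact (mul_comm _ _).le
  have hupp : survival L g i ≤ (1 + aR) / F.card * B.card := by
    rw [survival_eq_sum hF hsupp]
    refine le_trans (Finset.sum_le_sum fun x hx => (hG x (hmem x hx)).2) ?_
    rw [Finset.sum_const, nsmul_eq_mul]; exact (mul_comm _ _).le
  constructor
  · calc (1 - aL) * (1 - bL) * B.card = (1 - bL) * F.card * ((1 - aL) / F.card * B.card) := by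
          field_simp
      _ ≤ size i * survival L g i := by
          have := sub_pos.2 haL
          exact mul_le_mul h1 hlow (by positivity) hs0
  · calc size i * survival L g i ≤ (1 + bR) * F.card * ((1 + aR) / F.card * B.card) :=
          mul_le_mul h2 hupp (survival_nonneg i) (hs0.trans h2)
      _ = (1 + aR) * (1 + bR) * B.card := by field_simp

open Classical in
-- In the last set containing `x`, no later set can eliminate it, whatever the width.
theorem one_le_card_survivors {x : X} (hx : x ∈ ⋃ i, L.sets i) :
    1 ≤ (Finset.univ.filter fun i => x ∈ L.sets i ∧ x ∈ survivors L g i).card := by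
  obtain ⟨i₀, hi₀⟩ := Set.mem_iUnion.1 hx
  obtain ⟨i, hi, hmax⟩ := (Finset.univ.filter fun i => x ∈ L.sets i).exists_maximal ⟨i₀, by simpa using hi₀⟩
  refine Finset.card_pos.2 ⟨i, ?_⟩
  simp only [Finset.mem_filter, Finset.mem_univ, true_and] at hi hmax ⊢
  exact ⟨hi, fun j hij _ hj => absurd (hmax hj hij.le) (not_le.2 hij)⟩

open Classical in
-- Divide the indices into blocks of `g` consecutive ones. If `x` belongs to two sets of a block,
-- the later one eliminates it from the earlier one, so it survives at most once per block.
theorem card_survivors_le {x : X} (hg : 0 < g) :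
    (Finset.univ.filter fun i => x ∈ L.sets i ∧ x ∈ survivors L g i).card ≤ ⌈(m : ℝ) / g⌉₊ := by
  rw [← Finset.card_range ⌈(m : ℝ) / g⌉₊]
  have hg0 : (0 : ℝ) < g := by exact_mod_cast hg
  refine Finset.card_le_card_of_injOn (fun i => (i : ℕ) / g) ?_ ?_
  · intro i _
    simp only [Finset.coe_range, Set.mem_Iio]
    refine Nat.lt_ceil.2 (lt_of_le_of_lt Nat.cast_div_le ?_)
    have : ((i : ℕ) : ℝ) < m := by exact_mod_cast i.2
    gcongr
  · intro i hi j hj hij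
    simp only [Finset.coe_filter, Finset.mem_univ, true_and] at hi hj
    have key : ∀ i j : Fin m, x ∈ survivors L g i → x ∈ L.sets j → (i : ℕ) / g = j / g → ¬ i < j := by
      intro i j hi hj hij hlt
      refine hi j hlt ?_ hj
      have h1 := Nat.div_add_mod (i : ℕ) g
      have h2 := Nat.div_add_mod (j : ℕ) g
      have h3 := Nat.mod_lt (j : ℕ) hg
      rw [hij] at h1
      omega
    exact le_antisymm (not_lt.1 (key j i hj.2 hi.1 hij.symm)) (not_lt.1 (key i j hi.2 hj.1 hij))

/-- Double counting of the pairs of an index and a surviving element: each element of the union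
occurs between `1` and `⌈m/g⌉` times. -/
theorem sum_size_mul_survival_mem (hfin : ∀ i, (L.sets i).Finite) (haL : aL < 1) (haR : 0 < aR)
    (hbL : bL < 1) (hbR : 0 < bR) (h : IsBiasedList aL aR bL bR L.sets size L.gen) (hg : 0 < g) :
    ∑ i, size i * survival L g i ∈ Set.Icc
      ((1 - aL) * (1 - bL) * (⋃ i, L.sets i).ncard)
      ((1 + aR) * (1 + bR) * (⋃ i, L.sets i).ncard * ⌈(m : ℝ) / g⌉₊) := by
  classical
  set U := (Set.finite_iUnion hfin).toFinset with hU
  have hmemU : ∀ x, x ∈ U ↔ x ∈ ⋃ i, L.sets i := fun x => by rw [hU, Set.Finite.mem_toFinset]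
  have hcard : (⋃ i, L.sets i).ncard = U.card := Set.ncard_eq_toFinset_card _ _
  set F : Fin m → Finset X := fun i => U.filter (· ∈ L.sets i) with hFdef
  have hF : ∀ i, ↑(F i) = L.sets i := fun i => by
    ext x
    simp only [hFdef, Finset.coe_filter, Set.mem_ofPred_eq, hmemU, and_iff_right_iff_imp]
    exact fun hx => Set.mem_iUnion.2 ⟨i, hx⟩
  have hsum : ∑ i, ((F i).filter (· ∈ survivors L g i)).card =
      ∑ x ∈ U, (Finset.univ.filter fun i => x ∈ L.sets i ∧ x ∈ survivors L g i).card := by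
    refine Eq.trans ?_ (Finset.sum_card_bipartiteAbove_eq_sum_card_bipartiteBelow
      (s := Finset.univ) (t := U) fun (i : Fin m) x => x ∈ L.sets i ∧ x ∈ survivors L g i)
    refine Finset.sum_congr rfl fun i _ => ?_
    rw [Finset.bipartiteAbove, Finset.filter_filter]
  have hlow : U.card ≤ ∑ i, ((F i).filter (· ∈ survivors L g i)).card := by
    rw [hsum, Finset.card_eq_sum_ones]
    exact Finset.sum_le_sum fun x hx => one_le_card_survivors ((hmemU x).1 hx)
  have hupp : ∑ i, ((F i).filter (· ∈ survivors L g i)).card ≤ U.card * ⌈(m : ℝ) / g⌉₊ := by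
    rw [hsum, ← smul_eq_mul]
    exact Finset.sum_le_card_nsmul _ _ _ fun x _ => card_survivors_le hg
  have hmem := fun i => size_mul_survival_mem (g := g) (hF i) haL haR hbL h
  rw [hcard]
  have hL := mul_pos (sub_pos.2 haL) (sub_pos.2 hbL)
  constructor
  · refine le_trans ?_ (Finset.sum_le_sum fun i _ => (hmem i).1)
    rw [← Finset.mul_sum]
    refine mul_le_mul_of_nonneg_left ?_ hL.le
    exact_mod_cast hlow
  · refine (Finset.sum_le_sum fun i _ => (hmem i).2).trans ?_
    rw [← Finset.mul_sum, mul_assoc _ (U.card : ℝ)]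
    refine mul_le_mul_of_nonneg_left ?_ (by positivity)
    exact_mod_cast hupp

/-- One of the widths `2 ^ k` yields the largest normalized estimate, which is close to the size of the union. -/
theorem exists_best_width (hfin : ∀ i, (L.sets i).Finite) (haL : aL < 1) (haR : 0 < aR)
    (hbL : bL < 1) (hbR : 0 < bR) (h : IsBiasedList aL aR bL bR L.sets size L.gen) (hm : 1 ≤ m) :
    ∃ s < Nat.clog 2 (2 * m), ∃ V : ℝ,
      V * ⌈(m : ℝ) / (2 ^ s : ℕ)⌉₊ = ∑ i, size i * survival L (2 ^ s) i ∧
      (∀ k < Nat.clog 2 (2 * m),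
        ∑ i, size i * survival L (2 ^ k) i ≤ V * ⌈(m : ℝ) / (2 ^ k : ℕ)⌉₊) ∧
      V ∈ Set.Icc ((1 - aL) * (1 - bL) * (⋃ i, L.sets i).ncard)
        ((1 + aR) * (1 + bR) * (⋃ i, L.sets i).ncard) ∧ (∑ i, size i) / m ≤ V := by
  have hm0 : (0 : ℝ) < m := by exact_mod_cast hm
  set Lst := Nat.clog 2 (2 * m) with hLst
  have hL1 : 0 < Lst := Nat.clog_pos (by norm_num) (by omega)
  set b : ℕ → ℝ := fun k => (⌈(m : ℝ) / (2 ^ k : ℕ)⌉₊ : ℝ) with hb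
  have hb0 : ∀ k, 0 < b k := fun k => by
    have : 0 < ⌈(m : ℝ) / (2 ^ k : ℕ)⌉₊ := Nat.ceil_pos.2 (by positivity)
    simp only [hb]; exact_mod_cast this
  obtain ⟨s, hs, hmax⟩ := (Finset.range Lst).exists_max_image
    (fun k => (∑ i, size i * survival L (2 ^ k) i) / b k) ⟨0, Finset.mem_range.2 hL1⟩
  have hS := fun k => sum_size_mul_survival_mem hfin haL haR hbL hbR h (g := 2 ^ k) (by positivity)
  refine ⟨s, Finset.mem_range.1 hs, (∑ i, size i * survival L (2 ^ s) i) / b s,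
    div_mul_cancel₀ _ (hb0 s).ne', fun k hk => ?_, ⟨?_, ?_⟩, ?_⟩
  · rw [← div_le_iff₀ (hb0 k)]
    exact hmax k (Finset.mem_range.2 hk)
  -- The largest width is at least `m`, so there is a single block and the lower bound of the double
  -- counting is attained without loss.
  · have hlast : b (Lst - 1) = 1 := by
      have h1 : m ≤ 2 ^ (Lst - 1) := by
        have := Nat.le_pow_clog (b := 2) (by norm_num) (2 * m)
        rw [← hLst, show Lst = Lst - 1 + 1 by omega, pow_succ] at this
        omega
      have h2 : ⌈(m : ℝ) / (2 ^ (Lst - 1) : ℕ)⌉₊ = 1 := by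
        refine le_antisymm (Nat.ceil_le.2 ?_) (Nat.ceil_pos.2 (by positivity))
        rw [Nat.cast_one, div_le_one (by positivity)]
        exact_mod_cast h1
      simp only [hb, h2, Nat.cast_one]
    have h3 := hmax (Lst - 1) (Finset.mem_range.2 (by omega))
    rw [hlast, div_one] at h3
    exact (hS _).1.trans h3
  · rw [div_le_iff₀ (hb0 s)]
    exact (hS s).2
  -- At width `1` everything survives. This comparison guarantees that `V` is not too small relative
  -- to the total size, hence that the number of samples suffices.
  · have h3 := hmax 0 (Finset.mem_range.2 hL1)
    simp only [pow_zero, survival_one, mul_one, hb, Nat.cast_one, div_one, Nat.ceil_natCast] at h3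
    exact h3

end RandRAM


/-! ### Exponential moments of the number of living samples -/

namespace RandRAM
open Term

variable {X : Type} {m : ℕ} {L : SetList X m}

/-- The mean of `H i a (some x)` for a random element `x` of set `i`. -/
noncomputable def drawMean (L : SetList X m) (H : ℕ → ℝ → Option X → ℝ≥0∞) (i : ℕ) (a : ℝ) : ℝ≥0∞ :=
  if h : i < m then (L.gen ⟨i, h⟩).ev fun x => H i a (some x) else 0

open Classical in
/-- A union bound for programs that start with drawing samples: the expectation of a sum of products
over the samples, which is at least `1` whenever the program fails, bounds the probability of failure. -/
theorem runs_pick_draw {ι : Type*} {M : Memory} {reg : ℕ → Option X} {N P T R : ℕ} {I : ℕ → ℕ} {wt : ℕ → ℝ}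
    {c : Cmd} {G : Set (State X)} (h6 : M 6 0 = P) (hP : 0 < P) (h14 : M 14 0 = N)
    (h9 : ∀ u < P, M 9 u = I u ∧ I u < m) (hwt : ∀ i, M 1 i * M 2 0 / M 5 0 = wt i) (hwt0 : ∀ i, 0 ≤ wt i)
    (A : Finset ι) (co : ι → ℝ≥0∞) (H : ι → ℕ → ℕ → ℝ → Option X → ℝ≥0∞)
    (hrest : ∀ s' : State X, (∀ a, pickCmd.keeps a = true → s'.mem a = M a) →
      (∀ t < N, (∃ i < m, s'.mem 15 t = i) ∧ (s'.mem 17 t = 0 ∨ s'.mem 17 t = 1) ∧ ∃ x, s'.reg t = some x) →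
      Sv L c s' T R fun s'' => s'' ∈ G ∨
        1 ≤ ∑ a ∈ A, co a * ∏ t ∈ Finset.range N, H a t ⌊s'.mem 15 t⌋₊ (s'.mem 17 t) (s'.reg t)) :
    ∃ μ, Runs L (pickCmd ;; .draw (var 14) 15 16 ;; c) ⟨M, reg⟩ (7 * N + 2 + (N + 1 + T)) (1 + R) μ ∧
      1 ≤ μ.toOuterMeasure G +
        ∑ a ∈ A, co a * ∏ t ∈ Finset.range N, pieceMean P I wt (drawMean L (H a t)) := by
  obtain ⟨μ₁, hr, hQ, hf⟩ := (pr_pickCmd (L := L) h6 hP h14 h9 hwt hwt0).frame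
  set Φ : State X → ℝ≥0∞ := fun s' =>
    ∑ a ∈ A, co a * ∏ t ∈ Finset.range N, H a t ⌊s'.mem 15 t⌋₊ (s'.mem 17 t) (s'.reg t) with hΦ
  have hdraw : ∀ M' ∈ μ₁.support,
      (∀ s' ∈ (drawAll L 15 16 N ⟨M', reg⟩).support, s'.mem = M' ∧ ∀ t < N, ∃ x, s'.reg t = some x) ∧
      (drawAll L 15 16 N ⟨M', reg⟩).ev Φ =
        ∑ a ∈ A, co a * ∏ t ∈ Finset.range N, drawMean L (H a t) ⌊M' 15 t⌋₊ (M' 17 t) := by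
    intro M' hM'
    have hM := (hQ M' hM').1
    by_cases hm : 0 < m
    swap
    · have hN : N = 0 := by
        by_contra h
        obtain ⟨⟨i, hi, -⟩, -⟩ := hM 0 (by omega)
        omega
      subst hN
      simp [drawAll, hΦ]
    have hidx : ∀ t, ∃ i : Fin m, t < N → M' 15 t = (i : ℕ) := fun t => by
      by_cases ht : t < N
      · obtain ⟨⟨i, hi, h⟩, -⟩ := hM t ht
        exact ⟨⟨i, hi⟩, fun _ => h⟩
      · exact ⟨⟨0, hm⟩, fun h => absurd h ht⟩
    choose idx hidx using hidx
    obtain ⟨h1, h2⟩ := pr_draw_aux (L := L) 15 16 (s := ⟨M', reg⟩) N idx hidx fun t ht => (hM t ht).2.1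
    refine ⟨h1, ?_⟩
    have : (drawAll L 15 16 N ⟨M', reg⟩).ev Φ = (drawAll L 15 16 N ⟨M', reg⟩).ev fun s' =>
        ∑ a ∈ A, co a * ∏ t ∈ Finset.range N, H a t ⌊M' 15 t⌋₊ (M' 17 t) (s'.reg t) :=
      PMF.ev_congr fun s' hs' => by simp only [hΦ, (h1 s' hs').1]
    rw [this, PMF.ev_sum]
    refine Finset.sum_congr rfl fun a _ => ?_
    rw [PMF.ev_const_mul, h2 fun t o => H a t ⌊M' 15 t⌋₊ (M' 17 t) o]
    congr 1
    refine Finset.prod_congr rfl fun t ht => ?_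
    rw [hidx t (Finset.mem_range.1 ht), Nat.floor_natCast, drawMean, dif_pos (idx t).2]
  -- The continuation is deterministic after the draws. Its final state lies in `G`, or the weight
  -- `Φ` is at least `1`; so the indicator of `G` plus `Φ` is at least `1` for every outcome.
  have hex : ∀ s' : State X, ∃ s'', (∃ M' ∈ μ₁.support, s' ∈ (drawAll L 15 16 N ⟨M', reg⟩).support) →
      Runs L c s' T R (PMF.pure s'') ∧ 1 ≤ (if s'' ∈ G then 1 else 0) + Φ s' := by
    intro s'
    by_cases hs' : ∃ M' ∈ μ₁.support, s' ∈ (drawAll L 15 16 N ⟨M', reg⟩).support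
    · obtain ⟨M', hM', hs⟩ := hs'
      obtain ⟨e, hreg⟩ := (hdraw M' hM').1 s' hs
      obtain ⟨s'', h1, h2⟩ := hrest s' (fun a ha => by rw [e]; exact (hQ M' hM').2 a ha) fun t ht => by
        rw [e]; exact ⟨((hQ M' hM').1 t ht).1, ((hQ M' hM').1 t ht).2.2, hreg t ht⟩
      refine ⟨s'', fun _ => ⟨h1, ?_⟩⟩
      rcases h2 with h2 | h2
      · rw [if_pos h2]; exact le_self_add
      · exact h2.trans le_add_self
    · exact ⟨s', fun h => absurd h hs'⟩
  choose fin hfin using hex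
  refine ⟨(μ₁.map fun M' => (⟨M', reg⟩ : State X)).bind fun s => (drawAll L 15 16 N s).bind fun s' =>
    PMF.pure (fin s'), ?_, ?_⟩
  · have := Runs.seq (L := L) pickCmd (.draw (var 14) 15 16 ;; c) ⟨M, reg⟩ (7 * N + 2) (N + 1 + T) 0 (1 + R) _
      (fun s => (drawAll L 15 16 N s).bind fun s' => PMF.pure (fin s')) (hr reg) ?_
    · rwa [zero_add] at this
    · intro s hs
      simp only [PMF.mem_support_map_iff] at hs
      obtain ⟨M', hM', rfl⟩ := hs
      have hN : (var 14).nat M' = N := by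
        simp [Term.nat, (hQ M' hM').2 14 (by decide), h14]
      refine Runs.seq _ _ _ _ _ _ _ _ _ ?_ fun s' hs' => (hfin s' ⟨M', hM', hs'⟩).1
      have := Runs.draw (L := L) (var 14) 15 16 ⟨M', reg⟩
      rwa [hN] at this
  · rw [PMF.toOuterMeasure_eq_ev, PMF.ev_bind, PMF.ev_map]
    have : ∑ a ∈ A, co a * ∏ t ∈ Finset.range N, pieceMean P I wt (drawMean L (H a t)) =
        μ₁.ev fun M' => (drawAll L 15 16 N ⟨M', reg⟩).ev Φ := by
      rw [PMF.ev_congr fun M' hM' => (hdraw M' hM').2, PMF.ev_sum]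
      refine Finset.sum_congr rfl fun a _ => ?_
      rw [PMF.ev_const_mul]
      exact congrArg _ (hf fun t => drawMean L (H a t)).symm
    rw [this, ← PMF.ev_add]
    refine le_trans (PMF.ev_const μ₁ 1).ge (PMF.ev_mono fun M' hM' => ?_)
    simp only [Function.comp, PMF.ev_bind, PMF.ev_pure]
    rw [← PMF.ev_add]
    refine le_trans (PMF.ev_const (drawAll L 15 16 N ⟨M', reg⟩) 1).ge (PMF.ev_mono fun s' hs' => ?_)
    exact (hfin s' ⟨M', hM', hs'⟩).2

open Classical in
/-- The factor of sample `t` in `E` to the number of the first `n` samples that are alive. -/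
noncomputable def aliveWeight (L : SetList X m) (g n : ℕ) (E : ℝ) (t i : ℕ) (a : ℝ) (o : Option X) : ℝ≥0∞ :=
  if t < n ∧ a = 1 ∧ ∃ x, o = some x ∧ ∀ (j : ℕ) (hj : j < m), i < j → j < i + g → x ∉ L.sets ⟨j, hj⟩ then
    ENNReal.ofReal E else 1

/-- This turns `E` to the number of living samples into a product with one factor for each sample,
whose expectation factorises. -/
theorem prod_aliveWeight {s : State X} {x : ℕ → X} {g n N : ℕ} {E : ℝ} (hn : n ≤ N)
    (hx : ∀ t < N, s.reg t = some (x t)) (hE : 0 ≤ E) :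
    ∏ t ∈ Finset.range N, aliveWeight L g n E t ⌊s.mem 15 t⌋₊ (s.mem 17 t) (s.reg t) =
      ENNReal.ofReal (E ^ aliveCount L (fun t => ⌊s.mem 15 t⌋₊) x (fun t => s.mem 17 t = 1) g n) := by
  classical
  have : ∀ t ∈ Finset.range N, aliveWeight L g n E t ⌊s.mem 15 t⌋₊ (s.mem 17 t) (s.reg t) =
      if t < n ∧ Alive L (fun t => ⌊s.mem 15 t⌋₊) x (fun t => s.mem 17 t = 1) g t then ENNReal.ofReal E
        else 1 := by
    intro t ht
    rw [aliveWeight, hx t (Finset.mem_range.1 ht)]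
    refine if_congr ?_ rfl rfl
    simp only [Option.some.injEq, exists_eq_left', Alive]
  rw [Finset.prod_congr rfl this, Finset.prod_ite, Finset.prod_const, Finset.prod_const_one, mul_one,
    ENNReal.ofReal_pow hE, aliveCount]
  congr 2
  ext t
  simp only [Finset.mem_filter, Finset.mem_range]
  constructor
  · rintro ⟨-, h⟩; exact h
  · rintro ⟨h1, h2⟩; exact ⟨by omega, h1, h2⟩

open Classical in
theorem ev_ite_ofReal {α : Type*} (μ : PMF α) (s : Set α) {E : ℝ} (hE : 0 ≤ E) :
    (μ.ev fun x => if x ∈ s then ENNReal.ofReal E else 1) =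
      ENNReal.ofReal (1 + (E - 1) * (μ.toOuterMeasure s).toReal) := by
  have h1 : μ.toOuterMeasure s + μ.toOuterMeasure sᶜ = 1 := by
    rw [PMF.toOuterMeasure_eq_ev, PMF.toOuterMeasure_eq_ev, ← PMF.ev_add, ← PMF.ev_const μ 1]
    refine PMF.ev_congr fun x _ => ?_
    by_cases hx : x ∈ s <;> simp [hx]
  have h2 : (μ.ev fun x => if x ∈ s then ENNReal.ofReal E else 1) =
      ENNReal.ofReal E * μ.toOuterMeasure s + μ.toOuterMeasure sᶜ := by
    rw [PMF.toOuterMeasure_eq_ev, PMF.toOuterMeasure_eq_ev, ← PMF.ev_const_mul, ← PMF.ev_add]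
    refine PMF.ev_congr fun x _ => ?_
    by_cases hx : x ∈ s <;> simp [hx]
  have hs : μ.toOuterMeasure s ≠ ∞ := fun h => by simp [h] at h1
  have hc : μ.toOuterMeasure sᶜ ≠ ∞ := fun h => by simp [h] at h1
  rw [h2]
  have h3 := congrArg ENNReal.toReal h1
  rw [ENNReal.toReal_add hs hc, ENNReal.toReal_one] at h3
  rw [← ENNReal.toReal_eq_toReal_iff' (by finiteness) (by finiteness),
    ENNReal.toReal_add (by finiteness) hc, ENNReal.toReal_mul, ENNReal.toReal_ofReal hE,
    ENNReal.toReal_ofReal]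
  · linarith
  · nlinarith [ENNReal.toReal_nonneg (a := μ.toOuterMeasure s), ENNReal.toReal_nonneg (a := μ.toOuterMeasure sᶜ)]

theorem drawMean_aliveWeight_one {g n t : ℕ} {E : ℝ} (ht : t < n) (hE : 0 ≤ E) (i : Fin m) :
    drawMean L (aliveWeight L g n E t) i 1 = ENNReal.ofReal (1 + (E - 1) * survival L g i) := by
  classical
  rw [drawMean, dif_pos i.2, survival, ← ev_ite_ofReal _ _ hE]
  refine PMF.ev_congr fun x _ => ?_
  refine if_congr ?_ rfl rfl
  simp only [ht, true_and, Option.some.injEq, exists_eq_left', survivors, Set.mem_ofPred_eq]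
  exact ⟨fun h j h1 h2 => h j j.2 h1 h2, fun h j hj h1 h2 => h ⟨j, hj⟩ h1 h2⟩

theorem drawMean_aliveWeight_zero {g n t : ℕ} {E : ℝ} (i : Fin m) :
    drawMean L (aliveWeight L g n E t) i 0 = 1 := by
  rw [drawMean, dif_pos i.2, ← PMF.ev_const (L.gen i) 1]
  refine PMF.ev_congr fun x _ => ?_
  simp [aliveWeight]

/-- The rounding of the numbers of pieces cancels: `⌊w⌋ + 1` pieces accepted with probability `w /
(⌊w⌋ + 1)` weigh `w`. Hence a sample is alive with probability `∑ wt i * survival i / P` exactly,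
and its factor is `E` in this case and `1` otherwise. -/
theorem pieceMean_aliveWeight {g n t P : ℕ} {E : ℝ} {I : ℕ → ℕ} {wt : ℕ → ℝ} (hE : 0 ≤ E) (hP : 0 < P)
    (hPsum : P = ∑ i ∈ Finset.range m, (⌊wt i⌋₊ + 1)) (hwt0 : ∀ i, 0 ≤ wt i)
    (hI : ∀ φ : ℕ → ℝ≥0∞, ∑ u ∈ Finset.range P, φ (I u) =
      ∑ i ∈ Finset.range m, ((⌊wt i⌋₊ + 1 : ℕ) : ℝ≥0∞) * φ i) (ht : t < n) :
    pieceMean P I wt (drawMean L (aliveWeight L g n E t)) =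
      ENNReal.ofReal (1 + (E - 1) * ((∑ i : Fin m, wt i * survival L g i) / P)) := by
  have hP0 : (0 : ℝ) < P := by exact_mod_cast hP
  have hσ : ∀ i : Fin m, 0 ≤ 1 + (E - 1) * survival L g i := fun i => by
    nlinarith [survival_nonneg (L := L) (g := g) i, survival_le_one (L := L) (g := g) i]
  rw [pieceMean, hI fun i => acceptProb (wt i) * drawMean L (aliveWeight L g n E t) i 1 +
    (1 - acceptProb (wt i)) * drawMean L (aliveWeight L g n E t) i 0, Finset.sum_range]
  have hterm : ∀ i : Fin m, ((⌊wt i⌋₊ + 1 : ℕ) : ℝ≥0∞) *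
      (acceptProb (wt i) * drawMean L (aliveWeight L g n E t) i 1 +
        (1 - acceptProb (wt i)) * drawMean L (aliveWeight L g n E t) i 0) =
      ENNReal.ofReal ((⌊wt i⌋₊ + 1 : ℕ) + (E - 1) * (wt i * survival L g i)) := by
    intro i
    have hc : (0 : ℝ) < (⌊wt i⌋₊ + 1 : ℕ) := by positivity
    have hp1 : wt i / (⌊wt i⌋₊ + 1 : ℕ) ≤ 1 := by
      rw [div_le_one hc]; push_cast; exact (Nat.lt_floor_add_one _).le
    have hp0 : 0 ≤ wt i / (⌊wt i⌋₊ + 1 : ℕ) := div_nonneg (hwt0 i) hc.le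
    rw [drawMean_aliveWeight_one ht hE, drawMean_aliveWeight_zero, acceptProb, mul_one,
      ← ENNReal.ofReal_mul hp0, ← ENNReal.ofReal_one, ← ENNReal.ofReal_sub _ hp0,
      ← ENNReal.ofReal_add (mul_nonneg hp0 (hσ i)) (sub_nonneg.2 hp1),
      ← ENNReal.ofReal_natCast, ← ENNReal.ofReal_mul hc.le]
    congr 1
    field_simp
    ring
  have hnn : ∀ i : Fin m, 0 ≤ ((⌊wt i⌋₊ + 1 : ℕ) : ℝ) + (E - 1) * (wt i * survival L g i) := fun i => by
    have h1 : wt i ≤ (⌊wt i⌋₊ + 1 : ℕ) := by push_cast; exact (Nat.lt_floor_add_one _).le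
    have := mul_nonneg (hwt0 i) (hσ i)
    linarith
  rw [Finset.sum_congr rfl fun i _ => hterm i, ← ENNReal.ofReal_sum_of_nonneg fun i _ => hnn i,
    ← ENNReal.ofReal_natCast, ← ENNReal.ofReal_div_of_pos hP0, Finset.sum_add_distrib, ← Finset.mul_sum]
  congr 1
  rw [← Nat.cast_sum, ← Finset.sum_range (fun i => ⌊wt i⌋₊ + 1), ← hPsum]
  field_simp

theorem pieceMean_aliveWeight_of_le {g n t P : ℕ} {E : ℝ} {I : ℕ → ℕ} {wt : ℕ → ℝ} (hP : 0 < P)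
    (hIm : ∀ u < P, I u < m) (ht : n ≤ t) :
    pieceMean P I wt (drawMean L (aliveWeight L g n E t)) = 1 := by
  have hone : ∀ i < m, ∀ a, drawMean L (aliveWeight L g n E t) i a = 1 := fun i hi a => by
    rw [drawMean, dif_pos hi, ← PMF.ev_const (L.gen ⟨i, hi⟩) 1]
    refine PMF.ev_congr fun x _ => ?_
    simp [aliveWeight, not_lt.2 ht]
  rw [pieceMean, Finset.sum_congr rfl fun u hu => by
    rw [hone _ (hIm u (Finset.mem_range.1 hu)), hone _ (hIm u (Finset.mem_range.1 hu)), mul_one, mul_one,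
      add_tsub_cancel_of_le acceptProb_le_one]]
  rw [Finset.sum_const, Finset.card_range, nsmul_eq_mul, mul_one]
  exact ENNReal.div_self (by exact_mod_cast hP.ne') (by finiteness)

theorem prod_pieceMean_aliveWeight {g n N P : ℕ} {E : ℝ} {I : ℕ → ℕ} {wt : ℕ → ℝ} (hE : 0 ≤ E) (hP : 0 < P)
    (hPsum : P = ∑ i ∈ Finset.range m, (⌊wt i⌋₊ + 1)) (hwt0 : ∀ i, 0 ≤ wt i) (hIm : ∀ u < P, I u < m)
    (hI : ∀ φ : ℕ → ℝ≥0∞, ∑ u ∈ Finset.range P, φ (I u) =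
      ∑ i ∈ Finset.range m, ((⌊wt i⌋₊ + 1 : ℕ) : ℝ≥0∞) * φ i) (hn : n ≤ N) :
    ∏ t ∈ Finset.range N, pieceMean P I wt (drawMean L (aliveWeight L g n E t)) =
      ENNReal.ofReal (1 + (E - 1) * ((∑ i : Fin m, wt i * survival L g i) / P)) ^ n := by
  have : ∀ t ∈ Finset.range N, pieceMean P I wt (drawMean L (aliveWeight L g n E t)) =
      if t < n then ENNReal.ofReal (1 + (E - 1) * ((∑ i : Fin m, wt i * survival L g i) / P)) else 1 := by
    intro t _
    split_ifs with h
    · exact pieceMean_aliveWeight hE hP hPsum hwt0 hI h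
    · exact pieceMean_aliveWeight_of_le hP hIm (not_lt.1 h)
  rw [Finset.prod_congr rfl this, Finset.prod_ite, Finset.prod_const, Finset.prod_const_one, mul_one]
  congr 1
  rw [show (Finset.range N).filter (· < n) = Finset.range n by ext t; simp; omega, Finset.card_range]

end RandRAM


namespace RandRAM
open Term

/-! ## Exponential bounds -/

/-- The Chernoff computation for both tails, from `exp z ≤ 1 + z + z²`. In `hy` the factor `z + z²`
is kept since its sign decides the direction: for `0 < z` the mean `n q'` must be at most `y`, for
`-1 < z < 0` at least `y`. -/
theorem exp_mul_one_add_pow_le {z ε y q' : ℝ} {n : ℕ} (hz : |z| ≤ 1) (hq0 : 0 ≤ q') (hq1 : q' ≤ 1)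
    (hy : (z + z ^ 2) * (n * q') ≤ (z + z ^ 2) * y) :
    ENNReal.ofReal (Real.exp (-(z * ε * y))) *
      ENNReal.ofReal (1 + (Real.exp z - 1) * q') ^ n ≤ ENNReal.ofReal (Real.exp ((z + z ^ 2 - z * ε) * y)) := by
  have h0 : 0 ≤ 1 + (Real.exp z - 1) * q' := by nlinarith [Real.exp_pos z]
  have h1 : Real.exp z - 1 ≤ z + z ^ 2 := by
    have := (abs_le.1 (Real.abs_exp_sub_one_sub_id_le hz)).2; linarith
  rw [← ENNReal.ofReal_pow h0, ← ENNReal.ofReal_mul (Real.exp_pos _).le]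
  refine ENNReal.ofReal_le_ofReal ?_
  have h2 : 1 + (Real.exp z - 1) * q' ≤ Real.exp ((z + z ^ 2) * q') := by
    have := Real.add_one_le_exp ((z + z ^ 2) * q')
    nlinarith [mul_le_mul_of_nonneg_right h1 hq0]
  calc Real.exp (-(z * ε * y)) * (1 + (Real.exp z - 1) * q') ^ n
      ≤ Real.exp (-(z * ε * y)) * Real.exp ((z + z ^ 2) * q') ^ n := by gcongr
    _ = Real.exp (-(z * ε * y) + (z + z ^ 2) * (n * q')) := by
        rw [← Real.exp_nat_mul, ← Real.exp_add]; ring_nf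
    _ ≤ Real.exp ((z + z ^ 2 - z * ε) * y) := Real.exp_le_exp.2 (by linarith)

/-- This is the Markov step: on a bad event the exponential weight is at least `1`. Both signs of
`z` are used. -/
theorem one_le_exp_mul_pow {z x : ℝ} {n : ℕ} (h : z * x ≤ z * n) :
    1 ≤ ENNReal.ofReal (Real.exp (-(z * x))) * ENNReal.ofReal (Real.exp z ^ n) := by
  rw [← ENNReal.ofReal_mul (Real.exp_pos _).le, ← Real.exp_nat_mul, ← Real.exp_add, ENNReal.one_le_ofReal]
  exact Real.one_le_exp (by linarith)

/-- There are at most `3m · 33κm/ε² = 99κγ²u²` events, where `u = m/(εγ)`. As `100u < 2^κ` and `κ ≤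
2^κ`, this is at most `γ (2^κ)⁴ ≤ γ exp(4κ)`. -/
theorem card_mul_exp_le {m κ a N : ℕ} {ε γ : ℝ} (hm : 1 ≤ m) (hε : 0 < ε) (hε1 : ε < 1) (hγ : 0 < γ)
    (hγ1 : γ < 1) (hκ : 1 ≤ κ) (hw : 100 * m / (ε * γ) < 2 ^ κ) (ha : a ≤ 2 * m)
    (hN : (N : ℝ) ≤ 32 * κ * m / ε ^ 2 + 1) : ((a + 1) * N : ℝ) * Real.exp (-(4 * κ)) ≤ γ := by
  have hm' : (1 : ℝ) ≤ m := by exact_mod_cast hm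
  have hκ' : (1 : ℝ) ≤ κ := by exact_mod_cast hκ
  have ha' : (a : ℝ) ≤ 2 * m := by exact_mod_cast ha
  set w : ℝ := 2 ^ κ with hwdef
  have hwκ : (κ : ℝ) ≤ w := by rw [hwdef]; exact_mod_cast Nat.lt_two_pow_self.le
  have hw1 : 1 ≤ w := hκ'.trans hwκ
  have hexp : w ^ 4 ≤ Real.exp (4 * κ) := by
    have h2 : (2 : ℝ) ≤ Real.exp 1 := by have := Real.exp_one_gt_d9; linarith
    rw [show (4 * (κ : ℝ)) = ((κ * 4 : ℕ) : ℝ) * 1 by push_cast; ring, Real.exp_nat_mul, pow_mul, hwdef]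
    gcongr
  have hε2 : ε ^ 2 ≤ 1 := by nlinarith
  have hN' : (N : ℝ) ≤ 33 * κ * m / ε ^ 2 := by
    refine hN.trans ?_
    rw [div_add_one (by positivity)]
    gcongr
    nlinarith
  have hu : 1 ≤ m / (ε * γ) := by
    rw [one_le_div (by positivity)]; nlinarith
  set u := m / (ε * γ) with hudef
  have hw2 : 100 * u ≤ w := by rw [hudef, ← mul_div_assoc]; exact hw.le
  rw [Real.exp_neg, ← div_eq_mul_inv, div_le_iff₀ (Real.exp_pos _)]
  refine le_trans ?_ (mul_le_mul_of_nonneg_left hexp hγ.le)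
  have h1 : (a + 1) * N ≤ (3 * m) * (33 * κ * m / ε ^ 2) :=
    mul_le_mul (by linarith) hN' (by positivity) (by positivity)
  have h2 : (3 * m : ℝ) * (33 * κ * m / ε ^ 2) = 99 * κ * (γ * γ) * u ^ 2 := by
    rw [hudef]; field_simp; ring
  have h3 : (100 * u) ^ 2 ≤ w ^ 2 := by gcongr
  have h4 : κ * w ^ 2 ≤ w ^ 4 := by
    calc κ * w ^ 2 ≤ w * w ^ 2 := by gcongr
      _ = w ^ 3 := by ring
      _ ≤ w ^ 4 := pow_le_pow_right₀ hw1 (by norm_num)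
  calc ((a : ℝ) + 1) * N ≤ 99 * κ * (γ * γ) * u ^ 2 := h1.trans h2.le
    _ ≤ γ * (κ * (100 * u) ^ 2) := by
        have : 0 ≤ κ * γ * u ^ 2 := by positivity
        nlinarith
    _ ≤ γ * (κ * w ^ 2) := by gcongr
    _ ≤ γ * w ^ 4 := by gcongr

/-! ## The run of the program for unions -/

variable {X : Type} {m : ℕ} {L : SetList X m}

theorem Ev.runs_seq {c₁ c₂ : Cmd} {s : State X} {T₁ T₂ R : ℕ} {Q₁ : Memory → Prop} {p : PMF (State X) → Prop}
    (h₁ : Ev L c₁ s.mem T₁ Q₁) (h₂ : ∀ M', Q₁ M' → (∀ a, c₁.keeps a = true → M' a = s.mem a) →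
      ∃ μ, Runs L c₂ ⟨M', s.reg⟩ T₂ R μ ∧ p μ) : ∃ μ, Runs L (c₁ ;; c₂) s (T₁ + T₂) R μ ∧ p μ := by
  obtain ⟨M', h, hQ, hf⟩ := h₁.frame
  obtain ⟨μ, hμ, hp⟩ := h₂ M' hQ hf
  refine ⟨μ, ?_, hp⟩
  have h1 := h s.reg
  rw [PMF.pure_map] at h1
  have := Runs.seq _ _ _ _ _ _ _ _ (fun _ => μ) h1 fun s' hs' => by
    simp only [PMF.support_pure, Set.mem_singleton_iff] at hs'; rw [hs']; exact hμ
  rwa [PMF.pure_bind, zero_add] at this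

/-- The weights of the coefficients in the union bound: the first component of the index is `some k` for the
upper bound in stage `k`, and `none` for the lower bound in stage `s₀`. -/
noncomputable def failCoeff (ε q : ℝ) (b : ℕ → ℝ) (s₀ : ℕ) : Option ℕ × ℕ → ℝ≥0∞
  | (some k, n) => ENNReal.ofReal (Real.exp (-(ε / 2 * (1 + ε) * (n * (q * b k)))))
  | (none, n) => ENNReal.ofReal (Real.exp (-(-(ε / 2) * (1 - ε) * (n * (q * b s₀)))))

/-- The weights of the samples in the union bound. -/
noncomputable def failWeight (L : SetList X m) (ε : ℝ) (s₀ : ℕ) :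
    Option ℕ × ℕ → ℕ → ℕ → ℝ → Option X → ℝ≥0∞
  | (some k, n) => aliveWeight L (2 ^ k) n (Real.exp (ε / 2))
  | (none, n) => aliveWeight L (2 ^ s₀) n (Real.exp (-(ε / 2)))

/-- With `z = ±ε/2` both tails have the exponent `-(ε²/4) y`, where `y` is the reference number of
living samples. It is at least `16κ/ε²` for the prefixes considered, which gives `exp(-4κ)`. -/
theorem failCoeff_mul_prod_le {N P s₀ Lst κ nmin : ℕ} {ε q : ℝ} {b : ℕ → ℝ} {I : ℕ → ℕ} {wt : ℕ → ℝ}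
    (hε : 0 < ε) (hε1 : ε < 1) (hP : 0 < P)
    (hPsum : P = ∑ i ∈ Finset.range m, (⌊wt i⌋₊ + 1)) (hwt0 : ∀ i, 0 ≤ wt i) (hIm : ∀ u < P, I u < m)
    (hI : ∀ φ : ℕ → ℝ≥0∞, ∑ u ∈ Finset.range P, φ (I u) =
      ∑ i ∈ Finset.range m, ((⌊wt i⌋₊ + 1 : ℕ) : ℝ≥0∞) * φ i)
    (hq1 : ∀ g, (∑ i : Fin m, wt i * survival L g i) / P ≤ 1)
    (hup : ∀ k < Lst, (∑ i : Fin m, wt i * survival L (2 ^ k) i) / P ≤ q * b k)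
    (hlow : (∑ i : Fin m, wt i * survival L (2 ^ s₀) i) / P = q * b s₀)
    (hb : ∀ k, 1 ≤ b k) (hq : 0 ≤ q) (hnmin : ∀ n : ℕ, nmin ≤ n → 16 * κ / ε ^ 2 ≤ n * q)
    {a : Option ℕ × ℕ} (ha : a ∈ (Finset.range Lst).insertNone ×ˢ Finset.Icc nmin N) :
    failCoeff ε q b s₀ a * ∏ t ∈ Finset.range N, pieceMean P I wt (drawMean L (failWeight L ε s₀ a t)) ≤
      ENNReal.ofReal (Real.exp (-(4 * κ))) := by
  obtain ⟨o, n⟩ := a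
  rw [Finset.mem_product, Finset.mem_Icc] at ha
  obtain ⟨ho, hn1, hn2⟩ := ha
  have hq0 : ∀ g, 0 ≤ (∑ i : Fin m, wt i * survival L g i) / P := fun g =>
    div_nonneg (Finset.sum_nonneg fun i _ => mul_nonneg (hwt0 i) (survival_nonneg i)) (by positivity)
  have hexp : ∀ k, -(ε ^ 2 / 4) * (n * (q * b k)) ≤ -(4 * κ) := fun k => by
    have h1 := hnmin n hn1
    have h2 : (n : ℝ) * q ≤ n * q * b k := le_mul_of_one_le_right (by positivity) (hb k)
    have h3 := mul_le_mul_of_nonneg_left (h1.trans h2) (show 0 ≤ ε ^ 2 / 4 by positivity)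
    have h4 : ε ^ 2 / 4 * (16 * κ / ε ^ 2) = 4 * κ := by field_simp; norm_num
    linarith
  cases o with
  | some k =>
    have hk : k < Lst := by simpa using ho
    simp only [failCoeff, failWeight]
    rw [prod_pieceMean_aliveWeight (Real.exp_pos _).le hP hPsum hwt0 hIm hI hn2]
    refine (exp_mul_one_add_pow_le (z := ε / 2) (ε := 1 + ε) (y := n * (q * b k)) ?_ (hq0 _) (hq1 _) ?_).trans ?_
    · rw [abs_of_pos (by positivity)]; linarith
    · gcongr; exact hup k hk
    · refine ENNReal.ofReal_le_ofReal (Real.exp_le_exp.2 ((hexp k).trans' ?_))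
      exact le_of_eq (by ring)
  | none =>
    simp only [failCoeff, failWeight]
    rw [prod_pieceMean_aliveWeight (Real.exp_pos _).le hP hPsum hwt0 hIm hI hn2]
    refine (exp_mul_one_add_pow_le (z := -(ε / 2)) (ε := 1 - ε) (y := n * (q * b s₀)) ?_ (hq0 _) (hq1 _) ?_).trans ?_
    · rw [abs_neg, abs_of_pos (by positivity)]; linarith
    · rw [hlow]
    · refine ENNReal.ofReal_le_ofReal (Real.exp_le_exp.2 ((hexp s₀).trans' ?_))
      exact le_of_eq (by ring)

theorem one_le_failCoeff_mul_prod {s : State X} {x : ℕ → X} {N s₀ : ℕ} {ε q : ℝ} {b : ℕ → ℝ} {o : Option ℕ}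
    {n : ℕ} (hn : n ≤ N) (hε : 0 < ε) (hx : ∀ t < N, s.reg t = some (x t))
    (h : match o with
      | some k => (1 + ε) * (n * (q * b k)) ≤
          (aliveCount L (fun t => ⌊s.mem 15 t⌋₊) x (fun t => s.mem 17 t = 1) (2 ^ k) n : ℝ)
      | none => (aliveCount L (fun t => ⌊s.mem 15 t⌋₊) x (fun t => s.mem 17 t = 1) (2 ^ s₀) n : ℝ) ≤
          (1 - ε) * (n * (q * b s₀))) :
    1 ≤ failCoeff ε q b s₀ (o, n) *
      ∏ t ∈ Finset.range N, failWeight L ε s₀ (o, n) t ⌊s.mem 15 t⌋₊ (s.mem 17 t) (s.reg t) := by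
  cases o with
  | some k =>
    simp only [failCoeff, failWeight] at h ⊢
    rw [prod_aliveWeight hn hx (Real.exp_pos _).le, mul_assoc (ε / 2)]
    exact one_le_exp_mul_pow (mul_le_mul_of_nonneg_left h (by positivity))
  | none =>
    simp only [failCoeff, failWeight] at h ⊢
    rw [prod_aliveWeight hn hx (Real.exp_pos _).le, mul_assoc (-(ε / 2))]
    exact one_le_exp_mul_pow (mul_le_mul_of_nonpos_left h (by linarith))

end RandRAM


/-! ### The failure probability of the program for unions -/

namespace RandRAM
open Term

variable {X : Type} {m : ℕ} {L : SetList X m}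

theorem sum_floor_add_one_le {wt : ℕ → ℝ} (hwt0 : ∀ i, 0 ≤ wt i) (hsum : ∑ i : Fin m, wt i = m) :
    ∑ i ∈ Finset.range m, (⌊wt i⌋₊ + 1) ≤ 2 * m ∧ m ≤ ∑ i ∈ Finset.range m, (⌊wt i⌋₊ + 1) := by
  rw [Finset.sum_add_distrib, Finset.sum_const, Finset.card_range, smul_eq_mul, mul_one]
  refine ⟨?_, by omega⟩
  have : ((∑ i ∈ Finset.range m, ⌊wt i⌋₊ : ℕ) : ℝ) ≤ m := by
    push_cast
    rw [← hsum, ← Finset.sum_range wt]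
    exact Finset.sum_le_sum fun i _ => Nat.floor_le (hwt0 i)
  have : ∑ i ∈ Finset.range m, ⌊wt i⌋₊ ≤ m := by exact_mod_cast this
  omega

set_option maxHeartbeats 1000000 in
/-- The part of the program for unions that uses random samples. -/
theorem runs_sampling {M : Memory} {reg : ℕ → Option X} {P κ D : ℕ} {I : ℕ → ℕ} {size : Fin m → ℝ}
    {wt : ℕ → ℝ} {aL aR bL bR ε γ : ℝ}
    (hfin : ∀ i, (L.sets i).Finite) (haL : aL < 1) (haR : 0 < aR) (hbL : bL < 1) (hbR : 0 < bR)
    (h : IsBiasedList aL aR bL bR L.sets size L.gen) (hm : 1 ≤ m) (hε : 0 < ε) (hε1 : ε < 1) (hγ : 0 < γ)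
    (hγ1 : γ < 1) (hκ : 1 ≤ κ) (hw : 100 * m / (ε * γ) < 2 ^ κ) (hpos : 0 < ∑ i, size i)
    (hwt : ∀ i, M 1 i * M 2 0 / M 5 0 = wt i) (hwt0 : ∀ i, 0 ≤ wt i)
    (hwts : ∀ i : Fin m, wt i = size i * m / ∑ i, size i)
    (hPsum : P = ∑ i ∈ Finset.range m, (⌊wt i⌋₊ + 1))
    (h2 : M 2 0 = m) (h5 : M 5 0 = ∑ i, size i) (h6 : M 6 0 = P) (h9 : ∀ u < P, M 9 u = I u ∧ I u < m)
    (hI : ∀ φ : ℕ → ℝ≥0∞, ∑ u ∈ Finset.range P, φ (I u) =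
      ∑ i ∈ Finset.range m, ((⌊wt i⌋₊ + 1 : ℕ) : ℝ≥0∞) * φ i)
    (h13 : M 13 0 = 16 * κ / ε ^ 2) (h14 : M 14 0 = ⌈16 * κ / ε ^ 2 * P⌉₊)
    (hD : 12 * (16 * κ / ε ^ 2) * m ≤ D) :
    ∃ μ, Runs L (pickCmd ;; .draw (var 14) 15 16 ;; stagesCmd) ⟨M, reg⟩
      (7 * ⌈16 * κ / ε ^ 2 * P⌉₊ + 2 + (⌈16 * κ / ε ^ 2 * P⌉₊ + 1 +
        (Nat.clog 2 (2 * m) * (6 * ⌈16 * κ / ε ^ 2 * P⌉₊ + 10 * (D + 2) + 1) + 5)))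
      (1 + Nat.clog 2 (2 * m)) μ ∧
      ENNReal.ofReal (1 - γ) ≤ μ.toOuterMeasure {s | s.mem 0 0 ∈ Set.Icc
        ((1 - ε) * (1 - aL) * (1 - bL) * ((⋃ i, L.sets i).ncard : ℝ))
        ((1 + ε) * (1 + aR) * (1 + bR) * ((⋃ i, L.sets i).ncard : ℝ))} := by
  obtain ⟨s₀, hs₀, V, hV, hVmax, ⟨hVlow, hVupp⟩, hVmean⟩ := exists_best_width hfin haL haR hbL hbR h hm
  have hm0 : (0 : ℝ) < m := by exact_mod_cast hm
  have hκ0 : (1 : ℝ) ≤ κ := by exact_mod_cast hκ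
  set S := ∑ i, size i with hS
  have hwtsum : ∑ i : Fin m, wt i = m := by
    rw [Finset.sum_congr rfl fun i _ => hwts i, ← Finset.sum_div, ← Finset.sum_mul, ← hS]
    field_simp
  obtain ⟨hP2, hPm⟩ := sum_floor_add_one_le hwt0 hwtsum
  rw [← hPsum] at hP2 hPm
  have hP : 0 < P := by omega
  have hP0 : (0 : ℝ) < P := by exact_mod_cast hP
  have hPm' : (m : ℝ) ≤ P := by exact_mod_cast hPm
  have hP2' : (P : ℝ) ≤ 2 * m := by exact_mod_cast hP2
  set K : ℝ := 16 * κ / ε ^ 2 with hK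
  have hK1 : 1 ≤ K := by
    rw [hK, le_div_iff₀ (by positivity)]; nlinarith
  set N : ℕ := ⌈K * P⌉₊ with hN
  have hV0 : 0 < V := lt_of_lt_of_le (by positivity) hVmean
  -- `q` is `V` in the scale of probabilities: the chance that a sample is alive at width `2^k` is
  -- at most `q * b k`, with equality at the best width `s₀`.
  set q : ℝ := V * m / (P * S) with hq
  have hq0 : 0 < q := by positivity
  -- By this bound `nmin = ⌈K/q⌉` does not exceed the number `N = ⌈K P⌉` of available samples.
  have hqP : 1 / P ≤ q := by
    rw [hq, div_le_div_iff₀ hP0 (by positivity)]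
    rw [div_le_iff₀ hm0] at hVmean
    nlinarith
  set b : ℕ → ℝ := fun k => (⌈(m : ℝ) / (2 ^ k : ℕ)⌉₊ : ℝ) with hb
  have hb1 : ∀ k, 1 ≤ b k := fun k => by
    have : 1 ≤ ⌈(m : ℝ) / (2 ^ k : ℕ)⌉₊ := Nat.ceil_pos.2 (by positivity)
    simp only [hb]; exact_mod_cast this
  have hqg : ∀ g, (∑ i : Fin m, wt i * survival L g i) / P = (∑ i, size i * survival L g i) * (m / (P * S)) := by
    intro g
    rw [Finset.sum_mul, Finset.sum_div]
    refine Finset.sum_congr rfl fun i _ => ?_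
    rw [hwts]; field_simp
  have hqg1 : ∀ g, (∑ i : Fin m, wt i * survival L g i) / P ≤ 1 := by
    intro g
    rw [div_le_one hP0]
    refine le_trans (Finset.sum_le_sum fun i _ => mul_le_of_le_one_right (hwt0 i) (survival_le_one i)) ?_
    rw [hwtsum]; exact hPm'
  have hup : ∀ k < Nat.clog 2 (2 * m), (∑ i : Fin m, wt i * survival L (2 ^ k) i) / P ≤ q * b k := by
    intro k hk
    rw [hqg, hq, show V * m / (P * S) * b k = V * b k * (m / (P * S)) by ring]
    exact mul_le_mul_of_nonneg_right (hVmax k hk) (by positivity)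
  have hlow : (∑ i : Fin m, wt i * survival L (2 ^ s₀) i) / P = q * b s₀ := by
    rw [hqg, ← hV, hq]; ring
  have hq1 : q ≤ 1 := by
    have h1 := hqg1 (2 ^ s₀)
    rw [hlow] at h1
    nlinarith [hb1 s₀]
  set nmin : ℕ := ⌈K / q⌉₊ with hnmin
  have hn1 : 1 ≤ nmin := Nat.ceil_pos.2 (by positivity)
  have hnN : nmin ≤ N := by
    refine Nat.ceil_mono ?_
    rw [div_le_iff₀ hq0]
    have := mul_le_mul_of_nonneg_left hqP (show 0 ≤ K * P by positivity)
    rwa [mul_one_div, mul_div_cancel_right₀ _ hP0.ne'] at this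
  have hnK : ∀ n : ℕ, nmin ≤ n → K ≤ n * q := fun n hn => by
    rw [← div_le_iff₀ hq0]; exact Nat.ceil_le.1 hn
  -- The left side is at most `2 (K + q)`, and `q ≤ 1 ≤ K`. This is why the limit for living samples
  -- contains the factor `4`.
  have hn4 : (1 + ε) * (q * nmin) ≤ 4 * K := by
    have h1 : (nmin : ℝ) ≤ K / q + 1 := (Nat.ceil_lt_add_one (by positivity)).le
    have h2 : q * nmin ≤ K + q := by
      have := mul_le_mul_of_nonneg_left h1 hq0.le
      rwa [mul_add, mul_div_cancel₀ _ hq0.ne', mul_one] at this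
    have h3 : 0 ≤ q * nmin := by positivity
    have h4 := mul_le_mul_of_nonneg_right (show 1 + ε ≤ 2 by linarith) h3
    linarith
  set A : Finset (Option ℕ × ℕ) := (Finset.range (Nat.clog 2 (2 * m))).insertNone ×ˢ Finset.Icc nmin N with hA
  set G : Set (State X) := {s | s.mem 0 0 ∈ Set.Icc
        ((1 - ε) * (1 - aL) * (1 - bL) * ((⋃ i, L.sets i).ncard : ℝ))
        ((1 + ε) * (1 + aR) * (1 + bR) * ((⋃ i, L.sets i).ncard : ℝ))} with hG
  have hrest : ∀ s' : State X, (∀ a, pickCmd.keeps a = true → s'.mem a = M a) →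
      (∀ t < N, (∃ i < m, s'.mem 15 t = i) ∧ (s'.mem 17 t = 0 ∨ s'.mem 17 t = 1) ∧ ∃ x, s'.reg t = some x) →
      Sv L stagesCmd s' (Nat.clog 2 (2 * m) * (6 * N + 10 * (D + 2) + 1) + 5) (Nat.clog 2 (2 * m)) fun s'' =>
        s'' ∈ G ∨ 1 ≤ ∑ a ∈ A, failCoeff ε q b s₀ a *
          ∏ t ∈ Finset.range N, failWeight L ε s₀ a t ⌊s'.mem 15 t⌋₊ (s'.mem 17 t) (s'.reg t) := by
    intro s' hf hs'
    have hX : ∀ t, ∃ x : X, t < N → s'.reg t = some x := fun t => by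
      by_cases ht : t < N
      · obtain ⟨x, hx⟩ := (hs' t ht).2.2; exact ⟨x, fun _ => hx⟩
      · obtain ⟨x, -⟩ := (L.gen ⟨0, hm⟩).support_nonempty
        exact ⟨x, fun h => absurd h ht⟩
    choose x hx using hX
    refine Sv.mono (sv_stagesCmd (L := L) (I := fun t => ⌊s'.mem 15 t⌋₊) (x := x)
      (acc := fun t => s'.mem 17 t = 1) (N := N) (P := P) (S := S) (K := K) (D := D) (nmin := nmin)
      (s₀ := s₀) (q := q) (ε := ε) ?_ ?_ ?_ ?_ ?_ ?_ ?_ hx (by positivity) hD hm hpos.le hn1 hnN hq0.le hε.le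
      hn4 hs₀) ?_
    · rw [hf 2 (by decide), h2]
    · rw [hf 5 (by decide), h5]
    · rw [hf 6 (by decide), h6]
    · rw [hf 13 (by decide), h13]
    · rw [hf 14 (by decide), h14]
    · intro t ht
      obtain ⟨⟨i, -, hi⟩, -⟩ := hs' t ht
      rw [hi, Nat.floor_natCast]
    · intro t ht
      rcases (hs' t ht).2.1 with h0 | h0 <;> simp [h0]
    · intro s'' hs''
      by_contra hcon
      rw [not_or, not_le] at hcon
      obtain ⟨hnG, hlt⟩ := hcon
      have hno : ∀ a ∈ A, ¬ 1 ≤ failCoeff ε q b s₀ a *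
          ∏ t ∈ Finset.range N, failWeight L ε s₀ a t ⌊s'.mem 15 t⌋₊ (s'.mem 17 t) (s'.reg t) := fun a ha h1 =>
        absurd (h1.trans (Finset.single_le_sum (f := fun a => failCoeff ε q b s₀ a *
          ∏ t ∈ Finset.range N, failWeight L ε s₀ a t ⌊s'.mem 15 t⌋₊ (s'.mem 17 t) (s'.reg t))
          (fun _ _ => zero_le) ha)) (not_le.2 hlt)
      refine hnG ?_
      have g := hs'' (fun k hk n hn hnN' => by
          by_contra hlt'
          refine hno (some k, n) ?_ (one_le_failCoeff_mul_prod (x := x) hnN' hε hx (not_le.1 hlt').le)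
          rw [hA, Finset.mem_product, Finset.mem_Icc]
          exact ⟨by simpa using hk, hn, hnN'⟩)
        fun n hn hnN' => by
          by_contra hlt'
          refine hno (none, n) ?_ (one_le_failCoeff_mul_prod (x := x) hnN' hε hx (not_le.1 hlt').le)
          rw [hA, Finset.mem_product, Finset.mem_Icc]
          exact ⟨by simp, hn, hnN'⟩
      have hPSV : P * S / m * q = V := by rw [hq]; field_simp
      rw [hPSV] at g
      have e1 := mul_le_mul_of_nonneg_left hVlow (sub_pos.2 hε1).le
      have e2 := mul_le_mul_of_nonneg_left hVupp (by positivity : 0 ≤ 1 + ε)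
      exact ⟨by linarith [g.1], by linarith [g.2]⟩
  obtain ⟨μ, hμ, hprob⟩ := runs_pick_draw (reg := reg) h6 hP h14 h9 hwt hwt0 A (failCoeff ε q b s₀)
    (failWeight L ε s₀) hrest
  refine ⟨μ, hμ, ?_⟩
  have hsum : ∑ a ∈ A, failCoeff ε q b s₀ a *
      ∏ t ∈ Finset.range N, pieceMean P I wt (drawMean L (failWeight L ε s₀ a t)) ≤ ENNReal.ofReal γ := by
    refine (Finset.sum_le_card_nsmul _ _ _ fun a ha => failCoeff_mul_prod_le hε hε1 hP hPsum hwt0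
      (fun u hu => (h9 u hu).2) hI hqg1 hup hlow hb1 hq0.le hnK ha).trans ?_
    rw [nsmul_eq_mul, ← ENNReal.ofReal_natCast, ← ENNReal.ofReal_mul (by positivity)]
    refine ENNReal.ofReal_le_ofReal (le_trans ?_ (card_mul_exp_le (N := N) hm hε hε1 hγ hγ1 hκ hw
      (a := Nat.clog 2 (2 * m)) (Nat.clog_le_of_le_pow Nat.lt_two_pow_self.le) ?_))
    · refine mul_le_mul_of_nonneg_right ?_ (Real.exp_pos _).le
      rw [Finset.card_product, Finset.card_insertNone, Finset.card_range, Nat.card_Icc]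
      have : N + 1 - nmin ≤ N := by omega
      exact_mod_cast Nat.mul_le_mul_left _ this
    · refine (Nat.ceil_lt_add_one (by positivity)).le.trans ?_
      have := mul_le_mul_of_nonneg_left hP2' (show 0 ≤ K by positivity)
      have e : K * (2 * m) = 32 * κ * m / ε ^ 2 := by rw [hK]; ring
      linarith
  have h1 : 1 ≤ μ.toOuterMeasure G + ENNReal.ofReal γ := hprob.trans (by gcongr)
  rw [ENNReal.ofReal_sub _ hγ.le, ENNReal.ofReal_one]
  exact tsub_le_iff_right.2 h1

end RandRAM


/-! ### The complete run of the program for unions -/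

namespace RandRAM
open Term

variable {X : Type} {m : ℕ} {L : SetList X m}

theorem runs_serverCmd {size : Fin m → ℝ} {aL aR bL bR ε γ : ℝ} {k₀ N₀ D₀ : ℕ}
    (hfin : ∀ i, (L.sets i).Finite) (haL : aL < 1) (haR : 0 < aR) (hbL : bL < 1) (hbR : 0 < bR)
    (h : IsBiasedList aL aR bL bR L.sets size L.gen) (hm : 1 ≤ m) (hε : 0 < ε) (hε1 : ε < 1) (hγ : 0 < γ)
    (hγ1 : γ < 1) (hk₀ : 100 * m / (ε * γ) < 2 ^ k₀) (hN₀ : 32 * k₀ * m / ε ^ 2 ≤ N₀)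
    (hD₀ : 192 * k₀ * m / ε ^ 2 ≤ D₀) :
    ∃ μ, Runs L serverCmd (start [[(m : ℝ), ε, γ], List.ofFn size])
      (3 * m + 6 + (15 * m + 4 + (3 * k₀ + 6 + (7 * N₀ + 2 + (N₀ + 1 +
        (Nat.clog 2 (2 * m) * (6 * N₀ + 10 * (D₀ + 2) + 1) + 5)))) + 1))
      (1 + Nat.clog 2 (2 * m)) μ ∧
      ENNReal.ofReal (1 - γ) ≤ μ.toOuterMeasure {s | s.mem 0 0 ∈ Set.Icc
        ((1 - ε) * (1 - aL) * (1 - bL) * ((⋃ i, L.sets i).ncard : ℝ))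
        ((1 + ε) * (1 + aR) * (1 + bR) * ((⋃ i, L.sets i).ncard : ℝ))} := by
  have hm0 : (0 : ℝ) < m := by exact_mod_cast hm
  have hsize : ∀ i, 0 ≤ size i := fun i =>
    le_trans (mul_nonneg (sub_pos.2 hbL).le (Nat.cast_nonneg _)) (h i).1
  refine Ev.runs_seq (s := start [[(m : ℝ), ε, γ], List.ofFn size]) (ev_serverInputCmd size ε γ) ?_
  rintro M₁ ⟨h1, h2, h3, h4, h5⟩ -
  by_cases hS : 0 < ∑ i, size i
  · have hite : ¬ (var 5).eval M₁ ≤ (0 : Term).eval M₁ := by simpa [h5] using hS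
    set wt : ℕ → ℝ := fun i => coords size i * m / ∑ i, size i with hwt
    have hwt0 : ∀ i, 0 ≤ wt i := fun i => by
      have : 0 ≤ coords size i := by
        unfold coords; split_ifs
        · exact hsize _
        · exact le_rfl
      simp only [hwt]; positivity
    have hwts : ∀ i : Fin m, wt i = size i * m / ∑ i, size i := fun i => by simp only [hwt, coords_val]
    obtain ⟨hP2, hPm⟩ := sum_floor_add_one_le hwt0 (by
      rw [Finset.sum_congr rfl fun i _ => hwts i, ← Finset.sum_div, ← Finset.sum_mul]
      field_simp)
    set P := ∑ i ∈ Finset.range m, (⌊wt i⌋₊ + 1) with hP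
    have hP2' : (P : ℝ) ≤ 2 * m := by exact_mod_cast hP2
    suffices hs : ∃ μ, Runs L (pieceCmd ;; sampleCountCmd ;; pickCmd ;; .draw (var 14) 15 16 ;; stagesCmd)
        ⟨M₁, fun _ => none⟩ (15 * m + 4 + (3 * k₀ + 6 + (7 * N₀ + 2 + (N₀ + 1 +
        (Nat.clog 2 (2 * m) * (6 * N₀ + 10 * (D₀ + 2) + 1) + 5))))) (1 + Nat.clog 2 (2 * m)) μ ∧
        ENNReal.ofReal (1 - γ) ≤ μ.toOuterMeasure {s | s.mem 0 0 ∈ Set.Icc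
          ((1 - ε) * (1 - aL) * (1 - bL) * ((⋃ i, L.sets i).ncard : ℝ))
          ((1 + ε) * (1 + aR) * (1 + bR) * ((⋃ i, L.sets i).ncard : ℝ))} by
      obtain ⟨μ, hμ, hp⟩ := hs
      exact ⟨μ, .iteFalse _ _ _ _ _ _ _ _ hite hμ, hp⟩
    refine Ev.runs_seq (Ev.le (ev_pieceCmd (wt := wt) h2 (fun i => by
      change M₁ 1 i * m / M₁ 5 0 = _; rw [h1, h5]) hwt0) (by omega)) ?_
    rintro M₂ ⟨g6, I, hI9, hI⟩ f₂
    change ∀ a, _ → M₂ a = M₁ a at f₂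
    refine Ev.runs_seq (ev_sampleCountCmd (P := P) (m := m) (ε := ε) (γ := γ) (k₀ := k₀) ?_ ?_ ?_ g6
      (by omega) hm hε hγ hk₀ hγ1 hε1) ?_
    · change M₂ 2 0 = m; rw [f₂ 2 (by decide), h2]
    · change M₂ 3 0 = ε; rw [f₂ 3 (by decide), h3]
    · change M₂ 4 0 = γ; rw [f₂ 4 (by decide), h4]
    rintro M₃ ⟨κ, hκ1, hκ, hw, h13, h14⟩ f₃
    change ∀ a, _ → M₃ a = M₂ a at f₃
    have hκ' : (κ : ℝ) ≤ k₀ := by exact_mod_cast hκ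
    have hN : ⌈16 * κ / ε ^ 2 * P⌉₊ ≤ N₀ := by
      refine Nat.ceil_le.2 (le_trans ?_ hN₀)
      calc 16 * κ / ε ^ 2 * P ≤ 16 * k₀ / ε ^ 2 * (2 * m) := by gcongr
        _ = 32 * k₀ * m / ε ^ 2 := by ring
    have hD : 12 * (16 * κ / ε ^ 2) * m ≤ D₀ := by
      refine le_trans ?_ hD₀
      calc 12 * (16 * κ / ε ^ 2) * m ≤ 12 * (16 * k₀ / ε ^ 2) * m := by gcongr
        _ = 192 * k₀ * m / ε ^ 2 := by ring
    obtain ⟨μ, hμ, hp⟩ := runs_sampling (M := M₃) (reg := fun _ => none) (wt := wt) hfin haL haR hbL hbR h hm hε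
      hε1 hγ hγ1 hκ1 hw hS (fun i => by
        rw [f₃ 1 (by decide), f₃ 2 (by decide), f₃ 5 (by decide), f₂ 1 (by decide), f₂ 2 (by decide),
          f₂ 5 (by decide), h1, h2, h5]) hwt0 hwts hP
      (by rw [f₃ 2 (by decide), f₂ 2 (by decide), h2]) (by rw [f₃ 5 (by decide), f₂ 5 (by decide), h5])
      (by rw [f₃ 6 (by decide), g6]) (fun u hu => by rw [f₃ 9 (by decide)]; exact hI9 u hu) hI h13 h14 hD
    refine ⟨μ, .weaken _ _ _ _ _ _ _ ?_ le_rfl hμ, hp⟩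
    gcongr
  · have hite : (var 5).eval M₁ ≤ (0 : Term).eval M₁ := by simpa [h5] using hS
    -- Sizes are nonnegative and a nonempty set has positive size, so a vanishing total means that
    -- all sets are empty and the answer `0` is exact.
    have hsum : ∑ i, size i = 0 := le_antisymm (not_lt.1 hS) (Finset.sum_nonneg fun i _ => hsize i)
    have hempty : ∀ i, L.sets i = ∅ := fun i => by
      have h0 := (Finset.sum_eq_zero_iff_of_nonneg fun i _ => hsize i).1 hsum i (Finset.mem_univ i)
      have h1 := (h i).1
      rw [h0] at h1
      have h2 : ((L.sets i).ncard : ℝ) ≤ 0 := nonpos_of_mul_nonpos_right h1 (sub_pos.2 hbL)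
      exact (Set.ncard_eq_zero (hfin i)).1 (by exact_mod_cast h2.antisymm (Nat.cast_nonneg _))
    obtain ⟨M', hM', h0⟩ := Ev.put (L := L) (M := M₁) (a := 0) (e := 0) (Q := fun M' => M' 0 0 = 0) (by simp)
    refine ⟨_, .weaken _ _ _ _ _ _ _ ?_ (Nat.zero_le _) (.iteTrue _ _ _ _ _ _ _ _ hite (hM' fun _ => none)), ?_⟩
    · omega
    · rw [PMF.pure_map, PMF.toOuterMeasure_pure_apply, if_pos]
      · refine ENNReal.ofReal_le_one.2 (by linarith)
      · simp [hempty, h0]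

end RandRAM


/-! ### Running times and common constants -/

namespace RandRAM

theorem two_thirds_le_log {m : ℕ} (hm : 2 ≤ m) : (2 / 3 : ℝ) ≤ Real.log m := by
  have h1 := Real.log_two_gt_d9
  have h2 : Real.log 2 ≤ Real.log m := Real.log_le_log (by norm_num) (by exact_mod_cast hm)
  linarith

theorem clog_le_log {m : ℕ} (hm : 2 ≤ m) :
    (Nat.clog 2 (2 * m) : ℝ) ≤ 9 / 2 * Real.log m := by
  have hℓ := two_thirds_le_log hm
  have h0 : 0 < Nat.clog 2 (2 * m) := Nat.clog_pos (by norm_num) (by omega)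
  have h1 : 2 ^ (Nat.clog 2 (2 * m) - 1) < 2 * m := Nat.pow_pred_clog_lt_self (by norm_num) (by omega)
  obtain ⟨k, hk⟩ := Nat.exists_eq_add_of_le' h0
  rw [hk, Nat.add_sub_cancel] at h1
  rw [hk]
  have h2 : ((2 : ℝ) ^ k) ≤ 2 * m := by exact_mod_cast h1.le
  have h3 := Real.log_le_log (by positivity) h2
  rw [Real.log_pow, Real.log_mul (by norm_num) (by positivity)] at h3
  have h4 := Real.log_two_gt_d9
  have h5 := Real.log_two_lt_d9
  push_cast
  have hk0 : (0 : ℝ) ≤ k := Nat.cast_nonneg _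
  nlinarith

theorem log_ratio_le {m : ℕ} {ε γ : ℝ} (hm : 2 ≤ m) (hε : 0 < ε) (hγ : 0 < γ) :
    Real.log (100 * m / (ε * γ)) ≤ 5 + Real.log m + (1 / ε + Real.log (1 / γ)) := by
  have hm0 : (0 : ℝ) < m := by exact_mod_cast (by omega : 0 < m)
  have h100 : Real.log 100 ≤ 5 := by
    rw [Real.log_le_iff_le_exp (by norm_num), show (5 : ℝ) = (5 : ℕ) * 1 by norm_num, Real.exp_nat_mul]
    have h := Real.exp_one_gt_d9
    calc (100 : ℝ) ≤ 2.7 ^ 5 := by norm_num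
      _ ≤ Real.exp 1 ^ 5 := by gcongr; linarith
  have h1 : Real.log (1 / ε) ≤ 1 / ε := (Real.log_le_sub_one_of_pos (by positivity)).trans (by linarith)
  rw [show 100 * (m : ℝ) / (ε * γ) = 100 * m * ((1 / ε) * (1 / γ)) by field_simp,
    Real.log_mul (by positivity) (by positivity), Real.log_mul (by norm_num) hm0.ne',
    Real.log_mul (by positivity) (by positivity)]
  linarith

/-- With `y = 1/ε + log(1/γ) ≥ 1` and `ℓ = log m ≥ 2/3`, additive constants are absorbed into
products: `k₀` is `O(yℓ)`, `N₀` and `D₀` are `O(y³ m ℓ)`, and the `O(ℓ)` stages contribute the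
second factor `ℓ`. -/
theorem exists_server_parameters {m : ℕ} {ε γ : ℝ} (hm : 2 ≤ m) (hε : 0 < ε) (hε1 : ε < 1) (hγ : 0 < γ)
    (hγ1 : γ < 1) :
    ∃ k₀ N₀ D₀ : ℕ, 100 * m / (ε * γ) < 2 ^ k₀ ∧ 32 * k₀ * m / ε ^ 2 ≤ N₀ ∧ 192 * k₀ * m / ε ^ 2 ≤ D₀ ∧
      ((3 * m + 6 + (15 * m + 4 + (3 * k₀ + 6 + (7 * N₀ + 2 + (N₀ + 1 +
        (Nat.clog 2 (2 * m) * (6 * N₀ + 10 * (D₀ + 2) + 1) + 5)))) + 1) : ℕ) : ℝ) ≤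
      170000 * (1 / ε + Real.log (1 / γ)) ^ 3 * m * Real.log m ^ 2 := by
  have hm2 : (2 : ℝ) ≤ m := by exact_mod_cast hm
  have hℓ := two_thirds_le_log hm
  have hL := clog_le_log hm
  have hZ := log_ratio_le hm hε hγ
  have hlogγ : 0 ≤ Real.log (1 / γ) := Real.log_nonneg (by rw [le_div_iff₀ hγ]; linarith)
  have hε' : 1 ≤ 1 / ε := by rw [le_div_iff₀ hε]; linarith
  set y := 1 / ε + Real.log (1 / γ) with hy
  set ℓ := Real.log m with hldef
  have hy1 : 1 ≤ y := by linarith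
  have hεy : 1 / ε ^ 2 ≤ y ^ 2 := by
    rw [← one_div_pow]
    exact pow_le_pow_left₀ (by positivity) (by linarith) 2
  have hZpos : 0 < 100 * m / (ε * γ) := by positivity
  have hlogZ : 0 ≤ Real.log (100 * m / (ε * γ)) := by
    refine Real.log_nonneg ?_
    rw [le_div_iff₀ (by positivity)]
    nlinarith
  set k₀ : ℕ := ⌊Real.log (100 * m / (ε * γ)) / Real.log 2⌋₊ + 1 with hk₀
  have hl2 := Real.log_two_gt_d9
  have hl2pos : 0 < Real.log 2 := by linarith
  have hk : (k₀ : ℝ) ≤ 17 * (y * ℓ) := by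
    have h1 := Nat.floor_le (div_nonneg hlogZ hl2pos.le)
    have h2 : Real.log (100 * m / (ε * γ)) / Real.log 2 ≤ 3 / 2 * Real.log (100 * m / (ε * γ)) := by
      rw [div_le_iff₀ hl2pos]; nlinarith
    have h3 : 0 ≤ (y - 1) * ℓ := mul_nonneg (by linarith) (by linarith)
    have h4 : 0 ≤ y * (ℓ - 2 / 3) := mul_nonneg (by linarith) (by linarith)
    rw [hk₀]; push_cast
    linarith
  set w := y * ℓ with hw
  have hw0 : 2 / 3 ≤ w := hℓ.trans (le_mul_of_one_le_left (by linarith) hy1)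
  set v := y ^ 2 * w * m with hv
  have hy2 : 1 ≤ y ^ 2 := one_le_pow₀ hy1
  have hwv : 2 * w ≤ v := by
    calc 2 * w ≤ m * (1 * w) := by rw [one_mul]; gcongr
      _ ≤ m * (y ^ 2 * w) := by gcongr
      _ = v := by ring
  have hkm : k₀ * m / ε ^ 2 ≤ 17 * v := by
    calc k₀ * m / ε ^ 2 = k₀ * m * (1 / ε ^ 2) := by ring
      _ ≤ 17 * w * m * y ^ 2 := by gcongr
      _ = 17 * v := by ring
  have hkm0 : 0 ≤ k₀ * m / ε ^ 2 := by positivity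
  refine ⟨k₀, ⌈32 * k₀ * m / ε ^ 2⌉₊, ⌈192 * k₀ * m / ε ^ 2⌉₊, ?_, Nat.le_ceil _, Nat.le_ceil _, ?_⟩
  · rw [← Real.log_lt_log_iff hZpos (by positivity), Real.log_pow, ← div_lt_iff₀ hl2pos, hk₀]
    push_cast
    exact Nat.lt_floor_add_one _
  have hN : (⌈32 * k₀ * m / ε ^ 2⌉₊ : ℝ) ≤ 545 * v := by
    have h1 := (Nat.ceil_lt_add_one (show 0 ≤ 32 * k₀ * m / ε ^ 2 by positivity)).le
    have h2 : 32 * k₀ * m / ε ^ 2 = 32 * (k₀ * m / ε ^ 2) := by ring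
    linarith
  have hD : (⌈192 * k₀ * m / ε ^ 2⌉₊ : ℝ) ≤ 3265 * v := by
    have h1 := (Nat.ceil_lt_add_one (show 0 ≤ 192 * k₀ * m / ε ^ 2 by positivity)).le
    have h2 : 192 * k₀ * m / ε ^ 2 = 192 * (k₀ * m / ε ^ 2) := by ring
    linarith
  set N := ⌈32 * k₀ * m / ε ^ 2⌉₊
  set D := ⌈192 * k₀ * m / ε ^ 2⌉₊
  have hW : 170000 * y ^ 3 * m * ℓ ^ 2 = 170000 * (v * ℓ) := by rw [hv, hw]; ring
  have hvW : v ≤ 3 / 2 * (v * ℓ) := by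
    have := mul_le_mul_of_nonneg_left hℓ (show 0 ≤ v by linarith)
    linarith
  have hmv : m ≤ 3 / 2 * v := by
    have h1 : 2 / 3 ≤ y ^ 2 * w := hw0.trans (le_mul_of_one_le_left (by linarith) hy2)
    have := mul_le_mul_of_nonneg_right h1 (show (0 : ℝ) ≤ m by linarith)
    linarith
  have hprod : (Nat.clog 2 (2 * m) : ℝ) * (6 * N + 10 * (D + 2) + 1) ≤ 9 / 2 * ℓ * (35941 * v) := by
    refine mul_le_mul hL ?_ (by positivity) (by positivity)
    linarith
  rw [hW]
  push_cast
  linarith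

theorem count_time_le {n b : ℝ} (hn0 : 0 ≤ n) (hn : n ≤ 2 * b) (hb : 1 ≤ b) :
    3001600 * n ^ 34 ≤ 6100020 * 2 ^ 35 * b ^ 35 := by
  calc 3001600 * n ^ 34 ≤ 3001600 * (2 * b) ^ 34 := by gcongr
    _ = 3001600 * 2 ^ 34 * b ^ 34 := by rw [mul_pow, mul_assoc]
    _ ≤ 6100020 * 2 ^ 35 * b ^ 35 :=
        mul_le_mul (by norm_num) (pow_le_pow_right₀ hb (by norm_num)) (by positivity) (by positivity)

theorem sample_time_le {n b d x y : ℝ} (hn0 : 0 ≤ n) (hn : n ≤ 2 * b) (hb : 1 ≤ b) (hd0 : 0 ≤ d) (hd : d ≤ b)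
    (hx0 : 0 ≤ x) (hx : x ≤ b) (hy : y ≤ b) {T : ℝ}
    (hT : T ≤ 6100020 * n ^ 35 ∨ T ≤ (2 + 16 * d * (d * x + y)) * (800 * d ^ 5)) :
    T ≤ 6100020 * 2 ^ 35 * b ^ 35 := by
  rcases hT with h | h
  · refine h.trans ?_
    rw [mul_assoc, ← mul_pow]
    gcongr
  · have h1 : 1 ≤ b ^ 3 := one_le_pow₀ hb
    have h2 : b ≤ b * b := le_mul_of_one_le_left (by linarith) hb
    have h3 : d * x + y ≤ b * b + b * b := add_le_add (by gcongr) (hy.trans h2)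
    have h4 : 16 * d * (d * x + y) ≤ 16 * b * (b * b + b * b) :=
      (mul_le_mul_of_nonneg_left h3 (by positivity)).trans (by gcongr)
    have h5 : 2 + 16 * d * (d * x + y) ≤ 34 * b ^ 3 := by
      have : 16 * b * (b * b + b * b) = 32 * b ^ 3 := by ring
      linarith
    calc T ≤ (2 + 16 * d * (d * x + y)) * (800 * d ^ 5) := h
      _ ≤ 34 * b ^ 3 * (800 * b ^ 5) := mul_le_mul h5 (by gcongr) (by positivity) (by positivity)
      _ = 27200 * b ^ 8 := by ring
      _ ≤ 6100020 * 2 ^ 35 * b ^ 35 :=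
          mul_le_mul (by norm_num) (pow_le_pow_right₀ hb (by norm_num)) (by positivity) (by positivity)

/-- `log m` is below `1` for `m = 2`, so raising its exponent from `2` to `35` costs the factor
`2^33`, by `2x ≥ 1`. -/
theorem server_time_le {y M x : ℝ} (hy : 1 ≤ y) (hM : 0 ≤ M) (hx : 2 / 3 ≤ x) :
    170000 * y ^ 3 * M * x ^ 2 ≤ 6100020 * 2 ^ 35 * y ^ 35 * M * x ^ 35 := by
  have h1 : y ^ 3 ≤ y ^ 35 := pow_le_pow_right₀ hy (by norm_num)
  have h2 : x ^ 2 ≤ 2 ^ 33 * x ^ 35 := by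
    calc x ^ 2 ≤ x ^ 2 * (2 * x) ^ 33 := le_mul_of_one_le_right (by positivity) (one_le_pow₀ (by linarith))
      _ = 2 ^ 33 * (x ^ 2 * x ^ 33) := by rw [mul_pow]; ac_rfl
      _ = 2 ^ 33 * x ^ 35 := by rw [← pow_add]
  have hx0 : 0 ≤ x := by linarith
  calc 170000 * y ^ 3 * M * x ^ 2 ≤ 170000 * y ^ 35 * M * (2 ^ 33 * x ^ 35) := by gcongr
    _ = 170000 * 2 ^ 33 * (y ^ 35 * M * x ^ 35) := by ac_rfl
    _ ≤ 6100020 * 2 ^ 35 * (y ^ 35 * M * x ^ 35) :=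
        mul_le_mul_of_nonneg_right (by norm_num) (by positivity)
    _ = 6100020 * 2 ^ 35 * y ^ 35 * M * x ^ 35 := by ac_rfl

end RandRAM


/-! ### The theorem: the four programs with common constants -/

theorem mainTheorem9 :
    ∃ (count sample member server : RandRAM.Cmd) (C : ℝ) (c : ℕ),
      ∀ (d m : ℕ) (p : Fin m → EuclideanSpace ℝ (Fin d)) (r : Fin m → ℝ)
        (lam l ε γ αL αR βL βR β : ℝ),
        1 ≤ d → 2 ≤ m → (∀ i, 0 < r i) →
        ε ∈ Set.Ioo (0 : ℝ) 1 → γ ∈ Set.Ioo (0 : ℝ) 1 →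
        αL ∈ Set.Ioo (0 : ℝ) 1 → αR ∈ Set.Ioo (0 : ℝ) 1 →
        βL ∈ Set.Ioo (0 : ℝ) 1 → βR ∈ Set.Ioo (0 : ℝ) 1 →
        0 < β → β ≤ βL → β ≤ βR →
        (∀ i, 2 * (d : ℝ) ^ (3 / 2 : ℝ) / β < r i ∨ p i ∈ centerSet lam d l) →
        ∃ (size : Fin m → ℝ) (gen : Fin m → PMF (Fin d → ℤ)),
          -- the programs for a single ball
          (∀ i, ∃ T : ℕ,
            (T : ℝ) ≤ C * (d + 1 / β + |l| + |lam|) ^ c ∧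
            RandRAM.Computes count [[(d : ℝ), r i, β], List.ofFn (fun k => p i k)] T (size i)) ∧
          (∀ i, ∃ T : ℕ,
            (T : ℝ) ≤ C * (d + 1 / αL + 1 / αR + 1 / β + |l| + |lam| + Real.log (2 + r i)) ^ c ∧
            RandRAM.Generates sample
              [[(d : ℝ), r i, β, αL, αR], List.ofFn (fun k => p i k)] T (gen i)) ∧
          (∀ i, ∀ z : Fin d → ℤ, ∃ T : ℕ,
            (T : ℝ) ≤ C * d ∧
            RandRAM.Computes member
              [[(d : ℝ), r i], List.ofFn (fun k => p i k), List.ofFn (fun k => (z k : ℝ))] T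
              (Set.indicator (latticeBall (p i) (r i)) 1 z)) ∧
          IsBiasedList αL αR βL βR (fun i => latticeBall (p i) (r i)) size gen ∧
          -- the program for the union, which uses them through rounds of requests
          ∃ (T R : ℕ) (μ : PMF (RandRAM.State (Fin d → ℤ))),
            RandRAM.Runs ⟨gen, fun i => latticeBall (p i) (r i)⟩ server
              (RandRAM.start [[(m : ℝ), ε, γ], List.ofFn size]) T R μ ∧
            (T : ℝ) ≤ C * (1 / ε + Real.log (1 / γ)) ^ c * m * Real.log m ^ c ∧
            (R : ℝ) ≤ C * Real.log m ∧
            ENNReal.ofReal (1 - γ) ≤ μ.toOuterMeasure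
              {s | s.mem 0 0 ∈ Set.Icc
                ((1 - ε) * (1 - αL) * (1 - βL) * ((⋃ i, latticeBall (p i) (r i)).ncard : ℝ))
                ((1 + ε) * (1 + αR) * (1 + βR) * ((⋃ i, latticeBall (p i) (r i)).ncard : ℝ))} := by
  -- The constants are dictated by sampling from small balls, which takes at most `6100020 n^35`
  -- steps with `n` at most twice the sum of the parameters; the other bounds are weakened to them.
  refine ⟨RandRAM.countCmd, RandRAM.sampleCmd, RandRAM.memberCmd, RandRAM.serverCmd, 6100020 * 2 ^ 35, 35, ?_⟩
  intro d m p r lam l ε γ αL αR βL βR β hd hm hr hε hγ hαL hαR hβL hβR hβ hββL hββR hp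
  have hd' : (1 : ℝ) ≤ d := by exact_mod_cast hd
  have hβ1 : β < 1 := hββL.trans_lt hβL.2
  have hp' : ∀ i, 2 * (d : ℝ) * Real.sqrt d / β < r i ∨ p i ∈ centerSet lam d l := fun i => by
    have := hp i
    rwa [rpow_three_halves hd, ← mul_assoc] at this
  choose size hcount hlow hupp using fun i => RandRAM.computes_count hd (p i) (hr i) hβ hβ1 (hp' i)
  choose Ts gen hgen hTs hbias using fun i => RandRAM.generates_sample hd (p i) (hr i) hβ hβ1 hαL hαR (hp' i)
  have hn := sizeBound_le hd hβ hβ1 l lam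
  have hβ' : 1 ≤ 1 / β := by rw [le_div_iff₀ hβ]; linarith
  have hlist : IsBiasedList αL αR βL βR (fun i => latticeBall (p i) (r i)) size gen := fun i =>
    ⟨le_trans (by gcongr) (hlow i), (hupp i).trans (by gcongr), hbias i⟩
  refine ⟨size, gen, fun i => ⟨_, ?_, hcount i⟩, fun i => ⟨Ts i, ?_, hgen i⟩,
    fun i z => ⟨3 * d + 5, ?_, RandRAM.computes_member (p i) (hr i) z⟩, hlist, ?_⟩
  · push_cast
    refine RandRAM.count_time_le (Nat.cast_nonneg _) hn ?_
    linarith [abs_nonneg l, abs_nonneg lam]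
  · have hL : 0 < 1 / αL := one_div_pos.2 hαL.1
    have hR : 0 < 1 / αR := one_div_pos.2 hαR.1
    have hlog : 0 ≤ Real.log (2 + r i) := Real.log_nonneg (by linarith [hr i])
    have hl := abs_nonneg l
    have hlam := abs_nonneg lam
    exact RandRAM.sample_time_le (Nat.cast_nonneg _) (by linarith) (by linarith) (by linarith) (by linarith)
      (by linarith) (by linarith) (by linarith) (hTs i)
  · push_cast
    linarith
  · obtain ⟨k₀, N₀, D₀, hk₀, hN₀, hD₀, hT⟩ := RandRAM.exists_server_parameters hm hε.1 hε.2 hγ.1 hγ.2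
    obtain ⟨μ, hμ, hprob⟩ := RandRAM.runs_serverCmd (L := ⟨gen, fun i => latticeBall (p i) (r i)⟩)
      (fun i => latticeBall_finite (p i) (hr i)) hαL.2 hαR.1 hβL.2 hβR.1 hlist (by omega) hε.1 hε.2 hγ.1 hγ.2
      hk₀ hN₀ hD₀
    refine ⟨_, _, μ, hμ, hT.trans ?_, ?_, hprob⟩
    · have hlogγ : 0 ≤ Real.log (1 / γ) := Real.log_nonneg (by rw [le_div_iff₀ hγ.1]; linarith [hγ.2])
      have hε' : 1 ≤ 1 / ε := by rw [le_div_iff₀ hε.1]; linarith [hε.2]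
      exact RandRAM.server_time_le (by linarith) (Nat.cast_nonneg _) (RandRAM.two_thirds_le_log hm)
    · have hℓ := RandRAM.two_thirds_le_log hm
      have hL := RandRAM.clog_le_log hm
      push_cast
      linarith
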